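/- \textbf{Setting.} Let $t_0\in\mathbb R$, $I=[t_0,+\infty)$, $n\ge 2$, $m\ge 1$, $k\ge1$ integers, $A\in\mathbb R^{n\times n}$ with eigenvalues $\lambda_1,\dots,\lambda_n$ (with multiplicity), $\Lambda(A)$ its spectrum, $\Delta(A)=\{\lambda_j-\lambda_l: j\ne l\}$; vectors carry the maximum norm; $[x]$ is the integer part. For a set $\Omega\subset\mathbb C$ say that a non-empty set $\mathcal K$ of functions $I\to\mathbb R$ satisfies axioms $(\mathrm a)_\Omega$ if its elements are continuous and bounded, it is closed under real multiples, sums and products, and for every $\omega\in\Omega$ and $g:I\to\mathbb C$ with $\Re g,\Im g\in\mathcal K$ the equation $y'=\omega y+g(t)$ has a solution on $I$ with $\Re y,\Im y\in\mathcal K\cap C^1(I)$. A class $\mathcal K_3(A)$ is a set $\mathcal K$ that satisfies $(\mathrm a)_\Omega$ with $\Omega=\Lambda(A)$ and with $\Omega=\Delta(A)$, and such that every $f\in\mathcal K$ has a mean value $M(f)=\lim_{t\to\infty}\frac1t\int_{t_0}^t f\,d\tau$ with $\sup_{t\in I}\left|\int_{t_0}^t(f-M(f))\,d\tau\right|<\infty$.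 Fix a class $\mathcal K=\mathcal K_3(A)$. Let $f\in\mathcal K^n$, let $\varphi_0\in\mathcal K^n\cap C^1(I)$ be a solution of $\varphi_0'=A\varphi_0+f(t)$, let $a>0$ and $D=\{(t,y): t\in I,\ \|y-\varphi_0(t)\|\le a\}$. Consider $$y'=Ay+f(t)+\sum_{l=1}^m\varepsilon_l(t)f_l(t,y),\qquad (t,y)\in D,\ y\in\mathbb R^n. \tag{1}$$ Let $0<\varrho_1\le\dots\le\varrho_m$ be given ranks. A nontrivial monomial $\nu_\beta=\prod_{l,r}(\varepsilon_l^{(r)})^{\beta_{lr}}$ (finitely many nonzero $\beta_{lr}\in\mathbb N_0$, not all zero) has rank $\sum_{l,r}(\varrho_l+r)\beta_{lr}$; let $\rho_1<\rho_2<\dots$ be all the ranks of nontrivial monomials. Monomials with different exponents are treated as different. For $\wp\in\mathbb N_0^m$ put $|\wp|=\sum_l\wp_l$ and $\mu_\wp(t)=\prod_l\varepsilon_l(t)^{\wp_l}$. For $\wp\in\mathbb N_0^n$, $|\wp|$ is defined in the same way and $\partial_y^\wp$ is the corresponding partial derivative. Put $p_l=\max\{0,[\rho_k-\varrho_l]+1\}$,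 $q_l=[(\rho_k-\varrho_l)/\varrho_1]$, $N_l=\max\{2,q_l+1\}$. \textbf{Assumptions.} (i) $\varepsilon_l\in C^{p_l}(I)$, $\varepsilon_l^{(r)}=O(\varepsilon_1^{(\varrho_l+r)/\varrho_1})$ for $0\le r\le p_l$, $\varepsilon_1>0$ on $I$, $\varepsilon_1(t)\to0$ as $t\to+\infty$. (ii) $f_l$ has partial derivatives in $y$ up to order $N_l$, which are continuous and bounded on $D$; if $\varrho_l\le\rho_k$, then $\partial_y^\wp f_l(t,\varphi_0(t))\in\mathcal K^n$ for $|\wp|\le q_l$. (iii) There is $\varpi>0$ with $\varepsilon_1^\varpi$ integrable on $I$; $\varepsilon_l^{(r)}$ is absolutely integrable on $I$ for $1\le r\le[\rho_k-\varrho_l]$. (iv) If $\varrho_l\le\varpi\varrho_1$, then, with $s_l=[\varpi-\varrho_l/\varrho_1]$, $f_l$ has continuous partial derivatives in $y$ on $D$ up to order $s_l+2$, those of orders $3,\dots,s_l+2$ are bounded on $D$, and $\partial_y^\wp f_l(t,\varphi_0(t))\in\mathcal K^n$ for $1\le|\wp|\le s_l+1$. (v) $0\notin\Delta(A)$, i.e.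 the eigenvalues of $A$ are simple. (vi) Each $\varepsilon_l$ that is not absolutely integrable on $I$ is monotone on $I$, tends to $0$, and $\varepsilon_l'$ is continuous and absolutely integrable on $I$. (vii) Let $S$ be the finite set of $\wp\in\mathbb N_0^m$ with $1\le|\wp|<\varpi$ and $\mu_\wp$ not absolutely integrable on $I$. For all real $\gamma_1$ and $\gamma_\wp$ ($\wp\in S$) the function $\gamma_1\varepsilon_1'/\varepsilon_1+\sum_{\wp\in S}\gamma_\wp\mu_\wp$ is $\ge0$ for all large $t$ or $\le 0$ for all large $t$. (viii) $\rho_{k+1}>\varpi\varrho_1$ and $\rho_{k+1}\ge\varrho_1(2\varpi-1)$. \textbf{Formal coefficients.} Substitute the formal series $\varphi_0+\sum_{\beta\ne0}\nu_\beta\varphi_\beta$ in (1), expand $f_l$ in its formal Taylor series at $\varphi_0(t)$, and equate the coefficients of equal monomials, using the product rule for $\nu_\beta'$. This gives, for each $\beta$, a linear equation $\varphi_\beta'=A\varphi_\beta+g_\beta(t)$ with $g_\beta$ depending only on $\varphi_0$ and on those $\varphi_\gamma$ for which the rank of $\nu_\gamma$ is smaller than that of $\nu_\beta$. Admissible coefficients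 are functions $\varphi_\beta\in\mathcal K^n\cap C^1(I)$, for all $\beta$ with the rank of $\nu_\beta$ at most $\rho_k$, that satisfy these equations; put $s(t)=\varphi_0(t)+\sum_{0<\mathrm{rank}\,\nu_\beta\le\rho_k}\nu_\beta(t)\varphi_\beta(t)$. \textbf{Theorem.} Admissible coefficients exist, and for every choice of them the following holds. (A) For all sufficiently large $T$ there is a real Lyapunov matrix $Q(t)$ on $[T,+\infty)$ ($Q\in C^1$, $Q$ and $Q'$ bounded, $|\det Q|\ge\mathrm{const}>0$) such that $\det Q(t)$ has a nonzero limit and the transformation $r=Q(t)x$ takes the linear system $r'=\bigl(A+\sum_l\varepsilon_l(t)\,\partial f_l(t,s(t))/\partial y\bigr)r$ into $x'=\operatorname{diag}(\Re d_1(t),\dots,\Re d_n(t))\,x$, where $$d_j(t)=\lambda_j+\sum_{\wp\in S}\gamma_{j\wp}\mu_\wp(t)+\varsigma_j(t),$$ with $\gamma_{j\wp}\in\mathbb C$ and $\varsigma_j$ continuous and such that its improper integral over $[T,+\infty)$ converges. (B) For every such reduction (on some interval $[T_0,+\infty)$, $T_0\ge t_0$), put $$p_{jj}(t)=\Re d_j(t)+\Bigl(\varpi-\frac{\rho_{k+1}}{\varrho_1}\Bigr)\frac{\varepsilon_1'(t)}{\varepsilon_1(t)},$$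 and let $N$ be the number of indices $j\in\{1,\dots,n\}$ with $\int_{T_0}^{+\infty}p_{jj}(t)\,dt\ne+\infty$. Then for all sufficiently large $T$ equation (1) has on $[T,+\infty)$ a solution of the form $y=s(t)+r$ with $$r=O\bigl(\varepsilon_1(t)^{\rho_{k+1}/\varrho_1-\varpi}\bigr)\qquad(t\to+\infty).$$ Moreover, $r$ depends on $N$ arbitrary real constants of sufficiently small absolute value: there are $\delta>0$ and a family of such solutions $s+r(\cdot,c)$, $c\in\mathbb R^N$, $\|c\|<\delta$, with the $O$-estimate uniform in $c$, such that $c\mapsto r(t,c)$ is continuous for each $t\ge T$ and $c\mapsto r(T,c)$ is injective. (C) For every $T\ge t_0$ a solution of (1) on $[T,+\infty)$ is determined by its value at $T$; thus a family of solutions depends on at most $n$ independent scalar parameters. -/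

import Mathlib

open Set Filter Topology MeasureTheory

noncomputable section

/-! ### Abstract classes of oscillating functions on `I = [t₀, ∞)` -/

/-- `f`, restricted to `I = [t₀, ∞)`, belongs to the class `K` of functions `I → ℝ`. -/
def InClass {t₀ : ℝ} (K : Set (Ici t₀ → ℝ)) (f : ℝ → ℝ) : Prop :=
  (Ici t₀).domRestrict f ∈ K

/-- A non-empty class of continuous bounded functions on `I`, closed under real multiples, sums and
products, such that for each `ω ∈ Ω` and each complex `g` with real and imaginary parts in the
class, `y' = ω y + g` has on `I` a solution with real and imaginary parts in the class (such
a solution is automatically `C¹`). For `Ω = Λ(A)` these are the classes `𝒦₁(A)`. -/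
structure IsClassK1 {t₀ : ℝ} (Ω : Set ℂ) (K : Set (Ici t₀ → ℝ)) : Prop where
  nonempty : K.Nonempty
  continuous : ∀ f ∈ K, Continuous f
  bounded : ∀ f ∈ K, ∃ C : ℝ, ∀ t, |f t| ≤ C
  smul_mem : ∀ (α : ℝ), ∀ f ∈ K, (fun t => α * f t) ∈ K
  add_mem : ∀ f ∈ K, ∀ g ∈ K, (fun t => f t + g t) ∈ K
  mul_mem : ∀ f ∈ K, ∀ g ∈ K, (fun t => f t * g t) ∈ K
  exists_solution : ∀ ω ∈ Ω, ∀ g : ℝ → ℂ,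
    InClass K (fun t => (g t).re) → InClass K (fun t => (g t).im) →
    ∃ y : ℝ → ℂ, (∀ t ∈ Ici t₀, HasDerivWithinAt y (ω * y t + g t) (Ici t₀) t) ∧
      InClass K (fun t => (y t).re) ∧ InClass K (fun t => (y t).im)

/-- The classes `𝒦₂(A)` (for `Ω = Δ(A)`): the previous axioms, and every member has a mean value,
and a bounded primitive after the mean value has been subtracted. -/
structure IsClassK2 {t₀ : ℝ} (Ω : Set ℂ) (K : Set (Ici t₀ → ℝ)) : Prop
    extends IsClassK1 Ω K where
  mean : ∀ f : ℝ → ℝ, InClass K f → ∃ M : ℝ,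
    Tendsto (fun t => (1 / t) * ∫ τ in t₀..t, f τ) atTop (𝓝 M) ∧
    ∃ C : ℝ, ∀ t ∈ Ici t₀, |∫ τ in t₀..t, (f τ - M)| ≤ C

/-- `Δ(A)`, the differences of eigenvalues with different indices (`lam` lists the eigenvalues with
multiplicity). -/
def eigenDiff {n : ℕ} (lam : Fin n → ℂ) : Set ℂ :=
  {z | ∃ j l : Fin n, j ≠ l ∧ z = lam j - lam l}

/-- The classes `𝒦₃(A)`: all axioms of `𝒦₁(A)` and of `𝒦₂(A)` at once. -/
def IsClassK3 {t₀ : ℝ} {n : ℕ} (lam : Fin n → ℂ) (K : Set (Ici t₀ → ℝ)) : Prop :=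
  IsClassK1 (range lam) K ∧ IsClassK2 (eigenDiff lam) K

/-! ### Partial derivatives in `y` on the tube `D` -/

/-- Partial derivative in the `j`-th coordinate, relative to the set `B`. -/
def pd {n : ℕ} (B : Set (Fin n → ℝ)) (j : Fin n) (h : (Fin n → ℝ) → (Fin n → ℝ)) :
    (Fin n → ℝ) → (Fin n → ℝ) :=
  fun y => fderivWithin ℝ h B y (Pi.single j 1)

/-- `∂^℘ h = ∂₁^{℘₁} ⋯ ∂ₙ^{℘ₙ} h`, relative to the set `B`. -/
def mpd {n : ℕ} (B : Set (Fin n → ℝ)) (P : Fin n → ℕ) (h : (Fin n → ℝ) → (Fin n → ℝ)) :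
    (Fin n → ℝ) → (Fin n → ℝ) :=
  (List.finRange n).foldr (fun j u => (pd B j)^[P j] u) h

/-- `D = {(t, y) : t ≥ t₀, ‖y - φ₀(t)‖ ≤ a}` (maximum norm). Its slice at `t` is
`Metric.closedBall (φ₀ t) a`. -/
def tube {n : ℕ} (t₀ a : ℝ) (φ₀ : ℝ → Fin n → ℝ) : Set (ℝ × (Fin n → ℝ)) :=
  {p | t₀ ≤ p.1 ∧ p.2 ∈ Metric.closedBall (φ₀ p.1) a}

/-- `h ∈ C^{0,N}_{t,y}(D)`: the `y`-derivatives up to order `N` exist on the slices of `D` and are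
continuous in `(t, y)` on `D`. -/
def IsC0N {n : ℕ} (t₀ a : ℝ) (φ₀ : ℝ → Fin n → ℝ) (N : ℕ)
    (h : ℝ → (Fin n → ℝ) → (Fin n → ℝ)) : Prop :=
  (∀ t ∈ Ici t₀, ContDiffOn ℝ N (h t) (Metric.closedBall (φ₀ t) a)) ∧
  ∀ P : Fin n → ℕ, ∑ j, P j ≤ N →
    ContinuousOn (fun p : ℝ × (Fin n → ℝ) => mpd (Metric.closedBall (φ₀ p.1) a) P (h p.1) p.2)
      (tube t₀ a φ₀)

/-- `sup_D ‖∂_y^℘ h‖ < ∞`. -/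
def BddPartial {n : ℕ} (t₀ a : ℝ) (φ₀ : ℝ → Fin n → ℝ) (P : Fin n → ℕ)
    (h : ℝ → (Fin n → ℝ) → (Fin n → ℝ)) : Prop :=
  ∃ C : ℝ, ∀ p ∈ tube t₀ a φ₀, ‖mpd (Metric.closedBall (φ₀ p.1) a) P (h p.1) p.2‖ ≤ C

/-! ### Ranks -/

/-- A monomial `∏ (d^r ε_l / dt^r)^{β_{lr}}` is given by its exponents `β (l, r)`. -/
abbrev Mon (m : ℕ) := (Fin m × ℕ) →₀ ℕ

/-- `Rank = ∑ (ϱ_l + r) β_{lr}`. -/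
def rank {m : ℕ} (ϱ : Fin m → ℝ) (β : Mon m) : ℝ :=
  β.sum fun x b => (ϱ x.1 + x.2) * b

/-- The set of all ranks of nontrivial monomials. -/
def rankSet {m : ℕ} (ϱ : Fin m → ℝ) : Set ℝ := {x | ∃ β : Mon m, β ≠ 0 ∧ rank ϱ β = x}

/-- The increasing enumeration `ρ₁ < ρ₂ < ⋯` of the set of ranks (with `ρ₀ = 0` added): each term
is the least rank above the previous one. -/
def rho {m : ℕ} (ϱ : Fin m → ℝ) : ℕ → ℝ
  | 0 => 0
  | s + 1 => sInf {x ∈ rankSet ϱ | rho ϱ s < x}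

/-- The function `ν_β(t) = ∏ (d^r ε_l / dt^r)^{β_{lr}}` on `[t₀, ∞)`. -/
def nu {m : ℕ} (t₀ : ℝ) (ε : Fin m → ℝ → ℝ) (β : Mon m) (t : ℝ) : ℝ :=
  β.prod fun x b => (iteratedDerivWithin x.2 (ε x.1) (Ici t₀) t) ^ b

/-- `μ_℘(t) = ∏ ε_l(t)^{℘_l}`. -/
def mu {m : ℕ} (ε : Fin m → ℝ → ℝ) (P : Fin m → ℕ) (t : ℝ) : ℝ := ∏ l, ε l t ^ P l

open Classical in
/-- The finite set of the multi-indices `℘` with `1 ≤ |℘| < w` and `μ_℘` not integrable on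
`[t₀, ∞)`. -/
def nonIntegrableIdx {m : ℕ} (t₀ w : ℝ) (ε : Fin m → ℝ → ℝ) : Finset (Fin m → ℕ) :=
  (Fintype.piFinset fun _ : Fin m => Finset.range ⌈w⌉₊).filter fun P =>
    1 ≤ ∑ l, P l ∧ ((∑ l, P l : ℕ) : ℝ) < w ∧ ¬ IntegrableOn (mu ε P) (Ici t₀)

/-! ### The formal solution `φ₀ + ∑ ν_β φ_β` -/

/-- The `j`-th component of the formal series `δ = ∑_{β ≠ 0} φ_β(t) X^β`, where the variable
`X (l, r)` stands for the `r`-th derivative of `ε_l`. -/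
def formalDelta {m n : ℕ} (φ : Mon m → ℝ → Fin n → ℝ) (t : ℝ) (j : Fin n) :
    MvPowerSeries (Fin m × ℕ) ℝ :=
  fun β => if β = 0 then 0 else φ β t j

/-- The coefficient of `ν_β` in `∑_γ (dν_γ/dt) φ_γ(t)`. By the product rule
`dν_γ/dt = ∑_{(l,r)} γ_{lr} ν_{γ - e_{lr} + e_{l,r+1}}`, so `ν_β` arises from
`γ = β - e_{l,q} + e_{l,q-1}` with `q ≥ 1` and `β_{lq} ≥ 1`, with the factor `β_{l,q-1} + 1`. -/
def derivCoeff {m n : ℕ} (φ : Mon m → ℝ → Fin n → ℝ) (β : Mon m) (t : ℝ) : Fin n → ℝ :=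
  ∑ x ∈ β.support, if x.2 = 0 then 0 else
    ((β (x.1, x.2 - 1) : ℝ) + 1) •
      φ (β - Finsupp.single x 1 + Finsupp.single (x.1, x.2 - 1) 1) t

/-- The coefficient of `ν_β` in `∑_l ε_l ∑_℘ (1/℘!) ∂_y^℘ F_l(t, φ₀(t)) δ^℘`. As `δ` has no constant
term, only `℘` with `|℘| < deg β` contribute. -/
def nonlinCoeff {m n : ℕ} (a : ℝ) (F : Fin m → ℝ → (Fin n → ℝ) → (Fin n → ℝ))
    (φ₀ : ℝ → Fin n → ℝ) (φ : Mon m → ℝ → Fin n → ℝ) (β : Mon m) (t : ℝ) : Fin n → ℝ :=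
  ∑ l, ∑ P ∈ Fintype.piFinset (fun _ : Fin n => Finset.range β.degree),
    (((∏ j, (P j).factorial : ℕ) : ℝ)⁻¹ *
      MvPowerSeries.coeff β (MvPowerSeries.X (l, 0) * ∏ j, formalDelta φ t j ^ P j)) •
    mpd (Metric.closedBall (φ₀ t) a) P (F l t) (φ₀ t)

/-- The functions `φ_β`, `0 < Rank ν_β ≤ ρ_k`, belong to `Kⁿ ∩ C¹(I)` and satisfy on `I` the linear
equations `φ_β' = A φ_β + g_β` that result from equating the coefficients of `ν_β` after the formal
series `φ₀ + ∑ ν_β φ_β` has been substituted in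
`y' = A y + f(t) + ∑_l ε_l(t) F_l(t, y)`. Here `g_β` involves only `φ₀` and the `φ_γ` of lower rank;
the values of `φ` at the other indices play no role. -/
def IsFormalCoeff {m n : ℕ} {t₀ : ℝ} (a : ℝ) (K : Set (Ici t₀ → ℝ)) (ϱ : Fin m → ℝ)
    (A : Matrix (Fin n) (Fin n) ℝ) (F : Fin m → ℝ → (Fin n → ℝ) → (Fin n → ℝ))
    (φ₀ : ℝ → Fin n → ℝ) (k : ℕ) (φ : Mon m → ℝ → Fin n → ℝ) : Prop :=
  ∀ β : Mon m, β ≠ 0 → rank ϱ β ≤ rho ϱ k →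
    (∀ i, InClass K (fun t => φ β t i)) ∧ ContDiffOn ℝ 1 (φ β) (Ici t₀) ∧
    ∀ t ∈ Ici t₀, HasDerivWithinAt (φ β)
      (A.mulVec (φ β t) + (nonlinCoeff a F φ₀ φ β t - derivCoeff φ β t)) (Ici t₀) t

/-- The truncated sum `s(t) = φ₀(t) + ∑_{s=1}^k ∑_{Rank ν_β = ρ_s} ν_β(t) φ_β(t)` (for positive
`ϱ_l` the inner sums are finite). -/
def truncSum {m n : ℕ} (t₀ : ℝ) (ε : Fin m → ℝ → ℝ) (ϱ : Fin m → ℝ) (φ₀ : ℝ → Fin n → ℝ) (k : ℕ)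
    (φ : Mon m → ℝ → Fin n → ℝ) (t : ℝ) : Fin n → ℝ :=
  φ₀ t + ∑ s ∈ Finset.Icc 1 k, ∑ᶠ β ∈ {β : Mon m | rank ϱ β = rho ϱ s}, nu t₀ ε β t • φ β t

/-! ### Solutions and the diagonal form of the linear part -/

/-- `y` is a solution of `y' = A y + f(t) + ∑_l ε_l(t) F_l(t, y)`, `(t, y) ∈ D`, on `[T, ∞)`. -/
def IsSolution {m n : ℕ} (a T : ℝ) (A : Matrix (Fin n) (Fin n) ℝ) (f : ℝ → Fin n → ℝ)
    (ε : Fin m → ℝ → ℝ) (F : Fin m → ℝ → (Fin n → ℝ) → (Fin n → ℝ)) (φ₀ : ℝ → Fin n → ℝ)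
    (y : ℝ → Fin n → ℝ) : Prop :=
  ∀ t ∈ Ici T, y t ∈ Metric.closedBall (φ₀ t) a ∧
    HasDerivWithinAt y (A.mulVec (y t) + f t + ∑ l, ε l t • F l t (y t)) (Ici T) t

/-- `Â(t) = A + ∑_l ε_l(t) ∂F_l(t, s(t))/∂y`. -/
def linPart {m n : ℕ} (a : ℝ) (A : Matrix (Fin n) (Fin n) ℝ)
    (ε : Fin m → ℝ → ℝ) (F : Fin m → ℝ → (Fin n → ℝ) → (Fin n → ℝ)) (φ₀ : ℝ → Fin n → ℝ)
    (s : ℝ → Fin n → ℝ) (t : ℝ) : Matrix (Fin n) (Fin n) ℝ :=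
  Matrix.of fun i j => A i j + ∑ l, ε l t * pd (Metric.closedBall (φ₀ t) a) j (F l t) (s t) i

/-- Real Lyapunov matrices on `[T, ∞)`. -/
structure IsLyapunov {n : ℕ} (T : ℝ) (Q : ℝ → Matrix (Fin n) (Fin n) ℝ) : Prop where
  contDiffOn : ∀ i j, ContDiffOn ℝ 1 (fun t => Q t i j) (Ici T)
  bounded : ∃ C : ℝ, ∀ t ∈ Ici T, ∀ i j, |Q t i j| ≤ C
  deriv_bounded : ∃ C : ℝ, ∀ t ∈ Ici T, ∀ i j, |derivWithin (fun τ => Q τ i j) (Ici T) t| ≤ C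
  det_bounded_below : ∃ c > 0, ∀ t ∈ Ici T, c ≤ |(Q t).det|

/-- `d_j(t) = λ_j + ∑_{℘ ∈ S} γ_{j℘} μ_℘(t) + ς_j(t)`. -/
def diagEntry {m n : ℕ} (lam : Fin n → ℂ) (ε : Fin m → ℝ → ℝ) (S : Finset (Fin m → ℕ))
    (γ : Fin n → (Fin m → ℕ) → ℂ) (ς : Fin n → ℝ → ℂ) (j : Fin n) (t : ℝ) : ℂ :=
  lam j + ∑ P ∈ S, γ j P * (mu ε P t : ℂ) + ς j t

/-- The real Lyapunov transformation `r = Q(t) x` reduces `r' = Â(t) r` on `[T, ∞)` to the diagonal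
form `x' = Re D(t) x`, `D = diag(d_1, …, d_n)`; the remainders `ς_j` are continuous with convergent
improper integral, and `det Q` has a nonzero limit. -/
structure IsDiagReduction {m n : ℕ} (T : ℝ) (Ahat : ℝ → Matrix (Fin n) (Fin n) ℝ) (lam : Fin n → ℂ)
    (ε : Fin m → ℝ → ℝ) (S : Finset (Fin m → ℕ)) (Q : ℝ → Matrix (Fin n) (Fin n) ℝ)
    (γ : Fin n → (Fin m → ℕ) → ℂ) (ς : Fin n → ℝ → ℂ) : Prop where
  lyapunov : IsLyapunov T Q
  det_limit : ∃ d : ℝ, d ≠ 0 ∧ Tendsto (fun t => (Q t).det) atTop (𝓝 d)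
  rem_continuous : ∀ j, ContinuousOn (ς j) (Ici T)
  rem_integral : ∀ j, ∃ z : ℂ, Tendsto (fun t => ∫ τ in T..t, ς j τ) atTop (𝓝 z)
  reduces : ∀ t ∈ Ici T, ∀ i j, HasDerivWithinAt (fun τ => Q τ i j)
    ((Ahat t * Q t - Q t * Matrix.diagonal fun l => (diagEntry lam ε S γ ς l t).re) i j) (Ici T) t

/-- `p_jj(t) = Re d_j(t) + (w - ρ_{k+1}/ϱ₁) ε₁'(t)/ε₁(t)`; here `κ = ρ_{k+1}/ϱ₁`. -/
def pEntry {m n : ℕ} [NeZero m] (t₀ w κ : ℝ) (lam : Fin n → ℂ) (ε : Fin m → ℝ → ℝ)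
    (S : Finset (Fin m → ℕ)) (γ : Fin n → (Fin m → ℕ) → ℂ) (ς : Fin n → ℝ → ℂ)
    (j : Fin n) (t : ℝ) : ℝ :=
  (diagEntry lam ε S γ ς j t).re + (w - κ) * (derivWithin (ε 0) (Ici t₀) t / ε 0 t)

/-- The indices `j` with `∫_T^∞ p_jj(t) dt ≠ +∞`. -/
def freeIdx {n : ℕ} (T : ℝ) (p : Fin n → ℝ → ℝ) : Set (Fin n) :=
  {j | ¬ Tendsto (fun t => ∫ τ in T..t, p j τ) atTop atTop}

end

/-! Write κ = ρ_{k+1}/ϱ₁ and w for ϖ. The truncated sum s satisfies (1) up to a residual of order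
ε₁^κ, and a true solution is sought as s + r with r = O(ε₁^(κ-w)). Three things have to be shown.

The residual. The equations for the φ_β are solvable in the class, since each g_β arises by sums and
products from functions of the class (`exists_isFormalCoeff`). If s is differentiated term by term
and the F_l are expanded at φ₀, the terms of rank at most ρ_k cancel by the choice of the
coefficients. What remains are monomials of rank above ρ_k and Taylor remainders of the same order.
A monomial of rank ρ is O(ε₁^(ρ/ϱ₁)), and no rank lies strictly between ρ_k and ρ_{k+1}, so all of
this is O(ε₁^κ) (`IsSmallParam.exists_residual`).

The linear part. Up to absolutely integrable terms, the entries of Â - A are combinations of the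
products μ_℘, ℘ ∈ S, with coefficients from the class (`IsSmallParam.isAdm_eps_mul_pd`). A
substitution with 1 + ∑ μ_℘ X_℘, where the X_℘ solve homological equations in the frame of
eigenvectors of A, makes all coefficients at the μ_℘ diagonal in that frame. The errors are products
outside S and derivatives of the μ_℘, both integrable (`IsSmallParam.exists_approximate`). The
diagonal coefficients split into mean values, which give γ_{j℘}, and oscillating parts, whose
products with μ_℘ have convergent integrals by Dirichlet's test and form ς_j. A rotating frame
removes the imaginary parts and makes everything real (`IsEigenFrame.exists_real_frame`), and an
argument of Levinson type removes the integrable error (`exists_exact_of_approximate`). The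
dichotomy it needs for Re d_i - Re d_j follows from the sign hypothesis (vii).

The nonlinear problem. The substitution r = ε₁^(κ-w) Q z leads to z_j' = p_jj z_j + G_j(t, z). The
residual divided by the weight is O(ε₁^w), and the Lipschitz constant of G is O(ε₁^(1+κ-w)); both
are integrable, the second because κ ≥ 2w - 1. By (vii) the increments of the primitive of each p_jj
are bounded on one side. If they are bounded above, the bounded solution of the j-th scalar equation
has a free initial value; otherwise it is fixed by a condition at infinity. Successive
approximations with these scalar solutions contract once T is so large that the tail integrals are
small (`exists_bounded_solution_family`). The free initial values are the N parameters.

Part (C) is uniqueness for a right-hand side that is Lipschitz in y on the slices of the tube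
(`IsSolution.eqOn`). -/

/-! ### Scalar linear equations with an integral dichotomy -/

/-- The solution of `y' = p y + q`, `y T = c`. -/
noncomputable def linSol (p q : ℝ → ℝ) (T c t : ℝ) : ℝ :=
  Real.exp (∫ τ in T..t, p τ) * (c + ∫ s in T..t, Real.exp (-(∫ τ in T..s, p τ)) * q s)

lemma linSol_self (p q : ℝ → ℝ) (T c : ℝ) : linSol p q T c T = c := by simp [linSol]

lemma continuous_exp_neg_primitive {p : ℝ → ℝ} (hp : Continuous p) (T : ℝ) :
    Continuous fun s => Real.exp (-(∫ τ in T..s, p τ)) :=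
  Real.continuous_exp.comp
    (intervalIntegral.continuous_primitive (fun a b => hp.intervalIntegrable a b) T).neg

lemma hasDerivAt_linSol {p q : ℝ → ℝ} (hp : Continuous p) (hq : Continuous q) (T c t : ℝ) :
    HasDerivAt (linSol p q T c) (p t * linSol p q T c t + q t) t := by
  have h1 : HasDerivAt (fun t => ∫ τ in T..t, p τ) (p t) t :=
    intervalIntegral.integral_hasDerivAt_right (hp.intervalIntegrable _ _)
      hp.aestronglyMeasurable.stronglyMeasurableAtFilter hp.continuousAt
  have hc : Continuous fun s => Real.exp (-(∫ τ in T..s, p τ)) * q s :=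
    (continuous_exp_neg_primitive hp T).mul hq
  have h2 : HasDerivAt (fun t => ∫ s in T..t, Real.exp (-(∫ τ in T..s, p τ)) * q s)
      (Real.exp (-(∫ τ in T..t, p τ)) * q t) t :=
    intervalIntegral.integral_hasDerivAt_right (hc.intervalIntegrable _ _)
      hc.aestronglyMeasurable.stronglyMeasurableAtFilter hc.continuousAt
  have h3 := h1.exp.mul (h2.const_add c)
  refine h3.congr_deriv ?_
  have : Real.exp (∫ τ in T..t, p τ) * Real.exp (-(∫ τ in T..t, p τ)) = 1 := by
    rw [← Real.exp_add]; simp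
  simp only [linSol]
  linear_combination (q t) * this

lemma continuous_linSol {p q : ℝ → ℝ} (hp : Continuous p) (hq : Continuous q) (T c : ℝ) :
    Continuous (linSol p q T c) :=
  continuous_iff_continuousAt.2 fun t => (hasDerivAt_linSol hp hq T c t).continuousAt

/-- Growth of the primitive of `p` on `[T, ∞)`: bounded above if `J`, bounded below otherwise. -/
def HasDichotomy (p : ℝ → ℝ) (J : Prop) (T M : ℝ) : Prop :=
  (J → ∀ s t, T ≤ s → s ≤ t → ∫ τ in s..t, p τ ≤ M) ∧
  (¬ J → ∀ s t, T ≤ s → s ≤ t → -M ≤ ∫ τ in s..t, p τ)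

open Classical in
/-- The initial value of the bounded solution of `y' = p y + q`. -/
noncomputable def dichInit (p q : ℝ → ℝ) (J : Prop) (T c : ℝ) : ℝ :=
  if J then c else -∫ s in Ioi T, Real.exp (-(∫ τ in T..s, p τ)) * q s

/-- When the increments of the primitive are bounded below, the weight exp(-∫ p) is at most exp M,
so the integral over the half-line in `dichInit` converges absolutely. -/
lemma integrableOn_exp_neg_mul {p q b : ℝ → ℝ} (hp : Continuous p) (hq : Continuous q) {T M : ℝ}
    (h : ∀ s t, T ≤ s → s ≤ t → -M ≤ ∫ τ in s..t, p τ) (hb : IntegrableOn b (Ioi T))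
    (hqb : ∀ t, T ≤ t → |q t| ≤ b t) :
    IntegrableOn (fun s => Real.exp (-(∫ τ in T..s, p τ)) * q s) (Ioi T) := by
  refine Integrable.mono' (hb.const_mul (Real.exp M))
    ((continuous_exp_neg_primitive hp T).mul hq).aestronglyMeasurable ?_
  refine (ae_restrict_iff' measurableSet_Ioi).2 (Eventually.of_forall fun s hs => ?_)
  have hs' : T ≤ s := le_of_lt hs
  rw [norm_mul, Real.norm_eq_abs, Real.norm_eq_abs, Real.abs_exp]
  have := h T s le_rfl hs'
  exact mul_le_mul (Real.exp_le_exp.2 (by linarith)) (hqb s hs') (abs_nonneg _) (Real.exp_nonneg _)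

/-- The chosen initial value cancels the part of the integral before t. Only the future values of q
remain, and the growing exponential is gone. -/
lemma linSol_dichInit_eq {p q b : ℝ → ℝ} (hp : Continuous p) (hq : Continuous q) {T M : ℝ} {J : Prop}
    (h : HasDichotomy p J T M) (hJ : ¬ J) (hb : IntegrableOn b (Ioi T))
    (hqb : ∀ t, T ≤ t → |q t| ≤ b t) (c : ℝ) {t : ℝ} (ht : T ≤ t) :
    linSol p q T (dichInit p q J T c) t =
      -∫ s in Ioi t, Real.exp (-∫ τ in t..s, p τ) * q s := by
  have hi := integrableOn_exp_neg_mul hp hq (h.2 hJ) hb hqb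
  have h1 : ∫ s in T..t, Real.exp (-(∫ τ in T..s, p τ)) * q s =
      (∫ s in Ioi T, Real.exp (-(∫ τ in T..s, p τ)) * q s) -
      ∫ s in Ioi t, Real.exp (-(∫ τ in T..s, p τ)) * q s := by
    rw [intervalIntegral.integral_of_le ht, eq_sub_iff_add_eq,
      ← setIntegral_union (Ioc_disjoint_Ioi le_rfl) measurableSet_Ioi
        (hi.mono_set Ioc_subset_Ioi_self) (hi.mono_set (Ioi_subset_Ioi ht)), Ioc_union_Ioi_eq_Ioi ht]
  rw [linSol, dichInit, if_neg hJ, h1]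
  have : ∀ x y : ℝ, -x + (x - y) = -y := by intros; ring
  rw [this, mul_neg, ← integral_const_mul]
  congr 1
  refine integral_congr_ae (Eventually.of_forall fun s => ?_)
  have h2 : (∫ τ in T..s, p τ) = (∫ τ in T..t, p τ) + ∫ τ in t..s, p τ :=
    (intervalIntegral.integral_add_adjacent_intervals (hp.intervalIntegrable _ _)
      (hp.intervalIntegrable _ _)).symm
  simp only
  rw [h2, ← mul_assoc, ← Real.exp_add]
  congr 2
  ring

/-- Variation of constants restarted at s. It is used with s = T for the a priori bound and with
large s for the limit at infinity. -/
lemma linSol_eq_add {p q : ℝ → ℝ} (hp : Continuous p) (hq : Continuous q) (T c s t : ℝ) :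
    linSol p q T c t = Real.exp (∫ τ in s..t, p τ) * linSol p q T c s +
      ∫ r in s..t, Real.exp (∫ τ in r..t, p τ) * q r := by
  have hc : Continuous fun s => Real.exp (-(∫ τ in T..s, p τ)) * q s :=
    (continuous_exp_neg_primitive hp T).mul hq
  have hadd : ∀ a b c : ℝ, (∫ τ in a..b, p τ) + ∫ τ in b..c, p τ = ∫ τ in a..c, p τ := fun a b c =>
    intervalIntegral.integral_add_adjacent_intervals (hp.intervalIntegrable _ _)
      (hp.intervalIntegrable _ _)
  rw [linSol, ← intervalIntegral.integral_add_adjacent_intervals (hc.intervalIntegrable T s)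
    (hc.intervalIntegrable s t), ← add_assoc, mul_add, linSol, ← mul_assoc, ← Real.exp_add,
    add_comm (∫ τ in s..t, p τ), hadd]
  congr 1
  rw [← intervalIntegral.integral_const_mul]
  refine intervalIntegral.integral_congr fun r _ => ?_
  rw [← mul_assoc, ← Real.exp_add, ← hadd T r t]
  congr 2
  ring

/-- The kernel is at most exp M. The bound is by the tail of b from s on, not from T on, so that
restarting late makes this contribution small. -/
lemma abs_intervalIntegral_exp_mul_le {p q b : ℝ → ℝ} {T M : ℝ} (h : ∀ s t, T ≤ s → s ≤ t → ∫ τ in s..t, p τ ≤ M) (hb : IntegrableOn b (Ioi T))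
    (hqb : ∀ t, T ≤ t → |q t| ≤ b t) {s t : ℝ} (hs : T ≤ s) (ht : s ≤ t) :
    |∫ r in s..t, Real.exp (∫ τ in r..t, p τ) * q r| ≤ Real.exp M * ∫ r in Ioi s, b r := by
  have hbs : IntegrableOn b (Ioi s) := hb.mono_set (Ioi_subset_Ioi hs)
  rw [intervalIntegral.integral_of_le ht, ← integral_const_mul, ← Real.norm_eq_abs]
  refine (norm_integral_le_of_norm_le (g := fun r => Real.exp M * b r)
    ((hbs.mono_set Ioc_subset_Ioi_self).const_mul _) ?_).trans ?_
  · refine (ae_restrict_iff' measurableSet_Ioc).2 (Eventually.of_forall fun r hr => ?_)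
    rw [norm_mul, Real.norm_eq_abs, Real.norm_eq_abs, Real.abs_exp]
    exact mul_le_mul (Real.exp_le_exp.2 (h r t (hs.trans hr.1.le) hr.2)) (hqb r (hs.trans hr.1.le))
      (abs_nonneg _) (Real.exp_nonneg _)
  · refine setIntegral_mono_set (hbs.const_mul _) ?_ Ioc_subset_Ioi_self.eventuallyLE
    refine (ae_restrict_iff' measurableSet_Ioi).2 (Eventually.of_forall fun r hr => ?_)
    exact mul_nonneg (Real.exp_nonneg _)
      ((abs_nonneg _).trans (hqb r (hs.trans (le_of_lt hr))))

lemma abs_setIntegral_exp_mul_le {p q b : ℝ → ℝ} {T M : ℝ}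
    (h : ∀ s t, T ≤ s → s ≤ t → -M ≤ ∫ τ in s..t, p τ) (hb : IntegrableOn b (Ioi T))
    (hqb : ∀ t, T ≤ t → |q t| ≤ b t) {t : ℝ} (ht : T ≤ t) :
    |∫ s in Ioi t, Real.exp (-∫ τ in t..s, p τ) * q s| ≤ Real.exp M * ∫ r in Ioi t, b r := by
  have hbs : IntegrableOn b (Ioi t) := hb.mono_set (Ioi_subset_Ioi ht)
  rw [← integral_const_mul, ← Real.norm_eq_abs]
  refine norm_integral_le_of_norm_le (hbs.const_mul _) ?_
  refine (ae_restrict_iff' measurableSet_Ioi).2 (Eventually.of_forall fun r hr => ?_)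
  have hr' : t ≤ r := le_of_lt hr
  have := h t r ht hr'
  rw [norm_mul, Real.norm_eq_abs, Real.norm_eq_abs, Real.abs_exp]
  exact mul_le_mul (Real.exp_le_exp.2 (by linarith)) (hqb r (ht.trans hr'))
      (abs_nonneg _) (Real.exp_nonneg _)

lemma setIntegral_Ioi_anti {b : ℝ → ℝ} {T : ℝ} (hb : IntegrableOn b (Ioi T))
    (hb0 : ∀ t, T ≤ t → 0 ≤ b t) {t : ℝ} (ht : T ≤ t) : ∫ r in Ioi t, b r ≤ ∫ r in Ioi T, b r := by
  refine setIntegral_mono_set hb ?_ (Ioi_subset_Ioi ht).eventuallyLE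
  exact (ae_restrict_iff' measurableSet_Ioi).2 (Eventually.of_forall fun r hr => hb0 r (le_of_lt hr))

/-- A priori bound for the bounded solution. -/
lemma abs_linSol_dichInit_le {p q b : ℝ → ℝ} (hp : Continuous p) (hq : Continuous q) {T M : ℝ}
    {J : Prop} (h : HasDichotomy p J T M) (hb : IntegrableOn b (Ioi T))
    (hqb : ∀ t, T ≤ t → |q t| ≤ b t) (c : ℝ) {t : ℝ} (ht : T ≤ t) :
    |linSol p q T (dichInit p q J T c) t| ≤ Real.exp M * (|c| + ∫ s in Ioi T, b s) := by
  by_cases hJ : J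
  · rw [linSol_eq_add hp hq T _ T t, linSol_self, dichInit, if_pos hJ, mul_add]
    refine (abs_add_le _ _).trans (add_le_add ?_
      (abs_intervalIntegral_exp_mul_le (h.1 hJ) hb hqb le_rfl ht))
    rw [abs_mul, Real.abs_exp]
    exact mul_le_mul_of_nonneg_right (Real.exp_le_exp.2 (h.1 hJ T t le_rfl ht)) (abs_nonneg _)
  · rw [linSol_dichInit_eq hp hq h hJ hb hqb c ht, abs_neg]
    refine (abs_setIntegral_exp_mul_le (h.2 hJ) hb hqb ht).trans ?_
    refine mul_le_mul_of_nonneg_left ?_ (Real.exp_nonneg _)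
    have := setIntegral_Ioi_anti hb (fun t ht => (abs_nonneg _).trans (hqb t ht)) ht
    have := abs_nonneg c
    linarith

lemma tendsto_setIntegral_Ioi_zero {b : ℝ → ℝ} {T : ℝ} (hb : IntegrableOn b (Ioi T)) :
    Tendsto (fun t => ∫ r in Ioi t, b r) atTop (𝓝 0) := by
  have h1 := intervalIntegral_tendsto_integral_Ioi T hb tendsto_id
  have h2 : Tendsto (fun t => (∫ r in Ioi T, b r) - ∫ r in T..t, b r) atTop (𝓝 0) := by
    simpa using h1.const_sub (∫ r in Ioi T, b r)
  refine h2.congr' ?_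
  filter_upwards [eventually_ge_atTop T] with t ht
  rw [intervalIntegral.integral_of_le ht, sub_eq_iff_eq_add, add_comm,
      ← setIntegral_union (Ioc_disjoint_Ioi le_rfl) measurableSet_Ioi
        (hb.mono_set Ioc_subset_Ioi_self) (hb.mono_set (Ioi_subset_Ioi ht)), Ioc_union_Ioi_eq_Ioi ht]

/-- For a free initial value, restart at s so late that the forcing after s contributes less than
η/2; the homogeneous part then decays because the primitive tends to -∞. In the other case the
solution is itself a tail integral, so no hypothesis on the primitive is needed. -/
lemma tendsto_linSol_dichInit {p q b : ℝ → ℝ} (hp : Continuous p) (hq : Continuous q) {T M : ℝ}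
    {J : Prop} (h : HasDichotomy p J T M) (hb : IntegrableOn b (Ioi T))
    (hqb : ∀ t, T ≤ t → |q t| ≤ b t) (c : ℝ)
    (hlim : J → Tendsto (fun t => ∫ τ in T..t, p τ) atTop atBot) :
    Tendsto (linSol p q T (dichInit p q J T c)) atTop (𝓝 0) := by
  have hb0 := (tendsto_setIntegral_Ioi_zero hb).const_mul (Real.exp M)
  rw [mul_zero] at hb0
  by_cases hJ : J
  · rw [Metric.tendsto_atTop]
    intro η hη
    set y := linSol p q T (dichInit p q J T c) with hy
    obtain ⟨s, hs1, hs2⟩ := ((hb0.eventually (gt_mem_nhds (half_pos hη))).and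
      (eventually_ge_atTop T)).exists
    have h3 : Tendsto (fun t => Real.exp (∫ τ in s..t, p τ) * y s) atTop (𝓝 0) := by
      rw [← zero_mul (y s)]
      refine Tendsto.mul_const _ (Real.tendsto_exp_atBot.comp ?_)
      have := tendsto_atBot_add_const_left atTop (-∫ τ in T..s, p τ) (hlim hJ)
      refine this.congr fun t => ?_
      rw [neg_add_eq_iff_eq_add]
      exact (intervalIntegral.integral_add_adjacent_intervals (hp.intervalIntegrable _ _)
      (hp.intervalIntegrable _ _)).symm
    obtain ⟨t0, ht0⟩ := (Metric.tendsto_atTop.1 h3) (η / 2) (half_pos hη)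
    refine ⟨max t0 s, fun t ht => ?_⟩
    have ht1 := ht0 t ((le_max_left _ _).trans ht)
    have ht2 := abs_intervalIntegral_exp_mul_le (h.1 hJ) hb hqb hs2
      ((le_max_right _ _).trans ht)
    rw [Real.dist_eq, sub_zero] at ht1 ⊢
    rw [hy, linSol_eq_add hp hq T _ s t]
    refine (abs_add_le _ _).trans_lt ?_
    rw [← hy]
    linarith
  · refine squeeze_zero_norm' ?_ hb0
    filter_upwards [eventually_ge_atTop T] with t ht
    rw [linSol_dichInit_eq hp hq h hJ hb hqb c ht, norm_neg]
    exact abs_setIntegral_exp_mul_le (h.2 hJ) hb hqb ht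

lemma linSol_sub {p q q' : ℝ → ℝ} (hp : Continuous p) (hq : Continuous q) (hq' : Continuous q')
    (T c c' t : ℝ) :
    linSol p q T c t - linSol p q' T c' t = linSol p (fun s => q s - q' s) T (c - c') t := by
  have hc : IntervalIntegrable (fun s => Real.exp (-(∫ τ in T..s, p τ)) * q s) volume T t :=
    ((continuous_exp_neg_primitive hp T).mul hq).intervalIntegrable T t
  have hc' : IntervalIntegrable (fun s => Real.exp (-(∫ τ in T..s, p τ)) * q' s) volume T t :=
    ((continuous_exp_neg_primitive hp T).mul hq').intervalIntegrable T t
  simp only [linSol, mul_sub]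
  rw [intervalIntegral.integral_sub hc hc']
  ring

/-- Together with `linSol_sub` this makes the difference of two bounded solutions a bounded solution
with the differences of the data, so that the a priori bound also yields the contraction estimate.
-/
lemma dichInit_sub {p q q' b : ℝ → ℝ} (hp : Continuous p) (hq : Continuous q) (hq' : Continuous q')
    {T M : ℝ} {J : Prop} (h : HasDichotomy p J T M) (hb : IntegrableOn b (Ioi T))
    (hqb : ∀ t, T ≤ t → |q t| ≤ b t) (hqb' : ∀ t, T ≤ t → |q' t| ≤ b t) (c c' : ℝ) :
    dichInit p q J T c - dichInit p q' J T c' = dichInit p (fun s => q s - q' s) J T (c - c') := by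
  by_cases hJ : J
  · simp [dichInit, hJ]
  · simp only [dichInit, hJ, if_false, mul_sub]
    rw [integral_sub (integrableOn_exp_neg_mul hp hq (h.2 hJ) hb hqb)
      (integrableOn_exp_neg_mul hp hq' (h.2 hJ) hb hqb')]
    ring

/-! ### Bounded solutions of weakly coupled systems -/

section Family

variable {ι : Type*} [Fintype ι]

/-- One step of the successive approximations for `z' = p z + G(t, z)`. -/
noncomputable def dichStep (p : ι → ℝ → ℝ) (J : Set ι) (G : ℝ → (ι → ℝ) → ι → ℝ) (T : ℝ) (c : ι → ℝ)
    (z : ℝ → ι → ℝ) (t : ℝ) (i : ι) : ℝ :=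
  linSol (p i) (fun s => G s (z s) i) T (dichInit (p i) (fun s => G s (z s) i) (i ∈ J) T (c i)) t

/-- Banach's fixed point theorem for `dichStep` in the space of bounded continuous functions. By the
a priori bound, the Lipschitz constant in z is exp M times the integral of g, hence at most 1/2, and
the dependence on c is Lipschitz uniformly in t. -/
theorem exists_bounded_solution_family {T M : ℝ} {p : ι → ℝ → ℝ} (hp : ∀ i, Continuous (p i))
    {J : Set ι} (hJ : ∀ i, HasDichotomy (p i) (i ∈ J) T M) {G : ℝ → (ι → ℝ) → ι → ℝ}
    (hG : Continuous fun x : ℝ × (ι → ℝ) => G x.1 x.2) {g : ℝ → ℝ} (hg : IntegrableOn g (Ioi T))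
    (hg0 : ∀ t, T ≤ t → 0 ≤ g t)
    (hLip : ∀ t, T ≤ t → ∀ x y, ‖G t x - G t y‖ ≤ g t * ‖x - y‖) (h0 : ∀ t, T ≤ t → ‖G t 0‖ ≤ g t)
    (hsmall : Real.exp M * ∫ t in Ioi T, g t ≤ 1 / 2) :
    ∃ z : (ι → ℝ) → ℝ → ι → ℝ, (∀ c, ∀ t ∈ Ici T, ∀ i,
        HasDerivWithinAt (fun τ => z c τ i) (p i t * z c t i + G t (z c t) i) (Ici T) t) ∧
      (∀ c t, ‖z c t‖ ≤ 2 * (Real.exp M * ‖c‖ + Real.exp M * ∫ t in Ioi T, g t)) ∧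
      (∀ c, ∀ i ∈ J, z c T i = c i) ∧ (∀ c, ∀ t ∈ Ici T, ContinuousAt (fun c => z c t) c) ∧
      ∀ c i, (i ∈ J → Tendsto (fun t => ∫ τ in T..t, p i τ) atTop atBot) →
        Tendsto (fun t => z c t i) atTop (𝓝 0) := by
  have hqc : ∀ (z : BoundedContinuousFunction ℝ (ι → ℝ)) i, Continuous fun s => G s (z s) i :=
    fun z i => (continuous_apply i).comp (hG.comp (continuous_id.prodMk z.continuous))
  have hbd : ∀ (z : BoundedContinuousFunction ℝ (ι → ℝ)) i t, T ≤ t →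
      |G t (z t) i| ≤ (‖z‖ + 1) * g t := by
    intro z i t ht
    have h1 := hLip t ht (z t) 0
    have h2 := h0 t ht
    have h3 : ‖G t (z t)‖ ≤ ‖G t (z t) - G t 0‖ + ‖G t 0‖ := by
      simpa using norm_add_le (G t (z t) - G t 0) (G t 0)
    rw [sub_zero] at h1
    have h4 := mul_le_mul_of_nonneg_left (z.norm_coe_le_norm t) (hg0 t ht)
    have h5 := norm_le_pi_norm (G t (z t)) i
    rw [Real.norm_eq_abs] at h5
    linarith
  set I := ∫ t in Ioi T, g t with hI
  have hI0 : 0 ≤ I := setIntegral_nonneg measurableSet_Ioi fun t ht => hg0 t (le_of_lt ht)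
  have hgi : ∀ x : ℝ, IntegrableOn (fun t => x * g t) (Ioi T) := fun x => hg.const_mul x
  have hgI : ∀ x : ℝ, ∫ t in Ioi T, x * g t = x * I := fun x => integral_const_mul _ _
  -- The iterates matter only on [T, ∞); composition with max t T extends them by a constant to the
  -- left, so that they live on the whole line.
  have hstep_cont : ∀ c (z : BoundedContinuousFunction ℝ (ι → ℝ)),
      Continuous fun t => dichStep p J G T c z (max t T) := fun c z =>
    continuous_pi fun i => (continuous_linSol (hp i) (hqc z i) _ _).comp
      (continuous_id.max continuous_const)
  have hstep_bd : ∀ c (z : BoundedContinuousFunction ℝ (ι → ℝ)) t,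
      ‖dichStep p J G T c z (max t T)‖ ≤ Real.exp M * (‖c‖ + (‖z‖ + 1) * I) := by
    intro c z t
    refine (pi_norm_le_iff_of_nonneg (by positivity)).2 fun i => ?_
    have := abs_linSol_dichInit_le (hp i) (hqc z i) (hJ i) (hgi (‖z‖ + 1)) (hbd z i) (c i)
      (le_max_right t T)
    rw [hgI] at this
    refine this.trans (mul_le_mul_of_nonneg_left ?_ (Real.exp_nonneg _))
    have := norm_le_pi_norm c i
    rw [Real.norm_eq_abs] at this
    linarith
  let Φ : (ι → ℝ) → BoundedContinuousFunction ℝ (ι → ℝ) → BoundedContinuousFunction ℝ (ι → ℝ) :=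
    fun c z => BoundedContinuousFunction.ofNormedAddCommGroup
      (fun t => dichStep p J G T c z (max t T)) (hstep_cont c z) _ (hstep_bd c z)
  have hΦ : ∀ c z t, Φ c z t = dichStep p J G T c z (max t T) := fun c z t => rfl
  have hdist : ∀ c c' z z', dist (Φ c z) (Φ c' z') ≤ Real.exp M * ‖c - c'‖ + 1 / 2 * dist z z' := by
    intro c c' z z'
    refine (BoundedContinuousFunction.dist_le (by positivity)).2 fun t => ?_
    rw [dist_eq_norm]
    refine (pi_norm_le_iff_of_nonneg (by positivity)).2 fun i => ?_
    rw [Pi.sub_apply, hΦ, hΦ, dichStep, dichStep, linSol_sub (hp i) (hqc z i) (hqc z' i),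
      dichInit_sub (b := fun t => (max ‖z‖ ‖z'‖ + 1) * g t) (hp i) (hqc z i) (hqc z' i) (hJ i)
        (hgi _) (fun t ht => (hbd z i t ht).trans ?_) (fun t ht => (hbd z' i t ht).trans ?_)]
    -- The sharp majorant of the difference is dist z z' · g. The cruder majorant used before only
    -- justifies subtracting the two improper integrals.
    · have := abs_linSol_dichInit_le (hp i) ((hqc z i).sub (hqc z' i)) (hJ i) (hgi (dist z z'))
        (fun t ht => ?_) (c i - c' i) (le_max_right t T)
      · rw [hgI] at this
        refine this.trans ?_
        have h1 := norm_le_pi_norm (c - c') i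
        rw [Pi.sub_apply, Real.norm_eq_abs] at h1
        have h2 := mul_le_mul_of_nonneg_left h1 (Real.exp_nonneg M)
        have h3 := mul_le_mul_of_nonneg_left hsmall (dist_nonneg (x := z) (y := z'))
        linarith
      · have h1 := norm_le_pi_norm (G t (z t) - G t (z' t)) i
        rw [Pi.sub_apply, Real.norm_eq_abs] at h1
        refine h1.trans ((hLip t ht _ _).trans ?_)
        rw [mul_comm, ← dist_eq_norm]
        exact mul_le_mul_of_nonneg_right (BoundedContinuousFunction.dist_coe_le_dist t) (hg0 t ht)
    · exact mul_le_mul_of_nonneg_right (by linarith [le_max_left ‖z‖ ‖z'‖]) (hg0 t ht)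
    · exact mul_le_mul_of_nonneg_right (by linarith [le_max_right ‖z‖ ‖z'‖]) (hg0 t ht)
  have hcontr : ∀ c, ContractingWith (1 / 2 : NNReal) (Φ c) := fun c =>
    ⟨by rw [← NNReal.coe_lt_coe]; norm_num, LipschitzWith.of_dist_le_mul fun z z' => by
      have := hdist c c z z'; simpa using this⟩
  let Z : (ι → ℝ) → BoundedContinuousFunction ℝ (ι → ℝ) := fun c => (hcontr c).fixedPoint
  have hfix : ∀ c, Φ c (Z c) = Z c := fun c => (hcontr c).fixedPoint_isFixedPt
  have hZ : ∀ c t, T ≤ t → Z c t = dichStep p J G T c (Z c) t := fun c t ht => by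
    conv_lhs => rw [← hfix c, hΦ, max_eq_left ht]
  have hZdist : ∀ c c', dist (Z c) (Z c') ≤ 2 * (Real.exp M * ‖c - c'‖) := by
    intro c c'
    have := hdist c c' (Z c) (Z c')
    rw [hfix, hfix] at this
    linarith
  refine ⟨fun c t => Z c t, ?_, ?_, ?_, ?_, ?_⟩
  · intro c t ht i
    have h1 := (hasDerivAt_linSol (hp i) (hqc (Z c) i) T
      (dichInit (p i) (fun s => G s (Z c s) i) (i ∈ J) T (c i)) t).hasDerivWithinAt (s := Ici T)
    have h2 : ∀ s ∈ Ici T, Z c s i = linSol (p i) (fun s => G s (Z c s) i) T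
      (dichInit (p i) (fun s => G s (Z c s) i) (i ∈ J) T (c i)) s := fun s hs =>
        congrFun (hZ c s hs) i
    refine (h1.congr h2 (h2 t ht)).congr_deriv ?_
    simp only
    rw [h2 t ht]
  · intro c t
    have h1 := (hstep_bd c (Z c) t)
    rw [← hΦ, hfix] at h1
    -- The fixed point bounds itself: since exp M · I ≤ 1/2, the term with ‖Z c‖ on the right is at
    -- most half of the left side and can be absorbed, which gives the factor 2.
    have h2 : ‖Z c‖ ≤ Real.exp M * (‖c‖ + (‖Z c‖ + 1) * I) := by
      refine (BoundedContinuousFunction.norm_le (by positivity)).2 fun s => ?_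
      have := (hstep_bd c (Z c) s)
      rwa [← hΦ, hfix] at this
    have h3 := mul_le_mul_of_nonneg_left hsmall (norm_nonneg (Z c))
    have h4 := (Z c).norm_coe_le_norm t
    simp only
    linarith
  · intro c i hi
    simp only
    rw [hZ c T le_rfl, dichStep, linSol_self, dichInit, if_pos hi]
  · intro c t _
    rw [Metric.continuousAt_iff]
    intro η hη
    refine ⟨η / (2 * Real.exp M), by positivity, fun c' hc' => ?_⟩
    refine (BoundedContinuousFunction.dist_coe_le_dist t).trans_lt ((hZdist c' c).trans_lt ?_)
    rw [dist_eq_norm, lt_div_iff₀ (by positivity)] at hc'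
    linarith
  · intro c i hi
    refine (tendsto_linSol_dichInit (hp i) (hqc (Z c) i) (hJ i) (hgi _) (hbd (Z c) i) (c i)
      hi).congr' ?_
    filter_upwards [eventually_ge_atTop T] with t ht
    exact (congrFun (hZ c t ht) i).symm

/-- The retraction of `ι → ℝ` onto the unit ball of the maximum norm. -/
noncomputable def clampOne (x : ι → ℝ) (i : ι) : ℝ := max (-1) (min 1 (x i))

lemma norm_clampOne_le (x : ι → ℝ) : ‖clampOne x‖ ≤ 1 := by
  refine (pi_norm_le_iff_of_nonneg zero_le_one).2 fun i => ?_
  rw [Real.norm_eq_abs, abs_le, clampOne]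
  exact ⟨le_max_left _ _, max_le (by norm_num) (min_le_left _ _)⟩

lemma clampOne_eq_self {x : ι → ℝ} (hx : ‖x‖ ≤ 1) : clampOne x = x := by
  ext i
  have := (norm_le_pi_norm x i).trans hx
  rw [Real.norm_eq_abs, abs_le] at this
  rw [clampOne, min_eq_right this.2, max_eq_right this.1]

lemma norm_clampOne_sub_le (x y : ι → ℝ) : ‖clampOne x - clampOne y‖ ≤ ‖x - y‖ := by
  refine (pi_norm_le_iff_of_nonneg (norm_nonneg _)).2 fun i => ?_
  refine le_trans ?_ (norm_le_pi_norm (x - y) i)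
  simp only [Pi.sub_apply, clampOne, Real.norm_eq_abs]
  refine (abs_max_sub_max_le_max _ _ _ _).trans ?_
  rw [sub_self, abs_zero, max_eq_right (abs_nonneg _)]
  refine (abs_min_sub_min_le_max _ _ _ _).trans ?_
  rw [sub_self, abs_zero, max_eq_right (abs_nonneg _)]

lemma continuous_clampOne {κ : Type*} : Continuous (clampOne : (κ → ℝ) → κ → ℝ) :=
  continuous_pi fun i => continuous_const.max (continuous_const.min (continuous_apply i))

/-- Bounded solutions of `z' = p z + G(t, z)` on `[T, ∞)` with `G` given on the unit ball. -/
theorem exists_bounded_solution_family_unitBall {T M : ℝ} {p : ι → ℝ → ℝ}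
    (hp : ∀ i, ContinuousOn (p i) (Ici T))
    {J : Set ι} (hJ : ∀ i, HasDichotomy (p i) (i ∈ J) T M) {G : ℝ → (ι → ℝ) → ι → ℝ}
    (hG : ContinuousOn (fun x : ℝ × (ι → ℝ) => G x.1 x.2) (Ici T ×ˢ Metric.closedBall 0 1))
    {g : ℝ → ℝ} (hg : IntegrableOn g (Ioi T)) (hg0 : ∀ t, T ≤ t → 0 ≤ g t)
    (hLip : ∀ t, T ≤ t → ∀ x y, ‖x‖ ≤ 1 → ‖y‖ ≤ 1 → ‖G t x - G t y‖ ≤ g t * ‖x - y‖)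
    (h0 : ∀ t, T ≤ t → ‖G t 0‖ ≤ g t)
    (hsmall : Real.exp M * ∫ t in Ioi T, g t ≤ 1 / 4) :
    ∃ z : (ι → ℝ) → ℝ → ι → ℝ, (∀ c, ‖c‖ ≤ Real.exp (-M) / 4 → ∀ t ∈ Ici T, ‖z c t‖ ≤ 1 ∧ ∀ i,
        HasDerivWithinAt (fun τ => z c τ i) (p i t * z c t i + G t (z c t) i) (Ici T) t) ∧
      (∀ c, ∀ i ∈ J, z c T i = c i) ∧ (∀ c, ∀ t ∈ Ici T, ContinuousAt (fun c => z c t) c) ∧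
      ∀ c i, (i ∈ J → Tendsto (fun t => ∫ τ in T..t, p i τ) atTop atBot) →
        Tendsto (fun t => z c t i) atTop (𝓝 0) := by
  have hmax : Continuous fun t : ℝ => max t T := continuous_id.max continuous_const
  have hint : ∀ i s t, T ≤ s → s ≤ t → ∫ τ in s..t, p i (max τ T) = ∫ τ in s..t, p i τ := by
    intro i s t hs ht
    refine intervalIntegral.integral_congr fun τ hτ => ?_
    rw [uIcc_of_le ht] at hτ
    simp only [max_eq_left (hs.trans hτ.1)]
  obtain ⟨z, h1, h2, h3, h4, h5⟩ := exists_bounded_solution_family (T := T) (M := M)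
    (p := fun i t => p i (max t T)) (J := J) (G := fun t x => G (max t T) (clampOne x)) (g := g)
    (fun i => (hp i).comp_continuous hmax fun t => le_max_right t T)
    (fun i => ⟨fun h s t hs ht => by rw [hint i s t hs ht]; exact (hJ i).1 h s t hs ht,
      fun h s t hs ht => by rw [hint i s t hs ht]; exact (hJ i).2 h s t hs ht⟩)
    (hG.comp_continuous ((hmax.comp continuous_fst).prodMk (continuous_clampOne.comp continuous_snd))
      fun x => ⟨le_max_right x.1 T, by simpa using norm_clampOne_le x.2⟩) hg hg0
    (fun t ht x y => by
      rw [max_eq_left ht]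
      exact (hLip t ht _ _ (norm_clampOne_le x) (norm_clampOne_le y)).trans
        (mul_le_mul_of_nonneg_left (norm_clampOne_sub_le x y) (hg0 t ht)))
    (fun t ht => by
      rw [max_eq_left ht, clampOne_eq_self (by simp)]
      exact h0 t ht) (hsmall.trans (by norm_num))
  refine ⟨z, fun c hc t ht => ?_, h3, h4, fun c i hi => h5 c i fun hiJ => (hi hiJ).congr' ?_⟩
  -- The general bound gives 2 (1/4 + 1/4) = 1, so the solution never leaves the unit ball and the
  -- truncation by `clampOne` is inactive.
  · have hz : ‖z c t‖ ≤ 1 := by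
      have e1 : Real.exp M * Real.exp (-M) = 1 := by rw [← Real.exp_add]; simp
      have := mul_le_mul_of_nonneg_left hc (Real.exp_nonneg M)
      have := h2 c t
      linarith
    refine ⟨hz, fun i => ?_⟩
    have := h1 c t ht i
    rwa [max_eq_left ht, clampOne_eq_self hz] at this
  · filter_upwards [eventually_ge_atTop T] with t ht using (hint i T t le_rfl ht).symm

end Family

/-! ### The dichotomy -/

lemma exists_abs_le_of_isBigO_one {f : ℝ → ℝ} {T : ℝ} (hf : ContinuousOn f (Ici T))
    (h : f =O[atTop] fun _ => (1 : ℝ)) : ∃ C, 0 ≤ C ∧ ∀ t ∈ Ici T, |f t| ≤ C := by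
  obtain ⟨C, hC⟩ := h.bound
  obtain ⟨t1, ht1⟩ := eventually_atTop.1 hC
  obtain ⟨C', hC'⟩ := (isCompact_Icc (a := T) (b := t1)).exists_bound_of_continuousOn
    (hf.mono Icc_subset_Ici_self)
  refine ⟨max 0 (max C C'), le_max_left _ _, fun t ht => ?_⟩
  rcases le_total t1 t with h | h
  · have := ht1 t h
    rw [norm_one, mul_one, Real.norm_eq_abs] at this
    exact this.trans ((le_max_left _ _).trans (le_max_right _ _))
  · exact (hC' t ⟨ht, h⟩).trans ((le_max_right _ _).trans (le_max_right _ _))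

lemma ContinuousOn.intervalIntegrable_of_Ici {f : ℝ → ℝ} {T s t : ℝ} (hf : ContinuousOn f (Ici T))
    (hs : T ≤ s) (ht : T ≤ t) : IntervalIntegrable f volume s t :=
  (hf.mono fun _ hx => (le_inf hs ht).trans hx.1).intervalIntegrable

lemma continuousOn_primitive_Ici {f : ℝ → ℝ} {T : ℝ} (hf : ContinuousOn f (Ici T)) :
    ContinuousOn (fun t => ∫ τ in T..t, f τ) (Ici T) := by
  have h : Continuous fun t => f (max t T) :=
    hf.comp_continuous (continuous_id.max continuous_const) fun t => le_max_right t T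
  refine (intervalIntegral.continuous_primitive (fun a b => h.intervalIntegrable a b)
    T).continuousOn.congr fun t ht => intervalIntegral.integral_congr fun τ hτ => ?_
  rw [uIcc_of_le ht] at hτ
  simp only [max_eq_left hτ.1]

/-- Split p into σ and p - σ. The primitive of p - σ converges, hence is bounded; the primitive of σ
is bounded on a compact interval and nondecreasing afterwards. -/
lemma exists_le_integral_of_eventually_nonneg {p σ : ℝ → ℝ} {T : ℝ} (hp : ContinuousOn p (Ici T))
    (hσ : ContinuousOn σ (Ici T)) (hsgn : ∀ᶠ t in atTop, 0 ≤ σ t)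
    (hlim : ∃ z, Tendsto (fun t => ∫ τ in T..t, (p τ - σ τ)) atTop (𝓝 z)) :
    ∃ M, ∀ s t, T ≤ s → s ≤ t → -M ≤ ∫ τ in s..t, p τ := by
  obtain ⟨z, hz⟩ := hlim
  obtain ⟨b, hb0, hb⟩ := exists_abs_le_of_isBigO_one (continuousOn_primitive_Ici (hp.sub hσ))
    (hz.isBigO_one ℝ)
  obtain ⟨t1, ht1⟩ := eventually_atTop.1 (hsgn.and (eventually_ge_atTop T))
  have hT1 : T ≤ t1 := (ht1 t1 le_rfl).2
  obtain ⟨h, hh⟩ := (isCompact_Icc (a := T) (b := t1)).exists_bound_of_continuousOn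
    ((continuousOn_primitive_Ici hσ).mono Icc_subset_Ici_self)
  refine ⟨2 * b + 2 * h, fun s t hs ht => ?_⟩
  have hsub : ∀ {f : ℝ → ℝ}, ContinuousOn f (Ici T) → ∀ s t, T ≤ s → s ≤ t →
      (∫ τ in s..t, f τ) = (∫ τ in T..t, f τ) - ∫ τ in T..s, f τ := fun hf s t hs ht => by
    rw [intervalIntegral.integral_interval_sub_left
      (hf.intervalIntegrable_of_Ici le_rfl (hs.trans ht)) (hf.intervalIntegrable_of_Ici le_rfl hs)]
  have hps : ContinuousOn (fun τ => p τ - σ τ) (Ici T) := hp.sub hσ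
  have hE : ∫ τ in s..t, p τ = (∫ τ in s..t, σ τ) + ∫ τ in s..t, (p τ - σ τ) := by
    rw [intervalIntegral.integral_sub (hp.intervalIntegrable_of_Ici hs (hs.trans ht))
      (hσ.intervalIntegrable_of_Ici hs (hs.trans ht))]
    ring
  have h1 := abs_le.1 (hb t (hs.trans ht))
  have h2 := abs_le.1 (hb s hs)
  simp only [Pi.sub_apply] at h1 h2
  have hmono : ∀ s t, t1 ≤ s → s ≤ t → 0 ≤ ∫ τ in s..t, σ τ := fun s t hs ht =>
    intervalIntegral.integral_nonneg ht fun τ hτ => (ht1 τ (hs.trans hτ.1)).1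
  have hcpt : ∀ s, T ≤ s → s ≤ t1 → -h ≤ (∫ τ in T..s, σ τ) ∧ (∫ τ in T..s, σ τ) ≤ h :=
    fun s hs ht => abs_le.1 (hh s ⟨hs, ht⟩)
  have h3 : -(2 * h) ≤ ∫ τ in s..t, σ τ := by
    rcases le_total t t1 with h4 | h4
    · have := hcpt t (hs.trans ht) h4
      have := hcpt s hs (ht.trans h4)
      rw [hsub hσ s t hs ht]
      linarith
    · have h5 := hcpt t1 hT1 le_rfl
      rcases le_total s t1 with h6 | h6
      · have := hcpt s hs h6
        have := hmono t1 t le_rfl h4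
        rw [hsub hσ _ _ hT1 h4] at this
        rw [hsub hσ s t hs ht]
        linarith
      · have := hmono s t h6 ht
        linarith
  rw [hE, hsub hps s t hs ht]
  linarith

/-- A continuous function of eventually constant sign, up to a function with convergent integral,
has a dichotomy. -/
theorem exists_dichotomy {p σ : ℝ → ℝ} {T : ℝ} (hp : ContinuousOn p (Ici T))
    (hσ : ContinuousOn σ (Ici T)) (hsgn : (∀ᶠ t in atTop, 0 ≤ σ t) ∨ ∀ᶠ t in atTop, σ t ≤ 0)
    (hlim : ∃ z, Tendsto (fun t => ∫ τ in T..t, (p τ - σ τ)) atTop (𝓝 z)) :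
    ∃ M, ∀ T' ∈ Ici T,
      HasDichotomy p (¬ Tendsto (fun t => ∫ τ in T..t, p τ) atTop atTop) T' M := by
  -- The increments are controlled over all of [T, ∞), so one constant serves every later initial
  -- point T', while the alternative itself is decided by the integral from T.
  have key : (∃ M, ∀ s t, T ≤ s → s ≤ t → -M ≤ ∫ τ in s..t, p τ) ∨
      ∃ M, ∀ s t, T ≤ s → s ≤ t → ∫ τ in s..t, p τ ≤ M := by
    rcases hsgn with h | h
    · exact Or.inl (exists_le_integral_of_eventually_nonneg hp hσ h hlim)
    · refine Or.inr ?_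
      obtain ⟨z, hz⟩ := hlim
      obtain ⟨M, hM⟩ := exists_le_integral_of_eventually_nonneg hp.neg hσ.neg
        (h.mono fun t ht => neg_nonneg.2 ht) ⟨-z, hz.neg.congr fun t => by
          rw [← intervalIntegral.integral_neg]
          refine intervalIntegral.integral_congr fun τ _ => ?_
          simp only [Pi.neg_apply]
          ring⟩
      refine ⟨M, fun s t hs ht => ?_⟩
      have := hM s t hs ht
      simp only [Pi.neg_apply, intervalIntegral.integral_neg] at this
      linarith
  by_cases htop : Tendsto (fun t => ∫ τ in T..t, p τ) atTop atTop
  · have : ∃ M, ∀ s t, T ≤ s → s ≤ t → -M ≤ ∫ τ in s..t, p τ := by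
      rcases key with h | ⟨M, hM⟩
      · exact h
      · exfalso
        obtain ⟨t, ht1, ht2⟩ := ((htop.eventually_gt_atTop M).and (eventually_ge_atTop T)).exists
        exact absurd (hM T t le_rfl ht2) (not_le.2 ht1)
    obtain ⟨M, hM⟩ := this
    exact ⟨M, fun T' hT' => ⟨fun h => absurd htop h, fun _ s t hs ht => hM s t (hT'.trans hs) ht⟩⟩
  · have : ∃ M, ∀ s t, T ≤ s → s ≤ t → ∫ τ in s..t, p τ ≤ M := by
      rcases key with ⟨m, hm⟩ | h
      · have hadd : ∀ s t, T ≤ s → s ≤ t →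
            (∫ τ in T..s, p τ) + ∫ τ in s..t, p τ = ∫ τ in T..t, p τ := fun s t hs ht =>
          intervalIntegral.integral_add_adjacent_intervals (hp.intervalIntegrable_of_Ici le_rfl hs)
            (hp.intervalIntegrable_of_Ici hs (hs.trans ht))
        -- With increments bounded below by -m, a primitive that once exceeds A + m stays above A.
        -- An unbounded primitive would therefore tend to +∞.
        have hA : ∃ A, ∀ s, T ≤ s → ∫ τ in T..s, p τ ≤ A := by
          by_contra! hcon
          refine htop (tendsto_atTop.2 fun A => ?_)
          obtain ⟨s, hs, hs'⟩ := hcon (A + m)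
          filter_upwards [eventually_ge_atTop s] with t ht
          have := hm s t hs ht
          have := hadd s t hs ht
          linarith
        obtain ⟨A, hA⟩ := hA
        refine ⟨A + m, fun s t hs ht => ?_⟩
        have := hadd s t hs ht
        have := hA t (hs.trans ht)
        have := hm T s le_rfl hs
        linarith
      · exact h
    obtain ⟨M, hM⟩ := this
    exact ⟨M, fun T' hT' => ⟨fun _ s t hs ht => hM s t (hT'.trans hs) ht, fun h => absurd htop h⟩⟩

lemma HasDichotomy.mono {p : ℝ → ℝ} {J : Prop} {T M M' : ℝ} (h : HasDichotomy p J T M)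
    (hM : M ≤ M') : HasDichotomy p J T M' :=
  ⟨fun hJ s t hs ht => (h.1 hJ s t hs ht).trans hM,
    fun hJ s t hs ht => (neg_le_neg hM).trans (h.2 hJ s t hs ht)⟩


/-! ### Arithmetic in the classes -/

section ClassArith

variable {t₀ : ℝ} {K : Set (Ici t₀ → ℝ)} {Ω : Set ℂ}

lemma InClass.congr {f g : ℝ → ℝ} (hf : InClass K f) (h : ∀ t ∈ Ici t₀, g t = f t) :
    InClass K g := by
  have : (Ici t₀).domRestrict g = (Ici t₀).domRestrict f := funext fun t => h t t.2
  rw [InClass, this]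
  exact hf

lemma IsClassK1.add (hK : IsClassK1 Ω K) {f g : ℝ → ℝ} (hf : InClass K f) (hg : InClass K g) :
    InClass K fun t => f t + g t := hK.add_mem _ hf _ hg

lemma IsClassK1.mul (hK : IsClassK1 Ω K) {f g : ℝ → ℝ} (hf : InClass K f) (hg : InClass K g) :
    InClass K fun t => f t * g t := hK.mul_mem _ hf _ hg

lemma IsClassK1.const_mul (hK : IsClassK1 Ω K) (c : ℝ) {f : ℝ → ℝ} (hf : InClass K f) :
    InClass K fun t => c * f t := hK.smul_mem c _ hf

lemma IsClassK1.zero (hK : IsClassK1 Ω K) : InClass K fun _ => (0 : ℝ) := by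
  obtain ⟨f, hf⟩ := hK.nonempty
  have := hK.smul_mem 0 f hf
  simp only [zero_mul] at this
  exact this

lemma IsClassK1.neg (hK : IsClassK1 Ω K) {f : ℝ → ℝ} (hf : InClass K f) :
    InClass K fun t => -f t := (hK.const_mul (-1) hf).congr fun t _ => by ring

lemma IsClassK1.sub (hK : IsClassK1 Ω K) {f g : ℝ → ℝ} (hf : InClass K f) (hg : InClass K g) :
    InClass K fun t => f t - g t := (hK.add hf (hK.neg hg)).congr fun t _ => by ring

lemma IsClassK1.sum (hK : IsClassK1 Ω K) {ι : Type*} (s : Finset ι) {f : ι → ℝ → ℝ}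
    (hf : ∀ i ∈ s, InClass K (f i)) : InClass K fun t => ∑ i ∈ s, f i t := by
  classical
  induction s using Finset.induction_on with
  | empty => simpa using hK.zero
  | insert i s hi ih =>
    refine (hK.add (hf i (Finset.mem_insert_self _ _))
      (ih fun j hj => hf j (Finset.mem_insert_of_mem hj))).congr fun t _ => ?_
    rw [Finset.sum_insert hi]

lemma IsClassK1.continuousOn (hK : IsClassK1 Ω K) {f : ℝ → ℝ} (hf : InClass K f) :
    ContinuousOn f (Ici t₀) := continuousOn_iff_continuous_domRestrict.2 (hK.continuous _ hf)

lemma IsClassK1.exists_bound (hK : IsClassK1 Ω K) {f : ℝ → ℝ} (hf : InClass K f) :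
    ∃ C, 0 ≤ C ∧ ∀ t ∈ Ici t₀, |f t| ≤ C := by
  obtain ⟨C, hC⟩ := hK.bounded _ hf
  exact ⟨C, (abs_nonneg _).trans (hC ⟨t₀, self_mem_Ici⟩), fun t ht => hC ⟨t, ht⟩⟩

/-- The functions that are on `[t₀, ∞)` sums of a constant and a member of the class. -/
def classAlg (hK : IsClassK1 Ω K) : Subalgebra ℝ (ℝ → ℝ) where
  carrier := {g | ∃ (c : ℝ) (h : ℝ → ℝ), InClass K h ∧ ∀ t ∈ Ici t₀, g t = c + h t}
  mul_mem' := by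
    rintro g g' ⟨c, h, hh, e⟩ ⟨c', h', hh', e'⟩
    refine ⟨c * c', fun t => (c * h' t + c' * h t) + h t * h' t, hK.add (hK.add (hK.const_mul c hh')
      (hK.const_mul c' hh)) (hK.mul hh hh'), fun t ht => ?_⟩
    rw [Pi.mul_apply, e t ht, e' t ht]
    ring
  add_mem' := by
    rintro g g' ⟨c, h, hh, e⟩ ⟨c', h', hh', e'⟩
    refine ⟨c + c', fun t => h t + h' t, hK.add hh hh', fun t ht => ?_⟩
    rw [Pi.add_apply, e t ht, e' t ht]
    ring
  algebraMap_mem' := fun r => ⟨r, fun _ => 0, hK.zero, fun t _ => by simp⟩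

lemma mem_classAlg_of_inClass (hK : IsClassK1 Ω K) {f : ℝ → ℝ} (hf : InClass K f) :
    f ∈ classAlg hK := ⟨0, f, hf, fun t _ => by simp⟩

/-- The class need not contain constants, but it is an ideal in the algebra generated by it and the
constants. Coefficients of products of formal series lie only in that algebra; a Taylor coefficient
from the class brings the product back. -/
lemma inClass_mul_of_mem_classAlg (hK : IsClassK1 Ω K) {g f : ℝ → ℝ} (hg : g ∈ classAlg hK)
    (hf : InClass K f) : InClass K fun t => g t * f t := by
  obtain ⟨c, h, hh, e⟩ := hg
  refine (hK.add (hK.const_mul c hf) (hK.mul hh hf)).congr fun t ht => ?_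
  rw [e t ht]
  ring

/-- Complex functions with real and imaginary part in the class. -/
def InClassC (K : Set (Ici t₀ → ℝ)) (g : ℝ → ℂ) : Prop :=
  InClass K (fun t => (g t).re) ∧ InClass K (fun t => (g t).im)

lemma IsClassK1.zeroC (hK : IsClassK1 Ω K) : InClassC K fun _ => (0 : ℂ) := ⟨hK.zero, hK.zero⟩

lemma IsClassK1.const_mulC (hK : IsClassK1 Ω K) (c : ℂ) {f : ℝ → ℂ} (hf : InClassC K f) :
    InClassC K fun t => c * f t :=
  ⟨(hK.sub (hK.const_mul c.re hf.1) (hK.const_mul c.im hf.2)).congr fun t _ => by simp,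
    (hK.add (hK.const_mul c.re hf.2) (hK.const_mul c.im hf.1)).congr fun t _ => by simp⟩

lemma IsClassK1.mul_constC (hK : IsClassK1 Ω K) (c : ℂ) {f : ℝ → ℂ} (hf : InClassC K f) :
    InClassC K fun t => f t * c := by
  simpa only [mul_comm] using hK.const_mulC c hf

lemma IsClassK1.sumC (hK : IsClassK1 Ω K) {ι : Type*} (s : Finset ι) {f : ι → ℝ → ℂ}
    (hf : ∀ i ∈ s, InClassC K (f i)) : InClassC K fun t => ∑ i ∈ s, f i t :=
  ⟨(hK.sum s fun i hi => (hf i hi).1).congr fun _ _ => Complex.re_sum _ _,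
    (hK.sum s fun i hi => (hf i hi).2).congr fun _ _ => Complex.im_sum _ _⟩

lemma IsClassK1.ofRealC (hK : IsClassK1 Ω K) {f : ℝ → ℝ} (hf : InClass K f) :
    InClassC K fun t => (f t : ℂ) := ⟨hf, by simpa using hK.zero⟩

end ClassArith

/-! ### Entrywise derivatives of matrix functions -/

section MatDeriv

variable {n : ℕ} {𝕜 : Type*} [RCLike 𝕜]

/-- Entrywise derivative of a matrix function. -/
def HasMatDeriv (X : ℝ → Matrix (Fin n) (Fin n) 𝕜) (X' : Matrix (Fin n) (Fin n) 𝕜) (s : Set ℝ)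
    (t : ℝ) : Prop :=
  ∀ i j, HasDerivWithinAt (fun τ => X τ i j) (X' i j) s t

variable {X Y : ℝ → Matrix (Fin n) (Fin n) 𝕜} {X' Y' : Matrix (Fin n) (Fin n) 𝕜} {s : Set ℝ} {t : ℝ}

lemma hasMatDeriv_const (M : Matrix (Fin n) (Fin n) 𝕜) : HasMatDeriv (fun _ => M) 0 s t :=
  fun i j => hasDerivWithinAt_const t s (M i j)

lemma HasMatDeriv.add (hX : HasMatDeriv X X' s t) (hY : HasMatDeriv Y Y' s t) :
    HasMatDeriv (fun τ => X τ + Y τ) (X' + Y') s t := fun i j => (hX i j).add (hY i j)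

lemma HasMatDeriv.mul (hX : HasMatDeriv X X' s t) (hY : HasMatDeriv Y Y' s t) :
    HasMatDeriv (fun τ => X τ * Y τ) (X' * Y t + X t * Y') s t := by
  intro i j
  simp only [Matrix.mul_apply, Matrix.add_apply]
  rw [← Finset.sum_add_distrib]
  exact HasDerivWithinAt.fun_sum fun k _ => (hX i k).mul (hY k j)

lemma HasMatDeriv.const_mul_mul_const (M N : Matrix (Fin n) (Fin n) 𝕜) (hX : HasMatDeriv X X' s t) :
    HasMatDeriv (fun τ => M * X τ * N) (M * X' * N) s t := by
  have := ((hasMatDeriv_const M).mul hX).mul (hasMatDeriv_const N)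
  simpa using this

lemma HasMatDeriv.mono {s' : Set ℝ} (hX : HasMatDeriv X X' s t) (h : s' ⊆ s) :
    HasMatDeriv X X' s' t := fun i j => (hX i j).mono h

lemma HasMatDeriv.congr_deriv (hX : HasMatDeriv X X' s t) (h : X' = Y') : HasMatDeriv X Y' s t :=
  h ▸ hX

lemma HasMatDeriv.sum {ι : Type*} (u : Finset ι) {X : ι → ℝ → Matrix (Fin n) (Fin n) 𝕜}
    {X' : ι → Matrix (Fin n) (Fin n) 𝕜} (hX : ∀ i ∈ u, HasMatDeriv (X i) (X' i) s t) :
    HasMatDeriv (fun τ => ∑ i ∈ u, X i τ) (∑ i ∈ u, X' i) s t := by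
  intro i j
  simp only [Matrix.sum_apply]
  exact HasDerivWithinAt.fun_sum fun k hk => hX k hk i j

lemma HasMatDeriv.smul {c : ℝ → 𝕜} {c' : 𝕜} (hc : HasDerivWithinAt c c' s t)
    (hX : HasMatDeriv X X' s t) :
    HasMatDeriv (fun τ => c τ • X τ) (c' • X t + c t • X') s t := fun i j => hc.mul (hX i j)

end MatDeriv

/-! ### Eigenvectors of a real matrix with simple eigenvalues -/

section EigenFrame

variable {n : ℕ} {A : Matrix (Fin n) (Fin n) ℝ} {lam : Fin n → ℂ}

/-- The columns of `V` are eigenvectors to the eigenvalues `lam`, `V'` is the inverse of `V`, and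
complex conjugation permutes the eigenvectors. -/
structure IsEigenFrame (A : Matrix (Fin n) (Fin n) ℝ) (lam : Fin n → ℂ)
    (V V' : Matrix (Fin n) (Fin n) ℂ) (σ : Equiv.Perm (Fin n)) : Prop where
  mul_inv : V * V' = 1
  inv_mul : V' * V = 1
  eigen : A.map (fun x : ℝ => (x : ℂ)) * V = V * Matrix.diagonal lam
  conj_col : ∀ i j, V i (σ j) = starRingEnd ℂ (V i j)
  conj_lam : ∀ j, lam (σ j) = starRingEnd ℂ (lam j)
  invol : ∀ j, σ (σ j) = j

/-- Conjugating `V'` and permuting its rows by σ gives another left inverse of `V`, and the inverse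
is unique. -/
lemma IsEigenFrame.conj_inv {V V' : Matrix (Fin n) (Fin n) ℂ} {σ : Equiv.Perm (Fin n)}
    (h : IsEigenFrame A lam V V' σ) (j i : Fin n) : V' (σ j) i = starRingEnd ℂ (V' j i) := by
  have h1 : Matrix.of (fun j i => starRingEnd ℂ (V' (σ j) i)) * V = 1 := by
    ext j k
    have h2 := congrFun (congrFun h.inv_mul (σ j)) (σ k)
    rw [Matrix.mul_apply] at h2 ⊢
    have h3 : ∀ i, Matrix.of (fun j i => starRingEnd ℂ (V' (σ j) i)) j i * V i k =
        starRingEnd ℂ (V' (σ j) i * V i (σ k)) := fun i => by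
      rw [map_mul, h.conj_col, Complex.conj_conj]; rfl
    rw [Finset.sum_congr rfl fun i _ => h3 i, ← map_sum, h2]
    rcases eq_or_ne j k with rfl | hjk
    · simp
    · simp [hjk]
  have h2 : Matrix.of (fun j i => starRingEnd ℂ (V' (σ j) i)) = V' := by
    rw [← Matrix.mul_one (Matrix.of _), ← h.mul_inv, ← Matrix.mul_assoc, h1, Matrix.one_mul]
  have h3 := congrFun (congrFun h2 j) i
  rw [← h3, Matrix.of_apply, Complex.conj_conj]

lemma conj_mulVec (A : Matrix (Fin n) (Fin n) ℝ) (v : Fin n → ℂ) :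
    (A.map (fun x : ℝ => (x : ℂ))).mulVec (fun i => starRingEnd ℂ (v i)) =
      fun i => starRingEnd ℂ ((A.map (fun x : ℝ => (x : ℂ))).mulVec v i) := by
  ext i
  simp [Matrix.mulVec, dotProduct, map_sum]

/-- The eigenvalues are distinct, so eigenvectors are independent, and since A is real, conjugation
permutes the eigenvalues. The normalisation of the eigenvectors has to be chosen so that conjugation
permutes the vectors themselves and not only their lines. -/
theorem exists_isEigenFrame
    (hlam : (A.map (fun x : ℝ => (x : ℂ))).charpoly =
      ∏ j, (Polynomial.X - Polynomial.C (lam j)))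
    (hsimple : (0 : ℂ) ∉ eigenDiff lam) : ∃ V V' σ, IsEigenFrame A lam V V' σ := by
  have hinj : Function.Injective lam := fun j l h => by
    by_contra hne
    exact hsimple ⟨j, l, hne, by rw [h, sub_self]⟩
  set B := A.map (fun x : ℝ => (x : ℂ)) with hB
  have heig : ∀ z : ℂ, (∃ j, lam j = z) ↔ ∃ v : Fin n → ℂ, v ≠ 0 ∧ B.mulVec v = z • v := by
    intro z
    have h1 : (∃ j, lam j = z) ↔ (Matrix.scalar (Fin n) z - B).det = 0 := by
      rw [← Matrix.eval_charpoly, hlam, Polynomial.eval_prod, Finset.prod_eq_zero_iff]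
      simp [sub_eq_zero, eq_comm]
    rw [h1, ← Matrix.exists_mulVec_eq_zero_iff]
    refine exists_congr fun v => and_congr_right fun _ => ?_
    rw [Matrix.sub_mulVec, sub_eq_zero, eq_comm]
    simp [Matrix.scalar_apply, ← Matrix.smul_one_eq_diagonal, Matrix.smul_mulVec]
  choose u hu0 hu using fun j => (heig (lam j)).1 ⟨j, rfl⟩
  have hconj : ∀ j, ∃ l, lam l = starRingEnd ℂ (lam j) := by
    intro j
    refine (heig _).2 ⟨fun i => starRingEnd ℂ (u j i), fun h => hu0 j ?_, ?_⟩
    · ext i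
      have := congrFun h i
      simpa using this
    · rw [hB, conj_mulVec, ← hB, hu j]
      ext i
      simp
  choose σ hσ using hconj
  have hinv : Function.Involutive σ := fun j => hinj (by rw [hσ, hσ, Complex.conj_conj])
  -- For a real eigenvalue the vector u + ū is a real eigenvector unless it vanishes; in that case u
  -- is purely imaginary and i u is real.
  have hreal : ∀ j, (lam j).im = 0 → ∃ v : Fin n → ℂ, v ≠ 0 ∧ B.mulVec v = lam j • v ∧
      ∀ i, starRingEnd ℂ (v i) = v i := by
    intro j hj
    have hlj : starRingEnd ℂ (lam j) = lam j := Complex.conj_eq_iff_im.2 hj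
    have hcu : B.mulVec (fun i => starRingEnd ℂ (u j i)) = lam j • fun i => starRingEnd ℂ (u j i) := by
      rw [hB, conj_mulVec, ← hB, hu j]
      ext i
      simp [hlj]
    by_cases h : (fun i => u j i + starRingEnd ℂ (u j i)) = 0
    · refine ⟨fun i => Complex.I * u j i, fun h0 => hu0 j ?_, ?_, fun i => ?_⟩
      · ext i
        have := congrFun h0 i
        simpa using this
      · have : (fun i => Complex.I * u j i) = Complex.I • u j := rfl
        rw [this, Matrix.mulVec_smul, hu j, smul_comm]
      · have := congrFun h i
        simp only [Pi.zero_apply] at this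
        rw [map_mul, Complex.conj_I, eq_neg_of_add_eq_zero_right this]
        ring
    · refine ⟨_, h, ?_, fun i => by simp [add_comm]⟩
      have : (fun i => u j i + starRingEnd ℂ (u j i)) = u j + fun i => starRingEnd ℂ (u j i) := rfl
      rw [this, Matrix.mulVec_add, hu j, hcu, smul_add]
  -- Eigenvectors are chosen freely in the upper half-plane, real on the real axis, and as
  -- conjugates of their partners in the lower half-plane.
  have hv : ∃ v : Fin n → Fin n → ℂ, (∀ j, v j ≠ 0 ∧ B.mulVec (v j) = lam j • v j) ∧
      ∀ j i, v (σ j) i = starRingEnd ℂ (v j i) := by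
    choose r hr0 hr1 hr2 using hreal
    refine ⟨fun j => if h : (lam j).im = 0 then r j h else if 0 < (lam j).im then u j else
      fun i => starRingEnd ℂ (u (σ j) i), fun j => ?_, fun j i => ?_⟩
    · by_cases h : (lam j).im = 0
      · simp only [h, dif_pos]
        exact ⟨hr0 j h, hr1 j h⟩
      · by_cases h' : 0 < (lam j).im
        · simp only [h, h', dif_neg, not_false_iff, if_true]
          exact ⟨hu0 j, hu j⟩
        · simp only [h, h', dif_neg, not_false_iff, if_false]
          refine ⟨fun h0 => hu0 (σ j) ?_, ?_⟩
          · ext i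
            have := congrFun h0 i
            simpa using this
          · rw [hB, conj_mulVec, ← hB, hu (σ j)]
            ext i
            simp [hσ]
    · by_cases h : (lam j).im = 0
      · have hfix : σ j = j := hinj (by rw [hσ, Complex.conj_eq_iff_im.2 h])
        simp only [hfix, h, dif_pos]
        exact (hr2 j h i).symm
      · have h2 : ¬ (lam (σ j)).im = 0 := by rw [hσ, Complex.conj_im, neg_eq_zero]; exact h
        by_cases h' : 0 < (lam j).im
        · have h3 : ¬ 0 < (lam (σ j)).im := by rw [hσ, Complex.conj_im]; linarith
          simp only [h, h', h2, h3, dif_neg, not_false_iff, if_true, if_false, hinv j]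
        · have h3 : 0 < (lam (σ j)).im := by
            rw [hσ, Complex.conj_im]
            have := lt_of_le_of_ne (not_lt.1 h') h
            linarith
          simp only [h, h', h2, h3, dif_neg, not_false_iff, if_true, if_false, Complex.conj_conj]
  obtain ⟨v, hv1, hv2⟩ := hv
  have hli : LinearIndependent ℂ v :=
    Module.End.eigenvectors_linearIndependent' (Matrix.toLin' B) lam hinj v fun j =>
      ⟨Module.End.mem_eigenspace_iff.2 (by rw [Matrix.toLin'_apply]; exact (hv1 j).2), (hv1 j).1⟩
  set V : Matrix (Fin n) (Fin n) ℂ := Matrix.of fun i j => v j i with hV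
  have hunit : IsUnit V := Matrix.linearIndependent_cols_iff_isUnit.1 hli
  obtain ⟨U, hU⟩ := hunit
  refine ⟨V, (U⁻¹ : (Matrix (Fin n) (Fin n) ℂ)ˣ), hinv.toPerm, ?_, ?_, ?_, ?_, ?_, ?_⟩
  · rw [← hU]; exact U.mul_inv
  · rw [← hU]; exact U.inv_mul
  · ext i j
    rw [Matrix.mul_diagonal]
    have := congrFun (hv1 j).2 i
    rw [Pi.smul_apply, smul_eq_mul, mul_comm] at this
    exact this
  · intro i j; exact hv2 j i
  · intro j; exact hσ j
  · intro j; exact hinv j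

end EigenFrame


/-! ### Linear systems and homological equations in the class -/

section LinearInClass

variable {t₀ : ℝ} {K : Set (Ici t₀ → ℝ)} {n : ℕ} {A : Matrix (Fin n) (Fin n) ℝ} {lam : Fin n → ℂ}
  {V V' : Matrix (Fin n) (Fin n) ℂ} {σ : Equiv.Perm (Fin n)}

lemma hasDerivWithinAt_re {f : ℝ → ℂ} {f' : ℂ} {s : Set ℝ} {t : ℝ}
    (h : HasDerivWithinAt f f' s t) : HasDerivWithinAt (fun τ => (f τ).re) f'.re s t :=
  (Complex.reCLM.hasFDerivAt.comp_hasDerivWithinAt t h)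

lemma re_map_ofReal_mul (A : Matrix (Fin n) (Fin n) ℝ) (X : Matrix (Fin n) (Fin n) ℂ) :
    (A.map (fun x : ℝ => (x : ℂ)) * X).map Complex.re = A * X.map Complex.re := by
  ext i j
  simp [Matrix.mul_apply]

lemma re_mul_map_ofReal (A : Matrix (Fin n) (Fin n) ℝ) (X : Matrix (Fin n) (Fin n) ℂ) :
    (X * A.map (fun x : ℝ => (x : ℂ))).map Complex.re = X.map Complex.re * A := by
  ext i j
  simp [Matrix.mul_apply]

/-- Vector equations `y' = A y + g` are solvable in the class. -/
theorem exists_solution_inClass (hV : IsEigenFrame A lam V V' σ) (hK : IsClassK1 (range lam) K)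
    {g : ℝ → Fin n → ℝ} (hg : ∀ i, InClass K fun t => g t i) :
    ∃ y : ℝ → Fin n → ℝ, (∀ i, InClass K fun t => y t i) ∧ ContDiffOn ℝ 1 y (Ici t₀) ∧
      ∀ t ∈ Ici t₀, HasDerivWithinAt y (A.mulVec (y t) + g t) (Ici t₀) t := by
  have hg' : ∀ j, InClassC K fun t => ∑ i, V' j i * (g t i : ℂ) := fun j =>
    hK.sumC _ fun i _ => hK.const_mulC _ (hK.ofRealC (hg i))
  -- In the coordinates given by `V'` the system decouples into scalar equations covered by the
  -- axiom for Λ(A). As A and g are real, the real part of the recombined solution is again a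
  -- solution.
  choose z hz1 hz2 hz3 using fun j => hK.exists_solution (lam j) (mem_range_self j)
    (fun t => ∑ i, V' j i * (g t i : ℂ)) (hg' j).1 (hg' j).2
  have hy : ∀ i, InClass K fun t => (∑ j, V i j * z j t).re := fun i =>
    (hK.sumC _ fun j _ => hK.const_mulC (V i j) ⟨hz2 j, hz3 j⟩).1
  have hder : ∀ t ∈ Ici t₀, HasDerivWithinAt (fun t i => (∑ j, V i j * z j t).re)
      (A.mulVec (fun i => (∑ j, V i j * z j t).re) + g t) (Ici t₀) t := by
    intro t ht
    refine hasDerivWithinAt_pi.2 fun i => ?_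
    have h1 := hasDerivWithinAt_re (HasDerivWithinAt.fun_sum (u := Finset.univ)
      fun j _ => (hz1 j t ht).const_mul (V i j))
    refine h1.congr_deriv ?_
    have h2 : ∑ j, V i j * (lam j * z j t + ∑ k, V' j k * (g t k : ℂ)) =
        ∑ k, (A i k : ℂ) * ∑ j, V k j * z j t + g t i := by
      have e1 : ∀ j, V i j * lam j = ∑ k, (A i k : ℂ) * V k j := fun j => by
        have := congrFun (congrFun hV.eigen i) j
        rw [Matrix.mul_diagonal, Matrix.mul_apply] at this
        rw [← this]
        rfl
      have e2 : ∑ j, V i j * ∑ k, V' j k * (g t k : ℂ) = g t i := by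
        have : (V * V').mulVec (fun k => (g t k : ℂ)) i = g t i := by
          rw [hV.mul_inv, Matrix.one_mulVec]
        rw [← Matrix.mulVec_mulVec] at this
        exact this
      simp only [mul_add, Finset.sum_add_distrib, e2]
      congr 1
      simp only [← mul_assoc, e1, Finset.mul_sum, Finset.sum_mul]
      rw [Finset.sum_comm]
    rw [h2]
    simp [Matrix.mulVec, dotProduct]
  refine ⟨_, hy, ?_, hder⟩
  have hcont : ContinuousOn (fun t => A.mulVec (fun i => (∑ j, V i j * z j t).re) + g t) (Ici t₀) := by
    refine continuousOn_pi.2 fun i => ?_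
    have hi := hK.add (hK.sum Finset.univ fun k _ => hK.const_mul (A i k) (hy k)) (hg i)
    exact hK.continuousOn hi
  have h0 : (1 : WithTop ℕ∞) = 0 + 1 := by norm_num
  rw [h0, contDiffOn_succ_iff_derivWithin (uniqueDiffOn_Ici t₀)]
  refine ⟨fun t ht => (hder t ht).differentiableWithinAt, by simp, contDiffOn_zero.2 ?_⟩
  exact hcont.congr fun t ht => (hder t ht).derivWithin (uniqueDiffOn_Ici t₀ t ht)

lemma mul_diagonal_mul_apply (M N : Matrix (Fin n) (Fin n) ℂ) (d : Fin n → ℂ) (i j : Fin n) :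
    (M * Matrix.diagonal d * N) i j = ∑ k, M i k * d k * N k j := by
  rw [Matrix.mul_apply]
  exact Finset.sum_congr rfl fun k _ => by rw [Matrix.mul_diagonal]

/-- The diagonal of a matrix in the frame of eigenvectors. -/
def frameDiag (V V' : Matrix (Fin n) (Fin n) ℂ) (G : Matrix (Fin n) (Fin n) ℝ) (k : Fin n) : ℂ :=
  (V' * G.map (fun x : ℝ => (x : ℂ)) * V) k k

lemma IsEigenFrame.frameDiag_conj (hV : IsEigenFrame A lam V V' σ) (G : Matrix (Fin n) (Fin n) ℝ)
    (k : Fin n) : frameDiag V V' G (σ k) = starRingEnd ℂ (frameDiag V V' G k) := by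
  simp [frameDiag, Matrix.mul_apply, hV.conj_inv, hV.conj_col, map_sum]

/-- The real matrix that is diagonal in the frame of eigenvectors, with the diagonal of `G`. -/
def frameProj (V V' : Matrix (Fin n) (Fin n) ℂ) (G : Matrix (Fin n) (Fin n) ℝ) :
    Matrix (Fin n) (Fin n) ℝ :=
  (V * Matrix.diagonal (frameDiag V V' G) * V').map Complex.re

/-- The terms for k and σ k are conjugate, so the complex matrix is already real and taking real
parts in `frameProj` loses nothing. -/
lemma IsEigenFrame.map_frameProj (hV : IsEigenFrame A lam V V' σ) (G : Matrix (Fin n) (Fin n) ℝ) :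
    (frameProj V V' G).map (fun x : ℝ => (x : ℂ)) =
      V * Matrix.diagonal (frameDiag V V' G) * V' := by
  ext i j
  rw [frameProj, Matrix.map_apply, Matrix.map_apply]
  refine Complex.conj_eq_iff_re.1 ?_
  simp only [mul_diagonal_mul_apply, map_sum, map_mul]
  rw [← Equiv.sum_comp σ (fun k => V i k * frameDiag V V' G k * V' k j)]
  refine Finset.sum_congr rfl fun k _ => ?_
  rw [hV.conj_col, hV.frameDiag_conj, hV.conj_inv]

lemma IsEigenFrame.frameProj_mul (hV : IsEigenFrame A lam V V' σ) (G : Matrix (Fin n) (Fin n) ℝ) :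
    (frameProj V V' G).map (fun x : ℝ => (x : ℂ)) * V =
      V * Matrix.diagonal (frameDiag V V' G) := by
  rw [hV.map_frameProj, Matrix.mul_assoc, hV.inv_mul, Matrix.mul_one]

/-- The entries of `V' G V` are in the class. -/
lemma inClassC_frame {Ω : Set ℂ} (hK : IsClassK1 Ω K) {G : ℝ → Matrix (Fin n) (Fin n) ℝ}
    (hG : ∀ i j, InClass K fun t => G t i j) (M N : Matrix (Fin n) (Fin n) ℂ) (j k : Fin n) :
    InClassC K fun t => (M * (G t).map (fun x : ℝ => (x : ℂ)) * N) j k := by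
  simp only [Matrix.mul_apply, Matrix.map_apply]
  exact hK.sumC _ fun b _ => hK.mul_constC _
    (hK.sumC _ fun a _ => hK.const_mulC _ (hK.ofRealC (hG a b)))

lemma inClass_frameProj {Ω : Set ℂ} (hK : IsClassK1 Ω K) {G : ℝ → Matrix (Fin n) (Fin n) ℝ}
    (hG : ∀ i j, InClass K fun t => G t i j) (i j : Fin n) :
    InClass K fun t => frameProj V V' (G t) i j := by
  simp only [frameProj, Matrix.map_apply, mul_diagonal_mul_apply]
  exact (hK.sumC _ fun b _ => hK.mul_constC _ (hK.const_mulC _ (inClassC_frame hK hG V' V b b))).1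

/-- The homological equation `X' = A X - X A + G - D` with `D` diagonal in the frame of
eigenvectors. -/
theorem exists_homological (hV : IsEigenFrame A lam V V' σ) (hK : IsClassK1 (eigenDiff lam) K)
    {G : ℝ → Matrix (Fin n) (Fin n) ℝ} (hG : ∀ i j, InClass K fun t => G t i j) :
    ∃ X : ℝ → Matrix (Fin n) (Fin n) ℝ, (∀ i j, InClass K fun t => X t i j) ∧
      ∀ t ∈ Ici t₀, HasMatDeriv X (A * X t - X t * A + G t - frameProj V V' (G t)) (Ici t₀) t := by
  -- In the frame the entries decouple, the (j, k) entry having the coefficient λ_j - λ_k. Off the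
  -- diagonal the axiom for Δ(A) applies; on the diagonal the forcing has been removed, and 0 is a
  -- solution.
  have hsol : ∀ j k, ∃ c : ℝ → ℂ, InClassC K c ∧ ∀ t ∈ Ici t₀, HasDerivWithinAt c
      ((lam j - lam k) * c t + ((V' * (G t).map (fun x : ℝ => (x : ℂ)) * V) j k -
        Matrix.diagonal (frameDiag V V' (G t)) j k)) (Ici t₀) t := by
    intro j k
    have hg := inClassC_frame hK hG V' V j k
    rcases eq_or_ne j k with rfl | hjk
    · refine ⟨fun _ => 0, hK.zeroC, fun t _ => ?_⟩
      simp only [Matrix.diagonal_apply_eq, frameDiag, sub_self, mul_zero, add_zero]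
      exact hasDerivWithinAt_const _ _ _
    · obtain ⟨c, hc1, hc2, hc3⟩ := hK.exists_solution (lam j - lam k) ⟨j, k, hjk, rfl⟩ _ hg.1 hg.2
      refine ⟨c, ⟨hc2, hc3⟩, fun t ht => ?_⟩
      rw [Matrix.diagonal_apply_ne _ hjk, sub_zero]
      exact hc1 t ht
  choose c hc1 hc2 using hsol
  set C : ℝ → Matrix (Fin n) (Fin n) ℂ := fun t => Matrix.of fun j k => c j k t with hC
  -- The equation has real coefficients, A, G and the projection being real, so real parts may be
  -- taken.
  refine ⟨fun t => (V * C t * V').map Complex.re, fun i j => ?_, fun t ht => ?_⟩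
  · simp only [Matrix.map_apply, Matrix.mul_apply]
    exact (hK.sumC _ fun b _ => hK.mul_constC _ (hK.sumC _ fun a _ => hK.const_mulC _ (hc1 a b))).1
  · have h1 : HasMatDeriv C (Matrix.diagonal lam * C t - C t * Matrix.diagonal lam +
        (V' * (G t).map (fun x : ℝ => (x : ℂ)) * V - Matrix.diagonal (frameDiag V V' (G t))))
        (Ici t₀) t := by
      intro j k
      refine (hc2 j k t ht).congr_deriv ?_
      simp only [Matrix.add_apply, Matrix.sub_apply, Matrix.diagonal_mul, Matrix.mul_diagonal, hC,
        Matrix.of_apply]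
      ring
    have h2 := h1.const_mul_mul_const V V'
    have h3 : V * (Matrix.diagonal lam * C t - C t * Matrix.diagonal lam +
        (V' * (G t).map (fun x : ℝ => (x : ℂ)) * V - Matrix.diagonal (frameDiag V V' (G t)))) * V' =
        A.map (fun x : ℝ => (x : ℂ)) * (V * C t * V') - (V * C t * V') * A.map (fun x : ℝ => (x : ℂ)) +
        (G t).map (fun x : ℝ => (x : ℂ)) - (frameProj V V' (G t)).map (fun x : ℝ => (x : ℂ)) := by
      have e1 : V' * A.map (fun x : ℝ => (x : ℂ)) = Matrix.diagonal lam * V' := by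
        have := congrArg (fun X => V' * X * V') hV.eigen
        simp only [← Matrix.mul_assoc] at this
        rw [Matrix.mul_assoc _ V V', hV.mul_inv, Matrix.mul_one, hV.inv_mul, Matrix.one_mul] at this
        exact this
      rw [hV.map_frameProj]
      have e2 : (V * C t * V') * A.map (fun x : ℝ => (x : ℂ)) = V * (C t * Matrix.diagonal lam) * V' := by
        rw [Matrix.mul_assoc _ V', e1]
        simp only [Matrix.mul_assoc]
      have e3 : A.map (fun x : ℝ => (x : ℂ)) * (V * C t * V') = V * (Matrix.diagonal lam * C t) * V' := by
        simp only [← Matrix.mul_assoc, hV.eigen]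
      have e4 : V * (V' * (G t).map (fun x : ℝ => (x : ℂ)) * V) * V' =
          (G t).map (fun x : ℝ => (x : ℂ)) := by
        simp only [← Matrix.mul_assoc, hV.mul_inv, Matrix.one_mul]
        rw [Matrix.mul_assoc, hV.mul_inv, Matrix.mul_one]
      rw [e2, e3]
      simp only [Matrix.mul_add, Matrix.add_mul, Matrix.mul_sub, Matrix.sub_mul, e4]
      abel
    rw [h3] at h2
    intro i j
    refine (hasDerivWithinAt_re (h2 i j)).congr_deriv ?_
    simp only [Matrix.add_apply, Matrix.sub_apply, Complex.add_re, Complex.sub_re, Matrix.map_apply,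
      Complex.ofReal_re, ← re_map_ofReal_mul, ← re_mul_map_ofReal]

end LinearInClass


/-! ### Calculus of the partial derivatives on a box -/

section Partial

variable {n : ℕ} {y₀ : Fin n → ℝ} {a : ℝ}

lemma uniqueDiffOn_box (y₀ : Fin n → ℝ) (ha : 0 < a) : UniqueDiffOn ℝ (Metric.closedBall y₀ a) :=
  uniqueDiffOn_convex (convex_closedBall _ _)
    ⟨y₀, Metric.ball_subset_interior_closedBall (Metric.mem_ball_self ha)⟩

lemma pd_congr {B : Set (Fin n → ℝ)} {u v : (Fin n → ℝ) → Fin n → ℝ} (h : EqOn u v B) (j : Fin n) :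
    EqOn (pd B j u) (pd B j v) B := fun y hy => by
  rw [pd, pd, fderivWithin_congr h (h hy)]

lemma iterate_pd_congr {B : Set (Fin n → ℝ)} {u v : (Fin n → ℝ) → Fin n → ℝ} (h : EqOn u v B)
    (j : Fin n) (k : ℕ) : EqOn ((pd B j)^[k] u) ((pd B j)^[k] v) B := by
  induction k with
  | zero => exact h
  | succ k ih =>
    rw [Function.iterate_succ_apply', Function.iterate_succ_apply']
    exact pd_congr ih j

lemma contDiffOn_pd (ha : 0 < a) {u : (Fin n → ℝ) → Fin n → ℝ} {N : ℕ}
    (hu : ContDiffOn ℝ (N + 1 : ℕ) u (Metric.closedBall y₀ a)) (j : Fin n) :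
    ContDiffOn ℝ N (pd (Metric.closedBall y₀ a) j u) (Metric.closedBall y₀ a) :=
  (hu.fderivWithin (m := N) (uniqueDiffOn_box y₀ ha) (by norm_cast)).clm_apply contDiffOn_const

lemma contDiffOn_iterate_pd (ha : 0 < a) {u : (Fin n → ℝ) → Fin n → ℝ} {N : ℕ} (j : Fin n) (k : ℕ)
    (hu : ContDiffOn ℝ (N + k : ℕ) u (Metric.closedBall y₀ a)) :
    ContDiffOn ℝ N ((pd (Metric.closedBall y₀ a) j)^[k] u) (Metric.closedBall y₀ a) := by
  induction k generalizing u with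
  | zero => exact hu
  | succ k ih => exact ih (contDiffOn_pd ha hu j)

/-- Second derivatives are symmetric at boundary points of the box as well, because the box lies in
the closure of its interior. -/
lemma pd_comm (ha : 0 < a) {u : (Fin n → ℝ) → Fin n → ℝ}
    (hu : ContDiffOn ℝ (2 : ℕ) u (Metric.closedBall y₀ a)) (i j : Fin n) :
    EqOn (pd (Metric.closedBall y₀ a) i (pd (Metric.closedBall y₀ a) j u))
      (pd (Metric.closedBall y₀ a) j (pd (Metric.closedBall y₀ a) i u)) (Metric.closedBall y₀ a) := by
  intro y hy
  set B := Metric.closedBall y₀ a with hB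
  have hud := uniqueDiffOn_box y₀ ha
  have hd : DifferentiableWithinAt ℝ (fderivWithin ℝ u B) B y :=
    (hu.fderivWithin (m := 1) hud (by norm_cast)).differentiableOn (by norm_num) y hy
  have hkey : ∀ i j, pd B i (pd B j u) y =
      fderivWithin ℝ (fderivWithin ℝ u B) B y (Pi.single i 1) (Pi.single j 1) := fun i j => by
    have h1 := (hd.hasFDerivWithinAt.clm_apply
      (hasFDerivWithinAt_const (Pi.single j (1 : ℝ)) y B)).fderivWithin (hud y hy)
    have h2 : pd B i (pd B j u) y =
      fderivWithin ℝ (fun z => fderivWithin ℝ u B z (Pi.single j 1)) B y (Pi.single i 1) := rfl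
    rw [h2, h1]
    simp
  have hsymm : IsSymmSndFDerivWithinAt ℝ u B y := by
    refine (hu y hy).isSymmSndFDerivWithinAt (by simp) hud ?_ hy
    rw [(convex_closedBall y₀ a).closure_interior_eq_closure_of_nonempty_interior
      ⟨y₀, Metric.ball_subset_interior_closedBall (Metric.mem_ball_self ha)⟩]
    exact subset_closure hy
  rw [hkey, hkey]
  exact hsymm _ _

lemma pd_iterate_comm (ha : 0 < a) {u : (Fin n → ℝ) → Fin n → ℝ} (i j : Fin n) (k : ℕ)
    (hu : ContDiffOn ℝ (1 + k : ℕ) u (Metric.closedBall y₀ a)) :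
    EqOn (pd (Metric.closedBall y₀ a) i ((pd (Metric.closedBall y₀ a) j)^[k] u))
      ((pd (Metric.closedBall y₀ a) j)^[k] (pd (Metric.closedBall y₀ a) i u))
      (Metric.closedBall y₀ a) := by
  induction k generalizing u with
  | zero => exact fun _ _ => rfl
  | succ k ih =>
    rw [Function.iterate_succ_apply, Function.iterate_succ_apply]
    refine (ih (contDiffOn_pd ha hu j)).trans (iterate_pd_congr (pd_comm ha ?_ i j) j k)
    exact hu.of_le (by norm_cast; omega)

/-- The mixed derivative in the coordinates of a list. -/
noncomputable def mpdList (B : Set (Fin n → ℝ)) (L : List (Fin n)) (P : Fin n → ℕ)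
    (h : (Fin n → ℝ) → Fin n → ℝ) : (Fin n → ℝ) → Fin n → ℝ :=
  L.foldr (fun j u => (pd B j)^[P j] u) h

lemma mpd_eq_mpdList (B : Set (Fin n → ℝ)) (P : Fin n → ℕ) (h : (Fin n → ℝ) → Fin n → ℝ) :
    mpd B P h = mpdList B (List.finRange n) P h := rfl

lemma mpdList_cons (B : Set (Fin n → ℝ)) (j : Fin n) (L : List (Fin n)) (P : Fin n → ℕ)
    (h : (Fin n → ℝ) → Fin n → ℝ) : mpdList B (j :: L) P h = (pd B j)^[P j] (mpdList B L P h) := rfl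

lemma mpdList_congr_idx (B : Set (Fin n → ℝ)) (L : List (Fin n)) {P Q : Fin n → ℕ}
    (h : (Fin n → ℝ) → Fin n → ℝ) (hPQ : ∀ j ∈ L, P j = Q j) :
    mpdList B L P h = mpdList B L Q h := by
  induction L with
  | nil => rfl
  | cons j L ih =>
    rw [mpdList_cons, mpdList_cons, ih fun i hi => hPQ i (List.mem_cons_of_mem _ hi),
      hPQ j List.mem_cons_self]

lemma mpd_zero (B : Set (Fin n → ℝ)) (h : (Fin n → ℝ) → Fin n → ℝ) : mpd B 0 h = h := by
  rw [mpd_eq_mpdList]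
  induction List.finRange n with
  | nil => rfl
  | cons j L ih => rw [mpdList_cons, ih]; rfl

lemma contDiffOn_mpdList (ha : 0 < a) {u : (Fin n → ℝ) → Fin n → ℝ} {N : ℕ} (L : List (Fin n))
    (P : Fin n → ℕ) (hu : ContDiffOn ℝ (N + (L.map P).sum : ℕ) u (Metric.closedBall y₀ a)) :
    ContDiffOn ℝ N (mpdList (Metric.closedBall y₀ a) L P u) (Metric.closedBall y₀ a) := by
  induction L generalizing N with
  | nil => exact hu
  | cons j L ih =>
    rw [mpdList_cons]
    refine contDiffOn_iterate_pd ha j (P j) (ih ?_)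
    rw [List.map_cons, List.sum_cons, ← add_assoc] at hu
    exact hu

lemma pd_mpdList_comm (ha : 0 < a) {u : (Fin n → ℝ) → Fin n → ℝ} (i : Fin n) (L : List (Fin n))
    (P : Fin n → ℕ) (hu : ContDiffOn ℝ (1 + (L.map P).sum : ℕ) u (Metric.closedBall y₀ a)) :
    EqOn (pd (Metric.closedBall y₀ a) i (mpdList (Metric.closedBall y₀ a) L P u))
      (mpdList (Metric.closedBall y₀ a) L P (pd (Metric.closedBall y₀ a) i u))
      (Metric.closedBall y₀ a) := by
  induction L with
  | nil => exact fun _ _ => rfl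
  | cons j L ih =>
    rw [List.map_cons, List.sum_cons, ← add_assoc] at hu
    rw [mpdList_cons, mpdList_cons]
    refine (pd_iterate_comm ha i j (P j) (contDiffOn_mpdList ha L P hu)).trans
      (iterate_pd_congr (ih (hu.of_le ?_)) j _)
    norm_cast
    omega

lemma mpdList_add_single (ha : 0 < a) {u : (Fin n → ℝ) → Fin n → ℝ} (i : Fin n) {L : List (Fin n)}
    (hL : L.Nodup) (hi : i ∈ L) (P : Fin n → ℕ)
    (hu : ContDiffOn ℝ (1 + (L.map P).sum : ℕ) u (Metric.closedBall y₀ a)) :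
    EqOn (mpdList (Metric.closedBall y₀ a) L (P + Pi.single i 1) u)
      (mpdList (Metric.closedBall y₀ a) L P (pd (Metric.closedBall y₀ a) i u))
      (Metric.closedBall y₀ a) := by
  induction L with
  | nil => simp at hi
  | cons j L ih =>
    rw [List.map_cons, List.sum_cons] at hu
    have hu' : ContDiffOn ℝ (1 + (L.map P).sum : ℕ) u (Metric.closedBall y₀ a) :=
      hu.of_le (by norm_cast; omega)
    rw [mpdList_cons, mpdList_cons]
    rw [List.nodup_cons] at hL
    rcases eq_or_ne i j with rfl | hij
    · rw [mpdList_congr_idx (Q := P) _ L u fun k hk => by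
        have : k ≠ i := fun h => hL.1 (h ▸ hk)
        simp [this]]
      rw [Pi.add_apply, Pi.single_eq_same, Function.iterate_succ_apply]
      exact iterate_pd_congr (pd_mpdList_comm ha i L P hu') i _
    · rw [Pi.add_apply, Pi.single_eq_of_ne hij.symm, add_zero]
      exact iterate_pd_congr (ih hL.2 ((List.mem_cons.1 hi).resolve_left hij) hu') j _

lemma sum_map_finRange (P : Fin n → ℕ) : ((List.finRange n).map P).sum = ∑ j, P j := by
  rw [← List.ofFn_eq_map, List.sum_ofFn]

/-- `mpd` prescribes an order of differentiation; here one further derivative is moved to the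
innermost place. Hypotheses on the derivatives of F_l thereby become hypotheses on the derivatives
of its Jacobian, which is what gets expanded later. -/
lemma mpd_add_single (ha : 0 < a) {u : (Fin n → ℝ) → Fin n → ℝ} (i : Fin n) (P : Fin n → ℕ)
    (hu : ContDiffOn ℝ (1 + ∑ j, P j : ℕ) u (Metric.closedBall y₀ a)) :
    EqOn (mpd (Metric.closedBall y₀ a) (P + Pi.single i 1) u)
      (mpd (Metric.closedBall y₀ a) P (pd (Metric.closedBall y₀ a) i u))
      (Metric.closedBall y₀ a) := by
  refine mpdList_add_single ha i (List.nodup_finRange n) (List.mem_finRange i) P ?_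
  rwa [sum_map_finRange]

lemma mpd_single (ha : 0 < a) {u : (Fin n → ℝ) → Fin n → ℝ} (i : Fin n)
    (hu : ContDiffOn ℝ 1 u (Metric.closedBall y₀ a)) :
    EqOn (mpd (Metric.closedBall y₀ a) (Pi.single i 1) u)
      (pd (Metric.closedBall y₀ a) i u) (Metric.closedBall y₀ a) := by
  have := mpd_add_single ha i 0 (by simpa using hu)
  rwa [zero_add, mpd_zero] at this

/-! #### Lipschitz bounds -/

lemma norm_clm_le_of_single {E : Type*} [NormedAddCommGroup E] [NormedSpace ℝ E]
    (L : (Fin n → ℝ) →L[ℝ] E) {C : ℝ} (hC : ∀ j, ‖L (Pi.single j 1)‖ ≤ C) (hC0 : 0 ≤ C) :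
    ‖L‖ ≤ n * C := by
  refine L.opNorm_le_bound (by positivity) fun x => ?_
  have h1 : L x = ∑ j, x j • L (Pi.single j 1) := by
    conv_lhs => rw [pi_eq_sum_univ' x, map_sum]
    refine Finset.sum_congr rfl fun j _ => ?_
    rw [map_smul]
  rw [h1]
  refine (norm_sum_le _ _).trans ((Finset.sum_le_card_nsmul _ _ (‖x‖ * C) fun j _ => ?_).trans ?_)
  · rw [norm_smul]
    exact mul_le_mul (norm_le_pi_norm x j) (hC j) (norm_nonneg _) (norm_nonneg _)
  · rw [Finset.card_univ, Fintype.card_fin, nsmul_eq_mul]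
    exact le_of_eq (by ring)

lemma norm_sub_le_of_pd_le {u : (Fin n → ℝ) → Fin n → ℝ}
    (hu : ContDiffOn ℝ 1 u (Metric.closedBall y₀ a)) {C : ℝ} (hC0 : 0 ≤ C)
    (hC : ∀ j, ∀ z ∈ Metric.closedBall y₀ a, ‖pd (Metric.closedBall y₀ a) j u z‖ ≤ C)
    {y y' : Fin n → ℝ} (hy : y ∈ Metric.closedBall y₀ a) (hy' : y' ∈ Metric.closedBall y₀ a) :
    ‖u y - u y'‖ ≤ n * C * ‖y - y'‖ :=
  (convex_closedBall y₀ a).norm_image_sub_le_of_norm_fderivWithin_le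
    (hu.differentiableOn (by norm_num)) (fun z hz => norm_clm_le_of_single _ (fun j => hC j z hz) hC0)
    hy' hy

/-- The remainder of the linearisation at `s` has a small Lipschitz constant near `s`. -/
lemma norm_sub_sub_linear_le (ha : 0 < a) {u : (Fin n → ℝ) → Fin n → ℝ}
    (hu : ContDiffOn ℝ (2 : ℕ) u (Metric.closedBall y₀ a)) {C : ℝ} (hC0 : 0 ≤ C)
    (hC : ∀ i j, ∀ z ∈ Metric.closedBall y₀ a,
      ‖pd (Metric.closedBall y₀ a) i (pd (Metric.closedBall y₀ a) j u) z‖ ≤ C)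
    {s y y' : Fin n → ℝ} (hs : s ∈ Metric.closedBall y₀ a) (hy : y ∈ Metric.closedBall y₀ a)
    (hy' : y' ∈ Metric.closedBall y₀ a) {m : ℝ} (hm : ‖y - s‖ ≤ m) (hm' : ‖y' - s‖ ≤ m) :
    ‖u y - u y' - fderivWithin ℝ u (Metric.closedBall y₀ a) s (y - y')‖ ≤
      n * (n * C * m) * ‖y - y'‖ := by
  set B := Metric.closedBall y₀ a with hB
  have hm0 : 0 ≤ m := (norm_nonneg _).trans hm
  -- The mean value inequality on the part of the box within distance m of s, where the derivative
  -- differs from its value at s by at most n (n C m): one factor n for each passage from partial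
  -- derivatives to an operator norm.
  refine Convex.norm_image_sub_le_of_norm_hasFDerivWithin_le' (s := B ∩ Metric.closedBall s m)
    (f' := fun z => fderivWithin ℝ u B z)
    (fun z hz => ((hu.differentiableOn (by norm_num)) z hz.1).hasFDerivWithinAt.mono
      inter_subset_left) (fun z hz => ?_) ((convex_closedBall _ _).inter (convex_closedBall _ _))
    ⟨hy', by rwa [Metric.mem_closedBall, dist_eq_norm]⟩
    ⟨hy, by rwa [Metric.mem_closedBall, dist_eq_norm]⟩
  refine norm_clm_le_of_single _ (fun j => ?_) (by positivity)
  have h1 := norm_sub_le_of_pd_le (u := pd B j u) (contDiffOn_pd (N := 1) ha hu j) hC0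
    (fun i z hz => hC i j z hz) hz.1 hs
  have h2 : ‖z - s‖ ≤ m := by
    have := hz.2
    rwa [Metric.mem_closedBall, dist_eq_norm] at this
  exact h1.trans (mul_le_mul_of_nonneg_left h2 (by positivity))

end Partial


/-! ### Taylor's formula with multi-indices -/

section Taylor

/-- Induction on N: the derivative of the remainder is the remainder, of order one less, of the
shifted chain g (i + 1). The factor 1/N! is given away. -/
lemma norm_sub_taylor_le {E : Type*} [NormedAddCommGroup E] [NormedSpace ℝ E] {C : ℝ} (hC0 : 0 ≤ C)
    (N : ℕ) {g : ℕ → ℝ → E}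
    (hg : ∀ i < N, ∀ τ ∈ Icc (0 : ℝ) 1, HasDerivWithinAt (g i) (g (i + 1) τ) (Icc 0 1) τ)
    (hC : ∀ τ ∈ Icc (0 : ℝ) 1, ‖g N τ‖ ≤ C) :
    ∀ τ ∈ Icc (0 : ℝ) 1,
      ‖g 0 τ - ∑ i ∈ Finset.range N, (τ ^ i / (i.factorial : ℝ)) • g i 0‖ ≤ C * τ ^ N := by
  induction N generalizing g with
  | zero => simpa using hC
  | succ N ih =>
    intro τ hτ
    set e : ℝ → E := fun τ => g 0 τ - ∑ i ∈ Finset.range (N + 1), (τ ^ i / (i.factorial : ℝ)) • g i 0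
      with he
    set e' : ℝ → E := fun τ => g 1 τ - ∑ i ∈ Finset.range N, (τ ^ i / (i.factorial : ℝ)) • g (i + 1) 0
      with he'
    have hder : ∀ x ∈ Icc (0 : ℝ) 1, HasDerivWithinAt e (e' x) (Icc 0 1) x := by
      intro x hx
      refine (hg 0 (Nat.succ_pos N) x hx).sub ?_
      simp only [Finset.sum_range_succ' _ N, pow_zero, Nat.factorial_zero, Nat.cast_one, div_one,
        one_smul]
      refine HasDerivWithinAt.add_const _ (HasDerivWithinAt.fun_sum fun i _ => ?_)
      have h1 : HasDerivWithinAt (fun y : ℝ => y ^ (i + 1) / ((i + 1).factorial : ℝ))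
          (x ^ i / (i.factorial : ℝ)) (Icc 0 1) x := by
        refine (((hasDerivAt_pow (i + 1) x).div_const _).hasDerivWithinAt).congr_deriv ?_
        rw [Nat.factorial_succ]
        push_cast
        have : (i.factorial : ℝ) ≠ 0 := by positivity
        field_simp
      exact h1.smul_const _
    have hbd : ∀ x ∈ Ico (0 : ℝ) τ, ‖e' x‖ ≤ C * τ ^ N := by
      intro x hx
      have hx1 : x ∈ Icc (0 : ℝ) 1 := ⟨hx.1, hx.2.le.trans hτ.2⟩
      refine (ih (g := fun i => g (i + 1)) (fun i hi => hg (i + 1) (by omega)) hC x hx1).trans ?_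
      exact mul_le_mul_of_nonneg_left (pow_le_pow_left₀ hx.1 hx.2.le N) hC0
    have h := norm_image_sub_le_of_norm_deriv_le_segment' (f := e) (f' := e') (a := 0) (b := τ)
      (C := C * τ ^ N)
      (fun x hx => (hder x ⟨hx.1, hx.2.trans hτ.2⟩).mono (Icc_subset_Icc_right hτ.2)) hbd τ
      ⟨hτ.1, le_rfl⟩
    have h0 : e 0 = 0 := by
      simp [he, Finset.sum_range_succ' _ N]
    rw [h0, sub_zero, sub_zero, mul_assoc, ← pow_succ] at h
    exact h

variable {n : ℕ} {y₀ : Fin n → ℝ} {a : ℝ}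

/-- The multi-indices of order less than `N` that are supported in the list `L`. -/
def taylorIdx (L : List (Fin n)) (N : ℕ) : Finset (Fin n → ℕ) :=
  (Fintype.piFinset fun _ : Fin n => Finset.range N).filter fun P =>
    (∀ j, j ∉ L → P j = 0) ∧ ∑ j, P j < N

lemma mem_taylorIdx {L : List (Fin n)} {N : ℕ} {P : Fin n → ℕ} :
    P ∈ taylorIdx L N ↔ (∀ j, j ∉ L → P j = 0) ∧ ∑ j, P j < N := by
  rw [taylorIdx, Finset.mem_filter, Fintype.mem_piFinset]
  refine and_iff_right_of_imp fun h j => Finset.mem_range.2 (lt_of_le_of_lt ?_ h.2)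
  exact Finset.single_le_sum (f := P) (fun _ _ => Nat.zero_le _) (Finset.mem_univ j)

/-- `δ^P / P!`. -/
noncomputable def mpow (δ : Fin n → ℝ) (P : Fin n → ℕ) : ℝ :=
  ∏ j, (δ j ^ P j / ((P j).factorial : ℝ))

lemma mpow_update (δ : Fin n → ℝ) (P : Fin n → ℕ) (j : Fin n) (p : ℕ) (hP : P j = 0) :
    mpow δ (Function.update P j p) = mpow δ P * (δ j ^ p / (p.factorial : ℝ)) := by
  rw [mpow, mpow, ← Finset.mul_prod_erase _ _ (Finset.mem_univ j),
    ← Finset.mul_prod_erase (a := j) Finset.univ (fun j => δ j ^ P j / ((P j).factorial : ℝ))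
      (Finset.mem_univ j)]
  simp only [Function.update_self, hP, pow_zero, Nat.factorial_zero, Nat.cast_one, div_one, one_mul]
  rw [mul_comm]
  congr 1
  refine Finset.prod_congr rfl fun i hi => ?_
  rw [Function.update_of_ne (Finset.ne_of_mem_erase hi)]

lemma abs_mpow_le (δ : Fin n → ℝ) (P : Fin n → ℕ) : |mpow δ P| ≤ ‖δ‖ ^ ∑ j, P j := by
  rw [mpow, Finset.abs_prod, ← Finset.prod_pow_eq_pow_sum]
  refine Finset.prod_le_prod (fun _ _ => abs_nonneg _) fun j _ => ?_
  rw [abs_div, abs_pow, Nat.abs_cast]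
  have h1 : (1 : ℝ) ≤ ((P j).factorial : ℝ) := by exact_mod_cast Nat.factorial_pos _
  refine (div_le_self (by positivity) h1).trans ?_
  exact pow_le_pow_left₀ (abs_nonneg _) (norm_le_pi_norm δ j) _

lemma sum_update_eq (P : Fin n → ℕ) (j : Fin n) (p : ℕ) (hP : P j = 0) :
    ∑ i, Function.update P j p i = ∑ i, P i + p := by
  rw [← Finset.add_sum_erase _ _ (Finset.mem_univ j),
    ← Finset.add_sum_erase (a := j) Finset.univ P (Finset.mem_univ j), hP, Function.update_self,
    zero_add, add_comm]
  congr 1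
  exact Finset.sum_congr rfl fun i hi => Function.update_of_ne (Finset.ne_of_mem_erase hi) _ _

/-- Separates the exponent at j from the others. The range N - |P| left for it is the order to which
the coefficient belonging to P has to be expanded in the j-th coordinate. -/
lemma sum_taylorIdx_cons {E : Type*} [AddCommMonoid E] {j : Fin n} {L : List (Fin n)} (hj : j ∉ L)
    (N : ℕ) (f : (Fin n → ℕ) → E) :
    ∑ P ∈ taylorIdx (j :: L) N, f P =
      ∑ P ∈ taylorIdx L N, ∑ p ∈ Finset.range (N - ∑ i, P i), f (Function.update P j p) := by
  rw [Finset.sum_sigma']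
  refine Finset.sum_bij' (fun P _ => ⟨Function.update P j 0, P j⟩)
    (fun x _ => Function.update x.1 j x.2) ?_ ?_ ?_ ?_ ?_
  · intro P hP
    rw [mem_taylorIdx] at hP
    have hs : ∑ i, Function.update P j 0 i + P j = ∑ i, P i := by
      have := sum_update_eq (Function.update P j 0) j (P j) (Function.update_self _ _ _)
      rw [Function.update_idem, Function.update_eq_self] at this
      exact this.symm
    rw [Finset.mem_sigma, mem_taylorIdx, Finset.mem_range]
    refine ⟨⟨fun i hi => ?_, by simp only; omega⟩, by simp only; omega⟩
    rcases eq_or_ne i j with rfl | hij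
    · simp
    · simp only [Function.update_of_ne hij]
      exact hP.1 i (by simp [hij, hi])
  · rintro ⟨P, p⟩ hx
    rw [Finset.mem_sigma, mem_taylorIdx, Finset.mem_range] at hx
    simp only at hx ⊢
    rw [mem_taylorIdx, sum_update_eq P j p (hx.1.1 j hj)]
    refine ⟨fun i hi => ?_, by omega⟩
    rw [List.mem_cons, not_or] at hi
    rw [Function.update_of_ne hi.1]
    exact hx.1.1 i hi.2
  · intro P hP
    simp
  · rintro ⟨P, p⟩ hx
    rw [Finset.mem_sigma, mem_taylorIdx] at hx
    have : P j = 0 := hx.1.1 j hj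
    simp only [Function.update_idem, Function.update_self, Sigma.mk.injEq, heq_eq_eq, and_true]
    rw [← this, Function.update_eq_self]
  · intro P hP
    simp

/-- The one-variable formula along the segment in the direction of the j-th unit vector, which stays
in the box by convexity. -/
lemma taylor_coordinate (ha : 0 < a) {u : (Fin n → ℝ) → Fin n → ℝ} (j : Fin n) {N : ℕ}
    (hu : ContDiffOn ℝ N u (Metric.closedBall y₀ a)) {C : ℝ} (hC0 : 0 ≤ C)
    (hC : ∀ z ∈ Metric.closedBall y₀ a, ‖(pd (Metric.closedBall y₀ a) j)^[N] u z‖ ≤ C)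
    {y : Fin n → ℝ} {d : ℝ} (hy : y ∈ Metric.closedBall y₀ a)
    (hyd : Function.update y j (y j + d) ∈ Metric.closedBall y₀ a) :
    ‖u (Function.update y j (y j + d)) - ∑ p ∈ Finset.range N, (d ^ p / (p.factorial : ℝ)) •
      (pd (Metric.closedBall y₀ a) j)^[p] u y‖ ≤ C * |d| ^ N := by
  set B := Metric.closedBall y₀ a with hB
  have hline : ∀ τ : ℝ, y + τ • (d • Pi.single j (1 : ℝ)) = Function.update y j (y j + τ * d) := by
    intro τ
    ext i
    rcases eq_or_ne i j with rfl | hij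
    · simp
    · simp [hij]
  have hmem : ∀ τ ∈ Icc (0 : ℝ) 1, y + τ • (d • Pi.single j (1 : ℝ)) ∈ B := by
    intro τ hτ
    have h1 := hline 1
    rw [one_mul, one_smul] at h1
    refine (convex_closedBall y₀ a).add_smul_mem hy ?_ hτ
    rw [h1]
    exact hyd
  have hT := norm_sub_taylor_le (C := C * |d| ^ N) (by positivity) N
    (g := fun i τ => d ^ i • (pd B j)^[i] u (y + τ • (d • Pi.single j (1 : ℝ)))) ?_ ?_ 1
    ⟨zero_le_one, le_rfl⟩
  · simp only [pow_zero, one_smul, Function.iterate_zero, id, one_pow, zero_smul, add_zero,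
      mul_one, smul_smul, zero_mul, one_mul] at hT
    have h1 := hline 1
    rw [one_mul, one_smul] at h1
    rw [h1] at hT
    simp only [div_mul_eq_mul_div, one_mul] at hT
    exact hT
  · intro i hi τ hτ
    have hd : DifferentiableWithinAt ℝ ((pd B j)^[i] u) B (y + τ • (d • Pi.single j (1 : ℝ))) := by
      refine (contDiffOn_iterate_pd (N := 1) ha j i (hu.of_le ?_)).differentiableOn (by norm_num) _
        (hmem τ hτ)
      norm_cast
      omega
    have hl : HasDerivWithinAt (fun τ : ℝ => y + τ • (d • (Pi.single j (1 : ℝ) : Fin n → ℝ)))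
        (d • (Pi.single j (1 : ℝ) : Fin n → ℝ)) (Icc 0 1) τ := by
      have := ((hasDerivAt_id τ).smul_const (d • (Pi.single j (1 : ℝ) : Fin n → ℝ))).const_add y
      rw [one_smul] at this
      exact this.hasDerivWithinAt
    have hc := (hd.hasFDerivWithinAt.comp_hasDerivWithinAt τ hl hmem).const_smul (d ^ i)
    refine hc.congr_deriv ?_
    rw [map_smul, smul_smul, ← pow_succ, Function.iterate_succ_apply']
    rfl
  · intro τ hτ
    rw [norm_smul, Real.norm_eq_abs, abs_pow, mul_comm]
    exact mul_le_mul_of_nonneg_right (hC _ (hmem τ hτ)) (by positivity)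

/-- Change of the coordinates of `y` in the list `L` by `δ`. -/
def shiftOn (L : List (Fin n)) (δ y : Fin n → ℝ) : Fin n → ℝ :=
  fun i => if i ∈ L then y i + δ i else y i

/-- The coordinates are shifted one at a time. First u is expanded in the coordinates of L at the
point y' already shifted in the coordinate j; then each coefficient at y' is expanded in the j-th
coordinate around y. All intermediate points remain in the domain because membership in a box is a
condition on each coordinate separately. -/
theorem exists_taylor_list (L : List (Fin n)) (hL : L.Nodup) (N : ℕ) (hN : 1 ≤ N) :
    ∃ c : ℝ, 0 ≤ c ∧ ∀ (y₀ : Fin n → ℝ) (a : ℝ), 0 < a → ∀ (u : (Fin n → ℝ) → Fin n → ℝ),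
      ContDiffOn ℝ N u (Metric.closedBall y₀ a) → ∀ C : ℝ, 0 ≤ C →
      (∀ P : Fin n → ℕ, (∀ j, j ∉ L → P j = 0) → ∑ j, P j = N → ∀ z ∈ Metric.closedBall y₀ a,
        ‖mpdList (Metric.closedBall y₀ a) L P u z‖ ≤ C) →
      ∀ y ∈ Metric.closedBall y₀ a, ∀ δ : Fin n → ℝ, (∀ i ∈ L, |y i + δ i - y₀ i| ≤ a) →
      ‖u (shiftOn L δ y) - ∑ P ∈ taylorIdx L N, mpow δ P • mpdList (Metric.closedBall y₀ a) L P u y‖ ≤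
        c * C * ‖δ‖ ^ N := by
  induction L with
  | nil =>
    refine ⟨0, le_rfl, fun y₀ a ha u _ C hC0 _ y _ δ _ => ?_⟩
    have h1 : taylorIdx ([] : List (Fin n)) N = {0} := by
      ext P
      rw [mem_taylorIdx, Finset.mem_singleton]
      constructor
      · intro h
        ext j
        exact h.1 j (by simp)
      · rintro rfl
        exact ⟨fun _ _ => rfl, by simpa using Nat.lt_of_succ_le hN⟩
    have h2 : shiftOn [] δ y = y := by ext i; simp [shiftOn]
    rw [h1, Finset.sum_singleton, h2]
    simp [mpow, mpdList]
  | cons j L ih =>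
    rw [List.nodup_cons] at hL
    obtain ⟨c, hc0, hc⟩ := ih hL.2
    refine ⟨c + (taylorIdx L N).card, by positivity, fun y₀ a ha u hu C hC0 hC y hy δ hδ => ?_⟩
    set B := Metric.closedBall y₀ a with hB
    have hmem : ∀ z : Fin n → ℝ, z ∈ B ↔ ∀ i, |z i - y₀ i| ≤ a := fun z => by
      rw [hB, Metric.mem_closedBall, dist_pi_le_iff ha.le]
      rfl
    set y' := Function.update y j (y j + δ j) with hy'
    have hy'B : y' ∈ B := by
      rw [hmem]
      intro i
      rcases eq_or_ne i j with rfl | hij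
      · rw [hy', Function.update_self]
        exact hδ i List.mem_cons_self
      · rw [hy', Function.update_of_ne hij]
        exact (hmem y).1 hy i
    have hsh : shiftOn (j :: L) δ y = shiftOn L δ y' := by
      ext i
      rcases eq_or_ne i j with rfl | hij
      · simp [shiftOn, hL.1, hy']
      · simp [shiftOn, hij, hy']
    have h1 := hc y₀ a ha u hu C hC0 (fun P hPL hP z hz => by
      have := hC P (fun i hi => hPL i fun h => hi (List.mem_cons_of_mem _ h)) hP z hz
      rwa [mpdList_cons, hPL j hL.1] at this) y' hy'B δ
      (fun i hi => by
        have hij : i ≠ j := fun h => hL.1 (h ▸ hi)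
        rw [hy', Function.update_of_ne hij]
        exact hδ i (List.mem_cons_of_mem _ hi))
    -- A coefficient of order |P| is multiplied by δ^P, so expanding it to order N - |P| leaves an
    -- error of total order N.
    have h2 : ∀ P ∈ taylorIdx L N, ‖mpow δ P • mpdList B L P u y' -
        ∑ p ∈ Finset.range (N - ∑ i, P i), mpow δ (Function.update P j p) •
          mpdList B (j :: L) (Function.update P j p) u y‖ ≤ C * ‖δ‖ ^ N := by
      intro P hP
      rw [mem_taylorIdx] at hP
      have hPj : P j = 0 := hP.1 j hL.1
      have hsum : (L.map P).sum ≤ ∑ i, P i := by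
        rw [← List.sum_toFinset _ hL.2]
        exact Finset.sum_le_sum_of_subset (Finset.subset_univ _)
      have hmp : ∀ p, mpdList B (j :: L) (Function.update P j p) u =
          (pd B j)^[p] (mpdList B L P u) := fun p => by
        rw [mpdList_cons, Function.update_self, mpdList_congr_idx (Q := P) B L u fun i hi => by
          have hij : i ≠ j := fun h => hL.1 (h ▸ hi)
          rw [Function.update_of_ne hij]]
      have h3 := taylor_coordinate ha j (N := N - ∑ i, P i) (u := mpdList B L P u)
        (contDiffOn_mpdList ha L P (hu.of_le (by norm_cast; omega))) hC0 (fun z hz => by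
          have := hC (Function.update P j (N - ∑ i, P i)) (fun i hi => by
            rw [List.mem_cons, not_or] at hi
            rw [Function.update_of_ne hi.1]
            exact hP.1 i hi.2) (by rw [sum_update_eq P j _ hPj]; omega) z hz
          rwa [hmp] at this) hy hy'B
      simp only [hmp, mpow_update δ P j _ hPj, mul_smul, ← Finset.smul_sum]
      rw [← smul_sub, norm_smul, Real.norm_eq_abs]
      have h4 : |δ j| ^ (N - ∑ i, P i) ≤ ‖δ‖ ^ (N - ∑ i, P i) :=
        pow_le_pow_left₀ (abs_nonneg _) (norm_le_pi_norm δ j) _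
      calc _ ≤ ‖δ‖ ^ (∑ i, P i) * (C * ‖δ‖ ^ (N - ∑ i, P i)) :=
            mul_le_mul (abs_mpow_le δ P) (h3.trans (mul_le_mul_of_nonneg_left h4 hC0))
              (norm_nonneg _) (by positivity)
        _ = C * ‖δ‖ ^ N := by
            rw [mul_left_comm, ← pow_add, Nat.add_sub_cancel' hP.2.le]
    rw [hsh, sum_taylorIdx_cons hL.1]
    have h5 : ∀ x y z : Fin n → ℝ, x - z = (x - y) + (y - z) := fun x y z => by abel
    rw [h5 _ (∑ P ∈ taylorIdx L N, mpow δ P • mpdList B L P u y')]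
    have h6 : ‖∑ P ∈ taylorIdx L N, mpow δ P • mpdList B L P u y' - ∑ P ∈ taylorIdx L N,
        ∑ p ∈ Finset.range (N - ∑ i, P i), mpow δ (Function.update P j p) •
          mpdList B (j :: L) (Function.update P j p) u y‖ ≤
        (taylorIdx L N).card * (C * ‖δ‖ ^ N) := by
      rw [← Finset.sum_sub_distrib]
      refine (norm_sum_le _ _).trans ((Finset.sum_le_card_nsmul _ _ _ h2).trans ?_)
      rw [nsmul_eq_mul]
    refine (norm_add_le _ _).trans ((add_le_add h1 h6).trans (le_of_eq ?_))
    ring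

/-- Taylor's formula on a box around the centre. -/
theorem exists_taylor (n N : ℕ) (hN : 1 ≤ N) :
    ∃ c : ℝ, 0 ≤ c ∧ ∀ (y₀ : Fin n → ℝ) (a : ℝ), 0 < a → ∀ (u : (Fin n → ℝ) → Fin n → ℝ),
      ContDiffOn ℝ N u (Metric.closedBall y₀ a) → ∀ C : ℝ, 0 ≤ C →
      (∀ P : Fin n → ℕ, ∑ j, P j = N → ∀ z ∈ Metric.closedBall y₀ a,
        ‖mpd (Metric.closedBall y₀ a) P u z‖ ≤ C) →
      ∀ δ : Fin n → ℝ, ‖δ‖ ≤ a →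
      ‖u (y₀ + δ) - ∑ P ∈ taylorIdx (List.finRange n) N,
        mpow δ P • mpd (Metric.closedBall y₀ a) P u y₀‖ ≤ c * C * ‖δ‖ ^ N := by
  obtain ⟨c, hc0, hc⟩ := exists_taylor_list (List.finRange n) (List.nodup_finRange n) N hN
  refine ⟨c, hc0, fun y₀ a ha u hu C hC0 hC δ hδ => ?_⟩
  have h := hc y₀ a ha u hu C hC0 (fun P _ hP z hz => hC P hP z hz) y₀
    (Metric.mem_closedBall_self ha.le) δ fun i _ => by
      rw [add_sub_cancel_left]
      exact (norm_le_pi_norm δ i).trans hδ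
  have hs : shiftOn (List.finRange n) δ y₀ = y₀ + δ := by
    ext i
    simp [shiftOn]
  rwa [hs] at h

end Taylor


/-! ### Ranks of monomials -/

section Ranks

variable {m : ℕ} {ϱ : Fin m → ℝ}

lemma rank_add (β γ : Mon m) : rank ϱ (β + γ) = rank ϱ β + rank ϱ γ :=
  Finsupp.sum_add_index' (by simp) (fun x b c => by push_cast; ring)

lemma rank_zero : rank ϱ (0 : Mon m) = 0 := Finsupp.sum_zero_index

lemma rank_single (x : Fin m × ℕ) (b : ℕ) : rank ϱ (Finsupp.single x b) = (ϱ x.1 + x.2) * b :=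
  Finsupp.sum_single_index (by simp)

lemma rank_nonneg (hϱ : ∀ l, 0 < ϱ l) (β : Mon m) : 0 ≤ rank ϱ β :=
  Finset.sum_nonneg fun x _ => mul_nonneg (by have := hϱ x.1; positivity) (Nat.cast_nonneg _)

lemma rank_mono (hϱ : ∀ l, 0 < ϱ l) {β γ : Mon m} (h : β ≤ γ) : rank ϱ β ≤ rank ϱ γ := by
  obtain ⟨η, rfl⟩ := exists_add_of_le h
  rw [rank_add]
  linarith [rank_nonneg hϱ η]

lemma single_le_of_mem_support {β : Mon m} {x : Fin m × ℕ} (hx : x ∈ β.support) :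
    Finsupp.single x 1 ≤ β :=
  Finsupp.single_le_iff.2 (Nat.one_le_iff_ne_zero.2 (Finsupp.mem_support_iff.1 hx))

lemma le_rank_of_mem_support (hϱ : ∀ l, 0 < ϱ l) {β : Mon m} {x : Fin m × ℕ} (hx : x ∈ β.support) :
    ϱ x.1 + x.2 ≤ rank ϱ β := by
  have := rank_mono hϱ (single_le_of_mem_support hx)
  rw [rank_single] at this
  simpa using this

lemma rank_mon_pos (hϱ : ∀ l, 0 < ϱ l) {β : Mon m} (hβ : β ≠ 0) :
    0 < rank ϱ β := by
  obtain ⟨x, hx⟩ := Finsupp.support_nonempty_iff.2 hβ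
  have := le_rank_of_mem_support hϱ hx
  have := hϱ x.1
  have h2 : (0 : ℝ) ≤ x.2 := Nat.cast_nonneg _
  linarith

variable [NeZero m]

lemma degree_mul_le_rank (hmono : Monotone ϱ) (β : Mon m) :
    (β.degree : ℝ) * ϱ 0 ≤ rank ϱ β := by
  rw [rank, Finsupp.sum, Finsupp.degree_apply, Nat.cast_sum, Finset.sum_mul]
  refine Finset.sum_le_sum fun x _ => ?_
  rw [mul_comm]
  refine mul_le_mul_of_nonneg_right ?_ (Nat.cast_nonneg _)
  have := hmono (Fin.zero_le x.1)
  have h2 : (0 : ℝ) ≤ x.2 := Nat.cast_nonneg _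
  linarith

lemma le_rank_of_ne_zero (hϱ : ∀ l, 0 < ϱ l) (hmono : Monotone ϱ) {β : Mon m} (hβ : β ≠ 0) :
    ϱ 0 ≤ rank ϱ β := by
  obtain ⟨x, hx⟩ := Finsupp.support_nonempty_iff.2 hβ
  have := le_rank_of_mem_support hϱ hx
  have := hmono (Fin.zero_le x.1)
  have h2 : (0 : ℝ) ≤ x.2 := Nat.cast_nonneg _
  linarith

/-- Every factor costs at least ϱ₁ and every differentiation costs 1, so a bound on the rank bounds
both the exponents and the orders of the derivatives. -/
lemma finite_rank_le (hϱ : ∀ l, 0 < ϱ l) (hmono : Monotone ϱ) (c : ℝ) :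
    {β : Mon m | rank ϱ β ≤ c}.Finite := by
  refine (Finset.finite_toSet (Finset.finsupp
    ((Finset.univ : Finset (Fin m)) ×ˢ Finset.range (⌈c⌉₊ + 1))
    fun _ => Finset.range (⌈c / ϱ 0⌉₊ + 1))).subset fun β hβ => ?_
  rw [mem_ofPred_eq] at hβ
  rw [Finset.mem_coe, Finset.mem_finsupp_iff]
  refine ⟨fun x hx => ?_, fun x _ => ?_⟩
  · have h1 := le_rank_of_mem_support hϱ hx
    have h2 := hϱ x.1
    rw [Finset.mem_product, Finset.mem_range]
    refine ⟨Finset.mem_univ _, Nat.lt_succ_of_le ?_⟩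
    exact_mod_cast (show (x.2 : ℝ) ≤ ⌈c⌉₊ by linarith [Nat.le_ceil c])
  · rw [Finset.mem_range]
    refine Nat.lt_succ_of_le ?_
    have h1 : (β.degree : ℝ) ≤ c / ϱ 0 := by
      rw [le_div_iff₀ (hϱ 0)]
      exact (degree_mul_le_rank hmono β).trans hβ
    have h2 : β x ≤ β.degree := Finsupp.le_degree x β
    have h3 : (β x : ℝ) ≤ β.degree := by exact_mod_cast h2
    exact_mod_cast (show (β x : ℝ) ≤ ⌈c / ϱ 0⌉₊ by linarith [Nat.le_ceil (c / ϱ 0)])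

/-- The infimum in the definition of `rho` is attained, because only finitely many ranks lie below a
given one. -/
lemma isLeast_rho_succ (hϱ : ∀ l, 0 < ϱ l) (hmono : Monotone ϱ) (s : ℕ) :
    IsLeast {x ∈ rankSet ϱ | rho ϱ s < x} (rho ϱ (s + 1)) := by
  set S := {x ∈ rankSet ϱ | rho ϱ s < x} with hS
  have hne : S.Nonempty := by
    -- The monomial ε₁^N has rank N ϱ₁, which exceeds ρ_s for large N; the bound N > 1 keeps it
    -- nontrivial.
    obtain ⟨N, hN⟩ := exists_nat_gt (max 1 (rho ϱ s / ϱ 0))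
    have hN1 := (le_max_left _ _).trans_lt hN
    have hN2 := (le_max_right _ _).trans_lt hN
    refine ⟨(ϱ 0 + (0 : ℕ)) * N, ⟨Finsupp.single (0, 0) N, ?_, rank_single _ _⟩, ?_⟩
    · rw [Ne, Finsupp.single_eq_zero]
      rintro rfl
      norm_num at hN1
    · rw [div_lt_iff₀ (hϱ 0)] at hN2
      simp only [Nat.cast_zero, add_zero]
      linarith
  obtain ⟨x₀, hx₀⟩ := hne
  have hfin : (S ∩ Iic x₀).Finite := by
    refine ((finite_rank_le hϱ hmono x₀).image (rank ϱ)).subset ?_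
    rintro x ⟨⟨⟨β, _, rfl⟩, _⟩, hx⟩
    exact ⟨β, hx, rfl⟩
  obtain ⟨y, hy, hymin⟩ := Set.exists_min_image (S ∩ Iic x₀) id hfin ⟨x₀, hx₀, self_mem_Iic⟩
  have hleast : IsLeast S y := by
    refine ⟨hy.1, fun z hz => ?_⟩
    rcases le_total z x₀ with h | h
    · exact hymin z ⟨hz, h⟩
    · exact hy.2.trans h
  have : rho ϱ (s + 1) = y := by rw [rho]; exact hleast.csInf_eq
  rw [this]
  exact hleast

lemma rho_lt_succ (hϱ : ∀ l, 0 < ϱ l) (hmono : Monotone ϱ) (s : ℕ) : rho ϱ s < rho ϱ (s + 1) :=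
  (isLeast_rho_succ hϱ hmono s).1.2

lemma rho_strictMono (hϱ : ∀ l, 0 < ϱ l) (hmono : Monotone ϱ) : StrictMono (rho ϱ) :=
  strictMono_nat_of_lt_succ (rho_lt_succ hϱ hmono)

/-- The gap between consecutive ranks. It turns every error of rank merely above ρ_k into one of
order ε₁^(ρ_{k+1}/ϱ₁). -/
lemma rho_succ_le_rank (hϱ : ∀ l, 0 < ϱ l) (hmono : Monotone ϱ) {k : ℕ} {β : Mon m}
    (h : rho ϱ k < rank ϱ β) : rho ϱ (k + 1) ≤ rank ϱ β := by
  refine (isLeast_rho_succ hϱ hmono k).2 ⟨⟨β, ?_, rfl⟩, h⟩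
  rintro rfl
  rw [rank_zero] at h
  have := (rho_strictMono hϱ hmono).monotone (Nat.zero_le k)
  rw [rho] at this
  linarith

lemma exists_rank_eq_rho (hϱ : ∀ l, 0 < ϱ l) (hmono : Monotone ϱ) {k : ℕ} {β : Mon m}
    (hβ : β ≠ 0) (h : rank ϱ β ≤ rho ϱ k) : ∃ s ∈ Finset.Icc 1 k, rank ϱ β = rho ϱ s := by
  induction k with
  | zero =>
    rw [rho] at h
    exact absurd (rank_mon_pos hϱ hβ) (not_lt.2 h)
  | succ k ih =>
    rcases le_or_gt (rank ϱ β) (rho ϱ k) with h' | h'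
    · obtain ⟨s, hs, e⟩ := ih h'
      rw [Finset.mem_Icc] at hs
      exact ⟨s, Finset.mem_Icc.2 ⟨hs.1, hs.2.trans (Nat.le_succ k)⟩, e⟩
    · exact ⟨k + 1, Finset.mem_Icc.2 ⟨by omega, le_rfl⟩,
        le_antisymm h (rho_succ_le_rank hϱ hmono h')⟩

lemma rho_pos (hϱ : ∀ l, 0 < ϱ l) (hmono : Monotone ϱ) {k : ℕ} (hk : 1 ≤ k) : 0 < rho ϱ k := by
  have := rho_strictMono hϱ hmono (Nat.lt_of_succ_le hk)
  rwa [rho] at this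

lemma le_rho (hϱ : ∀ l, 0 < ϱ l) (hmono : Monotone ϱ) {k : ℕ} (hk : 1 ≤ k) : ϱ 0 ≤ rho ϱ k := by
  obtain ⟨j, rfl⟩ := Nat.exists_eq_add_of_le' hk
  obtain ⟨⟨β, hβ, e⟩, _⟩ := (isLeast_rho_succ hϱ hmono j).1
  rw [← e]
  exact le_rank_of_ne_zero hϱ hmono hβ

end Ranks

/-! ### The functions `ν_β` -/

/-- The assumptions on the small parameters that concern their smoothness and order. -/
structure IsSmallParam {m : ℕ} [NeZero m] (t₀ : ℝ) (ε : Fin m → ℝ → ℝ) (ϱ : Fin m → ℝ) (k : ℕ) :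
    Prop where
  pos : ∀ l, 0 < ϱ l
  mono : Monotone ϱ
  one_le : 1 ≤ k
  smooth : ∀ l, ContDiffOn ℝ ((⌊rho ϱ k - ϱ l⌋ + 1).toNat) (ε l) (Ici t₀)
  isBigO : ∀ l, ∀ r : ℕ, r ≤ (⌊rho ϱ k - ϱ l⌋ + 1).toNat →
      (fun t => iteratedDerivWithin r (ε l) (Ici t₀) t) =O[atTop]
        fun t => (ε 0 t) ^ ((ϱ l + r) / ϱ 0)
  eps_pos : ∀ t ∈ Ici t₀, 0 < ε 0 t
  tendsto : Tendsto (ε 0) atTop (𝓝 0)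

section Nu

variable {m : ℕ} {t₀ : ℝ} {ε : Fin m → ℝ → ℝ} {ϱ : Fin m → ℝ} {k : ℕ}

lemma nu_add (β γ : Mon m) (t : ℝ) : nu t₀ ε (β + γ) t = nu t₀ ε β t * nu t₀ ε γ t :=
  Finsupp.prod_add_index' (fun _ => pow_zero _) (fun _ _ _ => pow_add _ _ _)

lemma nu_zero (t : ℝ) : nu t₀ ε (0 : Mon m) t = 1 := Finsupp.prod_zero_index

lemma nu_single (x : Fin m × ℕ) (b : ℕ) (t : ℝ) :
    nu t₀ ε (Finsupp.single x b) t = iteratedDerivWithin x.2 (ε x.1) (Ici t₀) t ^ b :=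
  Finsupp.prod_single_index (pow_zero _)

/-- All derivatives in the monomial are covered by the smoothness assumption. -/
def IsCovered (ϱ : Fin m → ℝ) (k : ℕ) (β : Mon m) : Prop :=
  ∀ x ∈ β.support, x.2 ≤ (⌊rho ϱ k - ϱ x.1⌋ + 1).toNat

lemma IsCovered.add {β γ : Mon m} (hβ : IsCovered ϱ k β) (hγ : IsCovered ϱ k γ) :
    IsCovered ϱ k (β + γ) := fun x hx => by
  classical
  rcases Finset.mem_union.1 (Finsupp.support_add hx) with h | h
  · exact hβ x h
  · exact hγ x h

lemma IsCovered.mono {β γ : Mon m} (hγ : IsCovered ϱ k γ) (h : β ≤ γ) : IsCovered ϱ k β :=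
  fun x hx => hγ x (Finsupp.support_mono h hx)

lemma isCovered_single {x : Fin m × ℕ} (hx : x.2 ≤ (⌊rho ϱ k - ϱ x.1⌋ + 1).toNat) (b : ℕ) :
    IsCovered ϱ k (Finsupp.single x b) := fun y hy => by
  have := Finsupp.support_single_subset hy
  rw [Finset.mem_singleton] at this
  rwa [this]

lemma succ_le_of_rank_le (hϱ : ∀ l, 0 < ϱ l) {β : Mon m} (hβ : rank ϱ β ≤ rho ϱ k) {x : Fin m × ℕ}
    (hx : x ∈ β.support) : (x.2 : ℤ) ≤ ⌊rho ϱ k - ϱ x.1⌋ := by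
  have := le_rank_of_mem_support hϱ hx
  rw [Int.le_floor]
  push_cast
  linarith

lemma succ_le_toNat_of_rank_le (hϱ : ∀ l, 0 < ϱ l) {β : Mon m} (hβ : rank ϱ β ≤ rho ϱ k)
    {x : Fin m × ℕ} (hx : x ∈ β.support) : x.2 + 1 ≤ (⌊rho ϱ k - ϱ x.1⌋ + 1).toNat := by
  have := succ_le_of_rank_le hϱ hβ hx
  omega

lemma isCovered_of_rank_le (hϱ : ∀ l, 0 < ϱ l) {β : Mon m} (hβ : rank ϱ β ≤ rho ϱ k) :
    IsCovered ϱ k β := fun _ hx => (Nat.le_succ _).trans (succ_le_toNat_of_rank_le hϱ hβ hx)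

/-- The monomial that results from `β` if one factor `x` is differentiated. -/
noncomputable def bump (β : Mon m) (x : Fin m × ℕ) : Mon m :=
  β - Finsupp.single x 1 + Finsupp.single (x.1, x.2 + 1) 1

/-- The smoothness order p_l = [ρ_k - ϱ_l] + 1 exceeds by one the derivatives that occur in
monomials of rank at most ρ_k: exactly enough for differentiating such a monomial once. -/
lemma isCovered_bump (hϱ : ∀ l, 0 < ϱ l) {β : Mon m} (hβ : rank ϱ β ≤ rho ϱ k) {x : Fin m × ℕ}
    (hx : x ∈ β.support) : IsCovered ϱ k (bump β x) :=
  ((isCovered_of_rank_le hϱ hβ).mono tsub_le_self).add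
    (isCovered_single (succ_le_toNat_of_rank_le hϱ hβ hx) 1)

variable [NeZero m]

lemma IsSmallParam.eventually_pos (h : IsSmallParam t₀ ε ϱ k) : ∀ᶠ t in atTop, 0 < ε 0 t := by
  filter_upwards [eventually_ge_atTop t₀] with t ht using h.eps_pos t ht

lemma IsSmallParam.isBigO_rpow (h : IsSmallParam t₀ ε ϱ k) {b c : ℝ} (hbc : b ≤ c) :
    (fun t => ε 0 t ^ c) =O[atTop] fun t => ε 0 t ^ b := by
  refine Asymptotics.IsBigO.of_bound 1 ?_
  filter_upwards [h.eventually_pos, h.tendsto.eventually (gt_mem_nhds zero_lt_one)] with t h1 h2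
  rw [one_mul, Real.norm_eq_abs, Real.norm_eq_abs, abs_of_pos (Real.rpow_pos_of_pos h1 _),
    abs_of_pos (Real.rpow_pos_of_pos h1 _)]
  exact Real.rpow_le_rpow_of_exponent_ge h1 h2.le hbc

lemma IsSmallParam.isBigO_one (h : IsSmallParam t₀ ε ϱ k) {c : ℝ} (hc : 0 ≤ c) :
    (fun t => ε 0 t ^ c) =O[atTop] fun _ => (1 : ℝ) := by
  simpa using h.isBigO_rpow hc

lemma IsSmallParam.rpow_mul_rpow (h : IsSmallParam t₀ ε ϱ k) (b c : ℝ) :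
    (fun t => ε 0 t ^ b * ε 0 t ^ c) =ᶠ[atTop] fun t => ε 0 t ^ (b + c) := by
  filter_upwards [h.eventually_pos] with t ht
  rw [Real.rpow_add ht]

lemma IsSmallParam.tendsto_rpow (h : IsSmallParam t₀ ε ϱ k) {c : ℝ} (hc : 0 < c) :
    Tendsto (fun t => ε 0 t ^ c) atTop (𝓝 0) := by
  have := h.tendsto.rpow_const (Or.inr hc.le)
  rwa [Real.zero_rpow hc.ne'] at this

/-- Each factor contributes its own rank to the exponent, and ranks are additive over products. -/
lemma IsSmallParam.nu_isBigO (h : IsSmallParam t₀ ε ϱ k) {β : Mon m} (hβ : IsCovered ϱ k β) :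
    (nu t₀ ε β) =O[atTop] fun t => ε 0 t ^ (rank ϱ β / ϱ 0) := by
  induction β using Finsupp.induction_linear with
  | zero =>
    simp only [rank_zero, zero_div, Real.rpow_zero]
    have : nu t₀ ε (0 : Mon m) = fun _ => 1 := funext fun t => nu_zero t
    rw [this]
  | add β γ ihβ ihγ =>
    have h1 := (ihβ (hβ.mono le_self_add)).mul (ihγ (hβ.mono le_add_self))
    have : nu t₀ ε (β + γ) = fun t => nu t₀ ε β t * nu t₀ ε γ t := funext fun t => nu_add _ _ t
    rw [this, rank_add, add_div]
    exact h1.trans (h.rpow_mul_rpow _ _).isBigO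
  | single x b =>
    have : nu t₀ ε (Finsupp.single x b) = fun t => iteratedDerivWithin x.2 (ε x.1) (Ici t₀) t ^ b :=
      funext fun t => nu_single x b t
    rw [this]
    rcases Nat.eq_zero_or_pos b with rfl | hb
    · rw [Finsupp.single_zero, rank_zero, zero_div]
      simp only [pow_zero, Real.rpow_zero]
      exact Asymptotics.isBigO_refl _ _
    · have hx := hβ x (by rw [Finsupp.support_single _ hb.ne']; exact Finset.mem_singleton_self x)
      have h1 := (h.isBigO x.1 x.2 hx).pow b
      refine h1.trans (Filter.EventuallyEq.isBigO ?_)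
      filter_upwards [h.eventually_pos] with t ht
      rw [rank_single, ← Real.rpow_natCast, ← Real.rpow_mul ht.le]
      congr 1
      ring

lemma IsSmallParam.hasDerivWithinAt_iteratedDeriv (h : IsSmallParam t₀ ε ϱ k) (l : Fin m) {r : ℕ}
    (hr : r + 1 ≤ (⌊rho ϱ k - ϱ l⌋ + 1).toNat) {t : ℝ} (ht : t ∈ Ici t₀) :
    HasDerivWithinAt (iteratedDerivWithin r (ε l) (Ici t₀))
      (iteratedDerivWithin (r + 1) (ε l) (Ici t₀) t) (Ici t₀) t := by
  rw [iteratedDerivWithin_succ]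
  refine ((h.smooth l).differentiableOn_iteratedDerivWithin ?_ (uniqueDiffOn_Ici t₀) t
    ht).hasDerivWithinAt
  exact_mod_cast hr

lemma IsSmallParam.continuousOn_iteratedDeriv (h : IsSmallParam t₀ ε ϱ k) (l : Fin m) {r : ℕ}
    (hr : r ≤ (⌊rho ϱ k - ϱ l⌋ + 1).toNat) :
    ContinuousOn (iteratedDerivWithin r (ε l) (Ici t₀)) (Ici t₀) :=
  (h.smooth l).continuousOn_iteratedDerivWithin (by exact_mod_cast hr) (uniqueDiffOn_Ici t₀)

lemma IsSmallParam.continuousOn_nu (h : IsSmallParam t₀ ε ϱ k) {β : Mon m} (hβ : IsCovered ϱ k β) :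
    ContinuousOn (nu t₀ ε β) (Ici t₀) :=
  continuousOn_finsetProd _ fun x hx => (h.continuousOn_iteratedDeriv x.1 (hβ x hx)).pow _

lemma IsSmallParam.hasDerivWithinAt_nu (h : IsSmallParam t₀ ε ϱ k) {β : Mon m}
    (hβ : rank ϱ β ≤ rho ϱ k) {t : ℝ} (ht : t ∈ Ici t₀) :
    HasDerivWithinAt (nu t₀ ε β) (∑ x ∈ β.support, (β x : ℝ) * nu t₀ ε (bump β x) t) (Ici t₀) t := by
  classical
  have h1 := HasDerivWithinAt.fun_finsetProd (u := β.support)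
    (f := fun x t => iteratedDerivWithin x.2 (ε x.1) (Ici t₀) t ^ β x) fun x hx =>
      (h.hasDerivWithinAt_iteratedDeriv x.1 (succ_le_toNat_of_rank_le h.pos hβ hx) ht).pow (β x)
  refine h1.congr_deriv (Finset.sum_congr rfl fun x hx => ?_)
  have h2 : nu t₀ ε (β - Finsupp.single x 1) t =
      iteratedDerivWithin x.2 (ε x.1) (Ici t₀) t ^ (β x - 1) *
      ∏ y ∈ β.support.erase x, iteratedDerivWithin y.2 (ε y.1) (Ici t₀) t ^ β y := by
    rw [nu, Finsupp.prod_of_support_subset _ (Finsupp.support_mono tsub_le_self) _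
      (fun _ _ => pow_zero _), ← Finset.mul_prod_erase _ _ hx]
    congr 1
    · simp
    · refine Finset.prod_congr rfl fun y hy => ?_
      have : x ≠ y := (Finset.ne_of_mem_erase hy).symm
      simp [this]
  rw [bump, nu_add, h2, nu_single, pow_one, smul_eq_mul]
  ring

end Nu


/-! ### Coefficients of products of power series -/

section PowerSeries

variable {σ : Type*} {D : (σ →₀ ℕ) → Prop}

/-- Equality of all coefficients with index in `D`. -/
def AgreeOn (D : (σ →₀ ℕ) → Prop) (a b : MvPowerSeries σ ℝ) : Prop :=
  ∀ γ, D γ → MvPowerSeries.coeff γ a = MvPowerSeries.coeff γ b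

/-- A coefficient of a product involves only coefficients at smaller exponents, so downward closed
index sets `D` are compatible with multiplication. The same remark underlies `CoeffIn.mul`. -/
lemma AgreeOn.mul (hD : ∀ β γ, γ ≤ β → D β → D γ) {a b a' b' : MvPowerSeries σ ℝ}
    (h : AgreeOn D a b) (h' : AgreeOn D a' b') : AgreeOn D (a * a') (b * b') := by
  classical
  intro γ hγ
  rw [MvPowerSeries.coeff_mul, MvPowerSeries.coeff_mul]
  refine Finset.sum_congr rfl fun p hp => ?_
  rw [Finset.HasAntidiagonal.mem_antidiagonal] at hp
  rw [h p.1 (hD γ _ (hp ▸ le_self_add) hγ), h' p.2 (hD γ _ (hp ▸ le_add_self) hγ)]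

lemma AgreeOn.pow (hD : ∀ β γ, γ ≤ β → D β → D γ) {a b : MvPowerSeries σ ℝ}
    (h : AgreeOn D a b) (k : ℕ) : AgreeOn D (a ^ k) (b ^ k) := by
  induction k with
  | zero => exact fun _ _ => by rw [pow_zero, pow_zero]
  | succ k ih =>
    rw [pow_succ, pow_succ]
    exact ih.mul hD h

lemma AgreeOn.prod (hD : ∀ β γ, γ ≤ β → D β → D γ) {ι : Type*} (s : Finset ι)
    {a b : ι → MvPowerSeries σ ℝ} (h : ∀ i ∈ s, AgreeOn D (a i) (b i)) :
    AgreeOn D (∏ i ∈ s, a i) (∏ i ∈ s, b i) := by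
  classical
  induction s using Finset.induction_on with
  | empty => exact fun _ _ => rfl
  | insert i s hi ih =>
    rw [Finset.prod_insert hi, Finset.prod_insert hi]
    exact (h i (Finset.mem_insert_self _ _)).mul hD
      (ih fun j hj => h j (Finset.mem_insert_of_mem hj))

/-- The coefficients with index in `D` of a family of power series lie in an algebra of
functions. -/
def CoeffIn (𝒜 : Subalgebra ℝ (ℝ → ℝ)) (D : (σ →₀ ℕ) → Prop) (a : ℝ → MvPowerSeries σ ℝ) : Prop :=
  ∀ γ, D γ → (fun t => MvPowerSeries.coeff γ (a t)) ∈ 𝒜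

variable {𝒜 : Subalgebra ℝ (ℝ → ℝ)}

lemma CoeffIn.mul (hD : ∀ β γ, γ ≤ β → D β → D γ) {a b : ℝ → MvPowerSeries σ ℝ}
    (ha : CoeffIn 𝒜 D a) (hb : CoeffIn 𝒜 D b) : CoeffIn 𝒜 D fun t => a t * b t := by
  classical
  intro γ hγ
  simp only [MvPowerSeries.coeff_mul]
  have : (fun t => ∑ p ∈ Finset.HasAntidiagonal.antidiagonal γ,
      MvPowerSeries.coeff p.1 (a t) * MvPowerSeries.coeff p.2 (b t)) =
      ∑ p ∈ Finset.HasAntidiagonal.antidiagonal γ, (fun t => MvPowerSeries.coeff p.1 (a t)) *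
        fun t => MvPowerSeries.coeff p.2 (b t) := by
    ext t
    simp
  rw [this]
  refine Subalgebra.sum_mem _ fun p hp => ?_
  rw [Finset.HasAntidiagonal.mem_antidiagonal] at hp
  exact mul_mem (ha p.1 (hD γ _ (hp ▸ le_self_add) hγ)) (hb p.2 (hD γ _ (hp ▸ le_add_self) hγ))

lemma coeffIn_const (c : MvPowerSeries σ ℝ) : CoeffIn 𝒜 D fun _ => c := fun γ _ =>
  𝒜.algebraMap_mem (MvPowerSeries.coeff γ c)

lemma CoeffIn.pow (hD : ∀ β γ, γ ≤ β → D β → D γ) {a : ℝ → MvPowerSeries σ ℝ}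
    (ha : CoeffIn 𝒜 D a) (k : ℕ) : CoeffIn 𝒜 D fun t => a t ^ k := by
  induction k with
  | zero => simpa only [pow_zero] using coeffIn_const 1
  | succ k ih =>
    simp only [pow_succ]
    exact ih.mul hD ha

lemma CoeffIn.prod (hD : ∀ β γ, γ ≤ β → D β → D γ) {ι : Type*} (s : Finset ι)
    {a : ι → ℝ → MvPowerSeries σ ℝ} (h : ∀ i ∈ s, CoeffIn 𝒜 D (a i)) :
    CoeffIn 𝒜 D fun t => ∏ i ∈ s, a i t := by
  classical
  induction s using Finset.induction_on with
  | empty => simpa only [Finset.prod_empty] using coeffIn_const 1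
  | insert i s hi ih =>
    simp only [Finset.prod_insert hi]
    exact (h i (Finset.mem_insert_self _ _)).mul hD
      (ih fun j hj => h j (Finset.mem_insert_of_mem hj))

/-- All coefficients with `r`-weight less than `c` vanish. -/
def VanishBelow (r : (σ →₀ ℕ) → ℝ) (c : ℝ) (a : MvPowerSeries σ ℝ) : Prop :=
  ∀ γ, r γ < c → MvPowerSeries.coeff γ a = 0

variable {r : (σ →₀ ℕ) → ℝ}

/-- Orders of vanishing add for any additive weight. Two weights are used: the rank and the total
degree. -/
lemma VanishBelow.mul (hr : ∀ β γ, r (β + γ) = r β + r γ) {a b : MvPowerSeries σ ℝ} {c d : ℝ}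
    (ha : VanishBelow r c a) (hb : VanishBelow r d b) : VanishBelow r (c + d) (a * b) := by
  classical
  intro γ hγ
  rw [MvPowerSeries.coeff_mul]
  refine Finset.sum_eq_zero fun p hp => ?_
  rw [Finset.HasAntidiagonal.mem_antidiagonal] at hp
  rw [← hp, hr] at hγ
  rcases lt_or_ge (r p.1) c with h | h
  · rw [ha _ h, zero_mul]
  · rw [hb p.2 (by linarith), mul_zero]

lemma vanishBelow_one (hr0 : ∀ β, 0 ≤ r β) : VanishBelow r 0 (1 : MvPowerSeries σ ℝ) :=
  fun γ hγ => absurd (hr0 γ) (not_le.2 hγ)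

lemma VanishBelow.pow (hr : ∀ β γ, r (β + γ) = r β + r γ) (hr0 : ∀ β, 0 ≤ r β)
    {a : MvPowerSeries σ ℝ} {c : ℝ} (ha : VanishBelow r c a) (k : ℕ) :
    VanishBelow r (k * c) (a ^ k) := by
  induction k with
  | zero => simpa using vanishBelow_one hr0
  | succ k ih =>
    rw [pow_succ]
    have := ih.mul hr ha
    push_cast
    rwa [add_mul, one_mul]

lemma VanishBelow.prod (hr : ∀ β γ, r (β + γ) = r β + r γ) (hr0 : ∀ β, 0 ≤ r β) {ι : Type*}
    (s : Finset ι) {a : ι → MvPowerSeries σ ℝ} {c : ι → ℝ} (h : ∀ i ∈ s, VanishBelow r (c i) (a i)) :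
    VanishBelow r (∑ i ∈ s, c i) (∏ i ∈ s, a i) := by
  classical
  induction s using Finset.induction_on with
  | empty => simpa using vanishBelow_one hr0
  | insert i s hi ih =>
    rw [Finset.prod_insert hi, Finset.sum_insert hi]
    exact (h i (Finset.mem_insert_self _ _)).mul hr
      (ih fun j hj => h j (Finset.mem_insert_of_mem hj))

lemma vanishBelow_X (s : σ) :
    VanishBelow r (r (Finsupp.single s 1)) (MvPowerSeries.X s : MvPowerSeries σ ℝ) := by
  classical
  intro γ hγ
  rw [MvPowerSeries.coeff_X, if_neg]
  rintro rfl
  exact lt_irrefl _ hγ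

end PowerSeries

/-! ### Choice by recursion along a natural weight -/

/-- Choice where the condition on the value at β refers to the whole function but depends only on
its values at smaller weight. -/
theorem exists_rec_choice {ι Y : Type*} [Inhabited Y] (w : ι → ℕ) (Good : ι → (ι → Y) → Y → Prop)
    (hdep : ∀ β f g y, (∀ γ, w γ < w β → f γ = g γ) → Good β f y → Good β g y)
    (hex : ∀ β f, (∀ γ, w γ < w β → Good γ f (f γ)) → ∃ y, Good β f y) :
    ∃ f : ι → Y, ∀ β, Good β f (f β) := by
  classical
  -- Values at indices not yet available are filled with a default; by `hdep` they do not influence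
  -- the condition.
  let step : ∀ β, (∀ γ, w γ < w β → Y) → Y := fun β ih =>
    if h : ∃ y, Good β (fun γ => if hγ : w γ < w β then ih γ hγ else default) y then h.choose
    else default
  let f : ι → Y := (InvImage.wf w Nat.lt_wfRel.wf).fix step
  have hf : ∀ β, f β = step β fun γ _ => f γ := fun β => WellFounded.fix_eq _ _ _
  refine ⟨f, fun β => ?_⟩
  induction hN : w β using Nat.strong_induction_on generalizing β with
  | _ N ih =>
    have h1 : ∀ γ, w γ < w β → Good γ f (f γ) := fun γ hγ => ih (w γ) (hN ▸ hγ) γ rfl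
    obtain ⟨y, hy⟩ := hex β f h1
    have h2 : ∃ y, Good β (fun γ => if _ : w γ < w β then f γ else default) y :=
      ⟨y, hdep β f _ y (fun γ hγ => by simp [hγ]) hy⟩
    have h3 : f β = h2.choose := by
      rw [hf β]
      exact dif_pos h2
    rw [h3]
    exact hdep β _ f _ (fun γ hγ => by simp [hγ]) h2.choose_spec

/-! ### Existence of the coefficients of the formal solution -/

section FormalCoeff

variable {m n : ℕ} {t₀ a : ℝ} {K : Set (Ici t₀ → ℝ)} {ϱ : Fin m → ℝ} {k : ℕ}
  {F : Fin m → ℝ → (Fin n → ℝ) → Fin n → ℝ} {φ₀ : ℝ → Fin n → ℝ} {φ ψ : Mon m → ℝ → Fin n → ℝ}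

/-- The weight `∑ (r + 1) β_{lr}`, along which the coefficients are found. -/
def monWeight (β : Mon m) : ℕ := β.sum fun x b => (x.2 + 1) * b

lemma monWeight_add (β γ : Mon m) : monWeight (β + γ) = monWeight β + monWeight γ :=
  Finsupp.sum_add_index' (by simp) (fun x b c => by ring)

lemma monWeight_single (x : Fin m × ℕ) (b : ℕ) :
    monWeight (Finsupp.single x b) = (x.2 + 1) * b := Finsupp.sum_single_index (by simp)

lemma monWeight_mono {β γ : Mon m} (h : γ ≤ β) : monWeight γ ≤ monWeight β := by
  obtain ⟨η, rfl⟩ := exists_add_of_le h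
  rw [monWeight_add]
  exact Nat.le_add_right _ _

/-- The monomial from which `β` results by differentiation of one factor, which becomes `x`. -/
noncomputable def dropOne (β : Mon m) (x : Fin m × ℕ) : Mon m :=
  β - Finsupp.single x 1 + Finsupp.single (x.1, x.2 - 1) 1

lemma dropOne_ne_zero (β : Mon m) (x : Fin m × ℕ) : dropOne β x ≠ 0 := by
  intro h
  have := DFunLike.congr_fun h (x.1, x.2 - 1)
  simp [dropOne] at this

/-- Counting r + 1 for each factor makes the weight drop both when a differentiation is undone and
when the factor ε_l in front of F_l is split off (`monWeight_snd_lt`). Both parts of g_β thus refer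
only to coefficients of smaller weight, and the weight, unlike the rank, is a natural number. -/
lemma monWeight_dropOne {β : Mon m} {x : Fin m × ℕ} (hx : x ∈ β.support) (hx0 : x.2 ≠ 0) :
    monWeight (dropOne β x) < monWeight β := by
  have h1 : monWeight (β - Finsupp.single x 1) + monWeight (Finsupp.single x 1) = monWeight β := by
    rw [← monWeight_add, tsub_add_cancel_of_le (single_le_of_mem_support hx)]
  rw [dropOne, monWeight_add, ← h1, monWeight_single, monWeight_single]
  simp only
  omega

lemma rank_dropOne {β : Mon m} {x : Fin m × ℕ} (hx : x ∈ β.support) (hx0 : x.2 ≠ 0) :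
    rank ϱ (dropOne β x) + 1 = rank ϱ β := by
  have h1 : rank ϱ (β - Finsupp.single x 1) + rank ϱ (Finsupp.single x 1) = rank ϱ β := by
    rw [← rank_add, tsub_add_cancel_of_le (single_le_of_mem_support hx)]
  rw [dropOne, rank_add, ← h1, rank_single, rank_single]
  push_cast [Nat.one_le_iff_ne_zero.2 hx0]
  ring

lemma derivCoeff_eq (β : Mon m) (t : ℝ) : derivCoeff φ β t =
    ∑ x ∈ β.support, if x.2 = 0 then 0 else
      ((β (x.1, x.2 - 1) : ℝ) + 1) • φ (dropOne β x) t := rfl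

lemma derivCoeff_congr {β : Mon m} (h : ∀ γ, monWeight γ < monWeight β → φ γ = ψ γ) (t : ℝ) :
    derivCoeff φ β t = derivCoeff ψ β t := by
  rw [derivCoeff_eq, derivCoeff_eq]
  refine Finset.sum_congr rfl fun x hx => ?_
  by_cases hx0 : x.2 = 0
  · simp [hx0]
  · rw [if_neg hx0, if_neg hx0, h _ (monWeight_dropOne hx hx0)]

lemma coeff_formalDelta (t : ℝ) (j : Fin n) (γ : Mon m) :
    MvPowerSeries.coeff γ (formalDelta φ t j) = if γ = 0 then 0 else φ γ t j := rfl

lemma monWeight_snd_lt {β : Mon m} {l : Fin m} {p : Mon m × Mon m} (hp : p.1 + p.2 = β)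
    (h : p.1 = Finsupp.single (l, 0) 1) : monWeight p.2 < monWeight β := by
  rw [← hp, monWeight_add, h, monWeight_single]
  omega

lemma nonlinCoeff_congr {β : Mon m} (h : ∀ γ, monWeight γ < monWeight β → φ γ = ψ γ) (t : ℝ) :
    nonlinCoeff a F φ₀ φ β t = nonlinCoeff a F φ₀ ψ β t := by
  classical
  refine Finset.sum_congr rfl fun l _ => Finset.sum_congr rfl fun P _ => ?_
  congr 2
  rw [MvPowerSeries.coeff_mul, MvPowerSeries.coeff_mul]
  refine Finset.sum_congr rfl fun p hp => ?_
  rw [Finset.HasAntidiagonal.mem_antidiagonal] at hp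
  rw [MvPowerSeries.coeff_X]
  by_cases hp1 : p.1 = Finsupp.single (l, 0) 1
  · have hD : ∀ β' γ : Mon m, γ ≤ β' → monWeight β' < monWeight β → monWeight γ < monWeight β :=
      fun β' γ hle hlt => (monWeight_mono hle).trans_lt hlt
    congr 1
    refine AgreeOn.prod hD _ (fun j _ => AgreeOn.pow hD (fun γ hγ => ?_) _) _
      (monWeight_snd_lt hp hp1)
    rw [coeff_formalDelta, coeff_formalDelta, h γ hγ]
  · rw [if_neg hp1, zero_mul, zero_mul]

lemma vanishBelow_formalDelta [NeZero m] (hϱ : ∀ l, 0 < ϱ l) (hmono : Monotone ϱ) (t : ℝ)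
    (j : Fin n) : VanishBelow (rank ϱ) (ϱ 0) (formalDelta φ t j) := by
  intro γ hγ
  rw [coeff_formalDelta, if_pos]
  by_contra h
  exact absurd (le_rank_of_ne_zero hϱ hmono h) (not_le.2 hγ)

/-- The series δ starts at rank ϱ₁, so ε_l δ^P starts at ϱ_l + |P| ϱ₁. For monomials of rank at most
ρ_k only orders up to q_l = [(ρ_k - ϱ_l)/ϱ₁] survive. -/
lemma coeff_eq_zero_of_rank [NeZero m] (hϱ : ∀ l, 0 < ϱ l) (hmono : Monotone ϱ) {t : ℝ} {l : Fin m}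
    {P : Fin n → ℕ} {β : Mon m} (h : rank ϱ β < ϱ l + (∑ j, P j : ℕ) * ϱ 0) :
    MvPowerSeries.coeff β (MvPowerSeries.X (l, 0) * ∏ j, formalDelta φ t j ^ P j) = 0 := by
  have h1 := (vanishBelow_X (r := rank ϱ) (l, 0)).mul rank_add
    (VanishBelow.prod rank_add (rank_nonneg hϱ) Finset.univ fun j _ =>
      (vanishBelow_formalDelta (φ := φ) hϱ hmono t j).pow rank_add (rank_nonneg hϱ) (P j))
  refine h1 β ?_
  rw [rank_single, ← Finset.sum_mul]
  push_cast at h ⊢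
  simpa using h

/-- The same count by total degree: δ starts at degree 1 and ε_l adds one more. It shows that the
finite range of summation in `nonlinCoeff` is no restriction. -/
lemma coeff_eq_zero_of_degree {t : ℝ} {l : Fin m} {P : Fin n → ℕ} {β : Mon m}
    (h : β.degree ≤ ∑ j, P j) :
    MvPowerSeries.coeff β (MvPowerSeries.X (l, 0) * ∏ j, formalDelta φ t j ^ P j) = 0 := by
  have hadd : ∀ β γ : Mon m, ((β + γ).degree : ℝ) = β.degree + γ.degree := fun β γ => by
    rw [map_add]
    push_cast
    rfl
  have h0 : ∀ β : Mon m, (0 : ℝ) ≤ β.degree := fun β => Nat.cast_nonneg _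
  have hδ : ∀ j, VanishBelow (fun β : Mon m => (β.degree : ℝ)) 1 (formalDelta φ t j) := by
    intro j γ hγ
    rw [coeff_formalDelta, if_pos]
    rw [← Finsupp.degree_eq_zero_iff]
    simp only at hγ
    exact Nat.lt_one_iff.1 (by exact_mod_cast hγ)
  have h1 := (vanishBelow_X (r := fun β : Mon m => (β.degree : ℝ)) (l, 0)).mul hadd
    (VanishBelow.prod hadd h0 Finset.univ fun j _ => (hδ j).pow hadd h0 (P j))
  refine h1 β ?_
  rw [Finsupp.degree_single]
  have h2 : (β.degree : ℝ) ≤ (∑ j, P j : ℕ) := by exact_mod_cast h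
  push_cast at h2 ⊢
  simp only [mul_one]
  linarith

lemma coeff_mem_classAlg {Ω : Set ℂ} (hK : IsClassK1 Ω K) (hϱ : ∀ l, 0 < ϱ l) {β : Mon m}
    (hβ : rank ϱ β ≤ rho ϱ k) (hφ : ∀ γ : Mon m, γ ≠ 0 → rank ϱ γ ≤ rho ϱ k →
      monWeight γ < monWeight β → ∀ i, InClass K fun t => φ γ t i) (l : Fin m) (P : Fin n → ℕ) :
    (fun t => MvPowerSeries.coeff β (MvPowerSeries.X (l, 0) * ∏ j, formalDelta φ t j ^ P j)) ∈
      classAlg hK := by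
  classical
  have hD : ∀ β' γ : Mon m, γ ≤ β' → (rank ϱ β' ≤ rho ϱ k ∧ monWeight β' < monWeight β) →
      (rank ϱ γ ≤ rho ϱ k ∧ monWeight γ < monWeight β) := fun β' γ hle h =>
    ⟨(rank_mono hϱ hle).trans h.1, (monWeight_mono hle).trans_lt h.2⟩
  have h1 : CoeffIn (classAlg hK) (fun γ : Mon m => rank ϱ γ ≤ rho ϱ k ∧ monWeight γ < monWeight β)
      (fun t => ∏ j, formalDelta φ t j ^ P j) := by
    refine CoeffIn.prod hD _ fun j _ => CoeffIn.pow hD (fun γ hγ => ?_) _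
    simp only [coeff_formalDelta]
    by_cases hγ0 : γ = 0
    · simp only [hγ0, if_true]
      exact (classAlg hK).zero_mem
    · simp only [hγ0, if_false]
      exact mem_classAlg_of_inClass hK (hφ γ hγ0 hγ.1 hγ.2 j)
  have h2 : (fun t => MvPowerSeries.coeff β
      (MvPowerSeries.X (l, 0) * ∏ j, formalDelta φ t j ^ P j)) =
      ∑ p ∈ Finset.HasAntidiagonal.antidiagonal β, fun t => (if p.1 = Finsupp.single (l, 0) 1 then (1 : ℝ) else 0) *
        MvPowerSeries.coeff p.2 (∏ j, formalDelta φ t j ^ P j) := by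
    ext t
    rw [MvPowerSeries.coeff_mul]
    simp only [MvPowerSeries.coeff_X, Finset.sum_apply]
  rw [h2]
  refine Subalgebra.sum_mem _ fun p hp => ?_
  rw [Finset.HasAntidiagonal.mem_antidiagonal] at hp
  by_cases hp1 : p.1 = Finsupp.single (l, 0) 1
  · simp only [hp1, if_true, one_mul]
    exact h1 p.2 ⟨(rank_mono hϱ (hp ▸ le_add_self)).trans hβ, monWeight_snd_lt hp hp1⟩
  · simp only [hp1, if_false, zero_mul]
    exact (classAlg hK).zero_mem

lemma inClass_nonlinCoeff [NeZero m] {Ω : Set ℂ} (hK : IsClassK1 Ω K) (hϱ : ∀ l, 0 < ϱ l)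
    (hmono : Monotone ϱ)
    (hFK : ∀ l, ϱ l ≤ rho ϱ k →
      ∀ P : Fin n → ℕ, ∑ j, P j ≤ ⌊(rho ϱ k - ϱ l) / ϱ 0⌋₊ →
      ∀ i, InClass K (fun t => mpd (Metric.closedBall (φ₀ t) a) P (F l t) (φ₀ t) i)) {β : Mon m}
    (hβ : rank ϱ β ≤ rho ϱ k) (hφ : ∀ γ : Mon m, γ ≠ 0 → rank ϱ γ ≤ rho ϱ k →
      monWeight γ < monWeight β → ∀ i, InClass K fun t => φ γ t i) (i : Fin n) :
    InClass K fun t => nonlinCoeff a F φ₀ φ β t i := by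
  simp only [nonlinCoeff, Finset.sum_apply, Pi.smul_apply, smul_eq_mul]
  refine hK.sum _ fun l _ => hK.sum _ fun P _ => ?_
  -- Either the order of the derivative is at most q_l, so that its values along φ₀ belong to the
  -- class, or the coefficient in front of it vanishes by its rank.
  by_cases h : ϱ l + (∑ j, P j : ℕ) * ϱ 0 ≤ rho ϱ k
  · have h0 := hϱ 0
    have h1 : (0 : ℝ) ≤ (∑ j, P j : ℕ) * ϱ 0 := by positivity
    refine inClass_mul_of_mem_classAlg hK (g := fun t => _ * _) ?_ (hFK l (by linarith) P ?_ i)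
    · exact (classAlg hK).smul_mem (coeff_mem_classAlg hK hϱ hβ hφ l P) _
    · refine Nat.le_floor ?_
      rw [le_div_iff₀ h0]
      linarith
  · have : ∀ t, MvPowerSeries.coeff β
        (MvPowerSeries.X (l, 0) * ∏ j, formalDelta φ t j ^ P j) = 0 := fun t =>
      coeff_eq_zero_of_rank hϱ hmono (hβ.trans_lt (not_le.1 h))
    simp only [this, mul_zero, zero_mul]
    exact hK.zero

lemma inClass_derivCoeff {Ω : Set ℂ} (hK : IsClassK1 Ω K) {β : Mon m}
    (hβ : rank ϱ β ≤ rho ϱ k) (hφ : ∀ γ : Mon m, γ ≠ 0 → rank ϱ γ ≤ rho ϱ k →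
      monWeight γ < monWeight β → ∀ i, InClass K fun t => φ γ t i) (i : Fin n) :
    InClass K fun t => derivCoeff φ β t i := by
  simp only [derivCoeff_eq, Finset.sum_apply]
  refine hK.sum _ fun x hx => ?_
  by_cases hx0 : x.2 = 0
  · simp only [hx0, if_true, Pi.zero_apply]
    exact hK.zero
  · simp only [hx0, if_false, Pi.smul_apply, smul_eq_mul]
    refine hK.const_mul _ (hφ _ (dropOne_ne_zero β x) ?_ (monWeight_dropOne hx hx0) i)
    have := rank_dropOne (ϱ := ϱ) hx hx0
    linarith

theorem exists_isFormalCoeff [NeZero m] {A : Matrix (Fin n) (Fin n) ℝ} {lam : Fin n → ℂ}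
    {V V' : Matrix (Fin n) (Fin n) ℂ} {σ : Equiv.Perm (Fin n)} (hV : IsEigenFrame A lam V V' σ)
    (hK : IsClassK1 (range lam) K) (hϱ : ∀ l, 0 < ϱ l) (hmono : Monotone ϱ)
    (hFK : ∀ l, ϱ l ≤ rho ϱ k →
      ∀ P : Fin n → ℕ, ∑ j, P j ≤ ⌊(rho ϱ k - ϱ l) / ϱ 0⌋₊ →
      ∀ i, InClass K (fun t => mpd (Metric.closedBall (φ₀ t) a) P (F l t) (φ₀ t) i)) :
    ∃ φ : Mon m → ℝ → Fin n → ℝ, IsFormalCoeff a K ϱ A F φ₀ k φ := by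
  refine exists_rec_choice monWeight
    (fun β φ y => β ≠ 0 → rank ϱ β ≤ rho ϱ k →
      (∀ i, InClass K (fun t => y t i)) ∧ ContDiffOn ℝ 1 y (Ici t₀) ∧
      ∀ t ∈ Ici t₀, HasDerivWithinAt y
        (A.mulVec (y t) + (nonlinCoeff a F φ₀ φ β t - derivCoeff φ β t)) (Ici t₀) t) ?_ ?_
  · intro β φ ψ y h hy hβ0 hβ
    obtain ⟨h1, h2, h3⟩ := hy hβ0 hβ
    refine ⟨h1, h2, fun t ht => ?_⟩
    rw [← nonlinCoeff_congr h, ← derivCoeff_congr h]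
    exact h3 t ht
  · intro β φ hφ
    by_cases hβ : rank ϱ β ≤ rho ϱ k
    · have hφ' : ∀ γ : Mon m, γ ≠ 0 → rank ϱ γ ≤ rho ϱ k →
          monWeight γ < monWeight β → ∀ i, InClass K fun t => φ γ t i := fun γ hγ0 hγ hw =>
        (hφ γ hw hγ0 hγ).1
      obtain ⟨y, hy⟩ := exists_solution_inClass hV hK
        (g := fun t => nonlinCoeff a F φ₀ φ β t - derivCoeff φ β t) fun i =>
          hK.sub (inClass_nonlinCoeff hK hϱ hmono hFK hβ hφ' i) (inClass_derivCoeff hK hβ hφ' i)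
      exact ⟨y, fun _ _ => hy⟩
    -- Above rank ρ_k nothing is required of the coefficient.
    · exact ⟨fun _ => 0, fun _ h => absurd h hβ⟩

end FormalCoeff


/-! ### Products with bounded factors -/

lemma isBigO_one_mul {f g h : ℝ → ℝ} (hf : f =O[atTop] fun _ => (1 : ℝ)) (hg : g =O[atTop] h) :
    (fun t => f t * g t) =O[atTop] h := (hf.mul hg).congr_right fun _ => one_mul _

lemma isBigO_mul_one {f g h : ℝ → ℝ} (hf : f =O[atTop] h) (hg : g =O[atTop] fun _ => (1 : ℝ)) :
    (fun t => f t * g t) =O[atTop] h := (hf.mul hg).congr_right fun _ => mul_one _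

/-! ### The truncated sum -/

section TruncSum

variable {m n : ℕ} [NeZero m] {t₀ a : ℝ} {ε : Fin m → ℝ → ℝ} {ϱ : Fin m → ℝ} {k : ℕ}
  {F : Fin m → ℝ → (Fin n → ℝ) → Fin n → ℝ} {φ₀ : ℝ → Fin n → ℝ} {φ : Mon m → ℝ → Fin n → ℝ}

/-- The monomials of rank at most `ρ_k`, with the trivial one. -/
noncomputable def IsSmallParam.low (h : IsSmallParam t₀ ε ϱ k) : Finset (Mon m) :=
  (finite_rank_le h.pos h.mono (rho ϱ k)).toFinset

lemma IsSmallParam.mem_low (h : IsSmallParam t₀ ε ϱ k) {β : Mon m} :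
    β ∈ h.low ↔ rank ϱ β ≤ rho ϱ k := by
  rw [IsSmallParam.low, Set.Finite.mem_toFinset, mem_ofPred_eq]

/-- The coefficients `φ_β`, with `0` for the trivial monomial. -/
noncomputable def coefVec (φ : Mon m → ℝ → Fin n → ℝ) (β : Mon m) (t : ℝ) : Fin n → ℝ :=
  if β = 0 then 0 else φ β t

omit [NeZero m] in
lemma coeff_formalDelta' (t : ℝ) (j : Fin n) (β : Mon m) :
    MvPowerSeries.coeff β (formalDelta φ t j) = coefVec φ β t j := by
  rw [coeff_formalDelta, coefVec]
  split_ifs <;> rfl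

/-- The difference of the truncated sum and `φ₀`. -/
noncomputable def IsSmallParam.delta (h : IsSmallParam t₀ ε ϱ k) (φ : Mon m → ℝ → Fin n → ℝ)
    (t : ℝ) : Fin n → ℝ := ∑ β ∈ h.low, nu t₀ ε β t • coefVec φ β t

/-- The levels ρ_1, …, ρ_k exhaust the nontrivial monomials of rank at most ρ_k. The trivial
monomial may be included because `coefVec` is 0 there. -/
lemma IsSmallParam.truncSum_eq (h : IsSmallParam t₀ ε ϱ k) (t : ℝ) :
    truncSum t₀ ε ϱ φ₀ k φ t = φ₀ t + h.delta φ t := by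
  classical
  have hfin : ∀ s, {β : Mon m | rank ϱ β = rho ϱ s}.Finite := fun s =>
    (finite_rank_le h.pos h.mono (rho ϱ s)).subset fun β hβ => le_of_eq hβ
  have hinj := (rho_strictMono h.pos h.mono).injective
  rw [truncSum, IsSmallParam.delta]
  congr 1
  have h1 : ∀ s, ∑ᶠ β ∈ {β : Mon m | rank ϱ β = rho ϱ s}, nu t₀ ε β t • φ β t =
      ∑ β ∈ (hfin s).toFinset, nu t₀ ε β t • φ β t := fun s =>
    finsum_mem_eq_finite_toFinset_sum _ (hfin s)
  rw [Finset.sum_congr rfl fun s _ => h1 s, ← Finset.sum_biUnion fun s _ s' _ hss => by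
    rw [Function.onFun, Finset.disjoint_left]
    intro β hβ hβ'
    rw [Set.Finite.mem_toFinset, mem_ofPred_eq] at hβ hβ'
    exact hss (hinj (hβ.symm.trans hβ'))]
  have h2 : ∀ β ∈ h.low, β ∉ (Finset.Icc 1 k).biUnion (fun s => (hfin s).toFinset) →
      nu t₀ ε β t • coefVec φ β t = 0 := by
    intro β hβ hβ'
    by_cases hβ0 : β = 0
    · rw [coefVec, if_pos hβ0, smul_zero]
    · exfalso
      obtain ⟨s, hs, e⟩ := exists_rank_eq_rho h.pos h.mono hβ0 (h.mem_low.1 hβ)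
      exact hβ' (Finset.mem_biUnion.2 ⟨s, hs, (hfin s).mem_toFinset.2 e⟩)
  have h3 : (Finset.Icc 1 k).biUnion (fun s => (hfin s).toFinset) ⊆ h.low := by
    intro β hβ
    obtain ⟨s, hs, e⟩ := Finset.mem_biUnion.1 hβ
    rw [Set.Finite.mem_toFinset, mem_ofPred_eq] at e
    rw [h.mem_low, e]
    exact (rho_strictMono h.pos h.mono).monotone (Finset.mem_Icc.1 hs).2
  rw [← Finset.sum_subset h3 h2]
  refine Finset.sum_congr rfl fun β hβ => ?_
  obtain ⟨s, hs, e⟩ := Finset.mem_biUnion.1 hβ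
  rw [Set.Finite.mem_toFinset, mem_ofPred_eq] at e
  have hβ0 : β ≠ 0 := by
    rintro rfl
    rw [rank_zero] at e
    have := rho_pos h.pos h.mono (Finset.mem_Icc.1 hs).1
    linarith
  rw [coefVec, if_neg hβ0]

lemma IsSmallParam.nu_isBigO_of_not_low (h : IsSmallParam t₀ ε ϱ k) {β : Mon m}
    (hβ : IsCovered ϱ k β) (hlow : β ∉ h.low) :
    nu t₀ ε β =O[atTop] fun t => ε 0 t ^ (rho ϱ (k + 1) / ϱ 0) := by
  rw [h.mem_low, not_le] at hlow
  exact (h.nu_isBigO hβ).trans (h.isBigO_rpow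
    (div_le_div_of_nonneg_right (rho_succ_le_rank h.pos h.mono hlow) (h.pos 0).le))

lemma IsSmallParam.nu_isBigO_one (h : IsSmallParam t₀ ε ϱ k) {β : Mon m}
    (hβ : IsCovered ϱ k β) : nu t₀ ε β =O[atTop] fun _ => (1 : ℝ) :=
  (h.nu_isBigO hβ).trans (h.isBigO_one (div_nonneg (rank_nonneg h.pos β) (h.pos 0).le))

lemma IsSmallParam.isCovered_low (h : IsSmallParam t₀ ε ϱ k) {β : Mon m} (hβ : β ∈ h.low) :
    IsCovered ϱ k β := isCovered_of_rank_le h.pos (h.mem_low.1 hβ)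

/-! #### Asymptotic expansions of products -/

/-- The function `g` is, up to `O(ε₁^{ρ_{k+1}/ϱ₁})`, the sum of the monomials of rank at most `ρ_k`
with the coefficients of the power series `b`, which are bounded. -/
def IsSmallParam.HasExpansion (h : IsSmallParam t₀ ε ϱ k) (g : ℝ → ℝ)
    (b : ℝ → MvPowerSeries (Fin m × ℕ) ℝ) : Prop :=
  (∀ β ∈ h.low, (fun t => MvPowerSeries.coeff β (b t)) =O[atTop] fun _ => (1 : ℝ)) ∧
  (fun t => g t - ∑ β ∈ h.low, nu t₀ ε β t * MvPowerSeries.coeff β (b t)) =O[atTop]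
    fun t => ε 0 t ^ (rho ϱ (k + 1) / ϱ 0)

variable {h : IsSmallParam t₀ ε ϱ k}

lemma IsSmallParam.rho_div_nonneg (h : IsSmallParam t₀ ε ϱ k) : 0 ≤ rho ϱ (k + 1) / ϱ 0 :=
  div_nonneg (rho_pos h.pos h.mono (Nat.succ_le_succ (Nat.zero_le k))).le (h.pos 0).le

lemma IsSmallParam.HasExpansion.sum_isBigO_one {g : ℝ → ℝ}
    {b : ℝ → MvPowerSeries (Fin m × ℕ) ℝ} (hg : h.HasExpansion g b) :
    (fun t => ∑ β ∈ h.low, nu t₀ ε β t * MvPowerSeries.coeff β (b t)) =O[atTop]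
      fun _ => (1 : ℝ) :=
  Asymptotics.IsBigO.fun_sum fun β hβ =>
    isBigO_one_mul (h.nu_isBigO_one (h.isCovered_low hβ)) (hg.1 β hβ)

lemma IsSmallParam.HasExpansion.isBigO_one {g : ℝ → ℝ}
    {b : ℝ → MvPowerSeries (Fin m × ℕ) ℝ} (hg : h.HasExpansion g b) :
    g =O[atTop] fun _ => (1 : ℝ) := by
  have := (hg.2.trans (h.isBigO_one h.rho_div_nonneg)).add hg.sum_isBigO_one
  simpa using this

/-- The product of two truncated expansions differs from the truncation of the product only by
monomials of rank above ρ_k. Nothing is missing from the truncation, because the factors of a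
monomial of rank at most ρ_k have rank at most ρ_k. -/
lemma IsSmallParam.HasExpansion.mul {g g' : ℝ → ℝ} {b b' : ℝ → MvPowerSeries (Fin m × ℕ) ℝ}
    (hg : h.HasExpansion g b) (hg' : h.HasExpansion g' b') :
    h.HasExpansion (fun t => g t * g' t) fun t => b t * b' t := by
  classical
  have hdown : ∀ {β γ : Mon m}, β + γ ∈ h.low → β ∈ h.low ∧ γ ∈ h.low := fun {β γ} hβγ => by
    rw [h.mem_low] at hβγ
    exact ⟨h.mem_low.2 ((rank_mono h.pos le_self_add).trans hβγ),
      h.mem_low.2 ((rank_mono h.pos le_add_self).trans hβγ)⟩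
  refine ⟨fun β hβ => ?_, ?_⟩
  · simp only [MvPowerSeries.coeff_mul]
    refine Asymptotics.IsBigO.fun_sum fun p hp => ?_
    rw [Finset.HasAntidiagonal.mem_antidiagonal] at hp
    have := hdown (hp ▸ hβ)
    exact isBigO_one_mul (hg.1 p.1 this.1) (hg'.1 p.2 this.2)
  · set S := fun t => ∑ β ∈ h.low, nu t₀ ε β t * MvPowerSeries.coeff β (b t) with hS
    set S' := fun t => ∑ β ∈ h.low, nu t₀ ε β t * MvPowerSeries.coeff β (b' t) with hS'
    have h1 : (fun t => g t * (g' t - S' t)) =O[atTop] fun t => ε 0 t ^ (rho ϱ (k + 1) / ϱ 0) := 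
      isBigO_one_mul hg.isBigO_one hg'.2
    have h2 : (fun t => (g t - S t) * S' t) =O[atTop] fun t => ε 0 t ^ (rho ϱ (k + 1) / ϱ 0) := 
      isBigO_mul_one hg.2 hg'.sum_isBigO_one
    -- The cross terms that the truncation discards; by the gap between ranks they are of order
    -- ε₁^(ρ_{k+1}/ϱ₁).
    have h3 : (fun t => ∑ p ∈ (h.low ×ˢ h.low).filter (fun p => p.1 + p.2 ∉ h.low),
        nu t₀ ε (p.1 + p.2) t * (MvPowerSeries.coeff p.1 (b t) * MvPowerSeries.coeff p.2 (b' t)))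
        =O[atTop] fun t => ε 0 t ^ (rho ϱ (k + 1) / ϱ 0) := by
      refine Asymptotics.IsBigO.fun_sum fun p hp => ?_
      rw [Finset.mem_filter, Finset.mem_product] at hp
      have e1 := h.nu_isBigO_of_not_low ((h.isCovered_low hp.1.1).add (h.isCovered_low hp.1.2)) hp.2
      exact isBigO_mul_one e1 (isBigO_one_mul (hg.1 p.1 hp.1.1) (hg'.1 p.2 hp.1.2))
    refine ((h1.add h2).add h3).congr_left fun t => ?_
    have h4 : S t * S' t = ∑ p ∈ h.low ×ˢ h.low,
        nu t₀ ε (p.1 + p.2) t * (MvPowerSeries.coeff p.1 (b t) * MvPowerSeries.coeff p.2 (b' t)) := by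
      rw [hS, hS', Finset.sum_mul_sum, ← Finset.sum_product']
      refine Finset.sum_congr rfl fun p _ => ?_
      rw [nu_add]
      ring
    have h5 : ∑ p ∈ (h.low ×ˢ h.low).filter (fun p => p.1 + p.2 ∈ h.low),
        nu t₀ ε (p.1 + p.2) t * (MvPowerSeries.coeff p.1 (b t) * MvPowerSeries.coeff p.2 (b' t)) =
        ∑ β ∈ h.low, nu t₀ ε β t * MvPowerSeries.coeff β (b t * b' t) := by
      rw [← Finset.sum_fiberwise_of_maps_to (g := fun p : Mon m × Mon m => p.1 + p.2) (t := h.low)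
        fun p hp => (Finset.mem_filter.1 hp).2]
      refine Finset.sum_congr rfl fun β hβ => ?_
      rw [MvPowerSeries.coeff_mul, Finset.mul_sum]
      refine Finset.sum_congr ?_ fun p hp => ?_
      · ext p
        rw [Finset.mem_filter, Finset.mem_filter, Finset.mem_product,
          Finset.HasAntidiagonal.mem_antidiagonal]
        constructor
        · exact fun hp => hp.2
        · intro hp
          have hp' : p.1 + p.2 ∈ h.low := hp ▸ hβ
          exact ⟨⟨hdown hp', hp'⟩, hp⟩
      · rw [Finset.HasAntidiagonal.mem_antidiagonal] at hp
        rw [hp]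
    have h6 := Finset.sum_filter_add_sum_filter_not (h.low ×ˢ h.low) (fun p => p.1 + p.2 ∈ h.low)
      fun p => nu t₀ ε (p.1 + p.2) t *
        (MvPowerSeries.coeff p.1 (b t) * MvPowerSeries.coeff p.2 (b' t))
    rw [h5, ← h4] at h6
    linear_combination h6

lemma IsSmallParam.hasExpansion_one : h.HasExpansion (fun _ => 1) fun _ => 1 := by
  classical
  refine ⟨fun β _ => Asymptotics.isBigO_const_const _ one_ne_zero _, ?_⟩
  have h0 : (0 : Mon m) ∈ h.low := by
    rw [h.mem_low, rank_zero]
    exact (rho_pos h.pos h.mono h.one_le).le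
  have : (fun t : ℝ => (1 : ℝ) - ∑ β ∈ h.low, nu t₀ ε β t *
      MvPowerSeries.coeff β (1 : MvPowerSeries (Fin m × ℕ) ℝ)) = fun _ => 0 := by
    ext t
    rw [Finset.sum_eq_single_of_mem 0 h0 fun β _ hβ => by
      rw [MvPowerSeries.coeff_one, if_neg hβ, mul_zero], nu_zero, MvPowerSeries.coeff_one,
      if_pos rfl]
    ring
  rw [this]
  exact Asymptotics.isBigO_zero _ _

lemma IsSmallParam.HasExpansion.pow {g : ℝ → ℝ} {b : ℝ → MvPowerSeries (Fin m × ℕ) ℝ}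
    (hg : h.HasExpansion g b) (q : ℕ) : h.HasExpansion (fun t => g t ^ q) fun t => b t ^ q := by
  induction q with
  | zero => simpa only [pow_zero] using IsSmallParam.hasExpansion_one
  | succ q ih =>
    simp only [pow_succ]
    exact ih.mul hg

lemma IsSmallParam.HasExpansion.prod {ι : Type*} (s : Finset ι) {g : ι → ℝ → ℝ}
    {b : ι → ℝ → MvPowerSeries (Fin m × ℕ) ℝ} (hg : ∀ i ∈ s, h.HasExpansion (g i) (b i)) :
    h.HasExpansion (fun t => ∏ i ∈ s, g i t) fun t => ∏ i ∈ s, b i t := by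
  classical
  induction s using Finset.induction_on with
  | empty => simpa only [Finset.prod_empty] using IsSmallParam.hasExpansion_one
  | insert i s hi ih =>
    simp only [Finset.prod_insert hi]
    exact (hg i (Finset.mem_insert_self _ _)).mul
      (ih fun j hj => hg j (Finset.mem_insert_of_mem hj))

lemma IsSmallParam.hasExpansion_eps (l : Fin m) :
    h.HasExpansion (ε l) fun _ => MvPowerSeries.X (l, 0) := by
  classical
  refine ⟨fun β _ => Asymptotics.isBigO_const_const _ one_ne_zero _, ?_⟩
  have hnu : ∀ t, nu t₀ ε (Finsupp.single (l, 0) 1) t = ε l t := fun t => by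
    rw [nu_single, pow_one, iteratedDerivWithin_zero]
  by_cases h0 : Finsupp.single (l, 0) 1 ∈ h.low
  · have : (fun t : ℝ => ε l t - ∑ β ∈ h.low, nu t₀ ε β t *
        MvPowerSeries.coeff β (MvPowerSeries.X (l, 0) : MvPowerSeries (Fin m × ℕ) ℝ)) =
        fun _ => 0 := by
      ext t
      rw [Finset.sum_eq_single_of_mem _ h0 fun β _ hβ => by
        rw [MvPowerSeries.coeff_X, if_neg hβ, mul_zero], hnu, MvPowerSeries.coeff_X,
        if_pos rfl]
      ring
    rw [this]
    exact Asymptotics.isBigO_zero _ _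
  -- If ϱ_l > ρ_k, the truncated expansion of ε_l is empty and ε_l itself is an admissible error.
  · refine (h.nu_isBigO_of_not_low (isCovered_single (Nat.zero_le _) 1) h0).congr_left fun t => ?_
    rw [hnu, Finset.sum_eq_zero, sub_zero]
    intro β hβ
    rw [MvPowerSeries.coeff_X, if_neg, mul_zero]
    rintro rfl
    exact h0 hβ

lemma IsSmallParam.hasExpansion_delta (hφ : ∀ β ∈ h.low, ∀ j,
      (fun t => coefVec φ β t j) =O[atTop] fun _ => (1 : ℝ)) (j : Fin n) :
    h.HasExpansion (fun t => h.delta φ t j) fun t => formalDelta φ t j := by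
  refine ⟨fun β hβ => ?_, ?_⟩
  · simp only [coeff_formalDelta']
    exact hφ β hβ j
  · simp only [coeff_formalDelta', IsSmallParam.delta, Finset.sum_apply, Pi.smul_apply,
      smul_eq_mul, sub_self]
    exact Asymptotics.isBigO_zero _ _

lemma IsSmallParam.delta_isBigO (hφ : ∀ β ∈ h.low, ∀ j,
      (fun t => coefVec φ β t j) =O[atTop] fun _ => (1 : ℝ)) :
    (h.delta φ) =O[atTop] (ε 0) := by
  refine Asymptotics.isBigO_pi.2 fun j => ?_
  simp only [IsSmallParam.delta, Finset.sum_apply, Pi.smul_apply, smul_eq_mul]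
  refine Asymptotics.IsBigO.fun_sum fun β hβ => ?_
  by_cases hβ0 : β = 0
  · simp only [hβ0, coefVec, if_true, Pi.zero_apply, mul_zero]
    exact Asymptotics.isBigO_zero _ _
  · have h1 : nu t₀ ε β =O[atTop] fun t => ε 0 t ^ (1 : ℝ) := by
      refine (h.nu_isBigO (h.isCovered_low hβ)).trans (h.isBigO_rpow ?_)
      rw [le_div_iff₀ (h.pos 0), one_mul]
      exact le_rank_of_ne_zero h.pos h.mono hβ0
    simp only [Real.rpow_one] at h1
    exact isBigO_mul_one h1 (hφ β hβ j)

/-! #### The derivative of the truncated sum -/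

omit [NeZero m] in
lemma dropOne_bump {γ : Mon m} {x : Fin m × ℕ} (hx : x ∈ γ.support) :
    dropOne (bump γ x) (x.1, x.2 + 1) = γ := by
  rw [dropOne, bump, add_tsub_cancel_right]
  exact tsub_add_cancel_of_le (single_le_of_mem_support hx)

omit [NeZero m] in
lemma bump_dropOne {β : Mon m} {y : Fin m × ℕ} (hy : y ∈ β.support) (hy0 : y.2 ≠ 0) :
    bump (dropOne β y) (y.1, y.2 - 1) = β := by
  have : ((y.1, y.2 - 1).1, (y.1, y.2 - 1).2 + 1) = y := by
    ext
    · rfl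
    · exact Nat.sub_add_cancel (Nat.one_le_iff_ne_zero.2 hy0)
  rw [bump, this, dropOne, add_tsub_cancel_right]
  exact tsub_add_cancel_of_le (single_le_of_mem_support hy)

/-- The product rule gives a sum over pairs (γ, differentiated factor). Reindexed by the resulting
monomial and its new factor, the pairs whose result has rank at most ρ_k match `derivCoeff` exactly;
the others have rank at least ρ_{k+1}. -/
lemma IsSmallParam.deriv_sum_sub_isBigO (h : IsSmallParam t₀ ε ϱ k) (hφ : ∀ β ∈ h.low, ∀ j,
      (fun t => coefVec φ β t j) =O[atTop] fun _ => (1 : ℝ)) (i : Fin n) :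
    (fun t => ∑ γ ∈ h.low, (∑ x ∈ γ.support, (γ x : ℝ) * nu t₀ ε (bump γ x) t) * coefVec φ γ t i -
      ∑ β ∈ h.low, nu t₀ ε β t * derivCoeff φ β t i) =O[atTop]
      fun t => ε 0 t ^ (rho ϱ (k + 1) / ϱ 0) := by
  classical
  have h1 : (fun t => ∑ p ∈ (h.low.sigma fun γ => γ.support).filter
      (fun p => bump p.1 p.2 ∉ h.low), (p.1 p.2 : ℝ) * nu t₀ ε (bump p.1 p.2) t *
        coefVec φ p.1 t i) =O[atTop] fun t => ε 0 t ^ (rho ϱ (k + 1) / ϱ 0) := by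
    refine Asymptotics.IsBigO.fun_sum fun p hp => ?_
    rw [Finset.mem_filter, Finset.mem_sigma] at hp
    have e1 := h.nu_isBigO_of_not_low (isCovered_bump h.pos (h.mem_low.1 hp.1.1) hp.1.2) hp.2
    exact isBigO_mul_one (e1.const_mul_left (p.1 p.2 : ℝ)) (hφ p.1 hp.1.1 i)
  refine h1.congr_left fun t => ?_
  have h2 : ∑ γ ∈ h.low, (∑ x ∈ γ.support, (γ x : ℝ) * nu t₀ ε (bump γ x) t) * coefVec φ γ t i =
      ∑ p ∈ h.low.sigma fun γ => γ.support, (p.1 p.2 : ℝ) * nu t₀ ε (bump p.1 p.2) t *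
        coefVec φ p.1 t i := by
    rw [Finset.sum_sigma]
    exact Finset.sum_congr rfl fun γ _ => Finset.sum_mul _ _ _
  have h3 : ∑ β ∈ h.low, nu t₀ ε β t * derivCoeff φ β t i =
      ∑ p ∈ (h.low.sigma fun β => β.support).filter (fun p => p.2.2 ≠ 0),
        nu t₀ ε p.1 t * (((p.1 (p.2.1, p.2.2 - 1) : ℝ) + 1) * φ (dropOne p.1 p.2) t i) := by
    rw [Finset.sum_filter, Finset.sum_sigma]
    refine Finset.sum_congr rfl fun β _ => ?_
    rw [derivCoeff_eq, Finset.sum_apply, Finset.mul_sum]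
    refine Finset.sum_congr rfl fun x _ => ?_
    by_cases hx : x.2 = 0
    · simp [hx]
    · simp [hx]
  have h4 : ∑ p ∈ (h.low.sigma fun γ => γ.support).filter (fun p => bump p.1 p.2 ∈ h.low),
      (p.1 p.2 : ℝ) * nu t₀ ε (bump p.1 p.2) t * coefVec φ p.1 t i =
      ∑ p ∈ (h.low.sigma fun β => β.support).filter (fun p => p.2.2 ≠ 0),
        nu t₀ ε p.1 t * (((p.1 (p.2.1, p.2.2 - 1) : ℝ) + 1) * φ (dropOne p.1 p.2) t i) := by
    refine Finset.sum_bij' (fun p _ => ⟨bump p.1 p.2, (p.2.1, p.2.2 + 1)⟩)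
      (fun p _ => ⟨dropOne p.1 p.2, (p.2.1, p.2.2 - 1)⟩) ?_ ?_ ?_ ?_ ?_
    · rintro ⟨γ, x⟩ hp
      rw [Finset.mem_filter, Finset.mem_sigma] at hp ⊢
      refine ⟨⟨hp.2, ?_⟩, Nat.succ_ne_zero _⟩
      simp [bump]
    · rintro ⟨β, y⟩ hp
      rw [Finset.mem_filter, Finset.mem_sigma] at hp
      obtain ⟨⟨hβ, hy⟩, hy0⟩ := hp
      simp only at hβ hy hy0
      rw [Finset.mem_filter, Finset.mem_sigma]
      simp only [bump_dropOne hy hy0]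
      refine ⟨⟨?_, by simp [dropOne]⟩, hβ⟩
      have := rank_dropOne (ϱ := ϱ) hy hy0
      rw [h.mem_low] at hβ ⊢
      linarith
    · rintro ⟨γ, x⟩ hp
      rw [Finset.mem_filter, Finset.mem_sigma] at hp
      simp only [dropOne_bump hp.1.2, Nat.add_sub_cancel]
    · rintro ⟨β, y⟩ hp
      rw [Finset.mem_filter, Finset.mem_sigma] at hp
      simp only [bump_dropOne hp.1.2 hp.2, Nat.sub_add_cancel (Nat.one_le_iff_ne_zero.2 hp.2)]
    · rintro ⟨γ, x⟩ hp
      rw [Finset.mem_filter, Finset.mem_sigma] at hp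
      have hγ0 : γ ≠ 0 := by
        rintro rfl
        simp at hp
      simp only [dropOne_bump hp.1.2, Nat.add_sub_cancel, coefVec, if_neg hγ0]
      -- Differentiation lowers the exponent of x by one, so the factor γ x of the product rule is
      -- the exponent in the resulting monomial plus one, as in `derivCoeff`.
      have h5 : (γ x : ℝ) = (bump γ x x : ℝ) + 1 := by
        have hx : 1 ≤ γ x := Nat.one_le_iff_ne_zero.2 (Finsupp.mem_support_iff.1 hp.1.2)
        have hne : (x.1, x.2 + 1) ≠ x := fun e => by
          have := congrArg Prod.snd e
          simp at this
        have : bump γ x x = γ x - 1 := by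
          simp [bump, hne]
        rw [this, Nat.cast_sub hx]
        simp
      rw [h5]
      ring
  have h6 := Finset.sum_filter_add_sum_filter_not (h.low.sigma fun γ => γ.support)
    (fun p => bump p.1 p.2 ∈ h.low) fun p => (p.1 p.2 : ℝ) * nu t₀ ε (bump p.1 p.2) t *
        coefVec φ p.1 t i
  rw [h2, h3, ← h4, ← h6]
  ring

end TruncSum


/-! ### The residual of the truncated sum -/

section Residual

variable {m n : ℕ} [NeZero m] {t₀ a : ℝ} {ε : Fin m → ℝ → ℝ} {ϱ : Fin m → ℝ} {k : ℕ}
  {F : Fin m → ℝ → (Fin n → ℝ) → Fin n → ℝ} {φ₀ : ℝ → Fin n → ℝ} {φ : Mon m → ℝ → Fin n → ℝ}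

lemma isBigO_one_of_bound {f : ℝ → ℝ} {C T : ℝ} (h : ∀ t ∈ Ici T, |f t| ≤ C) :
    f =O[atTop] fun _ => (1 : ℝ) := by
  refine Asymptotics.IsBigO.of_bound C ?_
  filter_upwards [eventually_ge_atTop T] with t ht
  rw [norm_one, mul_one]
  exact h t ht

lemma IsSmallParam.eps_isBigO (h : IsSmallParam t₀ ε ϱ k) (l : Fin m) :
    (ε l) =O[atTop] fun t => ε 0 t ^ (ϱ l / ϱ 0) := by
  simpa using h.isBigO l 0 (Nat.zero_le _)

lemma IsSmallParam.eps_isBigO_one (h : IsSmallParam t₀ ε ϱ k) (l : Fin m) :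
    (ε l) =O[atTop] fun _ => (1 : ℝ) :=
  (h.eps_isBigO l).trans (h.isBigO_one (div_nonneg (h.pos l).le (h.pos 0).le))

lemma IsSmallParam.eps_isBigO_eps (h : IsSmallParam t₀ ε ϱ k) (l : Fin m) :
    (ε l) =O[atTop] (ε 0) := by
  have h1 := (h.eps_isBigO l).trans (h.isBigO_rpow (b := 1) (c := ϱ l / ϱ 0) (by
    rw [le_div_iff₀ (h.pos 0), one_mul]
    exact h.mono (Fin.zero_le l)))
  simpa using h1

lemma IsSmallParam.continuousOn_eps (h : IsSmallParam t₀ ε ϱ k) (l : Fin m) :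
    ContinuousOn (ε l) (Ici t₀) := (h.smooth l).continuousOn

lemma IsSmallParam.delta_tendsto (h : IsSmallParam t₀ ε ϱ k) (hφ : ∀ β ∈ h.low, ∀ j,
      (fun t => coefVec φ β t j) =O[atTop] fun _ => (1 : ℝ)) :
    Tendsto (h.delta φ) atTop (𝓝 0) := (IsSmallParam.delta_isBigO hφ).trans_tendsto h.tendsto

/-- The Taylor polynomial in `δ` approximates a bounded smooth function up to the power of `ε₁`
given by its order. -/
lemma IsSmallParam.taylor_isBigO (h : IsSmallParam t₀ ε ϱ k) (ha : 0 < a)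
    (hφ : ∀ β ∈ h.low, ∀ j, (fun t => coefVec φ β t j) =O[atTop] fun _ => (1 : ℝ))
    {G : ℝ → (Fin n → ℝ) → Fin n → ℝ} {N : ℕ} (hN : 1 ≤ N)
    (hG : ∀ t ∈ Ici t₀, ContDiffOn ℝ N (G t) (Metric.closedBall (φ₀ t) a)) {C : ℝ} (hC0 : 0 ≤ C)
    (hGC : ∀ P : Fin n → ℕ, ∑ j, P j = N → ∀ t ∈ Ici t₀, ∀ z ∈ Metric.closedBall (φ₀ t) a,
      ‖mpd (Metric.closedBall (φ₀ t) a) P (G t) z‖ ≤ C) (i : Fin n) :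
    (fun t => G t (φ₀ t + h.delta φ t) i - ∑ P ∈ taylorIdx (List.finRange n) N,
      mpow (h.delta φ t) P * mpd (Metric.closedBall (φ₀ t) a) P (G t) (φ₀ t) i) =O[atTop]
      fun t => ε 0 t ^ (N : ℝ) := by
  obtain ⟨c, hc0, hc⟩ := exists_taylor n N hN
  have h1 : (fun t => G t (φ₀ t + h.delta φ t) i - ∑ P ∈ taylorIdx (List.finRange n) N,
      mpow (h.delta φ t) P * mpd (Metric.closedBall (φ₀ t) a) P (G t) (φ₀ t) i) =O[atTop]
      fun t => ‖h.delta φ t‖ ^ N := by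
    refine Asymptotics.IsBigO.of_bound (c * C) ?_
    have hsmall : ∀ᶠ t in atTop, ‖h.delta φ t‖ < a := by
      have := (h.delta_tendsto hφ).norm
      rw [norm_zero] at this
      exact this.eventually (gt_mem_nhds ha)
    filter_upwards [hsmall, eventually_ge_atTop t₀] with t ht1 ht2
    have h2 := hc (φ₀ t) a ha (G t) (hG t ht2) C hC0 (fun P hP z hz => hGC P hP t ht2 z hz)
      (h.delta φ t) ht1.le
    have h3 := (norm_le_pi_norm _ i).trans h2
    rw [Pi.sub_apply, Finset.sum_apply] at h3
    rw [norm_pow, norm_norm]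
    exact h3
  refine h1.trans (((IsSmallParam.delta_isBigO hφ).norm_left.pow N).trans ?_)
  refine Filter.EventuallyEq.isBigO ?_
  filter_upwards [h.eventually_pos] with t ht
  rw [Real.rpow_natCast]

omit [NeZero m] in
lemma mpow_eq (δ : Fin n → ℝ) (P : Fin n → ℕ) :
    mpow δ P = ((∏ j, (P j).factorial : ℕ) : ℝ)⁻¹ * ∏ j, δ j ^ P j := by
  rw [mpow, Finset.prod_div_distrib, Nat.cast_prod, div_eq_inv_mul]

lemma le_floor_of_le {x y z : ℝ} (hz : 0 < z) {q : ℕ} (h : y + q * z ≤ x) : q ≤ ⌊(x - y) / z⌋₊ := by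
  refine Nat.le_floor ?_
  rw [le_div_iff₀ hz]
  linarith

/-- Only Taylor coefficients of order at most `[(ρ_k - ϱ_l) / ϱ₁]` contribute. -/
lemma IsSmallParam.nonlinCoeff_eq (h : IsSmallParam t₀ ε ϱ k) {β : Mon m} (hβ : β ∈ h.low) (t : ℝ)
    (i : Fin n) : nonlinCoeff a F φ₀ φ β t i =
      ∑ l, ∑ P ∈ taylorIdx (List.finRange n) (⌊(rho ϱ k - ϱ l) / ϱ 0⌋₊ + 1),
        (((∏ j, (P j).factorial : ℕ) : ℝ)⁻¹ *
          MvPowerSeries.coeff β (MvPowerSeries.X (l, 0) * ∏ j, formalDelta φ t j ^ P j)) *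
        mpd (Metric.closedBall (φ₀ t) a) P (F l t) (φ₀ t) i := by
  simp only [nonlinCoeff, Finset.sum_apply, Pi.smul_apply, smul_eq_mul]
  refine Finset.sum_congr rfl fun l _ => ?_
  -- The two ranges of summation differ only in vanishing terms: those outside the Taylor range
  -- vanish by rank, those outside the original range by degree.
  refine Finset.sum_congr_of_eq_on_inter (fun P _ hP => ?_) (fun P _ hP => ?_) fun _ _ _ => rfl
  · rw [coeff_eq_zero_of_rank h.pos h.mono, mul_zero, zero_mul]
    refine (h.mem_low.1 hβ).trans_lt (not_le.1 fun hle => hP ?_)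
    rw [mem_taylorIdx]
    exact ⟨fun j hj => absurd (List.mem_finRange j) hj,
      Nat.lt_succ_of_le (le_floor_of_le (h.pos 0) hle)⟩
  · rw [coeff_eq_zero_of_degree, mul_zero, zero_mul]
    by_contra hlt
    refine hP (Fintype.mem_piFinset.2 fun j => Finset.mem_range.2 ?_)
    exact (Finset.single_le_sum (f := P) (fun _ _ => Nat.zero_le _) (Finset.mem_univ j)).trans_lt
      (not_le.1 hlt)

/-- Two errors occur: the Taylor remainder of F_l after order q_l, and the truncation of the
products ε_l δ^P, which the calculus of `HasExpansion` controls. -/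
lemma IsSmallParam.nonlin_isBigO (h : IsSmallParam t₀ ε ϱ k) (ha : 0 < a)
    (hφ : ∀ β ∈ h.low, ∀ j, (fun t => coefVec φ β t j) =O[atTop] fun _ => (1 : ℝ))
    (hF : ∀ l, ∀ t ∈ Ici t₀,
      ContDiffOn ℝ (⌊(rho ϱ k - ϱ l) / ϱ 0⌋₊ + 1 : ℕ) (F l t) (Metric.closedBall (φ₀ t) a))
    (hFbdd : ∀ l, ∀ P : Fin n → ℕ, ∑ j, P j ≤ ⌊(rho ϱ k - ϱ l) / ϱ 0⌋₊ + 1 →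
      BddPartial t₀ a φ₀ P (F l)) (i : Fin n) :
    (fun t => ∑ β ∈ h.low, nu t₀ ε β t * nonlinCoeff a F φ₀ φ β t i -
      ∑ l, ε l t * F l t (φ₀ t + h.delta φ t) i) =O[atTop]
      fun t => ε 0 t ^ (rho ϱ (k + 1) / ϱ 0) := by
  set q : Fin m → ℕ := fun l => ⌊(rho ϱ k - ϱ l) / ϱ 0⌋₊ with hq
  have hbd : ∀ l, ∀ P : Fin n → ℕ, ∑ j, P j ≤ q l + 1 → ∃ C, 0 ≤ C ∧ ∀ t ∈ Ici t₀,
      ∀ z ∈ Metric.closedBall (φ₀ t) a, ‖mpd (Metric.closedBall (φ₀ t) a) P (F l t) z‖ ≤ C := by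
    intro l P hP
    obtain ⟨C, hC⟩ := hFbdd l P hP
    exact ⟨max C 0, le_max_right _ _, fun t ht z hz => (hC (t, z) ⟨ht, hz⟩).trans (le_max_left _ _)⟩
  have hrem : ∀ l, (fun t => ε l t * (F l t (φ₀ t + h.delta φ t) i -
      ∑ P ∈ taylorIdx (List.finRange n) (q l + 1), mpow (h.delta φ t) P *
        mpd (Metric.closedBall (φ₀ t) a) P (F l t) (φ₀ t) i)) =O[atTop]
      fun t => ε 0 t ^ (rho ϱ (k + 1) / ϱ 0) := by
    intro l
    have hfin : {P : Fin n → ℕ | ∑ j, P j = q l + 1}.Finite := by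
      refine (taylorIdx (List.finRange n) (q l + 2)).finite_toSet.subset fun P hP => ?_
      rw [Finset.mem_coe, mem_taylorIdx]
      exact ⟨fun j hj => absurd (List.mem_finRange j) hj,
        (le_of_eq hP).trans_lt (Nat.lt_succ_self _)⟩
    have hC : ∃ C, 0 ≤ C ∧ ∀ P : Fin n → ℕ, ∑ j, P j = q l + 1 → ∀ t ∈ Ici t₀,
        ∀ z ∈ Metric.closedBall (φ₀ t) a,
        ‖mpd (Metric.closedBall (φ₀ t) a) P (F l t) z‖ ≤ C := by
      choose! C hC0 hC using hbd l
      refine ⟨∑ P ∈ hfin.toFinset, C P, Finset.sum_nonneg fun P hP =>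
        hC0 P (le_of_eq (hfin.mem_toFinset.1 hP)), fun P hP t ht z hz =>
        (hC P hP.le t ht z hz).trans ?_⟩
      exact Finset.single_le_sum (f := C) (fun P hP => hC0 P (le_of_eq (hfin.mem_toFinset.1 hP)))
        (hfin.mem_toFinset.2 hP)
    obtain ⟨C, hC0, hC⟩ := hC
    have h1 := (h.eps_isBigO l).mul (h.taylor_isBigO ha hφ (Nat.succ_pos (q l)) (hF l) hC0 hC i)
    refine h1.trans ((h.rpow_mul_rpow _ _).isBigO.trans (h.isBigO_rpow ?_))
    -- The remainder has the order of the monomial ε_l ε₁^(q_l + 1). Its rank exceeds ρ_k by the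
    -- definition of q_l, hence is at least ρ_{k+1}.
    have h2 : rho ϱ k < rank ϱ (Finsupp.single ((l, 0) : Fin m × ℕ) 1 +
        Finsupp.single ((0 : Fin m), 0) (q l + 1)) := by
      rw [rank_add, rank_single, rank_single]
      have := Nat.lt_floor_add_one ((rho ϱ k - ϱ l) / ϱ 0)
      rw [div_lt_iff₀ (h.pos 0)] at this
      push_cast
      have e : (q l : ℝ) = (⌊(rho ϱ k - ϱ l) / ϱ 0⌋₊ : ℝ) := rfl
      rw [e]
      linarith
    have h3 := rho_succ_le_rank h.pos h.mono h2
    rw [rank_add, rank_single, rank_single] at h3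
    rw [div_add' _ _ _ (h.pos 0).ne']
    refine div_le_div_of_nonneg_right ?_ (h.pos 0).le
    push_cast at h3 ⊢
    linarith
  have hmain : ∀ l, ∀ P ∈ taylorIdx (List.finRange n) (q l + 1),
      (fun t => (ε l t * ∏ j, h.delta φ t j ^ P j - ∑ β ∈ h.low, nu t₀ ε β t *
        MvPowerSeries.coeff β (MvPowerSeries.X (l, 0) * ∏ j, formalDelta φ t j ^ P j)) *
        (((∏ j, (P j).factorial : ℕ) : ℝ)⁻¹ *
          mpd (Metric.closedBall (φ₀ t) a) P (F l t) (φ₀ t) i)) =O[atTop]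
      fun t => ε 0 t ^ (rho ϱ (k + 1) / ϱ 0) := by
    intro l P hP
    rw [mem_taylorIdx] at hP
    have h1 := (IsSmallParam.hasExpansion_eps (h := h) l).mul
      (IsSmallParam.HasExpansion.prod Finset.univ fun j _ =>
        (IsSmallParam.hasExpansion_delta hφ j).pow (P j))
    refine isBigO_mul_one h1.2 (Asymptotics.IsBigO.const_mul_left ?_ _)
    obtain ⟨C, hC0, hC⟩ := hbd l P hP.2.le
    exact isBigO_one_of_bound (T := t₀) fun t ht => (norm_le_pi_norm _ i).trans
      (hC t ht (φ₀ t) (Metric.mem_closedBall_self ha.le))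
  have htot := (Asymptotics.IsBigO.fun_sum fun l (_ : l ∈ Finset.univ) => hrem l).add
    (Asymptotics.IsBigO.fun_sum fun l (_ : l ∈ Finset.univ) =>
      Asymptotics.IsBigO.fun_sum fun P hP => hmain l P hP)
  refine htot.neg_left.congr_left fun t => ?_
  have hA : ∑ β ∈ h.low, nu t₀ ε β t * nonlinCoeff a F φ₀ φ β t i =
      ∑ l, ∑ P ∈ taylorIdx (List.finRange n) (q l + 1), (∑ β ∈ h.low, nu t₀ ε β t *
        MvPowerSeries.coeff β (MvPowerSeries.X (l, 0) * ∏ j, formalDelta φ t j ^ P j)) *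
        (((∏ j, (P j).factorial : ℕ) : ℝ)⁻¹ *
          mpd (Metric.closedBall (φ₀ t) a) P (F l t) (φ₀ t) i) := by
    rw [Finset.sum_congr rfl fun β hβ => by rw [h.nonlinCoeff_eq hβ]]
    simp only [Finset.mul_sum, Finset.sum_mul]
    rw [Finset.sum_comm]
    refine Finset.sum_congr rfl fun l _ => ?_
    rw [Finset.sum_comm]
    refine Finset.sum_congr rfl fun P _ => Finset.sum_congr rfl fun β _ => ?_
    ring
  rw [hA]
  rw [← Finset.sum_add_distrib, ← Finset.sum_neg_distrib, ← Finset.sum_sub_distrib]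
  refine Finset.sum_congr rfl fun l _ => ?_
  have hB : ∑ P ∈ taylorIdx (List.finRange n) (q l + 1), (ε l t * ∏ j, h.delta φ t j ^ P j -
        ∑ β ∈ h.low, nu t₀ ε β t *
        MvPowerSeries.coeff β (MvPowerSeries.X (l, 0) * ∏ j, formalDelta φ t j ^ P j)) *
        (((∏ j, (P j).factorial : ℕ) : ℝ)⁻¹ *
          mpd (Metric.closedBall (φ₀ t) a) P (F l t) (φ₀ t) i) =
      ε l t * ∑ P ∈ taylorIdx (List.finRange n) (q l + 1), mpow (h.delta φ t) P *
        mpd (Metric.closedBall (φ₀ t) a) P (F l t) (φ₀ t) i -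
      ∑ P ∈ taylorIdx (List.finRange n) (q l + 1), (∑ β ∈ h.low, nu t₀ ε β t *
        MvPowerSeries.coeff β (MvPowerSeries.X (l, 0) * ∏ j, formalDelta φ t j ^ P j)) *
        (((∏ j, (P j).factorial : ℕ) : ℝ)⁻¹ *
          mpd (Metric.closedBall (φ₀ t) a) P (F l t) (φ₀ t) i) := by
    rw [Finset.mul_sum, ← Finset.sum_sub_distrib]
    refine Finset.sum_congr rfl fun P _ => ?_
    rw [mpow_eq]
    ring
  rw [hB]
  ring

variable {K : Set (Ici t₀ → ℝ)} {A : Matrix (Fin n) (Fin n) ℝ} {f : ℝ → Fin n → ℝ} {Ω : Set ℂ}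

lemma IsSmallParam.coefVec_inClass (h : IsSmallParam t₀ ε ϱ k) (hK : IsClassK1 Ω K)
    (hφ : IsFormalCoeff a K ϱ A F φ₀ k φ) {β : Mon m} (hβ : β ∈ h.low) (j : Fin n) :
    InClass K fun t => coefVec φ β t j := by
  by_cases hβ0 : β = 0
  · simp only [coefVec, hβ0, if_true, Pi.zero_apply]
    exact hK.zero
  · simp only [coefVec, hβ0, if_false]
    exact (hφ β hβ0 (h.mem_low.1 hβ)).1 j

lemma IsClassK1.isBigO_one (hK : IsClassK1 Ω K) {g : ℝ → ℝ} (hg : InClass K g) :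
    g =O[atTop] fun _ => (1 : ℝ) := by
  obtain ⟨C, _, hC⟩ := hK.exists_bound hg
  exact isBigO_one_of_bound hC

lemma IsSmallParam.hasDerivWithinAt_coefVec (h : IsSmallParam t₀ ε ϱ k)
    (hφ : IsFormalCoeff a K ϱ A F φ₀ k φ) {β : Mon m} (hβ : β ∈ h.low) {t : ℝ} (ht : t ∈ Ici t₀) :
    HasDerivWithinAt (coefVec φ β)
      (A.mulVec (coefVec φ β t) + (nonlinCoeff a F φ₀ φ β t - derivCoeff φ β t)) (Ici t₀) t := by
  by_cases hβ0 : β = 0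
  · have h1 : nonlinCoeff a F φ₀ φ (0 : Mon m) t = 0 := by
      refine Finset.sum_eq_zero fun l _ => Finset.sum_eq_zero fun P _ => ?_
      rw [coeff_eq_zero_of_degree (by simp), mul_zero, zero_smul]
    have h2 : derivCoeff φ (0 : Mon m) t = 0 := by simp [derivCoeff_eq]
    have h3 : coefVec φ β = fun _ => 0 := by
      ext t
      simp [coefVec, hβ0]
    rw [h3, hβ0, h1, h2]
    simpa using hasDerivWithinAt_const t (Ici t₀) (0 : Fin n → ℝ)
  · have : coefVec φ β = φ β := by
      funext t
      simp [coefVec, hβ0]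
    rw [this]
    exact (hφ β hβ0 (h.mem_low.1 hβ)).2.2 t ht

/-- After the equations for φ₀ and the φ_β are inserted into the derivative of the truncated sum,
the terms with A and f cancel identically. The rest is the sum of the errors of
`deriv_sum_sub_isBigO` and `nonlin_isBigO`. -/
theorem IsSmallParam.exists_residual (h : IsSmallParam t₀ ε ϱ k) (ha : 0 < a) (hK : IsClassK1 Ω K)
    (hφ : IsFormalCoeff a K ϱ A F φ₀ k φ) (hf : ∀ i, InClass K fun t => f t i)
    (hφ₀K : ∀ i, InClass K (fun t => φ₀ t i))
    (hφ₀ : ∀ t ∈ Ici t₀, HasDerivWithinAt φ₀ (A.mulVec (φ₀ t) + f t) (Ici t₀) t)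
    (hF : ∀ l, ∀ t ∈ Ici t₀,
      ContDiffOn ℝ (⌊(rho ϱ k - ϱ l) / ϱ 0⌋₊ + 1 : ℕ) (F l t) (Metric.closedBall (φ₀ t) a))
    (hFbdd : ∀ l, ∀ P : Fin n → ℕ, ∑ j, P j ≤ ⌊(rho ϱ k - ϱ l) / ϱ 0⌋₊ + 1 →
      BddPartial t₀ a φ₀ P (F l))
    (hFK : ∀ l, ϱ l ≤ rho ϱ k →
      ∀ P : Fin n → ℕ, ∑ j, P j ≤ ⌊(rho ϱ k - ϱ l) / ϱ 0⌋₊ →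
      ∀ i, InClass K (fun t => mpd (Metric.closedBall (φ₀ t) a) P (F l t) (φ₀ t) i)) :
    ∃ s' : ℝ → Fin n → ℝ, ContinuousOn s' (Ici t₀) ∧
      (∀ t ∈ Ici t₀, HasDerivWithinAt (truncSum t₀ ε ϱ φ₀ k φ) (s' t) (Ici t₀) t) ∧
      (fun t => s' t - (A.mulVec (truncSum t₀ ε ϱ φ₀ k φ t) + f t +
        ∑ l, ε l t • F l t (truncSum t₀ ε ϱ φ₀ k φ t))) =O[atTop]
        fun t => ε 0 t ^ (rho ϱ (k + 1) / ϱ 0) := by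
  have hφO : ∀ β ∈ h.low, ∀ j, (fun t => coefVec φ β t j) =O[atTop] fun _ => (1 : ℝ) :=
    fun β hβ j => hK.isBigO_one (h.coefVec_inClass hK hφ hβ j)
  have hs : truncSum t₀ ε ϱ φ₀ k φ = fun t => φ₀ t + h.delta φ t := funext fun t => h.truncSum_eq t
  set c' : Mon m → ℝ → Fin n → ℝ := fun β t =>
    A.mulVec (coefVec φ β t) + (nonlinCoeff a F φ₀ φ β t - derivCoeff φ β t) with hc'
  set s' : ℝ → Fin n → ℝ := fun t => (A.mulVec (φ₀ t) + f t) + ∑ β ∈ h.low,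
    (nu t₀ ε β t • c' β t +
      (∑ x ∈ β.support, (β x : ℝ) * nu t₀ ε (bump β x) t) • coefVec φ β t) with hs'
  have hAcont : ∀ g : ℝ → Fin n → ℝ, ContinuousOn g (Ici t₀) →
      ContinuousOn (fun t => A.mulVec (g t)) (Ici t₀) := fun g hg =>
    (Continuous.matrix_mulVec continuous_const continuous_id).comp_continuousOn hg
  have hcV : ∀ β ∈ h.low, ContinuousOn (coefVec φ β) (Ici t₀) := fun β hβ =>
    continuousOn_pi.2 fun j => hK.continuousOn (h.coefVec_inClass hK hφ hβ j)
  have hφcl : ∀ γ : Mon m, γ ≠ 0 → rank ϱ γ ≤ rho ϱ k → ∀ i, InClass K fun t => φ γ t i :=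
    fun γ hγ0 hγ => (hφ γ hγ0 hγ).1
  refine ⟨s', ?_, fun t ht => ?_, ?_⟩
  · refine ((hAcont φ₀ (continuousOn_pi.2 fun i => hK.continuousOn (hφ₀K i))).add
      (continuousOn_pi.2 fun i => hK.continuousOn (hf i))).add (continuousOn_finsetSum _ fun β hβ => ?_)
    have hβ' := h.mem_low.1 hβ
    refine ((h.continuousOn_nu (h.isCovered_low hβ)).smul ((hAcont _ (hcV β hβ)).add
      (ContinuousOn.sub ?_ ?_))).add ((continuousOn_finsetSum _ fun x hx =>
        continuousOn_const.mul (h.continuousOn_nu (isCovered_bump h.pos hβ' hx))).smul (hcV β hβ))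
    · exact continuousOn_pi.2 fun i => hK.continuousOn
        (inClass_nonlinCoeff hK h.pos h.mono hFK hβ' (fun γ h1 h2 _ => hφcl γ h1 h2) i)
    · exact continuousOn_pi.2 fun i => hK.continuousOn
        (inClass_derivCoeff hK hβ' (fun γ h1 h2 _ => hφcl γ h1 h2) i)
  · rw [hs]
    refine (hφ₀ t ht).add ?_
    unfold IsSmallParam.delta
    exact HasDerivWithinAt.fun_sum fun β hβ =>
      (h.hasDerivWithinAt_nu (h.mem_low.1 hβ) ht).smul (h.hasDerivWithinAt_coefVec hφ hβ ht)
  · refine Asymptotics.isBigO_pi.2 fun i => ?_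
    refine ((h.deriv_sum_sub_isBigO hφO i).add
      (h.nonlin_isBigO ha hφO hF hFbdd i)).congr_left fun t => ?_
    rw [hs]
    have hA : A.mulVec (h.delta φ t) i = ∑ β ∈ h.low, nu t₀ ε β t * A.mulVec (coefVec φ β t) i := by
      rw [IsSmallParam.delta, Matrix.mulVec_sum, Finset.sum_apply]
      refine Finset.sum_congr rfl fun β _ => ?_
      rw [Matrix.mulVec_smul, Pi.smul_apply, smul_eq_mul]
    simp only [hs', hc', Pi.sub_apply, Pi.add_apply, Finset.sum_apply, Pi.smul_apply, smul_eq_mul,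
      Matrix.mulVec_add, hA, mul_add, mul_sub, Finset.sum_add_distrib, Finset.sum_sub_distrib]
    ring

end Residual


/-! ### Negligible functions and expansions in the non-integrable products `μ_℘` -/

/-- Continuous, bounded and absolutely integrable functions on `[T, ∞)`. -/
structure IsNegl (T : ℝ) (g : ℝ → ℝ) : Prop where
  continuousOn : ContinuousOn g (Ici T)
  integrableOn : IntegrableOn g (Ici T)
  isBigO_one : g =O[atTop] fun _ => (1 : ℝ)

section Negl

variable {T : ℝ} {g h : ℝ → ℝ}

lemma IsNegl.add (hg : IsNegl T g) (hh : IsNegl T h) : IsNegl T fun t => g t + h t :=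
  ⟨hg.1.add hh.1, hg.2.add hh.2, hg.3.add hh.3⟩

lemma isNegl_zero (T : ℝ) : IsNegl T fun _ => 0 :=
  ⟨continuousOn_const, integrableOn_zero, Asymptotics.isBigO_zero _ _⟩

lemma IsNegl.sum {ι : Type*} (s : Finset ι) {g : ι → ℝ → ℝ} (hg : ∀ i ∈ s, IsNegl T (g i)) :
    IsNegl T fun t => ∑ i ∈ s, g i t := by
  classical
  induction s using Finset.induction_on with
  | empty => simpa using isNegl_zero T
  | insert i s hi ih =>
    simp only [Finset.sum_insert hi]
    exact (hg i (Finset.mem_insert_self _ _)).add (ih fun j hj => hg j (Finset.mem_insert_of_mem hj))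

lemma IsNegl.mul (hg : IsNegl T g) (hh : ContinuousOn h (Ici T))
    (hO : h =O[atTop] fun _ => (1 : ℝ)) : IsNegl T fun t => g t * h t := by
  obtain ⟨C, _, hC⟩ := exists_abs_le_of_isBigO_one hh hO
  exact ⟨hg.1.mul hh, hg.2.mul_bdd (hh.aestronglyMeasurable measurableSet_Ici)
    ((ae_restrict_iff' measurableSet_Ici).2 (ae_of_all _ hC)), isBigO_one_mul hg.3 hO⟩

lemma IsNegl.const_mul (c : ℝ) (hg : IsNegl T g) : IsNegl T fun t => c * g t :=
  ⟨continuousOn_const.mul hg.1, hg.2.const_mul c, hg.3.const_mul_left c⟩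

lemma IsNegl.congr (hg : IsNegl T g) (e : ∀ t ∈ Ici T, h t = g t) : IsNegl T h := by
  refine ⟨hg.1.congr e, hg.2.congr_fun (fun t ht => (e t ht).symm) measurableSet_Ici,
    hg.3.congr' ?_ EventuallyEq.rfl⟩
  filter_upwards [eventually_ge_atTop T] with t ht using (e t ht).symm

lemma IsNegl.mono {T' : ℝ} (hg : IsNegl T g) (hT : T ≤ T') : IsNegl T' g :=
  ⟨hg.1.mono (Ici_subset_Ici.2 hT), hg.2.mono_set (Ici_subset_Ici.2 hT), hg.3⟩

end Negl

section Expansion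

variable {m n : ℕ} [NeZero m] {t₀ a : ℝ} {ε : Fin m → ℝ → ℝ} {ϱ : Fin m → ℝ} {k : ℕ}
  {F : Fin m → ℝ → (Fin n → ℝ) → Fin n → ℝ} {φ₀ : ℝ → Fin n → ℝ} {φ : Mon m → ℝ → Fin n → ℝ}
  {w T : ℝ} {Ω : Set ℂ} {K : Set (Ici t₀ → ℝ)}

lemma IsSmallParam.isNegl_of_isBigO (h : IsSmallParam t₀ ε ϱ k) (hw : 0 < w)
    (hεw : IntegrableOn (fun t => (ε 0 t) ^ w) (Ici t₀)) {g : ℝ → ℝ} (hg : ContinuousOn g (Ici T))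
    (hO : g =O[atTop] fun t => ε 0 t ^ w) : IsNegl T g :=
  ⟨hg, (hg.locallyIntegrableOn measurableSet_Ici).integrableOn_of_isBigO_atTop hO
    ⟨Ici t₀, Ici_mem_atTop t₀, hεw⟩, hO.trans (h.isBigO_one hw.le)⟩

lemma IsSmallParam.continuousOn_mu (h : IsSmallParam t₀ ε ϱ k) (P : Fin m → ℕ) :
    ContinuousOn (mu ε P) (Ici t₀) :=
  continuousOn_finsetProd _ fun l _ => (h.continuousOn_eps l).pow _

lemma IsSmallParam.mu_isBigO (h : IsSmallParam t₀ ε ϱ k) (P : Fin m → ℕ) :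
    (mu ε P) =O[atTop] fun t => ε 0 t ^ ((∑ l, P l : ℕ) : ℝ) := by
  simp only [Real.rpow_natCast, ← Finset.prod_pow_eq_pow_sum]
  exact Asymptotics.IsBigO.finsetProd fun l _ => (h.eps_isBigO_eps l).pow _

lemma IsSmallParam.mu_isBigO_one (h : IsSmallParam t₀ ε ϱ k) (P : Fin m → ℕ) :
    (mu ε P) =O[atTop] fun _ => (1 : ℝ) :=
  (h.mu_isBigO P).trans (h.isBigO_one (Nat.cast_nonneg _))

lemma IsSmallParam.mu_tendsto (h : IsSmallParam t₀ ε ϱ k) {P : Fin m → ℕ} (hP : 1 ≤ ∑ l, P l) :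
    Tendsto (mu ε P) atTop (𝓝 0) :=
  (h.mu_isBigO P).trans_tendsto (h.tendsto_rpow (by exact_mod_cast hP))

omit [NeZero m] in
lemma mu_add (P Q : Fin m → ℕ) (t : ℝ) : mu ε (P + Q) t = mu ε P t * mu ε Q t := by
  simp only [mu, Pi.add_apply, pow_add, Finset.prod_mul_distrib]

omit [NeZero m] in
lemma mu_single (l : Fin m) (t : ℝ) : mu ε (Pi.single l 1) t = ε l t := by
  rw [mu, Finset.prod_eq_single l]
  · simp
  · intro j _ hj
    simp [hj]
  · simp

omit [NeZero m] in
lemma mem_nonIntegrableIdx {P : Fin m → ℕ} : P ∈ nonIntegrableIdx t₀ w ε ↔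
    1 ≤ ∑ l, P l ∧ ((∑ l, P l : ℕ) : ℝ) < w ∧ ¬ IntegrableOn (mu ε P) (Ici t₀) := by
  classical
  rw [nonIntegrableIdx, Finset.mem_filter, Fintype.mem_piFinset]
  refine ⟨fun h => h.2, fun h => ⟨fun l => Finset.mem_range.2 ?_, h⟩⟩
  rw [Nat.lt_ceil]
  exact (Nat.cast_le.2 (Finset.single_le_sum (f := P) (fun _ _ => Nat.zero_le _)
    (Finset.mem_univ l))).trans_lt h.2.1

/-- A product outside S is either integrable by definition or has at least w factors; in the second
case it is dominated by ε₁^w. -/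
lemma IsSmallParam.isNegl_mu (h : IsSmallParam t₀ ε ϱ k) (hw : 0 < w)
    (hεw : IntegrableOn (fun t => (ε 0 t) ^ w) (Ici t₀)) {P : Fin m → ℕ} (hP : 1 ≤ ∑ l, P l)
    (hPS : P ∉ nonIntegrableIdx t₀ w ε) : IsNegl t₀ (mu ε P) := by
  by_cases hPw : ((∑ l, P l : ℕ) : ℝ) < w
  · refine ⟨h.continuousOn_mu P, ?_, h.mu_isBigO_one P⟩
    by_contra hni
    exact hPS (mem_nonIntegrableIdx.2 ⟨hP, hPw, hni⟩)
  · exact h.isNegl_of_isBigO hw hεw (h.continuousOn_mu P)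
      ((h.mu_isBigO P).trans (h.isBigO_rpow (not_lt.1 hPw)))

/-- On `[T, ∞)` the function `g` is a combination of the non-integrable products `μ_℘` with
coefficients from the class, up to a negligible function. -/
def IsAdm (K : Set (Ici t₀ → ℝ)) (w : ℝ) (ε : Fin m → ℝ → ℝ) (T : ℝ) (g : ℝ → ℝ) : Prop :=
  ∃ b : (Fin m → ℕ) → ℝ → ℝ, (∀ P, InClass K (b P)) ∧
    IsNegl T fun t => g t - ∑ P ∈ nonIntegrableIdx t₀ w ε, mu ε P t * b P t

variable {g g' : ℝ → ℝ}

omit [NeZero m] in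
lemma IsNegl.isAdm (hK : IsClassK1 Ω K) (hg : IsNegl T g) : IsAdm K w ε T g :=
  ⟨fun _ _ => 0, fun _ => hK.zero, by simpa using hg⟩

omit [NeZero m] in
lemma IsAdm.add (hK : IsClassK1 Ω K) (hg : IsAdm K w ε T g) (hg' : IsAdm K w ε T g') :
    IsAdm K w ε T fun t => g t + g' t := by
  obtain ⟨b, hb, hR⟩ := hg
  obtain ⟨b', hb', hR'⟩ := hg'
  refine ⟨fun P t => b P t + b' P t, fun P => hK.add (hb P) (hb' P),
    (hR.add hR').congr fun t _ => ?_⟩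
  simp only [mul_add, Finset.sum_add_distrib]
  ring

omit [NeZero m] in
lemma IsAdm.sum (hK : IsClassK1 Ω K) {ι : Type*} (s : Finset ι) {g : ι → ℝ → ℝ}
    (hg : ∀ i ∈ s, IsAdm K w ε T (g i)) : IsAdm K w ε T fun t => ∑ i ∈ s, g i t := by
  classical
  induction s using Finset.induction_on with
  | empty => simpa using (isNegl_zero T).isAdm hK
  | insert i s hi ih =>
    simp only [Finset.sum_insert hi]
    exact (hg i (Finset.mem_insert_self _ _)).add hK
      (ih fun j hj => hg j (Finset.mem_insert_of_mem hj))

omit [NeZero m] in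
lemma IsAdm.congr (hg : IsAdm K w ε T g) (e : ∀ t ∈ Ici T, g' t = g t) : IsAdm K w ε T g' := by
  obtain ⟨b, hb, hR⟩ := hg
  exact ⟨b, hb, hR.congr fun t ht => by rw [e t ht]⟩

lemma IsSmallParam.isAdm_mu_mul (h : IsSmallParam t₀ ε ϱ k) (hw : 0 < w)
    (hεw : IntegrableOn (fun t => (ε 0 t) ^ w) (Ici t₀)) (hK : IsClassK1 Ω K) (hT : t₀ ≤ T)
    {P : Fin m → ℕ} (hP : 1 ≤ ∑ l, P l) {b : ℝ → ℝ} (hb : InClass K b) :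
    IsAdm K w ε T fun t => mu ε P t * b t := by
  classical
  by_cases hPS : P ∈ nonIntegrableIdx t₀ w ε
  · refine ⟨fun Q t => if Q = P then b t else 0, fun Q => ?_, (isNegl_zero T).congr fun t _ => ?_⟩
    · by_cases hQ : Q = P
      · simpa [hQ] using hb
      · simpa [hQ] using hK.zero
    · simp only
      rw [Finset.sum_eq_single_of_mem P hPS fun Q _ hQ => by rw [if_neg hQ, mul_zero], if_pos rfl,
        sub_self]
  · exact (((h.isNegl_mu hw hεw hP hPS).mul (hK.continuousOn hb) (hK.isBigO_one hb)).mono hT).isAdm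
      hK

lemma IsAdm.sum_continuousOn (h : IsSmallParam t₀ ε ϱ k) (hK : IsClassK1 Ω K) (hT : t₀ ≤ T)
    {b : (Fin m → ℕ) → ℝ → ℝ} (hb : ∀ P, InClass K (b P)) :
    ContinuousOn (fun t => ∑ P ∈ nonIntegrableIdx t₀ w ε, mu ε P t * b P t) (Ici T) :=
  (continuousOn_finsetSum _ fun P _ => (h.continuousOn_mu P).mul (hK.continuousOn (hb P))).mono
    (Ici_subset_Ici.2 hT)

lemma IsAdm.sum_isBigO_one (h : IsSmallParam t₀ ε ϱ k) (hK : IsClassK1 Ω K)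
    {b : (Fin m → ℕ) → ℝ → ℝ} (hb : ∀ P, InClass K (b P)) :
    (fun t => ∑ P ∈ nonIntegrableIdx t₀ w ε, mu ε P t * b P t) =O[atTop] fun _ => (1 : ℝ) :=
  Asymptotics.IsBigO.fun_sum fun P _ => isBigO_one_mul (h.mu_isBigO_one P) (hK.isBigO_one (hb P))

lemma IsAdm.continuousOn (h : IsSmallParam t₀ ε ϱ k) (hK : IsClassK1 Ω K) (hT : t₀ ≤ T)
    (hg : IsAdm K w ε T g) : ContinuousOn g (Ici T) := by
  obtain ⟨b, hb, hR⟩ := hg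
  exact (hR.1.add (IsAdm.sum_continuousOn h hK hT hb)).congr fun t _ => (sub_add_cancel _ _).symm

lemma IsAdm.isBigO_one (h : IsSmallParam t₀ ε ϱ k) (hK : IsClassK1 Ω K)
    (hg : IsAdm K w ε T g) : g =O[atTop] fun _ => (1 : ℝ) := by
  obtain ⟨b, hb, hR⟩ := hg
  exact (hR.3.add (IsAdm.sum_isBigO_one h hK hb)).congr_left fun t => sub_add_cancel _ _

/-- Since μ_P μ_Q = μ_{P+Q}, each product of leading terms is again a leading term or negligible,
and negligible functions absorb bounded continuous factors. -/
lemma IsAdm.mul (h : IsSmallParam t₀ ε ϱ k) (hw : 0 < w)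
    (hεw : IntegrableOn (fun t => (ε 0 t) ^ w) (Ici t₀)) (hK : IsClassK1 Ω K) (hT : t₀ ≤ T)
    (hg : IsAdm K w ε T g) (hg' : IsAdm K w ε T g') : IsAdm K w ε T fun t => g t * g' t := by
  have hgc' := hg'.continuousOn h hK hT
  have hgO' := hg'.isBigO_one h hK
  obtain ⟨b, hb, hR⟩ := hg
  obtain ⟨b', hb', hR'⟩ := hg'
  have h1 := (hR.mul hgc' hgO').isAdm (w := w) (ε := ε) hK
  have h2 := (hR'.mul (IsAdm.sum_continuousOn (w := w) h hK hT hb)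
    (IsAdm.sum_isBigO_one h hK hb)).isAdm (w := w) (ε := ε) hK
  have h3 : IsAdm K w ε T fun t => ∑ P ∈ nonIntegrableIdx t₀ w ε, ∑ Q ∈ nonIntegrableIdx t₀ w ε,
      mu ε (P + Q) t * (b P t * b' Q t) := by
    refine IsAdm.sum hK _ fun P hP => IsAdm.sum hK _ fun Q _ =>
      h.isAdm_mu_mul hw hεw hK hT ?_ (hK.mul (hb P) (hb' Q))
    have := (mem_nonIntegrableIdx.1 hP).1
    simp only [Pi.add_apply, Finset.sum_add_distrib]
    omega
  refine ((h1.add hK h2).add hK h3).congr fun t _ => ?_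
  have h4 : ∑ P ∈ nonIntegrableIdx t₀ w ε, ∑ Q ∈ nonIntegrableIdx t₀ w ε,
      mu ε (P + Q) t * (b P t * b' Q t) = (∑ P ∈ nonIntegrableIdx t₀ w ε, mu ε P t * b P t) *
      ∑ Q ∈ nonIntegrableIdx t₀ w ε, mu ε Q t * b' Q t := by
    rw [Finset.sum_mul_sum]
    refine Finset.sum_congr rfl fun P _ => Finset.sum_congr rfl fun Q _ => ?_
    rw [mu_add]
    ring
  rw [h4]
  ring

lemma IsSmallParam.isAdm_eps_mul_inClass (h : IsSmallParam t₀ ε ϱ k) (hw : 0 < w)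
    (hεw : IntegrableOn (fun t => (ε 0 t) ^ w) (Ici t₀)) (hK : IsClassK1 Ω K) (hT : t₀ ≤ T)
    (l : Fin m) (hg : InClass K g) : IsAdm K w ε T fun t => ε l t * g t := by
  have := h.isAdm_mu_mul hw hεw hK hT (P := Pi.single l 1) (by simp) hg
  simpa only [mu_single] using this

lemma IsAdm.eps_mul (h : IsSmallParam t₀ ε ϱ k) (hw : 0 < w)
    (hεw : IntegrableOn (fun t => (ε 0 t) ^ w) (Ici t₀)) (hK : IsClassK1 Ω K) (hT : t₀ ≤ T)
    (l : Fin m) (hg : IsAdm K w ε T g) : IsAdm K w ε T fun t => ε l t * g t := by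
  obtain ⟨b, hb, hR⟩ := hg
  have h1 := (hR.mul ((h.continuousOn_eps l).mono (Ici_subset_Ici.2 hT))
    (h.eps_isBigO_one l)).isAdm (w := w) (ε := ε) hK
  have h2 : IsAdm K w ε T fun t => ∑ P ∈ nonIntegrableIdx t₀ w ε,
      mu ε (Pi.single l 1 + P) t * b P t := IsAdm.sum hK _ fun P _ =>
    h.isAdm_mu_mul hw hεw hK hT (by simp [Finset.sum_add_distrib]) (hb P)
  refine (h1.add hK h2).congr fun t _ => ?_
  simp only [mu_add, mu_single, mul_assoc, ← Finset.mul_sum]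
  ring

/-- Induction on the degree, one factor being split off. An undifferentiated ε_l preserves
admissibility. A derivative that occurs in rank at most ρ_k has order at most [ρ_k - ϱ_l], is
therefore integrable, and makes the whole monomial negligible. -/
lemma IsSmallParam.isAdm_nu_mul (h : IsSmallParam t₀ ε ϱ k) (hw : 0 < w)
    (hεw : IntegrableOn (fun t => (ε 0 t) ^ w) (Ici t₀))
    (hεder : ∀ l, ∀ r : ℕ, 1 ≤ r → (r : ℤ) ≤ ⌊rho ϱ k - ϱ l⌋ →
      IntegrableOn (fun t => iteratedDerivWithin r (ε l) (Ici t₀) t) (Ici t₀))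
    (hK : IsClassK1 Ω K) (hT : t₀ ≤ T) (hg : InClass K g) {β : Mon m} (hβ : β ∈ h.low)
    (hβ0 : β ≠ 0) : IsAdm K w ε T fun t => nu t₀ ε β t * g t := by
  induction hd : β.degree using Nat.strong_induction_on generalizing β with
  | _ d ih =>
  obtain ⟨x, hx⟩ := Finsupp.support_nonempty_iff.2 hβ0
  have he : Finsupp.single x 1 + (β - Finsupp.single x 1) = β :=
    add_tsub_cancel_of_le (single_le_of_mem_support hx)
  set β' := β - Finsupp.single x 1 with hβ'
  have hlow : β' ∈ h.low := h.mem_low.2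
    ((rank_mono h.pos (he ▸ le_add_self)).trans (h.mem_low.1 hβ))
  have hnu : ∀ t, nu t₀ ε β t = iteratedDerivWithin x.2 (ε x.1) (Ici t₀) t * nu t₀ ε β' t :=
    fun t => by rw [← he, nu_add, nu_single, pow_one]
  simp only [hnu, mul_assoc]
  have hc := h.isCovered_low hlow
  by_cases hx0 : x.2 = 0
  · simp only [hx0, iteratedDerivWithin_zero]
    by_cases hz : β' = 0
    · simp only [hz, nu_zero, one_mul]
      exact h.isAdm_eps_mul_inClass hw hεw hK hT x.1 hg
    · refine (ih _ ?_ hlow hz rfl).eps_mul h hw hεw hK hT x.1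
      rw [← hd, ← he, map_add, Finsupp.degree_single]
      omega
  · have h1 := succ_le_of_rank_le h.pos (h.mem_low.1 hβ) hx
    have h2 := h.continuousOn_iteratedDeriv x.1 (h.isCovered_low hβ x hx)
    have h3 : IsNegl t₀ (iteratedDerivWithin x.2 (ε x.1) (Ici t₀)) :=
      ⟨h2, hεder x.1 x.2 (Nat.one_le_iff_ne_zero.2 hx0) h1,
        (h.isBigO x.1 x.2 (h.isCovered_low hβ x hx)).trans (h.isBigO_one (div_nonneg
          (add_nonneg (h.pos _).le (Nat.cast_nonneg _)) (h.pos 0).le))⟩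
    exact ((h3.mul ((h.continuousOn_nu hc).mul (hK.continuousOn hg))
      (isBigO_one_mul (h.nu_isBigO_one hc) (hK.isBigO_one hg))).mono hT).isAdm hK

variable {A : Matrix (Fin n) (Fin n) ℝ}

lemma IsSmallParam.isAdm_delta (h : IsSmallParam t₀ ε ϱ k) (hw : 0 < w)
    (hεw : IntegrableOn (fun t => (ε 0 t) ^ w) (Ici t₀))
    (hεder : ∀ l, ∀ r : ℕ, 1 ≤ r → (r : ℤ) ≤ ⌊rho ϱ k - ϱ l⌋ →
      IntegrableOn (fun t => iteratedDerivWithin r (ε l) (Ici t₀) t) (Ici t₀))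
    (hK : IsClassK1 Ω K) (hT : t₀ ≤ T) (hφ : IsFormalCoeff a K ϱ A F φ₀ k φ) (j : Fin n) :
    IsAdm K w ε T fun t => h.delta φ t j := by
  simp only [IsSmallParam.delta, Finset.sum_apply, Pi.smul_apply, smul_eq_mul]
  refine IsAdm.sum hK _ fun β hβ => ?_
  by_cases hβ0 : β = 0
  · simpa [coefVec, hβ0] using (isNegl_zero T).isAdm hK
  · exact h.isAdm_nu_mul hw hεw hεder hK hT (h.coefVec_inClass hK hφ hβ j) hβ hβ0

lemma IsSmallParam.isAdm_eps_mul_mpow (h : IsSmallParam t₀ ε ϱ k) (hw : 0 < w)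
    (hεw : IntegrableOn (fun t => (ε 0 t) ^ w) (Ici t₀))
    (hεder : ∀ l, ∀ r : ℕ, 1 ≤ r → (r : ℤ) ≤ ⌊rho ϱ k - ϱ l⌋ →
      IntegrableOn (fun t => iteratedDerivWithin r (ε l) (Ici t₀) t) (Ici t₀))
    (hK : IsClassK1 Ω K) (hT : t₀ ≤ T) (hφ : IsFormalCoeff a K ϱ A F φ₀ k φ) (l : Fin m)
    (hg : InClass K g) (P : Fin n → ℕ) :
    IsAdm K w ε T fun t => ε l t * (mpow (h.delta φ t) P * g t) := by
  classical
  have hpow : ∀ (j : Fin n) (q : ℕ) (g : ℝ → ℝ), IsAdm K w ε T g →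
      IsAdm K w ε T fun t => h.delta φ t j ^ q * g t := by
    intro j q g hg
    induction q with
    | zero => simpa using hg
    | succ q ih =>
      refine ((h.isAdm_delta hw hεw hεder hK hT hφ j).mul h hw hεw hK hT ih).congr fun t _ => ?_
      ring
  have hprod : ∀ (s : Finset (Fin n)) (g : ℝ → ℝ), IsAdm K w ε T g →
      IsAdm K w ε T fun t => (∏ j ∈ s, h.delta φ t j ^ P j) * g t := by
    intro s
    induction s using Finset.induction_on with
    | empty => exact fun g hg => by simpa using hg
    | insert j s hj ih =>
      intro g hg
      refine (hpow j (P j) _ (ih g hg)).congr fun t _ => ?_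
      rw [Finset.prod_insert hj, mul_assoc]
  refine (hprod Finset.univ _ (h.isAdm_eps_mul_inClass hw hεw hK hT l (hK.const_mul
    ((∏ j, (P j).factorial : ℕ) : ℝ)⁻¹ hg))).congr fun t _ => ?_
  rw [mpow_eq]
  ring

/-- Half of the radius of the tube is reserved for the correction r. -/
lemma IsSmallParam.exists_tube (h : IsSmallParam t₀ ε ϱ k) (hK : IsClassK1 Ω K) (ha : 0 < a)
    (hφ : IsFormalCoeff a K ϱ A F φ₀ k φ) :
    ∃ T ∈ Ici t₀, ∀ t ∈ Ici T, ‖h.delta φ t‖ ≤ a / 2 := by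
  have h1 := (h.delta_tendsto fun β hβ j => hK.isBigO_one (h.coefVec_inClass hK hφ hβ j)).norm
  rw [norm_zero] at h1
  obtain ⟨T, hT⟩ := eventually_atTop.1 (h1.eventually (ge_mem_nhds (half_pos ha)))
  exact ⟨max t₀ T, le_max_left t₀ T, fun t ht => hT t ((le_max_right t₀ T).trans ht)⟩

lemma IsSmallParam.delta_mem (h : IsSmallParam t₀ ε ϱ k) {t : ℝ} (ht : ‖h.delta φ t‖ ≤ a) :
    truncSum t₀ ε ϱ φ₀ k φ t ∈ Metric.closedBall (φ₀ t) a := by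
  rw [h.truncSum_eq, mem_closedBall_iff_norm, add_sub_cancel_left]
  exact ht

omit [NeZero m] in
lemma continuousOn_comp_tube {G : ℝ → (Fin n → ℝ) → Fin n → ℝ}
    (hG : ContinuousOn (fun p : ℝ × (Fin n → ℝ) => G p.1 p.2) (tube t₀ a φ₀)) (hT : t₀ ≤ T)
    {y : ℝ → Fin n → ℝ} (hy : ContinuousOn y (Ici T))
    (hya : ∀ t ∈ Ici T, y t ∈ Metric.closedBall (φ₀ t) a) :
    ContinuousOn (fun t => G t (y t)) (Ici T) :=
  hG.comp (continuousOn_id.prodMk hy) fun t ht => ⟨hT.trans ht, hya t ht⟩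

omit [NeZero m] in
lemma IsC0N.continuousOn_pd {N : ℕ} {G : ℝ → (Fin n → ℝ) → Fin n → ℝ} (ha : 0 < a)
    (hG : IsC0N t₀ a φ₀ N G) (hN : 1 ≤ N) (j : Fin n) : ContinuousOn
      (fun p : ℝ × (Fin n → ℝ) => pd (Metric.closedBall (φ₀ p.1) a) j (G p.1) p.2)
      (tube t₀ a φ₀) := by
  refine (hG.2 (Pi.single j 1) (by simpa using hN)).congr fun p hp => ?_
  exact ((mpd_single ha j ((hG.1 p.1 hp.1).of_le (by exact_mod_cast hN))) hp.2).symm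

omit [NeZero m] in
lemma BddPartial.exists_pd_le {N : ℕ} {G : ℝ → (Fin n → ℝ) → Fin n → ℝ} (ha : 0 < a)
    (hG : IsC0N t₀ a φ₀ N G) (hN : 1 ≤ N)
    (hb : ∀ j, BddPartial t₀ a φ₀ (Pi.single j 1) G) : ∃ C, 0 ≤ C ∧ ∀ j, ∀ t ∈ Ici t₀,
      ∀ z ∈ Metric.closedBall (φ₀ t) a, ‖pd (Metric.closedBall (φ₀ t) a) j (G t) z‖ ≤ C := by
  choose C hC using hb
  refine ⟨∑ j, |C j|, Finset.sum_nonneg fun _ _ => abs_nonneg _, fun j t ht z hz => ?_⟩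
  rw [← mpd_single ha j ((hG.1 t ht).of_le (by exact_mod_cast hN)) hz]
  exact ((hC j (t, z) ⟨ht, hz⟩).trans (le_abs_self _)).trans
    (Finset.single_le_sum (f := fun j => |C j|) (fun _ _ => abs_nonneg _) (Finset.mem_univ j))

lemma IsSmallParam.continuousOn_delta (h : IsSmallParam t₀ ε ϱ k) (hK : IsClassK1 Ω K)
    (hφ : IsFormalCoeff a K ϱ A F φ₀ k φ) : ContinuousOn (h.delta φ) (Ici t₀) :=
  continuousOn_finsetSum _ fun _ hβ => (h.continuousOn_nu (h.isCovered_low hβ)).smul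
    (continuousOn_pi.2 fun j => hK.continuousOn (h.coefVec_inClass hK hφ hβ j))

/-- The entries of `∑ ε_l ∂F_l(t, s(t))/∂y` are combinations of the non-integrable products. -/
theorem IsSmallParam.isAdm_eps_mul_pd (h : IsSmallParam t₀ ε ϱ k) (ha : 0 < a) (hw : 0 < w)
    (hεw : IntegrableOn (fun t => (ε 0 t) ^ w) (Ici t₀))
    (hεder : ∀ l, ∀ r : ℕ, 1 ≤ r → (r : ℤ) ≤ ⌊rho ϱ k - ϱ l⌋ →
      IntegrableOn (fun t => iteratedDerivWithin r (ε l) (Ici t₀) t) (Ici t₀))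
    (hK : IsClassK1 Ω K) (hT : t₀ ≤ T) (hφ : IsFormalCoeff a K ϱ A F φ₀ k φ)
    (hφ₀ : ContinuousOn φ₀ (Ici t₀)) (hTa : ∀ t ∈ Ici T, ‖h.delta φ t‖ ≤ a) {l : Fin m}
    (hF : IsC0N t₀ a φ₀ 2 (F l))
    (hFbdd : ∀ P : Fin n → ℕ, ∑ j, P j ≤ 2 → BddPartial t₀ a φ₀ P (F l))
    (hF' : ϱ l ≤ w * ϱ 0 → IsC0N t₀ a φ₀ (⌊w - ϱ l / ϱ 0⌋₊ + 2) (F l))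
    (hFbdd' : ϱ l ≤ w * ϱ 0 →
      ∀ P : Fin n → ℕ, 3 ≤ ∑ j, P j → ∑ j, P j ≤ ⌊w - ϱ l / ϱ 0⌋₊ + 2 →
      BddPartial t₀ a φ₀ P (F l))
    (hFK' : ϱ l ≤ w * ϱ 0 →
      ∀ P : Fin n → ℕ, 1 ≤ ∑ j, P j → ∑ j, P j ≤ ⌊w - ϱ l / ϱ 0⌋₊ + 1 →
      ∀ i, InClass K (fun t => mpd (Metric.closedBall (φ₀ t) a) P (F l t) (φ₀ t) i))
    (i j : Fin n) : IsAdm K w ε T fun t =>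
      ε l t * pd (Metric.closedBall (φ₀ t) a) j (F l t) (truncSum t₀ ε ϱ φ₀ k φ t) i := by
  have hφO : ∀ β ∈ h.low, ∀ j, (fun t => coefVec φ β t j) =O[atTop] fun _ => (1 : ℝ) :=
    fun β hβ j => hK.isBigO_one (h.coefVec_inClass hK hφ hβ j)
  have hs : ContinuousOn (truncSum t₀ ε ϱ φ₀ k φ) (Ici T) := by
    refine ((hφ₀.add (h.continuousOn_delta hK hφ)).mono (Ici_subset_Ici.2 hT)).congr fun t _ => ?_
    rw [h.truncSum_eq, Pi.add_apply]
  have hcont : ContinuousOn (fun t => pd (Metric.closedBall (φ₀ t) a) j (F l t)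
      (truncSum t₀ ε ϱ φ₀ k φ t) i) (Ici T) :=
    (continuous_apply i).comp_continuousOn (continuousOn_comp_tube
      (G := fun t => pd (Metric.closedBall (φ₀ t) a) j (F l t))
      (hF.continuousOn_pd ha one_le_two j) hT hs fun t ht => h.delta_mem (hTa t ht))
  have hεc := (h.continuousOn_eps l).mono (Ici_subset_Ici.2 hT)
  -- If ϱ_l > w ϱ₁, then ε_l is already dominated by the integrable ε₁^w and bounded first
  -- derivatives suffice. Otherwise the Jacobian has to be expanded in δ.
  by_cases hl : ϱ l ≤ w * ϱ 0
  · set s := ⌊w - ϱ l / ϱ 0⌋₊ with hs_def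
    have hFs := hF' hl
    have hpd : ∀ t ∈ Ici t₀, ∀ P : Fin n → ℕ, ∑ j, P j ≤ s + 1 →
        EqOn (mpd (Metric.closedBall (φ₀ t) a) (P + Pi.single j 1) (F l t))
          (mpd (Metric.closedBall (φ₀ t) a) P (pd (Metric.closedBall (φ₀ t) a) j (F l t)))
          (Metric.closedBall (φ₀ t) a) := fun t ht P hP =>
      mpd_add_single ha j P ((hFs.1 t ht).of_le (by norm_cast; omega))
    have hsum : ∀ P : Fin n → ℕ, ∑ i, (P + Pi.single j 1 : Fin n → ℕ) i = ∑ i, P i + 1 := fun P => by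
      simp [Finset.sum_add_distrib]
    have hfin : {P : Fin n → ℕ | ∑ j, P j = s + 1}.Finite := by
      refine (taylorIdx (List.finRange n) (s + 2)).finite_toSet.subset fun P hP => ?_
      rw [Finset.mem_coe, mem_taylorIdx]
      exact ⟨fun j hj => absurd (List.mem_finRange j) hj,
        (le_of_eq hP).trans_lt (Nat.lt_succ_self _)⟩
    have hbd : ∀ P : Fin n → ℕ, ∑ j, P j ≤ s + 2 → BddPartial t₀ a φ₀ P (F l) := fun P hP => by
      by_cases h2 : ∑ j, P j ≤ 2
      · exact hFbdd P h2
      · exact hFbdd' hl P (by omega) hP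
    choose! C hC using hbd
    have hC' : ∀ P : Fin n → ℕ, ∑ j, P j = s + 1 → ∀ t ∈ Ici t₀,
        ∀ z ∈ Metric.closedBall (φ₀ t) a, ‖mpd (Metric.closedBall (φ₀ t) a) P
          (pd (Metric.closedBall (φ₀ t) a) j (F l t)) z‖ ≤
          ∑ P ∈ hfin.toFinset, |C (P + Pi.single j 1)| := by
      intro P hP t ht z hz
      rw [← hpd t ht P hP.le hz]
      refine ((hC _ (by rw [hsum, hP]) (t, z) ⟨ht, hz⟩).trans (le_abs_self _)).trans ?_
      exact Finset.single_le_sum (f := fun P => |C (P + Pi.single j 1)|)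
        (fun _ _ => abs_nonneg _) (hfin.mem_toFinset.2 hP)
    have htay := h.taylor_isBigO ha hφO (G := fun t => pd (Metric.closedBall (φ₀ t) a) j (F l t))
      (Nat.succ_pos s) (fun t ht => contDiffOn_pd ha (hFs.1 t ht) j)
      (Finset.sum_nonneg fun _ _ => abs_nonneg _) hC' i
    have hKm : ∀ P ∈ taylorIdx (List.finRange n) (s + 1), InClass K fun t =>
        mpd (Metric.closedBall (φ₀ t) a) P (pd (Metric.closedBall (φ₀ t) a) j (F l t))
          (φ₀ t) i := by
      intro P hP
      have hP' := (mem_taylorIdx.1 hP).2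
      refine (hFK' hl (P + Pi.single j 1) (by rw [hsum]; omega) (by rw [hsum]; omega) i).congr
        fun t ht => ?_
      rw [hpd t ht P hP'.le (Metric.mem_closedBall_self ha.le)]
    have h1 : IsAdm K w ε T fun t => ∑ P ∈ taylorIdx (List.finRange n) (s + 1),
        ε l t * (mpow (h.delta φ t) P * mpd (Metric.closedBall (φ₀ t) a) P
          (pd (Metric.closedBall (φ₀ t) a) j (F l t)) (φ₀ t) i) := IsAdm.sum hK _ fun P hP =>
      h.isAdm_eps_mul_mpow hw hεw hεder hK hT hφ l (hKm P hP) P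
    have hrem := (h.eps_isBigO l).mul htay
    -- The Taylor remainder of order s_l + 1 gives the exponent ϱ_l/ϱ₁ + s_l + 1, which exceeds w
    -- because s_l is the integer part of w - ϱ_l/ϱ₁.
    have hrem' := hrem.trans ((h.rpow_mul_rpow _ _).isBigO.trans (h.isBigO_rpow (b := w) (by
      have := Nat.lt_floor_add_one (w - ϱ l / ϱ 0)
      push_cast
      linarith)))
    have h2 : ContinuousOn (fun t => ε l t * (pd (Metric.closedBall (φ₀ t) a) j (F l t)
        (φ₀ t + h.delta φ t) i - ∑ P ∈ taylorIdx (List.finRange n) (s + 1),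
        mpow (h.delta φ t) P * mpd (Metric.closedBall (φ₀ t) a) P
          (pd (Metric.closedBall (φ₀ t) a) j (F l t)) (φ₀ t) i)) (Ici T) := by
      simp only [h.truncSum_eq] at hcont
      have hδ := (h.continuousOn_delta hK hφ).mono (Ici_subset_Ici.2 hT)
      refine hεc.mul (hcont.sub (continuousOn_finsetSum _ fun P hP => ContinuousOn.mul ?_
        ((hK.continuousOn (hKm P hP)).mono (Ici_subset_Ici.2 hT))))
      exact continuousOn_finsetProd _ fun j _ =>
        (((continuous_apply j).comp_continuousOn hδ).pow _).div_const _
    refine ((h.isNegl_of_isBigO hw hεw h2 hrem').isAdm hK |>.add hK h1).congr fun t _ => ?_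
    rw [h.truncSum_eq, ← Finset.mul_sum]
    ring
  · obtain ⟨C, hC0, hC⟩ := BddPartial.exists_pd_le ha hF one_le_two fun j => hFbdd _ (by simp)
    have hO : (fun t => pd (Metric.closedBall (φ₀ t) a) j (F l t)
        (truncSum t₀ ε ϱ φ₀ k φ t) i) =O[atTop] fun _ => (1 : ℝ) :=
      isBigO_one_of_bound (T := T) (C := C) fun t ht => (norm_le_pi_norm _ i).trans
        (hC j t (hT.trans ht) _ (h.delta_mem (hTa t ht)))
    refine (h.isNegl_of_isBigO hw hεw (hεc.mul hcont) (isBigO_mul_one ((h.eps_isBigO l).trans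
      (h.isBigO_rpow ?_)) hO)).isAdm hK
    rw [le_div_iff₀ (h.pos 0)]
    exact (not_le.1 hl).le

end Expansion


/-! ### An asymptotic theorem of Levinson type -/

section Levinson

variable {n : ℕ}

/-- Bounded entries stay in a compact set, on which a continuous function is bounded; it serves for
the entries of the adjugate. -/
lemma isBigO_one_comp {L : ℝ → Matrix (Fin n) (Fin n) ℝ}
    (hL : ∀ i j, (fun t => L t i j) =O[atTop] fun _ => (1 : ℝ))
    {Φ : Matrix (Fin n) (Fin n) ℝ → ℝ} (hΦ : Continuous Φ) :
    (fun t => Φ (L t)) =O[atTop] fun _ => (1 : ℝ) := by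
  choose C hC using fun i j => (hL i j).bound
  have hcpt : IsCompact (univ.pi fun i => univ.pi fun j => Icc (-C i j) (C i j) :
      Set (Fin n → Fin n → ℝ)) :=
    isCompact_univ_pi fun i => isCompact_univ_pi fun j => isCompact_Icc
  obtain ⟨B, hB⟩ := hcpt.exists_bound_of_continuousOn (f := Φ) hΦ.continuousOn
  refine Asymptotics.IsBigO.of_bound B ?_
  filter_upwards [eventually_all.2 fun i => eventually_all.2 fun j => hC i j] with t ht
  rw [norm_one, mul_one]
  refine hB _ fun i _ j _ => ?_
  have := ht i j
  rw [norm_one, mul_one, Real.norm_eq_abs] at this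
  exact abs_le.1 this

lemma HasMatDeriv.continuousOn {T : ℝ} {L L' : ℝ → Matrix (Fin n) (Fin n) ℝ}
    (hL : ∀ t ∈ Ici T, HasMatDeriv L (L' t) (Ici T) t) : ContinuousOn L (Ici T) :=
  continuousOn_pi.2 fun i => continuousOn_pi.2 fun j t ht => (hL t ht i j).continuousWithinAt

lemma abs_mul_apply_le (S X : Matrix (Fin n) (Fin n) ℝ) {x : ℝ} (hX : ∀ i j, |X i j| ≤ x) (i j : Fin n) :
    |(S * X) i j| ≤ (∑ i, ∑ k, |S i k|) * x := by
  rw [Matrix.mul_apply]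
  refine (Finset.abs_sum_le_sum_abs _ _).trans ?_
  have hx : 0 ≤ x := (abs_nonneg _).trans (hX i j)
  calc ∑ k, |S i k * X k j| ≤ ∑ k, |S i k| * x := Finset.sum_le_sum fun k _ => by
        rw [abs_mul]
        exact mul_le_mul_of_nonneg_left (hX k j) (abs_nonneg _)
    _ = (∑ k, |S i k|) * x := (Finset.sum_mul _ _ _).symm
    _ ≤ _ := mul_le_mul_of_nonneg_right (Finset.single_le_sum (f := fun i => ∑ k, |S i k|)
        (fun i _ => Finset.sum_nonneg fun k _ => abs_nonneg _) (Finset.mem_univ i)) hx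

/-- Solutions `Z → 1` of `Z' = Δ Z - Z Δ + S Z` with an integrable matrix `S`. -/
theorem exists_levinson_tendsto_one {T : ℝ} {S : ℝ → Matrix (Fin n) (Fin n) ℝ} {d : ℝ → Fin n → ℝ}
    (hS : ∀ i j, IsNegl T fun t => S t i j) (hd : ∀ i, ContinuousOn (fun t => d t i) (Ici T))
    (hdich : ∀ i j, ∃ σ : ℝ → ℝ, ContinuousOn σ (Ici T) ∧
      ((∀ᶠ t in atTop, 0 ≤ σ t) ∨ ∀ᶠ t in atTop, σ t ≤ 0) ∧
      ∃ z, Tendsto (fun t => ∫ τ in T..t, (d τ i - d τ j - σ τ)) atTop (𝓝 z)) :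
    ∃ T₁ ∈ Ici T, ∃ Z : ℝ → Matrix (Fin n) (Fin n) ℝ,
      (∀ t ∈ Ici T₁, HasMatDeriv Z (Matrix.diagonal (d t) * Z t - Z t * Matrix.diagonal (d t) +
        S t * Z t) (Ici T₁) t) ∧ ∀ i j, Tendsto (fun t => Z t i j) atTop (𝓝 ((1 : Matrix _ _ ℝ) i j)) := by
  set p : Fin n × Fin n → ℝ → ℝ := fun x t => d t x.1 - d t x.2 with hp
  have hpc : ∀ x, ContinuousOn (p x) (Ici T) := fun x => (hd x.1).sub (hd x.2)
  -- The alternative is taken as divergence to -∞, obtained from the dichotomy of -p, and not as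
  -- failure of divergence to +∞. Components with a free initial value then decay, which is needed
  -- for Z → 1.
  have h1 : ∀ x, ∃ M, ∀ T' ∈ Ici T,
      HasDichotomy (p x) (Tendsto (fun t => ∫ τ in T..t, p x τ) atTop atBot) T' M := by
    intro x
    obtain ⟨σ, hσ, hsgn, hlim⟩ := hdich x.2 x.1
    obtain ⟨M, hM⟩ := exists_dichotomy ((hpc (x.2, x.1))) hσ hsgn hlim
    have hneg : ∀ s t : ℝ, ∫ τ in s..t, p (x.2, x.1) τ = -∫ τ in s..t, p x τ := fun s t => by
      rw [← intervalIntegral.integral_neg]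
      exact intervalIntegral.integral_congr fun τ _ => by simp [hp]
    refine ⟨M, fun T' hT' => ⟨fun hJ s t hs ht => ?_, fun hJ s t hs ht => ?_⟩⟩
    · have := (hM T' hT').2 (fun h => h (by
        simp only [hneg]
        exact tendsto_neg_atBot_atTop.comp hJ)) s t hs ht
      rw [hneg] at this
      linarith
    · have := (hM T' hT').1 (fun h => hJ (by
        simp only [hneg] at h
        exact tendsto_neg_atTop_iff.1 h)) s t hs ht
      rw [hneg] at this
      linarith
  choose M hM using h1
  set M' := ∑ x, |M x| with hM'
  have hMM : ∀ x, M x ≤ M' := fun x => (le_abs_self _).trans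
    (Finset.single_le_sum (f := fun x => |M x|) (fun _ _ => abs_nonneg _) (Finset.mem_univ x))
  set g : ℝ → ℝ := fun t => ∑ i, ∑ k, |S t i k| with hg
  have hgi : IntegrableOn g (Ici T) :=
    integrable_finsetSum _ fun i _ => integrable_finsetSum _ fun k _ => (hS i k).integrableOn.abs
  have hg0 : ∀ t, 0 ≤ g t := fun t =>
    Finset.sum_nonneg fun _ _ => Finset.sum_nonneg fun _ _ => abs_nonneg _
  obtain ⟨T₁, hT₁⟩ := eventually_atTop.1 (((tendsto_setIntegral_Ioi_zero
    (hgi.mono_set Ioi_subset_Ici_self)).const_mul (Real.exp M')).eventually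
      (ge_mem_nhds (by norm_num : Real.exp M' * 0 < 1 / 4)))
  set T' := max T T₁ with hT'
  have hTT : T' ∈ Ici T := le_max_left T T₁
  have hsub : Ici T' ⊆ Ici T := Ici_subset_Ici.2 hTT
  let G : ℝ → (Fin n × Fin n → ℝ) → Fin n × Fin n → ℝ := fun t z x =>
    (S t * (1 + Matrix.of fun i j => z (i, j))) x.1 x.2
  have hGsub : ∀ t y z x, G t y x - G t z x =
      (S t * Matrix.of fun i j => y (i, j) - z (i, j)) x.1 x.2 := by
    intro t y z x
    have : (1 + Matrix.of fun i j => y (i, j)) - (1 + Matrix.of fun i j => z (i, j)) =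
        (Matrix.of fun i j => y (i, j) - z (i, j) : Matrix (Fin n) (Fin n) ℝ) := by
      ext i j
      simp
    simp only [G, ← Matrix.sub_apply, ← Matrix.mul_sub, this]
  have hG0 : ∀ t x, G t 0 x = S t x.1 x.2 := by
    intro t x
    have : (1 + Matrix.of fun i j => (0 : Fin n × Fin n → ℝ) (i, j)) =
        (1 : Matrix (Fin n) (Fin n) ℝ) := by
      ext i j
      simp
    simp only [G, this, Matrix.mul_one]
  have hGc : ContinuousOn (fun x : ℝ × (Fin n × Fin n → ℝ) => G x.1 x.2)
      (Ici T' ×ˢ Metric.closedBall 0 1) := by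
    refine continuousOn_pi.2 fun x => ?_
    simp only [G, Matrix.mul_apply, Matrix.add_apply, Matrix.of_apply]
    refine continuousOn_finsetSum _ fun k _ => ContinuousOn.mul ?_ ?_
    · exact ((hS x.1 k).continuousOn.mono hsub).comp continuousOn_fst fun y hy => hy.1
    · exact (continuous_const.add ((continuous_apply (k, x.2)).comp continuous_snd)).continuousOn
  have hLip : ∀ t, T' ≤ t → ∀ y z, ‖y‖ ≤ 1 → ‖z‖ ≤ 1 → ‖G t y - G t z‖ ≤ g t * ‖y - z‖ := by
    intro t _ y z _ _
    refine (pi_norm_le_iff_of_nonneg (mul_nonneg (hg0 t) (norm_nonneg _))).2 fun x => ?_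
    rw [Pi.sub_apply, hGsub, Real.norm_eq_abs]
    exact abs_mul_apply_le _ _ (fun i j => norm_le_pi_norm (y - z) (i, j)) _ _
  have hG1 : ∀ t, T' ≤ t → ‖G t 0‖ ≤ g t := by
    intro t _
    refine (pi_norm_le_iff_of_nonneg (hg0 t)).2 fun x => ?_
    rw [hG0, Real.norm_eq_abs]
    exact (Finset.single_le_sum (f := fun k => |S t x.1 k|) (fun _ _ => abs_nonneg _)
      (Finset.mem_univ x.2)).trans (Finset.single_le_sum (f := fun i => ∑ k, |S t i k|)
      (fun _ _ => Finset.sum_nonneg fun _ _ => abs_nonneg _) (Finset.mem_univ x.1))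
  obtain ⟨z, hz1, -, -, hz4⟩ := exists_bounded_solution_family_unitBall (T := T') (M := M') (p := p)
    (fun x => (hpc x).mono hsub)
    (J := {x | Tendsto (fun t => ∫ τ in T..t, p x τ) atTop atBot})
    (fun x => (hM x T' hTT).mono (hMM x)) hGc (hgi.mono_set (Ioi_subset_Ici_self.trans hsub))
    (fun t _ => hg0 t) hLip hG1 (hT₁ T' (le_max_right T T₁))
  -- One solution is enough, so all free initial values of Z - 1 are set to 0.
  have h0 : ‖(0 : Fin n × Fin n → ℝ)‖ ≤ Real.exp (-M') / 4 := by
    rw [norm_zero]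
    positivity
  refine ⟨T', hTT, fun t => 1 + Matrix.of fun i j => z 0 t (i, j), fun t ht i j => ?_, fun i j => ?_⟩
  · refine (((hz1 0 h0 t ht).2 (i, j)).const_add ((1 : Matrix (Fin n) (Fin n) ℝ) i j)).congr_deriv ?_
    simp only [G, hp, Matrix.add_apply, Matrix.sub_apply, Matrix.diagonal_mul, Matrix.mul_diagonal,
      Matrix.of_apply]
    by_cases hij : i = j
    · subst hij
      ring
    · rw [Matrix.one_apply_ne hij]
      ring
  · have h2 := (hz4 0 (i, j) fun hJ => ?_).const_add ((1 : Matrix (Fin n) (Fin n) ℝ) i j)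
    · rw [add_zero] at h2
      exact h2
    · have h3 : Tendsto (fun t => -(∫ τ in T..T', p (i, j) τ) + ∫ τ in T..t, p (i, j) τ)
          atTop atBot := tendsto_atBot_add_const_left _ _ hJ
      refine h3.congr' ?_
      filter_upwards [eventually_ge_atTop T'] with t ht
      rw [← intervalIntegral.integral_add_adjacent_intervals
        ((hpc (i, j)).intervalIntegrable_of_Ici le_rfl hTT)
        ((hpc (i, j)).intervalIntegrable_of_Ici hTT (le_trans hTT ht))]
      ring

/-- A perturbed fundamental matrix can be corrected by a factor that tends to the unit matrix. -/
theorem exists_exact_of_approximate {T c : ℝ} (hc : c ≠ 0)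
    {E L N : ℝ → Matrix (Fin n) (Fin n) ℝ} {d : ℝ → Fin n → ℝ}
    (hL : ∀ t ∈ Ici T, HasMatDeriv L (E t * L t - L t * Matrix.diagonal (d t) - N t) (Ici T) t)
    (hLb : ∀ i j, (fun t => L t i j) =O[atTop] fun _ => (1 : ℝ))
    (hLd : Tendsto (fun t => (L t).det) atTop (𝓝 c)) (hN : ∀ i j, IsNegl T fun t => N t i j)
    (hd : ∀ i, ContinuousOn (fun t => d t i) (Ici T))
    (hdich : ∀ i j, ∀ T₁ ∈ Ici T, ∃ σ : ℝ → ℝ, ContinuousOn σ (Ici T₁) ∧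
      ((∀ᶠ t in atTop, 0 ≤ σ t) ∨ ∀ᶠ t in atTop, σ t ≤ 0) ∧
      ∃ z, Tendsto (fun t => ∫ τ in T₁..t, (d τ i - d τ j - σ τ)) atTop (𝓝 z)) :
    ∃ T₁ ∈ Ici T, ∃ Q : ℝ → Matrix (Fin n) (Fin n) ℝ,
      (∀ t ∈ Ici T₁, HasMatDeriv Q (E t * Q t - Q t * Matrix.diagonal (d t)) (Ici T₁) t) ∧
      (∀ i j, (fun t => Q t i j) =O[atTop] fun _ => (1 : ℝ)) ∧
      Tendsto (fun t => (Q t).det) atTop (𝓝 c) := by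
  have hLc := HasMatDeriv.continuousOn hL
  obtain ⟨T₁, hT₁⟩ := eventually_atTop.1 (hLd.eventually_ne hc)
  set T' := max T T₁ with hT'
  have hTT : T' ∈ Ici T := le_max_left T T₁
  have hsub : Ici T' ⊆ Ici T := Ici_subset_Ici.2 hTT
  have hdet : ∀ t ∈ Ici T', (L t).det ≠ 0 := fun t ht => hT₁ t ((le_max_right T T₁).trans ht)
  have hdc : ContinuousOn (fun t => (L t).det⁻¹) (Ici T') :=
    ((continuous_id.matrix_det).comp_continuousOn (hLc.mono hsub)).inv₀ hdet
  have hdO : (fun t => (L t).det⁻¹) =O[atTop] fun _ => (1 : ℝ) := (hLd.inv₀ hc).isBigO_one ℝ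
  have hadj : ∀ i j, Continuous fun M : Matrix (Fin n) (Fin n) ℝ => M.adjugate i j := fun i j =>
    (continuous_id.matrix_adjugate).matrix_elem i j
  -- Here S = L⁻¹ N. If Z' = Δ Z - Z Δ + S Z, then in the derivative of L Z the contributions -N Z
  -- and L S Z cancel, so L Z reduces the system exactly.
  set S : ℝ → Matrix (Fin n) (Fin n) ℝ := fun t => (L t).det⁻¹ • ((L t).adjugate * N t) with hS
  have hSn : ∀ i j, IsNegl T' fun t => S t i j := by
    intro i j
    have h2 := IsNegl.sum (T := T') Finset.univ fun k _ =>
      ((hN k j).mono hTT).mul ((hadj i k).comp_continuousOn (hLc.mono hsub))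
        (isBigO_one_comp hLb (hadj i k))
    refine (h2.mul hdc hdO).congr fun t _ => ?_
    simp only [hS, Matrix.smul_apply, Matrix.mul_apply, smul_eq_mul, Function.comp_apply]
    rw [mul_comm]
    congr 1
    exact Finset.sum_congr rfl fun k _ => mul_comm _ _
  obtain ⟨T₂, hT₂, Z, hZ, hZ1⟩ := exists_levinson_tendsto_one hSn (fun i => (hd i).mono hsub)
    fun i j => hdich i j T' hTT
  have hLS : ∀ t ∈ Ici T', L t * S t = N t := fun t ht => by
    simp only [hS]
    rw [Matrix.mul_smul, ← Matrix.mul_assoc, Matrix.mul_adjugate, Matrix.smul_mul, Matrix.one_mul,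
      smul_smul, inv_mul_cancel₀ (hdet t ht), one_smul]
  refine ⟨T₂, hsub hT₂, fun t => L t * Z t, fun t ht => ?_, fun i j => ?_, ?_⟩
  · have ht' : t ∈ Ici T' := Ici_subset_Ici.2 hT₂ ht
    refine (((hL t (hsub ht')).mono (Ici_subset_Ici.2 (le_trans hTT hT₂))).mul (hZ t ht)).congr_deriv ?_
    have := hLS t ht'
    rw [← this]
    noncomm_ring
  · simp only [Matrix.mul_apply]
    exact Asymptotics.IsBigO.fun_sum fun k _ => isBigO_one_mul (hLb i k) ((hZ1 k j).isBigO_one ℝ)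
  · have hZt : Tendsto Z atTop (𝓝 1) :=
      tendsto_pi_nhds.2 fun i => tendsto_pi_nhds.2 fun j => hZ1 i j
    have hZd := ((continuous_id.matrix_det).tendsto (1 : Matrix (Fin n) (Fin n) ℝ)).comp hZt
    simp only [id, Matrix.det_one] at hZd
    simpa [Matrix.det_mul] using hLd.mul hZd

end Levinson


/-! ### Real frames that rotate with the imaginary parts of the eigenvalues -/

lemma hasDerivWithinAt_primitive_Ici {f : ℝ → ℝ} {T : ℝ} (hf : ContinuousOn f (Ici T)) {t : ℝ}
    (ht : t ∈ Ici T) : HasDerivWithinAt (fun t => ∫ τ in T..t, f τ) (f t) (Ici T) t := by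
  have h : Continuous fun t => f (max t T) :=
    hf.comp_continuous (continuous_id.max continuous_const) fun t => le_max_right t T
  have h1 := (intervalIntegral.integral_hasDerivAt_right (h.intervalIntegrable T t)
    h.stronglyMeasurable.stronglyMeasurableAtFilter h.continuousAt).hasDerivWithinAt (s := Ici T)
  have ht' : T ≤ t := ht
  simp only [max_eq_left ht'] at h1
  refine h1.congr_of_mem (fun s hs => intervalIntegral.integral_congr fun τ hτ => ?_) ht
  rw [uIcc_of_le hs] at hτ
  simp only [max_eq_left hτ.1]

section Phase

variable {n : ℕ} {A : Matrix (Fin n) (Fin n) ℝ} {lam : Fin n → ℂ}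
  {V V' : Matrix (Fin n) (Fin n) ℂ} {σ : Equiv.Perm (Fin n)}

/-- The matrix that turns conjugate columns into the real and imaginary parts (up to a factor). -/
noncomputable def realifier (σ : Equiv.Perm (Fin n)) : Matrix (Fin n) (Fin n) ℂ :=
  (1 / 2 : ℂ) • ((1 + Complex.I) • 1 + (1 - Complex.I) • Matrix.of fun j k => if j = σ k then 1 else 0)

/-- The permutation matrix R of σ is an involution, so the inverse is found among the combinations
of 1 and R. -/
lemma det_realifier_ne_zero (hσ : ∀ j, σ (σ j) = j) : (realifier σ).det ≠ 0 := by
  set R : Matrix (Fin n) (Fin n) ℂ := Matrix.of fun j k => if j = σ k then 1 else 0 with hR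
  have hPP : R * R = 1 := by
    ext j k
    rw [Matrix.mul_apply, Finset.sum_eq_single (σ k)]
    · simp [hR, hσ, Matrix.one_apply]
    · intro l _ hl
      simp [hR, hl]
    · simp
  have h : realifier σ * ((1 / 2 : ℂ) • ((1 - Complex.I) • 1 + (1 + Complex.I) • R)) = 1 := by
    rw [realifier, ← hR]
    simp only [Matrix.smul_mul, Matrix.mul_smul, add_mul, mul_add, Matrix.one_mul, Matrix.mul_one, hPP]
    ext j k
    simp only [Matrix.smul_apply, Matrix.add_apply, smul_eq_mul]
    linear_combination ((R j k - (1 : Matrix (Fin n) (Fin n) ℂ) j k) / 2) * Complex.I_sq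
  exact left_ne_zero_of_mul_eq_one (by rw [← Matrix.det_mul, h, Matrix.det_one])

/-- The columns V_k e^(iθ_k), with θ_k a primitive of Im d_k, absorb the imaginary parts of the d_k.
The real part of (1 + i) times such a column is Re - Im of it, and Re + Im for the conjugate
partner, so conjugate pairs stay independent. A column belonging to a real eigenvalue is unchanged,
and no distinction of cases is needed. -/
theorem IsEigenFrame.exists_real_frame (hV : IsEigenFrame A lam V V' σ) {T : ℝ} {d : ℝ → Fin n → ℂ}
    (hd : ∀ k, ContinuousOn (fun t => d t k) (Ici T))
    (hσ : ∀ t ∈ Ici T, ∀ k, d t (σ k) = starRingEnd ℂ (d t k)) {E : ℝ → Matrix (Fin n) (Fin n) ℝ}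
    (hE : ∀ t ∈ Ici T, (E t).map (fun x : ℝ => (x : ℂ)) * V = V * Matrix.diagonal (d t)) :
    ∃ W : ℝ → Matrix (Fin n) (Fin n) ℝ, ∃ c : ℝ, c ≠ 0 ∧
      (∀ t ∈ Ici T, HasMatDeriv W
        (E t * W t - W t * Matrix.diagonal fun k => (d t k).re) (Ici T) t) ∧
      (∀ i j, (fun t => W t i j) =O[atTop] fun _ => (1 : ℝ)) ∧ ∀ t ∈ Ici T, (W t).det = c := by
  set θ : ℝ → Fin n → ℝ := fun t k => ∫ τ in T..t, (d τ k).im with hθ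
  set e : ℝ → Fin n → ℂ := fun t k => Complex.exp (Complex.I * θ t k) with he
  have him : ∀ k, ContinuousOn (fun t => (d t k).im) (Ici T) := fun k =>
    Complex.continuous_im.comp_continuousOn (hd k)
  have hθσ : ∀ t ∈ Ici T, ∀ k, θ t (σ k) = -θ t k := by
    intro t ht k
    simp only [hθ]
    rw [← intervalIntegral.integral_neg]
    refine intervalIntegral.integral_congr fun τ hτ => ?_
    rw [uIcc_of_le ht] at hτ
    simp only [hσ τ hτ.1 k, Complex.conj_im]
  have heσ : ∀ t ∈ Ici T, ∀ k, e t (σ k) = starRingEnd ℂ (e t k) := by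
    intro t ht k
    simp only [he, hθσ t ht k, ← Complex.exp_conj, map_mul, Complex.conj_I, Complex.conj_ofReal]
    congr 1
    push_cast
    ring
  have hed : ∀ t ∈ Ici T, ∀ k, HasDerivWithinAt (fun t => e t k)
      (Complex.I * (d t k).im * e t k) (Ici T) t := by
    intro t ht k
    have h1 := (hasDerivWithinAt_primitive_Ici (him k) ht).ofReal_comp
    refine ((h1.const_mul Complex.I).cexp).congr_deriv ?_
    simp only [he, hθ]
    ring
  set W : ℝ → Matrix (Fin n) (Fin n) ℝ := fun t =>
    Matrix.of fun i k => ((1 + Complex.I) * V i k * e t k).re with hW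
  have hWV : ∀ t ∈ Ici T, (W t).map (fun x : ℝ => (x : ℂ)) =
      V * Matrix.diagonal (e t) * realifier σ := by
    intro t ht
    ext i k
    rw [mul_diagonal_mul_apply]
    have h1 : ∀ j, V i j * e t j * realifier σ j k = (1 / 2 * (1 + Complex.I)) *
        (if j = k then V i j * e t j else 0) + (1 / 2 * (1 - Complex.I)) *
        (if j = σ k then V i j * e t j else 0) := by
      intro j
      simp only [realifier, Matrix.smul_apply, Matrix.add_apply, Matrix.of_apply, smul_eq_mul,
        Matrix.one_apply]
      split_ifs <;> ring
    rw [Finset.sum_congr rfl fun j _ => h1 j, Finset.sum_add_distrib, ← Finset.mul_sum,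
      ← Finset.mul_sum, Finset.sum_ite_eq' Finset.univ k, Finset.sum_ite_eq' Finset.univ (σ k),
      if_pos (Finset.mem_univ _), if_pos (Finset.mem_univ _), hV.conj_col, heσ t ht, Matrix.map_apply]
    simp only [hW, Matrix.of_apply]
    rw [Complex.re_eq_add_conj]
    simp only [map_mul, map_add, map_one, Complex.conj_I]
    ring
  have hdet : ∀ t ∈ Ici T, (((W t).det : ℝ) : ℂ) = V.det * (realifier σ).det := by
    intro t ht
    have h1 : (((W t).det : ℝ) : ℂ) = ((W t).map (fun x : ℝ => (x : ℂ))).det :=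
      RingHom.map_det Complex.ofRealHom (W t)
    -- The phases of conjugate indices are opposite, so the total phase vanishes and the determinant
    -- is constant.
    have h2 : ∑ k, θ t k = 0 := by
      have := Equiv.sum_comp σ (θ t)
      rw [Finset.sum_congr rfl fun k _ => hθσ t ht k, Finset.sum_neg_distrib] at this
      linarith
    have h3 : ∏ k, e t k = 1 := by
      simp only [he]
      rw [← Complex.exp_sum, ← Finset.mul_sum, ← Complex.ofReal_sum, h2]
      simp
    rw [h1, hWV t ht, Matrix.det_mul, Matrix.det_mul, Matrix.det_diagonal, h3, mul_one]
  have hVdet : V.det ≠ 0 := left_ne_zero_of_mul_eq_one (b := V'.det) (by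
    rw [← Matrix.det_mul, hV.mul_inv, Matrix.det_one])
  refine ⟨W, (V.det * (realifier σ).det).re, ?_, fun t ht i k => ?_, fun i k => ?_, fun t ht => ?_⟩
  · have h1 := hdet T self_mem_Ici
    rw [← h1, Complex.ofReal_re]
    intro h2
    rw [h2] at h1
    exact mul_ne_zero hVdet (det_realifier_ne_zero hV.invol) (by simpa using h1.symm)
  · have h1 := hasDerivWithinAt_re ((hed t ht k).const_mul ((1 + Complex.I) * V i k))
    refine h1.congr_deriv ?_
    have h2 : (E t * W t) i k = ((1 + Complex.I) * e t k * (V i k * d t k)).re := by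
      have h3 := congrFun (congrFun (hE t ht) i) k
      rw [Matrix.mul_diagonal] at h3
      rw [← h3, Matrix.mul_apply, Matrix.mul_apply, Finset.mul_sum, Complex.re_sum]
      refine Finset.sum_congr rfl fun j _ => ?_
      simp only [hW, Matrix.of_apply, Matrix.map_apply]
      rw [← Complex.re_ofReal_mul]
      congr 1
      ring
    rw [Matrix.sub_apply, h2, Matrix.mul_diagonal]
    simp only [hW, Matrix.of_apply]
    rw [← Complex.re_mul_ofReal, ← Complex.sub_re]
    congr 1
    have h4 := Complex.re_add_im (d t k)
    linear_combination ((1 + Complex.I) * V i k * e t k) * h4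
  · refine isBigO_one_of_bound (T := T) (C := ‖(1 + Complex.I) * V i k‖) fun t _ => ?_
    simp only [hW, Matrix.of_apply]
    refine (Complex.abs_re_le_norm _).trans ?_
    have h1 : ‖e t k‖ = 1 := by
      simp only [he]
      rw [mul_comm Complex.I, Complex.norm_exp_ofReal_mul_I]
    rw [norm_mul, h1, mul_one]
  · rw [← hdet t ht, Complex.ofReal_re]

end Phase

/-! ### Integrals of products of slowly varying and oscillating functions -/

/-- Dirichlet's test. -/
lemma exists_tendsto_integral_mul {T : ℝ} {u u' v : ℝ → ℝ}
    (hu : ∀ t ∈ Ici T, HasDerivWithinAt u (u' t) (Ici T) t) (hu' : ContinuousOn u' (Ici T))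
    (hui : IntegrableOn u' (Ici T)) (hu0 : Tendsto u atTop (𝓝 0)) (hv : ContinuousOn v (Ici T))
    {C : ℝ} (hC : ∀ t ∈ Ici T, |∫ τ in T..t, v τ| ≤ C) :
    ∃ z, Tendsto (fun t => ∫ τ in T..t, u τ * v τ) atTop (𝓝 z) := by
  set Φ : ℝ → ℝ := fun t => ∫ τ in T..t, v τ with hΦ
  have hΦc := continuousOn_primitive_Ici hv
  have huc : ContinuousOn u (Ici T) := fun t ht => (hu t ht).continuousWithinAt
  have hi : IntegrableOn (fun t => u' t * Φ t) (Ici T) :=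
    hui.mul_bdd (hΦc.aestronglyMeasurable measurableSet_Ici)
      ((ae_restrict_iff' measurableSet_Ici).2 (ae_of_all _ hC))
  have h1 := intervalIntegral_tendsto_integral_Ioi T (hi.mono_set Ioi_subset_Ici_self) tendsto_id
  have h2 : Tendsto (fun t => u t * Φ t) atTop (𝓝 0) := by
    have hO : Φ =O[atTop] fun _ => (1 : ℝ) := isBigO_one_of_bound hC
    have := (Asymptotics.isBigO_refl u atTop).mul hO
    simp only [mul_one] at this
    exact this.trans_tendsto hu0
  refine ⟨0 - ∫ t in Ioi T, u' t * Φ t, (h2.sub h1).congr' ?_⟩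
  filter_upwards [eventually_ge_atTop T] with t ht
  have hsub : uIcc T t ⊆ Ici T := by
    rw [uIcc_of_le ht]
    exact Icc_subset_Ici_self
  have h3 := intervalIntegral.integral_mul_deriv_eq_deriv_mul_of_hasDerivWithinAt
    (u := u) (v := Φ) (u' := u') (v' := v) (a := T) (b := t)
    (fun x hx => (hu x (hsub hx)).mono hsub)
    (fun x hx => (hasDerivWithinAt_primitive_Ici hv (hsub hx)).mono hsub)
    ((hu'.mono hsub).intervalIntegrable) ((hv.mono hsub).intervalIntegrable)
  rw [h3]
  simp [hΦ]


/-! ### The normal form of the linear part -/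

section NormalForm

variable {m n : ℕ} [NeZero m] {t₀ : ℝ} {ε : Fin m → ℝ → ℝ} {ϱ : Fin m → ℝ} {k : ℕ} {w T : ℝ}
  {K : Set (Ici t₀ → ℝ)}

/-- If ϱ_l > ρ_k, then ϱ_l ≥ ρ_{k+1} > w ϱ₁ and ε_l = O(ε₁^w) would be integrable. Hence ϱ_l ≤ ρ_k,
and the first derivative is among those that are controlled. -/
lemma IsSmallParam.isNegl_derivWithin (h : IsSmallParam t₀ ε ϱ k) (hw : 0 < w)
    (hεw : IntegrableOn (fun t => (ε 0 t) ^ w) (Ici t₀)) (hk1 : ϱ 0 * w < rho ϱ (k + 1))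
    (hder : ∀ l, ¬ IntegrableOn (ε l) (Ici t₀) →
      IntegrableOn (derivWithin (ε l) (Ici t₀)) (Ici t₀)) {l : Fin m}
    (hl : ¬ IntegrableOn (ε l) (Ici t₀)) :
    (∀ t ∈ Ici t₀, HasDerivWithinAt (ε l) (derivWithin (ε l) (Ici t₀) t) (Ici t₀) t) ∧
      IsNegl t₀ (derivWithin (ε l) (Ici t₀)) := by
  have hle : ϱ l ≤ rho ϱ k := by
    by_contra hlt
    have h1 : rho ϱ k < rank ϱ (Finsupp.single ((l, 0) : Fin m × ℕ) 1) := by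
      rw [rank_single]
      simpa using not_le.1 hlt
    have h2 := rho_succ_le_rank h.pos h.mono h1
    rw [rank_single] at h2
    simp only [Nat.cast_zero, add_zero, Nat.cast_one, mul_one] at h2
    refine hl (h.isNegl_of_isBigO hw hεw (h.continuousOn_eps l) ((h.eps_isBigO l).trans
      (h.isBigO_rpow ?_))).integrableOn
    rw [le_div_iff₀ (h.pos 0)]
    linarith
  have h0 : (0 : ℤ) ≤ ⌊rho ϱ k - ϱ l⌋ := Int.floor_nonneg.2 (by linarith)
  have hr : 0 + 1 ≤ (⌊rho ϱ k - ϱ l⌋ + 1).toNat := by omega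
  have h1 := h.continuousOn_iteratedDeriv l hr
  have h2 := h.isBigO l (0 + 1) hr
  simp only [zero_add, iteratedDerivWithin_one] at h1 h2
  refine ⟨fun t ht => ?_, h1, hder l hl, h2.trans (h.isBigO_one ?_)⟩
  · have := h.hasDerivWithinAt_iteratedDeriv l hr ht
    simpa only [zero_add, iteratedDerivWithin_zero, iteratedDerivWithin_one] using this
  · exact div_nonneg (add_nonneg (h.pos l).le (Nat.cast_nonneg _)) (h.pos 0).le

/-- The other factors are bounded, so one integrable factor would make the whole product integrable.
-/
lemma IsSmallParam.not_integrableOn_eps (h : IsSmallParam t₀ ε ϱ k) {P : Fin m → ℕ}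
    (hP : P ∈ nonIntegrableIdx t₀ w ε) {l : Fin m} (hl : P l ≠ 0) :
    ¬ IntegrableOn (ε l) (Ici t₀) := by
  intro hi
  have h1 : IsNegl t₀ (ε l) := ⟨h.continuousOn_eps l, hi, h.eps_isBigO_one l⟩
  refine (mem_nonIntegrableIdx.1 hP).2.2 ((h1.mul (h.continuousOn_mu (P - Pi.single l 1))
    (h.mu_isBigO_one _)).congr fun t _ => ?_).integrableOn
  rw [← mu_single (ε := ε) l t, ← mu_add]
  congr 1
  ext j
  by_cases hj : j = l
  · subst hj
    simp only [Pi.add_apply, Pi.sub_apply, Pi.single_eq_same]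
    omega
  · simp [hj]

/-- All factors that really occur are non-integrable, so their derivatives are integrable and the
product rule applies. This makes μ_℘ slowly varying, both in the change of variables and in
Dirichlet's test. -/
lemma IsSmallParam.exists_mu_deriv (h : IsSmallParam t₀ ε ϱ k) (hw : 0 < w)
    (hεw : IntegrableOn (fun t => (ε 0 t) ^ w) (Ici t₀)) (hk1 : ϱ 0 * w < rho ϱ (k + 1))
    (hder : ∀ l, ¬ IntegrableOn (ε l) (Ici t₀) →
      IntegrableOn (derivWithin (ε l) (Ici t₀)) (Ici t₀)) {P : Fin m → ℕ}
    (hP : P ∈ nonIntegrableIdx t₀ w ε) :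
    ∃ μ' : ℝ → ℝ, IsNegl t₀ μ' ∧
      ∀ t ∈ Ici t₀, HasDerivWithinAt (mu ε P) (μ' t) (Ici t₀) t := by
  classical
  have h1 : ∀ l, ∃ v : ℝ → ℝ, IsNegl t₀ v ∧
      ∀ t ∈ Ici t₀, HasDerivWithinAt (fun t => ε l t ^ P l) (v t) (Ici t₀) t := by
    intro l
    by_cases hl : P l = 0
    · refine ⟨fun _ => 0, isNegl_zero t₀, fun t _ => ?_⟩
      simp only [hl, pow_zero]
      exact hasDerivWithinAt_const t _ _
    · obtain ⟨h2, h3⟩ := h.isNegl_derivWithin hw hεw hk1 hder (h.not_integrableOn_eps hP hl)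
      refine ⟨_, h3.mul ((h.continuousOn_mu (Pi.single l (P l - 1))).const_smul (P l : ℝ))
        ((h.mu_isBigO_one _).const_mul_left _), fun t ht => ?_⟩
      refine ((h2 t ht).pow (P l)).congr_deriv ?_
      have : mu ε (Pi.single l (P l - 1)) t = ε l t ^ (P l - 1) := by
        rw [mu, Finset.prod_eq_single l]
        · simp
        · intro j _ hj
          simp [hj]
        · simp
      rw [Pi.smul_apply, this, smul_eq_mul]
      ring
  choose v hv hvd using h1
  refine ⟨fun t => ∑ l, v l t * ∏ j ∈ Finset.univ.erase l, ε j t ^ P j, IsNegl.sum _ fun l _ =>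
    (hv l).mul (continuousOn_finsetProd _ fun j _ => (h.continuousOn_eps j).pow _) ?_, fun t ht => ?_⟩
  · have := Asymptotics.IsBigO.finsetProd (l := atTop) (s := Finset.univ.erase l)
      (f := fun j t => ε j t ^ P j) (g := fun _ _ => (1 : ℝ) ^ P l) fun j _ => by
        have := (h.eps_isBigO_one j).pow (P j)
        simpa only [one_pow] using this
    simpa only [one_pow, Finset.prod_const_one] using this
  · refine (HasDerivWithinAt.fun_finsetProd (u := Finset.univ) fun l _ => hvd l t ht).congr_deriv
      (Finset.sum_congr rfl fun l _ => ?_)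
    rw [smul_eq_mul, mul_comm]

variable {A : Matrix (Fin n) (Fin n) ℝ} {lam : Fin n → ℂ} {V V' : Matrix (Fin n) (Fin n) ℂ}
  {σ : Equiv.Perm (Fin n)}

lemma inClass_matMul {Ω : Set ℂ} (hK : IsClassK1 Ω K) {X Y : ℝ → Matrix (Fin n) (Fin n) ℝ}
    (hX : ∀ i j, InClass K fun t => X t i j) (hY : ∀ i j, InClass K fun t => Y t i j) (i j : Fin n) :
    InClass K fun t => (X t * Y t) i j := by
  simp only [Matrix.mul_apply]
  exact hK.sum _ fun k _ => hK.mul (hX i k) (hY k j)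

/-- The coefficient at `μ_{℘₁ + ℘₂}` in the product of two expansions. -/
def crossTerm (V V' : Matrix (Fin n) (Fin n) ℂ)
    (B X G : (Fin m → ℕ) → ℝ → Matrix (Fin n) (Fin n) ℝ)
    (q : (Fin m → ℕ) × (Fin m → ℕ)) (t : ℝ) : Matrix (Fin n) (Fin n) ℝ :=
  B q.1 t * X q.2 t - X q.1 t * frameProj V V' (G q.2 t)

omit [NeZero m] in
lemma inClass_crossTerm {Ω : Set ℂ} (hK : IsClassK1 Ω K)
    {B X G : (Fin m → ℕ) → ℝ → Matrix (Fin n) (Fin n) ℝ} {q : (Fin m → ℕ) × (Fin m → ℕ)}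
    (hB : ∀ i j, InClass K fun t => B q.1 t i j) (hX : ∀ i j, InClass K fun t => X q.1 t i j)
    (hX' : ∀ i j, InClass K fun t => X q.2 t i j) (hG : ∀ i j, InClass K fun t => G q.2 t i j)
    (i j : Fin n) : InClass K fun t => crossTerm V V' B X G q t i j :=
  hK.sub (inClass_matMul hK hB hX' i j)
    (inClass_matMul hK hX (fun i j => inClass_frameProj hK hG i j) i j)

omit [NeZero m] in
/-- The recursive solution of the homological equations. -/
theorem exists_normal_form (hV : IsEigenFrame A lam V V' σ) (hK : IsClassK1 (eigenDiff lam) K)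
    {S : Finset (Fin m → ℕ)} (hS : ∀ P ∈ S, 1 ≤ ∑ l, P l)
    {B : (Fin m → ℕ) → ℝ → Matrix (Fin n) (Fin n) ℝ}
    (hB : ∀ P i j, InClass K fun t => B P t i j) :
    ∃ X G : (Fin m → ℕ) → ℝ → Matrix (Fin n) (Fin n) ℝ,
      (∀ P i j, InClass K fun t => X P t i j) ∧ (∀ P i j, InClass K fun t => G P t i j) ∧
      (∀ P t, G P t = B P t +
        ∑ q ∈ (S ×ˢ S).filter fun q => q.1 + q.2 = P, crossTerm V V' B X G q t) ∧
      ∀ P, ∀ t ∈ Ici t₀, HasMatDeriv (X P)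
        (A * X P t - X P t * A + G P t - frameProj V V' (G P t)) (Ici t₀) t := by
  -- Every index in S has positive order, so a sum of two of them has larger order than each: the
  -- homological equations can be solved recursively along |℘|.
  have hlt : ∀ P, ∀ q ∈ (S ×ˢ S).filter (fun q => q.1 + q.2 = P),
      ∑ l, q.1 l < ∑ l, P l ∧ ∑ l, q.2 l < ∑ l, P l := by
    intro P q hq
    rw [Finset.mem_filter, Finset.mem_product] at hq
    have h1 := hS _ hq.1.1
    have h2 := hS _ hq.1.2
    have h3 : ∑ l, q.1 l + ∑ l, q.2 l = ∑ l, P l := by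
      rw [← hq.2, ← Finset.sum_add_distrib]
      rfl
    omega
  let Good : (Fin m → ℕ) →
      ((Fin m → ℕ) → (ℝ → Matrix (Fin n) (Fin n) ℝ) × (ℝ → Matrix (Fin n) (Fin n) ℝ)) →
      (ℝ → Matrix (Fin n) (Fin n) ℝ) × (ℝ → Matrix (Fin n) (Fin n) ℝ) → Prop := fun P Y y =>
    (∀ i j, InClass K fun t => y.1 t i j) ∧ (∀ i j, InClass K fun t => y.2 t i j) ∧
      (∀ t, y.2 t = B P t + ∑ q ∈ (S ×ˢ S).filter fun q => q.1 + q.2 = P,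
        crossTerm V V' B (fun P => (Y P).1) (fun P => (Y P).2) q t) ∧
      ∀ t ∈ Ici t₀, HasMatDeriv y.1
        (A * y.1 t - y.1 t * A + y.2 t - frameProj V V' (y.2 t)) (Ici t₀) t
  suffices hY : ∃ Y, ∀ P, Good P Y (Y P) by
    obtain ⟨Y, hY⟩ := hY
    exact ⟨fun P => (Y P).1, fun P => (Y P).2, fun P => (hY P).1, fun P => (hY P).2.1,
      fun P => (hY P).2.2.1, fun P => (hY P).2.2.2⟩
  refine exists_rec_choice (fun P : Fin m → ℕ => ∑ l, P l) Good ?_ ?_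
  · rintro P Y Y' y hYY ⟨h1, h2, h3, h4⟩
    refine ⟨h1, h2, fun t => (h3 t).trans ?_, h4⟩
    congr 1
    refine Finset.sum_congr rfl fun q hq => ?_
    simp only [crossTerm, hYY _ (hlt P q hq).1, hYY _ (hlt P q hq).2]
  · intro P Y hY
    set G : ℝ → Matrix (Fin n) (Fin n) ℝ := fun t =>
      B P t + ∑ q ∈ (S ×ˢ S).filter fun q => q.1 + q.2 = P,
        crossTerm V V' B (fun P => (Y P).1) (fun P => (Y P).2) q t with hG
    have hGK : ∀ i j, InClass K fun t => G t i j := by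
      intro i j
      simp only [hG, Matrix.add_apply, Matrix.sum_apply]
      exact hK.add (hB P i j) (hK.sum _ fun q hq => inClass_crossTerm hK (hB _)
        (hY _ (hlt P q hq).1).1 (hY _ (hlt P q hq).2).1 (hY _ (hlt P q hq).2).2.1 i j)
    obtain ⟨X, hX1, hX2⟩ := exists_homological hV hK hGK
    exact ⟨(X, G), hX1, hGK, fun t => rfl, hX2⟩

/-- Under the transformation with the matrix `1 + ∑ μ_℘ X_℘` the linear part takes, up to
a negligible matrix, the form `A + ∑ μ_℘ D_℘` with matrices that are diagonal in the frame. -/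
theorem IsSmallParam.exists_approximate (h : IsSmallParam t₀ ε ϱ k) (hw : 0 < w)
    (hεw : IntegrableOn (fun t => (ε 0 t) ^ w) (Ici t₀)) (hk1 : ϱ 0 * w < rho ϱ (k + 1))
    (hder : ∀ l, ¬ IntegrableOn (ε l) (Ici t₀) →
      IntegrableOn (derivWithin (ε l) (Ici t₀)) (Ici t₀))
    (hV : IsEigenFrame A lam V V' σ) (hK : IsClassK1 (eigenDiff lam) K) (hT : t₀ ≤ T)
    {Ahat : ℝ → Matrix (Fin n) (Fin n) ℝ} (hA : ∀ i j, IsAdm K w ε T fun t => Ahat t i j - A i j) :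
    ∃ G : (Fin m → ℕ) → ℝ → Matrix (Fin n) (Fin n) ℝ, (∀ P i j, InClass K fun t => G P t i j) ∧
      ∃ X N : ℝ → Matrix (Fin n) (Fin n) ℝ, (∀ i j, IsNegl T fun t => N t i j) ∧
        Tendsto X atTop (𝓝 1) ∧ ∀ t ∈ Ici T, HasMatDeriv X (Ahat t * X t - X t *
          (A + ∑ P ∈ nonIntegrableIdx t₀ w ε, mu ε P t • frameProj V V' (G P t)) - N t) (Ici T) t := by
  classical
  set S := nonIntegrableIdx t₀ w ε with hS
  have hS1 : ∀ P ∈ S, 1 ≤ ∑ l, P l := fun P hP => (mem_nonIntegrableIdx.1 hP).1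
  have hsub : Ici T ⊆ Ici t₀ := Ici_subset_Ici.2 hT
  choose b hb hR using hA
  set B : (Fin m → ℕ) → ℝ → Matrix (Fin n) (Fin n) ℝ := fun P t =>
    Matrix.of fun i j => b i j P t with hB
  obtain ⟨X, G, hX, hG, hGeq, hXd⟩ := exists_normal_form hV hK hS1 (B := B) fun P i j => hb i j P
  choose! μ' hμ'n hμ' using fun P hP => h.exists_mu_deriv hw hεw hk1 hder (P := P) hP
  set R : ℝ → Matrix (Fin n) (Fin n) ℝ := fun t => Ahat t - A - ∑ P ∈ S, mu ε P t • B P t with hRdef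
  have hRn : ∀ i j, IsNegl T fun t => R t i j := fun i j => (hR i j).congr fun t _ => by
    simp only [hRdef, Matrix.sub_apply, Matrix.sum_apply, Matrix.smul_apply, smul_eq_mul, hB,
      Matrix.of_apply, hS]
  set x : ℝ → Matrix (Fin n) (Fin n) ℝ := fun t => ∑ P ∈ S, mu ε P t • X P t with hx
  set c : ℝ → Matrix (Fin n) (Fin n) ℝ := fun t => ∑ q ∈ (S ×ˢ S).filter fun q => q.1 + q.2 ∉ S,
    mu ε (q.1 + q.2) t • crossTerm V V' B X G q t with hc
  -- The total error: products of leading terms that fall outside S, the integrable part R of the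
  -- coefficient matrix, and the derivatives of the μ_℘.
  set N : ℝ → Matrix (Fin n) (Fin n) ℝ := fun t =>
    c t + R t * (1 + x t) - ∑ P ∈ S, μ' P t • X P t with hN
  have hxc : ∀ i j, ContinuousOn (fun t => x t i j) (Ici T) := fun i j => by
    simp only [hx, Matrix.sum_apply, Matrix.smul_apply, smul_eq_mul]
    exact continuousOn_finsetSum _ fun P _ =>
      ((h.continuousOn_mu P).mul (hK.continuousOn (hX P i j))).mono hsub
  have hx0 : ∀ i j, Tendsto (fun t => x t i j) atTop (𝓝 0) := fun i j => by
    simp only [hx, Matrix.sum_apply, Matrix.smul_apply, smul_eq_mul]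
    rw [← Finset.sum_const_zero (ι := Fin m → ℕ) (s := S)]
    refine tendsto_finsetSum _ fun P hP => ?_
    exact (isBigO_mul_one (Asymptotics.isBigO_refl (mu ε P) atTop)
      (hK.isBigO_one (hX P i j))).trans_tendsto (h.mu_tendsto (hS1 P hP))
  have hNn : ∀ i j, IsNegl T fun t => N t i j := by
    intro i j
    have h1 : IsNegl T fun t => c t i j := by
      simp only [hc, Matrix.sum_apply, Matrix.smul_apply, smul_eq_mul]
      refine IsNegl.sum _ fun q hq => ?_
      rw [Finset.mem_filter, Finset.mem_product] at hq
      have hK' := inClass_crossTerm (V := V) (V' := V') (q := q) hK (B := B) (hb · · q.1)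
        (hX q.1) (hX q.2) (hG q.2) i j
      refine ((h.isNegl_mu hw hεw ?_ hq.2).mul (hK.continuousOn hK') (hK.isBigO_one hK')).mono hT
      have := hS1 _ hq.1.1
      simp only [Pi.add_apply, Finset.sum_add_distrib]
      omega
    have h2 : IsNegl T fun t => (R t * (1 + x t)) i j := by
      simp only [Matrix.mul_apply, Matrix.add_apply]
      exact IsNegl.sum _ fun l _ => (hRn i l).mul (continuousOn_const.add (hxc l j))
        (((hx0 l j).const_add _).isBigO_one ℝ)
    have h3 : IsNegl T fun t => (∑ P ∈ S, μ' P t • X P t) i j := by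
      simp only [Matrix.sum_apply, Matrix.smul_apply, smul_eq_mul]
      exact IsNegl.sum _ fun P hP => ((hμ'n P hP).mul (hK.continuousOn (hX P i j))
        (hK.isBigO_one (hX P i j))).mono hT
    refine ((h1.add h2).add (h3.const_mul (-1))).congr fun t _ => ?_
    simp only [hN, Matrix.sub_apply, Matrix.add_apply]
    ring
  refine ⟨G, hG, fun t => 1 + x t, N, hNn, ?_, fun t ht => ?_⟩
  · refine tendsto_pi_nhds.2 fun i => tendsto_pi_nhds.2 fun j => ?_
    have := (hx0 i j).const_add ((1 : Matrix (Fin n) (Fin n) ℝ) i j)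
    rwa [add_zero] at this
  · have hd := (hasMatDeriv_const (s := Ici T) (t := t) (1 : Matrix (Fin n) (Fin n) ℝ)).add
      (HasMatDeriv.sum S fun P hP => (HasMatDeriv.smul ((hμ' P hP t (hsub ht)).mono hsub)
        ((hXd P t (hsub ht)).mono hsub)))
    refine hd.congr_deriv ?_
    -- The corrections in G_℘ are exactly the cross terms whose index sum is ℘. They compensate in
    -- `e2` the products that remain inside S.
    have e1 : ∑ P ∈ S, mu ε P t • G P t = ∑ P ∈ S, mu ε P t • B P t +
        ∑ q ∈ (S ×ˢ S).filter fun q => q.1 + q.2 ∈ S,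
          mu ε (q.1 + q.2) t • crossTerm V V' B X G q t := by
      rw [← Finset.sum_fiberwise_of_maps_to
        (g := fun q : (Fin m → ℕ) × (Fin m → ℕ) => q.1 + q.2) (t := S)
        fun q hq => (Finset.mem_filter.1 hq).2, ← Finset.sum_add_distrib]
      refine Finset.sum_congr rfl fun P hP => ?_
      rw [hGeq P t, smul_add, Finset.smul_sum]
      congr 1
      refine Finset.sum_congr ?_ fun q hq => by rw [(Finset.mem_filter.1 hq).2]
      ext q
      simp only [Finset.mem_filter]
      constructor
      · exact fun hq => ⟨⟨hq.1, hq.2 ▸ hP⟩, hq.2⟩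
      · exact fun hq => ⟨hq.1.1, hq.2⟩
    have e2 : (∑ P ∈ S, mu ε P t • B P t) * x t -
        x t * ∑ P ∈ S, mu ε P t • frameProj V V' (G P t) =
        ∑ q ∈ (S ×ˢ S).filter (fun q => q.1 + q.2 ∈ S),
          mu ε (q.1 + q.2) t • crossTerm V V' B X G q t + c t := by
      rw [hc, Finset.sum_filter_add_sum_filter_not, hx]
      simp only
      rw [Finset.sum_mul_sum, Finset.sum_mul_sum, ← Finset.sum_product', ← Finset.sum_product',
        ← Finset.sum_sub_distrib]
      refine Finset.sum_congr rfl fun q _ => ?_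
      simp only [crossTerm, mu_add, smul_sub, Matrix.smul_mul, Matrix.mul_smul, smul_smul]
      rw [mul_comm (mu ε q.2 t)]
    have e3 : Ahat t = A + ∑ P ∈ S, mu ε P t • B P t + R t := by
      simp only [hRdef]
      abel
    have e4 : ∑ P ∈ S, mu ε P t • (A * X P t - X P t * A + G P t - frameProj V V' (G P t)) =
        A * x t - x t * A + ∑ P ∈ S, mu ε P t • G P t -
          ∑ P ∈ S, mu ε P t • frameProj V V' (G P t) := by
      simp only [hx, smul_sub, smul_add, Finset.sum_sub_distrib, Finset.sum_add_distrib,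
        Finset.mul_sum, Finset.sum_mul, Matrix.mul_smul, Matrix.smul_mul]
    rw [Finset.sum_add_distrib, e4, e1, e3]
    simp only [hN]
    set b' := ∑ P ∈ S, mu ε P t • B P t
    set δ' := ∑ P ∈ S, mu ε P t • frameProj V V' (G P t)
    rw [sub_eq_iff_eq_add] at e2
    simp only [Matrix.add_mul, Matrix.mul_add, Matrix.one_mul, Matrix.mul_one, e2]
    abel

end NormalForm


/-! ### Existence of the diagonal form -/

/-- Continuous functions on `[T, ∞)` with a convergent improper integral. -/
def HasImproperIntegral (T : ℝ) (v : ℝ → ℝ) : Prop :=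
  ContinuousOn v (Ici T) ∧ ∃ z, Tendsto (fun t => ∫ τ in T..t, v τ) atTop (𝓝 z)

section Improper

variable {T : ℝ} {u v : ℝ → ℝ}

lemma HasImproperIntegral.add (hu : HasImproperIntegral T u) (hv : HasImproperIntegral T v) :
    HasImproperIntegral T fun t => u t + v t := by
  obtain ⟨hu, z, hz⟩ := hu
  obtain ⟨hv, z', hz'⟩ := hv
  refine ⟨hu.add hv, z + z', (hz.add hz').congr' ?_⟩
  filter_upwards [eventually_ge_atTop T] with t ht
  rw [intervalIntegral.integral_add (hu.intervalIntegrable_of_Ici le_rfl ht)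
    (hv.intervalIntegrable_of_Ici le_rfl ht)]

lemma HasImproperIntegral.neg (hu : HasImproperIntegral T u) :
    HasImproperIntegral T fun t => -u t := by
  obtain ⟨hu, z, hz⟩ := hu
  refine ⟨hu.neg, -z, ?_⟩
  simpa only [intervalIntegral.integral_neg] using hz.neg

lemma HasImproperIntegral.sum {ι : Type*} (s : Finset ι) {v : ι → ℝ → ℝ}
    (hv : ∀ i ∈ s, HasImproperIntegral T (v i)) : HasImproperIntegral T fun t => ∑ i ∈ s, v i t := by
  classical
  induction s using Finset.induction_on with
  | empty => exact ⟨by simpa using continuousOn_const, 0, by simp⟩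
  | insert i s hi ih =>
    simp only [Finset.sum_insert hi]
    exact (hv i (Finset.mem_insert_self _ _)).add
      (ih fun j hj => hv j (Finset.mem_insert_of_mem hj))

lemma HasImproperIntegral.mono (hu : HasImproperIntegral T u) {T' : ℝ} (hT : T ≤ T') :
    HasImproperIntegral T' u := by
  obtain ⟨hu, z, hz⟩ := hu
  refine ⟨hu.mono (Ici_subset_Ici.2 hT), z - ∫ τ in T..T', u τ, (hz.sub_const _).congr' ?_⟩
  filter_upwards [eventually_ge_atTop T'] with t ht
  rw [← intervalIntegral.integral_add_adjacent_intervals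
    (hu.intervalIntegrable_of_Ici le_rfl hT) (hu.intervalIntegrable_of_Ici hT (hT.trans ht))]
  ring

lemma HasImproperIntegral.congr (hu : HasImproperIntegral T u) (e : ∀ t ∈ Ici T, v t = u t) :
    HasImproperIntegral T v := by
  obtain ⟨hu, z, hz⟩ := hu
  refine ⟨hu.congr e, z, hz.congr' ?_⟩
  filter_upwards [eventually_ge_atTop T] with t ht
  refine intervalIntegral.integral_congr fun τ hτ => ?_
  rw [uIcc_of_le ht] at hτ
  exact (e τ hτ.1).symm

lemma exists_tendsto_integral_complex {g : ℝ → ℂ} (hre : HasImproperIntegral T fun t => (g t).re)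
    (him : HasImproperIntegral T fun t => (g t).im) :
    ContinuousOn g (Ici T) ∧ ∃ z, Tendsto (fun t => ∫ τ in T..t, g τ) atTop (𝓝 z) := by
  have e : ∀ t, g t = (((g t).re : ℝ) : ℂ) + ((g t).im : ℝ) * Complex.I := fun t =>
    (Complex.re_add_im (g t)).symm
  obtain ⟨hr, z, hz⟩ := hre
  obtain ⟨hi, z', hz'⟩ := him
  have hrc : ContinuousOn (fun t => ((g t).re : ℂ)) (Ici T) :=
    Complex.continuous_ofReal.comp_continuousOn hr
  have hic : ContinuousOn (fun t => ((g t).im : ℂ) * Complex.I) (Ici T) := (Complex.continuous_ofReal.comp_continuousOn hi).mul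
    (continuousOn_const (c := Complex.I))
  refine ⟨(hrc.add hic).congr fun t _ => e t, (z : ℂ) + z' * Complex.I, ?_⟩
  have h1 := ((Complex.continuous_ofReal.tendsto z).comp hz).add
    (((Complex.continuous_ofReal.tendsto z').comp hz').mul_const Complex.I)
  refine h1.congr' ?_
  filter_upwards [eventually_ge_atTop T] with t ht
  have hs : uIcc T t ⊆ Ici T := by
    rw [uIcc_of_le ht]
    exact Icc_subset_Ici_self
  rw [intervalIntegral.integral_congr fun τ _ => e τ, intervalIntegral.integral_add
    (hrc.mono hs).intervalIntegrable (hic.mono hs).intervalIntegrable,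
    intervalIntegral.integral_mul_const, Function.comp_apply, Function.comp_apply,
    intervalIntegral.integral_ofReal, intervalIntegral.integral_ofReal]

end Improper

/-! ### Reduction of the linear part to diagonal form -/

section Reduction

variable {m n : ℕ} [NeZero m] {t₀ : ℝ} {ε : Fin m → ℝ → ℝ} {ϱ : Fin m → ℝ} {k : ℕ} {w T : ℝ}
  {K : Set (Ici t₀ → ℝ)} {A : Matrix (Fin n) (Fin n) ℝ} {lam : Fin n → ℂ}
  {V V' : Matrix (Fin n) (Fin n) ℂ} {σ : Equiv.Perm (Fin n)}

/-- M is the mean value of f. Then f - M has a bounded primitive, and μ_℘ tends to 0 with integrable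
derivative, so Dirichlet's test applies. M does not depend on ℘. -/
lemma IsSmallParam.hasImproperIntegral_mu_mul (h : IsSmallParam t₀ ε ϱ k) (hw : 0 < w)
    (hεw : IntegrableOn (fun t => (ε 0 t) ^ w) (Ici t₀)) (hk1 : ϱ 0 * w < rho ϱ (k + 1))
    (hder : ∀ l, ¬ IntegrableOn (ε l) (Ici t₀) →
      IntegrableOn (derivWithin (ε l) (Ici t₀)) (Ici t₀)) {Ω : Set ℂ} (hK : IsClassK2 Ω K)
    {f : ℝ → ℝ} (hf : InClass K f) : ∃ M, ∀ P ∈ nonIntegrableIdx t₀ w ε,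
      HasImproperIntegral t₀ fun t => mu ε P t * (f t - M) := by
  obtain ⟨M, -, C, hC⟩ := hK.mean f hf
  have hv := (hK.toIsClassK1.continuousOn hf).sub (continuousOn_const (c := M))
  refine ⟨M, fun P hP => ⟨(h.continuousOn_mu P).mul hv, ?_⟩⟩
  obtain ⟨μ', hμ'n, hμ'⟩ := h.exists_mu_deriv hw hεw hk1 hder hP
  exact exists_tendsto_integral_mul hμ' hμ'n.continuousOn hμ'n.integrableOn
    (h.mu_tendsto (mem_nonIntegrableIdx.1 hP).1) hv hC

/-- A real function that is constant up to slowly varying terms does not change its sign. -/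
lemma IsSmallParam.eventually_sign (h : IsSmallParam t₀ ε ϱ k) {c b : ℝ} {u : ℝ → ℝ}
    {g : (Fin m → ℕ) → ℝ} (hu : c = 0 ∨ Tendsto u atTop (𝓝 0))
    (hsign : ∀ (c : ℝ) (g : (Fin m → ℕ) → ℝ),
      (∀ᶠ t in atTop, 0 ≤ c * u t + ∑ P ∈ nonIntegrableIdx t₀ w ε, g P * mu ε P t) ∨
      (∀ᶠ t in atTop, c * u t + ∑ P ∈ nonIntegrableIdx t₀ w ε, g P * mu ε P t ≤ 0)) :
    (∀ᶠ t in atTop, 0 ≤ b + (c * u t + ∑ P ∈ nonIntegrableIdx t₀ w ε, g P * mu ε P t)) ∨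
      ∀ᶠ t in atTop, b + (c * u t + ∑ P ∈ nonIntegrableIdx t₀ w ε, g P * mu ε P t) ≤ 0 := by
  have hlim : Tendsto (fun t => b + (c * u t + ∑ P ∈ nonIntegrableIdx t₀ w ε, g P * mu ε P t))
      atTop (𝓝 (b + (c * 0 + ∑ P ∈ nonIntegrableIdx t₀ w ε, g P * 0))) := by
    refine ((Tendsto.add ?_ (tendsto_finsetSum _ fun P hP =>
      (h.mu_tendsto (mem_nonIntegrableIdx.1 hP).1).const_mul _))).const_add b
    rcases hu with rfl | hu
    · simp
    · exact hu.const_mul c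
  simp only [mul_zero, Finset.sum_const_zero, add_zero] at hlim
  rcases lt_trichotomy b 0 with hb | rfl | hb
  · exact Or.inr ((hlim.eventually (gt_mem_nhds hb)).mono fun _ => le_of_lt)
  · simpa only [zero_add] using hsign c g
  · exact Or.inl ((hlim.eventually (lt_mem_nhds hb)).mono fun _ => le_of_lt)

lemma contDiffOn_one_of_hasDerivWithinAt {f f' : ℝ → ℝ}
    (hf : ∀ t ∈ Ici T, HasDerivWithinAt f (f' t) (Ici T) t) (hf' : ContinuousOn f' (Ici T)) :
    ContDiffOn ℝ 1 f (Ici T) := by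
  rw [contDiffOn_one_iff_derivWithin (uniqueDiffOn_Ici T)]
  exact ⟨fun t ht => (hf t ht).differentiableWithinAt, hf'.congr fun t ht =>
    (hf t ht).derivWithin (uniqueDiffOn_Ici T t ht)⟩

/-- Three transformations are composed: the normal form 1 + ∑ μ_℘ X_℘, the rotating real frame W of
the matrix A + ∑ μ_℘ D_℘, which has the fixed eigenvectors V, and the Levinson correction of X W,
whose error N W is still integrable. The determinant inherits a nonzero limit because the first and
the last factor tend to 1 and det W is constant. -/
theorem IsSmallParam.exists_isDiagReduction (h : IsSmallParam t₀ ε ϱ k) (hw : 0 < w)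
    (hεw : IntegrableOn (fun t => (ε 0 t) ^ w) (Ici t₀)) (hk1 : ϱ 0 * w < rho ϱ (k + 1))
    (hder : ∀ l, ¬ IntegrableOn (ε l) (Ici t₀) →
      IntegrableOn (derivWithin (ε l) (Ici t₀)) (Ici t₀))
    {u : ℝ → ℝ} (hsign : ∀ (c : ℝ) (g : (Fin m → ℕ) → ℝ),
      (∀ᶠ t in atTop, 0 ≤ c * u t + ∑ P ∈ nonIntegrableIdx t₀ w ε, g P * mu ε P t) ∨
      (∀ᶠ t in atTop, c * u t + ∑ P ∈ nonIntegrableIdx t₀ w ε, g P * mu ε P t ≤ 0))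
    (hV : IsEigenFrame A lam V V' σ) (hK : IsClassK2 (eigenDiff lam) K) (hT : t₀ ≤ T)
    {Ahat : ℝ → Matrix (Fin n) (Fin n) ℝ} (hA : ∀ i j, IsAdm K w ε T fun t => Ahat t i j - A i j) :
    ∃ T₁ ∈ Ici T, ∀ T' ∈ Ici T₁, ∃ Q γ ς,
      IsDiagReduction T' Ahat lam ε (nonIntegrableIdx t₀ w ε) Q γ ς := by
  have hK1 := hK.toIsClassK1
  obtain ⟨G, hG, X, N, hN, hX, hXd⟩ := h.exists_approximate hw hεw hk1 hder hV hK1 hT hA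
  set S := nonIntegrableIdx t₀ w ε with hS
  have hsub : Ici T ⊆ Ici t₀ := Ici_subset_Ici.2 hT
  have hδ : ∀ P j, InClassC K fun t => frameDiag V V' (G P t) j := fun P j =>
    inClassC_frame hK1 (hG P) V' V j j
  choose Mre hMre using fun P j =>
    h.hasImproperIntegral_mu_mul hw hεw hk1 hder hK (hδ P j).1
  choose Mim hMim using fun P j =>
    h.hasImproperIntegral_mu_mul hw hεw hk1 hder hK (hδ P j).2
  -- The constants are the mean values of the diagonal coefficients; the deviations, multiplied by
  -- μ_℘, are collected in ς.
  set γ : Fin n → (Fin m → ℕ) → ℂ := fun j P => ⟨Mre P j, Mim P j⟩ with hγ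
  set ς : Fin n → ℝ → ℂ := fun j t =>
    ∑ P ∈ S, (mu ε P t : ℂ) * (frameDiag V V' (G P t) j - γ j P) with hς
  have hςre : ∀ j, HasImproperIntegral t₀ fun t => (ς j t).re := fun j => by
    refine (HasImproperIntegral.sum S fun P hP => hMre P j P hP).congr fun t _ => ?_
    simp [hς, hγ]
  have hςim : ∀ j, HasImproperIntegral t₀ fun t => (ς j t).im := fun j => by
    refine (HasImproperIntegral.sum S fun P hP => hMim P j P hP).congr fun t _ => ?_
    simp [hς, hγ]
  set d : ℝ → Fin n → ℂ := fun t j => diagEntry lam ε S γ ς j t with hd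
  have hd' : ∀ t j, d t j = lam j + ∑ P ∈ S, (mu ε P t : ℂ) * frameDiag V V' (G P t) j := by
    intro t j
    simp only [hd, diagEntry, hς, add_assoc, ← Finset.sum_add_distrib]
    congr 1
    refine Finset.sum_congr rfl fun P _ => ?_
    ring
  have hdc : ∀ j, ContinuousOn (fun t => d t j) (Ici T) := fun j => by
    have h1 := (exists_tendsto_integral_complex (hςre j) (hςim j)).1
    simp only [hd, diagEntry]
    exact ((continuousOn_const.add (continuousOn_finsetSum _ fun P _ => continuousOn_const.mul
      (Complex.continuous_ofReal.comp_continuousOn (h.continuousOn_mu P)))).add h1).mono hsub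
  have hdre : ∀ j, ContinuousOn (fun t => (d t j).re) (Ici T) := fun j =>
    Complex.continuous_re.comp_continuousOn (hdc j)
  have hdO : ∀ j, (fun t => (d t j).re) =O[atTop] fun _ => (1 : ℝ) := fun j => by
    have : (fun t => (d t j).re) = fun t => (lam j).re +
        ∑ P ∈ S, mu ε P t * (frameDiag V V' (G P t) j).re := by
      ext t
      simp [hd']
    rw [this]
    exact (Asymptotics.isBigO_const_const _ one_ne_zero _).add
      (Asymptotics.IsBigO.fun_sum fun P _ => isBigO_one_mul (h.mu_isBigO_one P)
        (hK1.isBigO_one (hδ P j).1))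
  have hdσ : ∀ t ∈ Ici T, ∀ j, d t (σ j) = starRingEnd ℂ (d t j) := fun t _ j => by
    simp only [hd', hV.conj_lam, hV.frameDiag_conj, map_add, map_sum, map_mul, Complex.conj_ofReal]
  have hE : ∀ t ∈ Ici T,
      (A + ∑ P ∈ S, mu ε P t • frameProj V V' (G P t)).map (fun x : ℝ => (x : ℂ)) * V =
        V * Matrix.diagonal (d t) := by
    intro t _
    have e1 : (A + ∑ P ∈ S, mu ε P t • frameProj V V' (G P t)).map (fun x : ℝ => (x : ℂ)) =
        A.map (fun x : ℝ => (x : ℂ)) + ∑ P ∈ S, (mu ε P t : ℂ) •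
          (frameProj V V' (G P t)).map (fun x : ℝ => (x : ℂ)) := by
      ext i j
      simp [Matrix.sum_apply]
    have e2 : Matrix.diagonal (d t) = Matrix.diagonal lam + ∑ P ∈ S, (mu ε P t : ℂ) •
        Matrix.diagonal (frameDiag V V' (G P t)) := by
      ext i j
      by_cases hij : i = j
      · subst hij
        simp [hd', Matrix.sum_apply]
      · simp [hij, Matrix.sum_apply]
    rw [e1, e2, Matrix.add_mul, Matrix.mul_add, hV.eigen, Finset.sum_mul, Finset.mul_sum]
    congr 1
    refine Finset.sum_congr rfl fun P _ => ?_
    rw [Matrix.smul_mul, Matrix.mul_smul, hV.frameProj_mul]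
  obtain ⟨W, c, hc, hWd, hWO, hWdet⟩ := hV.exists_real_frame hdc hdσ hE
  have hXO : ∀ i j, (fun t => X t i j) =O[atTop] fun _ => (1 : ℝ) := fun i j =>
    (((tendsto_pi_nhds.1 (tendsto_pi_nhds.1 hX i)) j)).isBigO_one ℝ
  have hWc := HasMatDeriv.continuousOn hWd
  have hWcij : ∀ i j, ContinuousOn (fun t => W t i j) (Ici T) := fun i j =>
    continuousOn_pi.1 (continuousOn_pi.1 hWc i) j
  obtain ⟨T₁, hT₁, Q, hQd, hQO, hQdet⟩ := exists_exact_of_approximate (T := T) (c := c) hc (E := Ahat)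
    (L := fun t => X t * W t) (N := fun t => N t * W t) (d := fun t j => (d t j).re) (fun t ht => by
      refine ((hXd t ht).mul (hWd t ht)).congr_deriv ?_
      noncomm_ring) (fun i j => by
      simp only [Matrix.mul_apply]
      exact Asymptotics.IsBigO.fun_sum fun l _ => isBigO_one_mul (hXO i l) (hWO l j)) (by
      have h1 := ((continuous_id.matrix_det).tendsto (1 : Matrix (Fin n) (Fin n) ℝ)).comp hX
      simp only [id, Matrix.det_one] at h1
      have h2 := h1.mul_const c
      rw [one_mul] at h2
      refine h2.congr' ?_
      filter_upwards [eventually_ge_atTop T] with t ht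
      rw [Matrix.det_mul, hWdet t ht]
      rfl) (fun i j => by
      simp only [Matrix.mul_apply]
      exact IsNegl.sum _ fun l _ => (hN i l).mul (hWcij l j) (hWO l j)) hdre (fun i j T₁ hT₁ => by
      have hTT : t₀ ≤ T₁ := hT.trans hT₁
      -- Up to ς_i - ς_j, the difference Re d_i - Re d_j is a constant plus a combination of the
      -- μ_℘. Its eventual sign comes from the sign hypothesis with coefficient 0 at ε₁'/ε₁.
      refine ⟨fun t => ((lam i).re - (lam j).re) + (0 * u t +
        ∑ P ∈ S, ((γ i P).re - (γ j P).re) * mu ε P t), ?_, h.eventually_sign (Or.inl rfl) hsign, ?_⟩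
      · simp only [zero_mul, zero_add]
        exact continuousOn_const.add (continuousOn_finsetSum _ fun P _ => continuousOn_const.mul
          ((h.continuousOn_mu P).mono (Ici_subset_Ici.2 hTT)))
      · refine ((((hςre i).add (hςre j).neg).mono hTT).congr fun t _ => ?_).2
        simp only [hd, diagEntry, Complex.add_re, Complex.re_sum, Complex.re_mul_ofReal, sub_mul,
          Finset.sum_sub_distrib]
        ring)
  have hTT : t₀ ≤ T₁ := hT.trans hT₁
  have hsub1 : Ici T₁ ⊆ Ici T := Ici_subset_Ici.2 hT₁
  have hQc := HasMatDeriv.continuousOn hQd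
  have hQcij : ∀ i j, ContinuousOn (fun t => Q t i j) (Ici T₁) := fun i j =>
    continuousOn_pi.1 (continuousOn_pi.1 hQc i) j
  have hAcij : ∀ i j, ContinuousOn (fun t => Ahat t i j) (Ici T) := fun i j =>
    (((hA i j).continuousOn h hK1 hT).add (continuousOn_const (c := A i j))).congr
      fun t _ => (sub_add_cancel _ _).symm
  have hAO : ∀ i j, (fun t => Ahat t i j) =O[atTop] fun _ => (1 : ℝ) := fun i j =>
    (((hA i j).isBigO_one h hK1).add (Asymptotics.isBigO_const_const (A i j) one_ne_zero _)).congr_left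
      fun t => sub_add_cancel _ _
  have hDc : ∀ i j, ContinuousOn (fun t => (Ahat t * Q t - Q t * Matrix.diagonal
      fun l => (d t l).re) i j) (Ici T₁) := fun i j => by
    simp only [Matrix.sub_apply, Matrix.mul_diagonal, Matrix.mul_apply (M := Ahat _)]
    exact (continuousOn_finsetSum _ fun l _ => ((hAcij i l).mono hsub1).mul (hQcij l j)).sub
      ((hQcij i j).mul ((hdre j).mono hsub1))
  have hDO : ∀ i j, (fun t => (Ahat t * Q t - Q t * Matrix.diagonal
      fun l => (d t l).re) i j) =O[atTop] fun _ => (1 : ℝ) := fun i j => by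
    simp only [Matrix.sub_apply, Matrix.mul_diagonal, Matrix.mul_apply (M := Ahat _)]
    exact (Asymptotics.IsBigO.fun_sum fun l _ => isBigO_one_mul (hAO i l) (hQO l j)).sub
      (isBigO_one_mul (hQO i j) (hdO j))
  obtain ⟨T₂, hT₂⟩ := eventually_atTop.1
    (hQdet.abs.eventually (lt_mem_nhds (half_lt_self (abs_pos.2 hc))))
  refine ⟨max T₁ T₂, le_trans hT₁ (le_max_left T₁ T₂), fun T' hT' => ⟨Q, γ, ς, ?_⟩⟩
  have hT1' : T₁ ≤ T' := le_trans (le_max_left T₁ T₂) hT'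
  have hsub2 : Ici T' ⊆ Ici T₁ := Ici_subset_Ici.2 hT1'
  have hred : ∀ t ∈ Ici T', ∀ i j, HasDerivWithinAt (fun τ => Q τ i j)
      ((Ahat t * Q t - Q t * Matrix.diagonal fun l => (d t l).re) i j) (Ici T') t :=
    fun t ht i j => (hQd t (hsub2 ht) i j).mono hsub2
  have hbd : ∀ g : ℝ → Fin n → Fin n → ℝ, (∀ i j, ContinuousOn (fun t => g t i j) (Ici T₁)) →
      (∀ i j, (fun t => g t i j) =O[atTop] fun _ => (1 : ℝ)) →
      ∃ C : ℝ, ∀ t ∈ Ici T', ∀ i j, |g t i j| ≤ C := by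
    intro g hg hgO
    choose C hC0 hC using fun i j => exists_abs_le_of_isBigO_one (hg i j) (hgO i j)
    exact ⟨∑ i, ∑ j, C i j, fun t ht i j => (hC i j t (hsub2 ht)).trans
      ((Finset.single_le_sum (f := fun j => C i j) (fun j _ => hC0 i j) (Finset.mem_univ j)).trans
        (Finset.single_le_sum (f := fun i => ∑ j, C i j)
          (fun i _ => Finset.sum_nonneg fun j _ => hC0 i j) (Finset.mem_univ i)))⟩
  refine ⟨⟨fun i j => contDiffOn_one_of_hasDerivWithinAt (fun t ht => hred t ht i j)
    ((hDc i j).mono hsub2), hbd _ hQcij hQO, ?_, |c| / 2, half_pos (abs_pos.2 hc), fun t ht =>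
    (hT₂ t (le_trans (le_max_right T₁ T₂) (le_trans hT' ht))).le⟩, ⟨c, hc, hQdet⟩, fun j => ?_,
    fun j => ?_, hred⟩
  · obtain ⟨C, hC⟩ := hbd _ hDc hDO
    refine ⟨C, fun t ht i j => ?_⟩
    rw [(hred t ht i j).derivWithin (uniqueDiffOn_Ici T' t ht)]
    exact hC t ht i j
  · exact (exists_tendsto_integral_complex ((hςre j).mono (hTT.trans hT1'))
      ((hςim j).mono (hTT.trans hT1'))).1
  · exact (exists_tendsto_integral_complex ((hςre j).mono (hTT.trans hT1'))
      ((hςim j).mono (hTT.trans hT1'))).2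

end Reduction


/-! ### Families of solutions of quasilinear systems -/

section Family

variable {n : ℕ}

lemma norm_mulVec_le {M : Matrix (Fin n) (Fin n) ℝ} {b : ℝ} (hb : 0 ≤ b) (hM : ∀ i j, |M i j| ≤ b)
    (v : Fin n → ℝ) : ‖M.mulVec v‖ ≤ n * b * ‖v‖ := by
  refine (pi_norm_le_iff_of_nonneg (by positivity)).2 fun i => ?_
  rw [Real.norm_eq_abs, Matrix.mulVec, dotProduct]
  refine (Finset.abs_sum_le_sum_abs _ _).trans ?_
  calc ∑ j, |M i j * v j| ≤ ∑ _j : Fin n, b * ‖v‖ := Finset.sum_le_sum fun j _ => by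
        rw [abs_mul]
        exact mul_le_mul (hM i j) (norm_le_pi_norm v j) (abs_nonneg _) hb
    _ = n * b * ‖v‖ := by
        rw [Finset.sum_const, Finset.card_univ, Fintype.card_fin, nsmul_eq_mul, mul_assoc]

open Classical in
/-- Parameters on a subset of the indices, extended by zero. -/
noncomputable def extendParam (J : Set (Fin n)) (c : Fin J.ncard → ℝ) (i : Fin n) : ℝ :=
  if hi : i ∈ J then c (Finite.equivFinOfCardEq (Nat.card_coe_set_eq J) ⟨i, hi⟩) else 0

lemma norm_extendParam_le (J : Set (Fin n)) (c : Fin J.ncard → ℝ) : ‖extendParam J c‖ ≤ ‖c‖ := by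
  refine (pi_norm_le_iff_of_nonneg (norm_nonneg c)).2 fun i => ?_
  by_cases hi : i ∈ J
  · rw [extendParam, dif_pos hi]
    exact norm_le_pi_norm c _
  · rw [extendParam, dif_neg hi, norm_zero]
    exact norm_nonneg c

lemma continuous_extendParam (J : Set (Fin n)) : Continuous (extendParam J) := by
  refine continuous_pi fun i => ?_
  by_cases hi : i ∈ J
  · simp only [extendParam, dif_pos hi]
    exact continuous_apply _
  · simp only [extendParam, dif_neg hi]
    exact continuous_const

lemma extendParam_injective {J : Set (Fin n)} {c c' : Fin J.ncard → ℝ}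
    (h : ∀ i ∈ J, extendParam J c i = extendParam J c' i) : c = c' := by
  ext x
  set y := (Finite.equivFinOfCardEq (Nat.card_coe_set_eq J)).symm x with hy
  have h1 := h y y.2
  have e : (Finite.equivFinOfCardEq (Nat.card_coe_set_eq J)) y = x := by
    rw [hy, Equiv.apply_symm_apply]
  simpa only [extendParam, dif_pos y.2, e] using h1

/-- Small solutions `r = α Q z` of `r' = E r + Ψ(t, r)`, where `r = Q x` reduces the linear part to
a diagonal form. -/
theorem exists_small_solution_family {T M b : ℝ} {α α' q g : ℝ → ℝ}
    {E Q R : ℝ → Matrix (Fin n) (Fin n) ℝ} {d : ℝ → Fin n → ℝ} {p : Fin n → ℝ → ℝ} {J : Set (Fin n)}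
    {Ψ : ℝ → (Fin n → ℝ) → Fin n → ℝ} (hα : ∀ t ∈ Ici T, 0 < α t)
    (hα' : ∀ t ∈ Ici T, HasDerivWithinAt α (α' t) (Ici T) t)
    (hQ : ∀ t ∈ Ici T, HasMatDeriv Q (E t * Q t - Q t * Matrix.diagonal (d t)) (Ici T) t)
    (hRc : ∀ i j, ContinuousOn (fun t => R t i j) (Ici T)) (hQR : ∀ t ∈ Ici T, Q t * R t = 1)
    (hb : 0 ≤ b) (hQb : ∀ t ∈ Ici T, ∀ i j, |Q t i j| ≤ b) (hRb : ∀ t ∈ Ici T, ∀ i j, |R t i j| ≤ b)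
    (hp : ∀ i, ContinuousOn (p i) (Ici T)) (hpd : ∀ t ∈ Ici T, ∀ i, p i t = d t i - α' t / α t)
    (hJ : ∀ i, HasDichotomy (p i) (i ∈ J) T M)
    (hΨc : ContinuousOn (fun x : ℝ × (Fin n → ℝ) => Ψ x.1 x.2)
      {x | T ≤ x.1 ∧ ‖x.2‖ ≤ n * b * α x.1})
    (hΨ : ∀ t ∈ Ici T, ∀ r r', ‖r‖ ≤ n * b * α t → ‖r'‖ ≤ n * b * α t →
      ‖Ψ t r - Ψ t r'‖ ≤ q t * ‖r - r'‖) (hq : ∀ t ∈ Ici T, 0 ≤ q t)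
    (hg : IntegrableOn g (Ioi T)) (hgq : ∀ t ∈ Ici T, n * b * (n * b) * q t ≤ g t)
    (hg0 : ∀ t ∈ Ici T, n * b * ((α t)⁻¹ * ‖Ψ t 0‖) ≤ g t)
    (hsmall : Real.exp M * ∫ t in Ioi T, g t ≤ 1 / 4) :
    ∃ δ > 0, ∃ r : (Fin J.ncard → ℝ) → ℝ → Fin n → ℝ,
      (∀ c ∈ Metric.ball 0 δ, ∀ t ∈ Ici T, ‖r c t‖ ≤ n * b * α t ∧
        HasDerivWithinAt (r c) ((E t).mulVec (r c t) + Ψ t (r c t)) (Ici T) t) ∧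
      InjOn (fun c => r c T) (Metric.ball 0 δ) ∧
      ∀ t ∈ Ici T, ContinuousOn (fun c => r c t) (Metric.ball 0 δ) := by
  have hαc : ContinuousOn α (Ici T) := fun t ht => (hα' t ht).continuousWithinAt
  have hQc := HasMatDeriv.continuousOn hQ
  have hQcij : ∀ i j, ContinuousOn (fun t => Q t i j) (Ici T) := fun i j =>
    continuousOn_pi.1 (continuousOn_pi.1 hQc i) j
  have hbound : ∀ t ∈ Ici T, ∀ z : Fin n → ℝ, ‖α t • (Q t).mulVec z‖ ≤ n * b * α t * ‖z‖ := by
    intro t ht z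
    rw [norm_smul, Real.norm_eq_abs, abs_of_pos (hα t ht)]
    calc α t * ‖(Q t).mulVec z‖ ≤ α t * (n * b * ‖z‖) :=
          mul_le_mul_of_nonneg_left (norm_mulVec_le hb (hQb t ht) z) (hα t ht).le
      _ = _ := by ring
  have hbound1 : ∀ t ∈ Ici T, ∀ z : Fin n → ℝ, ‖z‖ ≤ 1 → ‖α t • (Q t).mulVec z‖ ≤ n * b * α t :=
    fun t ht z hz => (hbound t ht z).trans (mul_le_of_le_one_right
      (mul_nonneg (mul_nonneg (Nat.cast_nonneg n) hb) (hα t ht).le) hz)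
  -- With r = α Q z the equation becomes z' = (Δ - α'/α) z + G(t, z), where `R` is the inverse of Q.
  -- Passing through Q and R costs a factor n b each, and in the Lipschitz estimate the powers of α
  -- cancel.
  let G : ℝ → (Fin n → ℝ) → Fin n → ℝ := fun t z =>
    (α t)⁻¹ • (R t).mulVec (Ψ t (α t • (Q t).mulVec z))
  have hGc : ContinuousOn (fun x : ℝ × (Fin n → ℝ) => G x.1 x.2)
      (Ici T ×ˢ Metric.closedBall 0 1) := by
    have hfst : ∀ u : ℝ → ℝ, ContinuousOn u (Ici T) → ContinuousOn
        (fun x : ℝ × (Fin n → ℝ) => u x.1) (Ici T ×ˢ Metric.closedBall 0 1) := fun u hu =>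
      hu.comp continuousOn_fst fun x hx => hx.1
    have h1 : ContinuousOn (fun x : ℝ × (Fin n → ℝ) => α x.1 • (Q x.1).mulVec x.2)
        (Ici T ×ˢ Metric.closedBall 0 1) := by
      refine continuousOn_pi.2 fun i => ?_
      simp only [Pi.smul_apply, smul_eq_mul, Matrix.mulVec, dotProduct]
      exact (hfst α hαc).mul (continuousOn_finsetSum _ fun j _ => (hfst _ (hQcij i j)).mul
        ((continuous_apply j).comp continuous_snd).continuousOn)
    have h2 : ContinuousOn (fun x : ℝ × (Fin n → ℝ) => Ψ x.1 (α x.1 • (Q x.1).mulVec x.2))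
        (Ici T ×ˢ Metric.closedBall 0 1) :=
      hΨc.comp (continuousOn_fst.prodMk h1) fun x hx =>
        ⟨hx.1, hbound1 x.1 hx.1 x.2 (mem_closedBall_zero_iff.1 hx.2)⟩
    refine continuousOn_pi.2 fun i => ?_
    simp only [G, Pi.smul_apply, smul_eq_mul, Matrix.mulVec, dotProduct]
    exact (hfst _ (hαc.inv₀ fun t ht => (hα t ht).ne')).mul (continuousOn_finsetSum _ fun j _ =>
      (hfst _ (hRc i j)).mul (continuousOn_pi.1 h2 j))
  have hnb : 0 ≤ n * b := mul_nonneg (Nat.cast_nonneg n) hb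
  have hgn : ∀ t, T ≤ t → 0 ≤ g t := fun t ht =>
    (mul_nonneg (mul_nonneg hnb hnb) (hq t ht)).trans (hgq t ht)
  have hGL : ∀ t, T ≤ t → ∀ x y, ‖x‖ ≤ 1 → ‖y‖ ≤ 1 → ‖G t x - G t y‖ ≤ g t * ‖x - y‖ := by
    intro t ht x y hx hy
    have hαt := hα t ht
    simp only [G, ← smul_sub, ← Matrix.mulVec_sub]
    rw [norm_smul, norm_inv, Real.norm_eq_abs, abs_of_pos hαt]
    have h1 := norm_mulVec_le hb (hRb t ht)
      (Ψ t (α t • (Q t).mulVec x) - Ψ t (α t • (Q t).mulVec y))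
    have h2 := hΨ t ht _ _ (hbound1 t ht x hx) (hbound1 t ht y hy)
    rw [← smul_sub, ← Matrix.mulVec_sub] at h2
    have h3 := hbound t ht (x - y)
    calc (α t)⁻¹ * ‖(R t).mulVec (Ψ t (α t • (Q t).mulVec x) - Ψ t (α t • (Q t).mulVec y))‖
        ≤ (α t)⁻¹ * (n * b * (q t * (n * b * α t * ‖x - y‖))) := by
          refine mul_le_mul_of_nonneg_left (h1.trans (mul_le_mul_of_nonneg_left (h2.trans ?_) hnb))
            (inv_nonneg.2 hαt.le)
          exact mul_le_mul_of_nonneg_left h3 (hq t ht)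
      _ = (n * b * (n * b) * q t) * ‖x - y‖ := by
          field_simp
      _ ≤ g t * ‖x - y‖ := mul_le_mul_of_nonneg_right (hgq t ht) (norm_nonneg _)
  have hG0 : ∀ t, T ≤ t → ‖G t 0‖ ≤ g t := by
    intro t ht
    refine le_trans ?_ (hg0 t ht)
    simp only [G, Matrix.mulVec_zero, smul_zero]
    rw [norm_smul, norm_inv, Real.norm_eq_abs, abs_of_pos (hα t ht)]
    calc (α t)⁻¹ * ‖(R t).mulVec (Ψ t 0)‖ ≤ (α t)⁻¹ * (n * b * ‖Ψ t 0‖) :=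
          mul_le_mul_of_nonneg_left (norm_mulVec_le hb (hRb t ht) _) (inv_nonneg.2 (hα t ht).le)
      _ = _ := by ring
  obtain ⟨z, hz1, hz2, hz3, -⟩ := exists_bounded_solution_family_unitBall hp hJ hGc hg hgn hGL hG0
    hsmall
  have hT : T ∈ Ici T := self_mem_Ici
  refine ⟨Real.exp (-M) / 4, by positivity, fun c t => α t • (Q t).mulVec (z (extendParam J c) t),
    fun c hc t ht => ?_, fun c _ c' _ hcc => ?_, fun t ht => ?_⟩
  · rw [mem_ball_zero_iff] at hc
    obtain ⟨h1, h2⟩ := hz1 (extendParam J c) ((norm_extendParam_le J c).trans hc.le) t ht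
    refine ⟨hbound1 t ht _ h1, hasDerivWithinAt_pi.2 fun i => ?_⟩
    have hαt := (hα t ht).ne'
    set Z := z (extendParam J c) with hZ
    have h3 : Ψ t (α t • (Q t).mulVec (Z t)) = α t • (Q t).mulVec (G t (Z t)) := by
      simp only [G]
      rw [Matrix.mulVec_smul, smul_smul, mul_inv_cancel₀ hαt, one_smul, Matrix.mulVec_mulVec,
        hQR t ht, Matrix.one_mulVec]
    have h4 : HasDerivWithinAt (fun τ => α τ * ∑ j, Q τ i j * Z τ j)
        (α' t * ∑ j, Q t i j * Z t j + α t * ∑ j, ((E t * Q t - Q t * Matrix.diagonal (d t)) i j * Z t j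
          + Q t i j * (p j t * Z t j + G t (Z t) j))) (Ici T) t :=
      (hα' t ht).mul (HasDerivWithinAt.fun_sum fun j _ => (hQ t ht i j).mul (h2 j))
    refine h4.congr_deriv ?_
    rw [h3]
    simp only [Matrix.mulVec_smul, Matrix.mulVec_mulVec, Pi.add_apply, Pi.smul_apply, smul_eq_mul]
    have h5 : (E t * Q t).mulVec (Z t) i = ∑ j, (E t * Q t) i j * Z t j := rfl
    have h6 : (Q t).mulVec (G t (Z t)) i = ∑ j, Q t i j * G t (Z t) j := rfl
    rw [h5, h6, ← mul_add, ← Finset.sum_add_distrib, Finset.mul_sum, Finset.mul_sum, Finset.mul_sum,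
      ← Finset.sum_add_distrib]
    refine Finset.sum_congr rfl fun j _ => ?_
    rw [hpd t ht j, Matrix.sub_apply, Matrix.mul_diagonal]
    field_simp
    ring
  -- From r(T) one recovers z(T), since α(T) and Q(T) are invertible, and the components of z(T)
  -- with index in J are the parameters themselves.
  · have hRQ : R T * Q T = 1 := mul_eq_one_comm.1 (hQR T hT)
    have h1 := congrArg (fun v => (R T).mulVec ((α T)⁻¹ • v)) hcc
    simp only [smul_smul, inv_mul_cancel₀ (hα T hT).ne', one_smul, Matrix.mulVec_mulVec, hRQ,
      Matrix.one_mulVec] at h1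
    refine extendParam_injective fun i hi => ?_
    rw [← hz2 (extendParam J c) i hi, ← hz2 (extendParam J c') i hi, h1]
  · have h1 : Continuous fun c => z (extendParam J c) t :=
      (continuous_iff_continuousAt.2 fun c => hz3 c t ht).comp (continuous_extendParam J)
    exact ((Continuous.matrix_mulVec continuous_const h1).const_smul (α t)).continuousOn

end Family


/-! ### Solutions close to the truncated sum -/

section Main

variable {m n : ℕ} [NeZero m] {t₀ a : ℝ} {ε : Fin m → ℝ → ℝ} {ϱ : Fin m → ℝ} {k : ℕ} {w T : ℝ}
  {K : Set (Ici t₀ → ℝ)} {A : Matrix (Fin n) (Fin n) ℝ} {f : ℝ → Fin n → ℝ}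
  {F : Fin m → ℝ → (Fin n → ℝ) → Fin n → ℝ} {φ₀ : ℝ → Fin n → ℝ} {φ : Mon m → ℝ → Fin n → ℝ}

/-- The right-hand side of the equation. -/
def rightSide (A : Matrix (Fin n) (Fin n) ℝ) (f : ℝ → Fin n → ℝ) (ε : Fin m → ℝ → ℝ)
    (F : Fin m → ℝ → (Fin n → ℝ) → Fin n → ℝ) (t : ℝ) (y : Fin n → ℝ) : Fin n → ℝ :=
  A.mulVec y + f t + ∑ l, ε l t • F l t y

omit [NeZero m] in
lemma linPart_mulVec (s : ℝ → Fin n → ℝ) (t : ℝ) (r : Fin n → ℝ) :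
    (linPart a A ε F φ₀ s t).mulVec r = A.mulVec r +
      ∑ l, ε l t • fderivWithin ℝ (F l t) (Metric.closedBall (φ₀ t) a) (s t) r := by
  ext i
  have h1 : ∀ l, fderivWithin ℝ (F l t) (Metric.closedBall (φ₀ t) a) (s t) r i =
      ∑ j, r j * pd (Metric.closedBall (φ₀ t) a) j (F l t) (s t) i := fun l => by
    have h2 := congrFun (LinearMap.pi_apply_eq_sum_univ
      (fderivWithin ℝ (F l t) (Metric.closedBall (φ₀ t) a) (s t)).toLinearMap r) i
    rw [ContinuousLinearMap.coe_coe] at h2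
    rw [h2, Finset.sum_apply]
    refine Finset.sum_congr rfl fun j _ => ?_
    rw [Pi.smul_apply, smul_eq_mul, pd]
    have h3 : (fun i => if j = i then (1 : ℝ) else 0) = Pi.single j 1 := by
      ext x
      simp [Pi.single_apply, eq_comm]
    rw [h3]
  simp only [Pi.add_apply, Finset.sum_apply, Pi.smul_apply, smul_eq_mul, h1, Matrix.mulVec,
    dotProduct, linPart, Matrix.of_apply, add_mul, Finset.sum_add_distrib, Finset.sum_mul,
    Finset.mul_sum]
  congr 1
  rw [Finset.sum_comm]
  refine Finset.sum_congr rfl fun l _ => Finset.sum_congr rfl fun j _ => ?_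
  ring

omit [NeZero m] in
lemma exists_second_bound (ha : 0 < a) (hF : ∀ l, IsC0N t₀ a φ₀ 2 (F l))
    (hFbdd : ∀ l, ∀ P : Fin n → ℕ, ∑ j, P j ≤ 2 → BddPartial t₀ a φ₀ P (F l)) :
    ∃ C, 0 ≤ C ∧ ∀ l i j, ∀ t ∈ Ici t₀, ∀ z ∈ Metric.closedBall (φ₀ t) a,
      ‖pd (Metric.closedBall (φ₀ t) a) i (pd (Metric.closedBall (φ₀ t) a) j (F l t)) z‖ ≤ C := by
  have h1 : ∀ l (i j : Fin n), BddPartial t₀ a φ₀ (Pi.single i 1 + Pi.single j 1) (F l) :=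
    fun l i j => hFbdd l _ (by simp [Finset.sum_add_distrib])
  choose C hC using h1
  refine ⟨∑ l, ∑ i, ∑ j, |C l i j|, Finset.sum_nonneg fun _ _ => Finset.sum_nonneg fun _ _ =>
    Finset.sum_nonneg fun _ _ => abs_nonneg _, fun l i j t ht z hz => ?_⟩
  have h2 := (hF l).1 t ht
  rw [← mpd_single ha i (contDiffOn_pd (N := 1) ha h2 j) hz,
    ← mpd_add_single ha j (Pi.single i 1) (by simpa using h2) hz]
  refine (hC l i j (t, z) ⟨ht, hz⟩).trans ((le_abs_self _).trans ?_)
  refine (Finset.single_le_sum (f := fun j => |C l i j|) (fun _ _ => abs_nonneg _)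
    (Finset.mem_univ j)).trans ?_
  refine (Finset.single_le_sum (f := fun i => ∑ j, |C l i j|) (fun _ _ => Finset.sum_nonneg
    fun _ _ => abs_nonneg _) (Finset.mem_univ i)).trans ?_
  exact Finset.single_le_sum (f := fun l => ∑ i, ∑ j, |C l i j|) (fun _ _ => Finset.sum_nonneg
    fun _ _ => Finset.sum_nonneg fun _ _ => abs_nonneg _) (Finset.mem_univ l)

omit [NeZero m] in
/-- The deviation from the linearization at `s(t)` is Lipschitz with a small constant. -/
lemma norm_rightSide_sub_le (ha : 0 < a) (hF : ∀ l, IsC0N t₀ a φ₀ 2 (F l)) {C : ℝ} (hC0 : 0 ≤ C)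
    (hC : ∀ l i j, ∀ t ∈ Ici t₀, ∀ z ∈ Metric.closedBall (φ₀ t) a,
      ‖pd (Metric.closedBall (φ₀ t) a) i (pd (Metric.closedBall (φ₀ t) a) j (F l t)) z‖ ≤ C)
    {s : ℝ → Fin n → ℝ} {t : ℝ} (ht : t ∈ Ici t₀) (hs : s t ∈ Metric.closedBall (φ₀ t) a)
    {r r' : Fin n → ℝ} (hr : s t + r ∈ Metric.closedBall (φ₀ t) a)
    (hr' : s t + r' ∈ Metric.closedBall (φ₀ t) a) {x : ℝ} (hx : ‖r‖ ≤ x) (hx' : ‖r'‖ ≤ x) :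
    ‖(rightSide A f ε F t (s t + r) - (linPart a A ε F φ₀ s t).mulVec r) -
      (rightSide A f ε F t (s t + r') - (linPart a A ε F φ₀ s t).mulVec r')‖ ≤
      (∑ l, |ε l t|) * (n * (n * C * x)) * ‖r - r'‖ := by
  have e : (rightSide A f ε F t (s t + r) - (linPart a A ε F φ₀ s t).mulVec r) -
      (rightSide A f ε F t (s t + r') - (linPart a A ε F φ₀ s t).mulVec r') =
      ∑ l, ε l t • (F l t (s t + r) - F l t (s t + r') -
        fderivWithin ℝ (F l t) (Metric.closedBall (φ₀ t) a) (s t) (r - r')) := by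
    simp only [rightSide, linPart_mulVec, Matrix.mulVec_add, smul_sub, map_sub,
      Finset.sum_sub_distrib]
    abel
  rw [e]
  refine (norm_sum_le _ _).trans ?_
  rw [Finset.sum_mul, Finset.sum_mul]
  refine Finset.sum_le_sum fun l _ => ?_
  rw [norm_smul, Real.norm_eq_abs, mul_assoc]
  refine mul_le_mul_of_nonneg_left ?_ (abs_nonneg _)
  have := norm_sub_sub_linear_le ha ((hF l).1 t ht) hC0 (fun i j z hz => hC l i j t ht z hz) hs hr hr'
    (m := x) (by rwa [add_sub_cancel_left]) (by rwa [add_sub_cancel_left])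
  rwa [add_sub_add_left_eq_sub] at this

omit [NeZero m] in
lemma continuousOn_rightSide (hf : ContinuousOn f (Ici t₀)) (hε : ∀ l, ContinuousOn (ε l) (Ici t₀))
    {N : ℕ} (hF : ∀ l, IsC0N t₀ a φ₀ N (F l)) :
    ContinuousOn (fun x : ℝ × (Fin n → ℝ) => rightSide A f ε F x.1 x.2) (tube t₀ a φ₀) := by
  have hfst : MapsTo (Prod.fst : ℝ × (Fin n → ℝ) → ℝ) (tube t₀ a φ₀) (Ici t₀) := fun x hx => hx.1
  refine (((Continuous.matrix_mulVec continuous_const continuous_snd).continuousOn).add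
    (hf.comp continuousOn_fst hfst)).add (continuousOn_finsetSum _ fun l _ =>
      ((hε l).comp continuousOn_fst hfst).smul ?_)
  have := (hF l).2 0 (by simp)
  simpa only [mpd_zero] using this

omit [NeZero m] in
/-- A solution is determined by one of its values. -/
theorem IsSolution.eqOn (ha : 0 < a) (hT : T ∈ Ici t₀) (hε : ∀ l, ContinuousOn (ε l) (Ici t₀))
    (hF : ∀ l, IsC0N t₀ a φ₀ 2 (F l))
    (hFbdd : ∀ l, ∀ P : Fin n → ℕ, ∑ j, P j ≤ 2 → BddPartial t₀ a φ₀ P (F l))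
    {y₁ y₂ : ℝ → Fin n → ℝ} (h₁ : IsSolution a T A f ε F φ₀ y₁) (h₂ : IsSolution a T A f ε F φ₀ y₂)
    (h : y₁ T = y₂ T) : EqOn y₁ y₂ (Ici T) := by
  intro t ht
  have hsub : Ici T ⊆ Ici t₀ := Ici_subset_Ici.2 hT
  choose C hC0 hC using fun l =>
    BddPartial.exists_pd_le ha (hF l) one_le_two fun j => hFbdd l _ (by simp)
  choose b hb using fun l => (isCompact_Icc (a := T) (b := t)).exists_bound_of_continuousOn
    ((hε l).mono (Icc_subset_Ici_self.trans hsub))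
  obtain ⟨Λ, hΛ⟩ : ∃ Λ : NNReal, ∀ y y', ‖A.mulVec y - A.mulVec y'‖ ≤ Λ * ‖y - y'‖ := by
    refine ⟨‖A.mulVecLin.toContinuousLinearMap‖₊, fun y y' => ?_⟩
    rw [← Matrix.mulVec_sub]
    exact A.mulVecLin.toContinuousLinearMap.le_opNorm _
  set L : ℝ := Λ + ∑ l, |b l| * (n * C l) with hL
  have hL0 : 0 ≤ L := add_nonneg Λ.2 (Finset.sum_nonneg fun l _ =>
    mul_nonneg (abs_nonneg _) (mul_nonneg (Nat.cast_nonneg n) (hC0 l)))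
  -- On the compact interval the ε_l are bounded, and the first derivatives of the F_l are bounded
  -- on the convex slices of the tube, so one Lipschitz constant serves for all τ.
  have hlip : ∀ τ ∈ Ico T t, LipschitzOnWith L.toNNReal (rightSide A f ε F τ)
      (Metric.closedBall (φ₀ τ) a) := by
    intro τ hτ
    refine LipschitzOnWith.of_dist_le_mul fun y hy y' hy' => ?_
    rw [dist_eq_norm, dist_eq_norm, Real.coe_toNNReal L hL0]
    have e : rightSide A f ε F τ y - rightSide A f ε F τ y' = (A.mulVec y - A.mulVec y') +
        ∑ l, ε l τ • (F l τ y - F l τ y') := by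
      simp only [rightSide, smul_sub, Finset.sum_sub_distrib]
      abel
    rw [e, hL, add_mul, Finset.sum_mul]
    refine (norm_add_le _ _).trans (add_le_add (hΛ y y') ((norm_sum_le _ _).trans
      (Finset.sum_le_sum fun l _ => ?_)))
    rw [norm_smul, mul_assoc]
    have hτ0 : τ ∈ Ici t₀ := hsub hτ.1
    exact mul_le_mul ((hb l τ (Ico_subset_Icc_self hτ)).trans (le_abs_self _))
      (norm_sub_le_of_pd_le (((hF l).1 τ hτ0).of_le (by norm_num)) (hC0 l)
        (fun j z hz => hC l j τ hτ0 z hz) hy hy') (norm_nonneg _) (abs_nonneg _)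
  have hc : ∀ {y}, IsSolution a T A f ε F φ₀ y → ContinuousOn y (Icc T t) := fun hy τ hτ =>
    ((hy τ hτ.1).2.continuousWithinAt).mono Icc_subset_Ici_self
  have hd : ∀ {y}, IsSolution a T A f ε F φ₀ y → ∀ τ ∈ Ico T t,
      HasDerivWithinAt y (rightSide A f ε F τ (y τ)) (Ici τ) τ := fun hy τ hτ =>
    ((hy τ hτ.1).2).mono (Ici_subset_Ici.2 hτ.1)
  exact ODE_solution_unique_of_mem_Icc_right (v := rightSide A f ε F)
    (s := fun τ => Metric.closedBall (φ₀ τ) a) hlip (hc h₁) (hd h₁) (fun τ hτ => (h₁ τ hτ.1).1)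
    (hc h₂) (hd h₂) (fun τ hτ => (h₂ τ hτ.1).1) h (right_mem_Icc.2 ht)

end Main


/-! ### The family of solutions that belongs to a diagonal form -/

section FamilyOfSolutions

variable {m n : ℕ} [NeZero m] {t₀ a : ℝ} {ε : Fin m → ℝ → ℝ} {ϱ : Fin m → ℝ} {k : ℕ} {w T : ℝ}
  {K : Set (Ici t₀ → ℝ)} {A : Matrix (Fin n) (Fin n) ℝ} {f : ℝ → Fin n → ℝ}
  {F : Fin m → ℝ → (Fin n → ℝ) → Fin n → ℝ} {φ₀ : ℝ → Fin n → ℝ} {φ : Mon m → ℝ → Fin n → ℝ}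
  {lam : Fin n → ℂ}

/-- From ε₁' = O(ε₁^(1 + 1/ϱ₁)) one gets ε₁'/ε₁ = O(ε₁^(1/ϱ₁)) → 0. A nonzero Re λ_j therefore
decides the sign of the remaining part of p_jj. -/
lemma IsSmallParam.derivWithin_eps_zero (h : IsSmallParam t₀ ε ϱ k) :
    (∀ t ∈ Ici t₀, HasDerivWithinAt (ε 0) (derivWithin (ε 0) (Ici t₀) t) (Ici t₀) t) ∧
      ContinuousOn (derivWithin (ε 0) (Ici t₀)) (Ici t₀) ∧
      Tendsto (fun t => derivWithin (ε 0) (Ici t₀) t / ε 0 t) atTop (𝓝 0) := by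
  have h0 : (0 : ℤ) ≤ ⌊rho ϱ k - ϱ 0⌋ :=
    Int.floor_nonneg.2 (sub_nonneg.2 (le_rho h.pos h.mono h.one_le))
  have hr : 0 + 1 ≤ (⌊rho ϱ k - ϱ 0⌋ + 1).toNat := by omega
  have h1 := h.continuousOn_iteratedDeriv 0 hr
  have h2 := h.isBigO 0 (0 + 1) hr
  simp only [zero_add, iteratedDerivWithin_one] at h1 h2
  refine ⟨fun t ht => ?_, h1, ?_⟩
  · have := h.hasDerivWithinAt_iteratedDeriv 0 hr ht
    simpa only [zero_add, iteratedDerivWithin_zero, iteratedDerivWithin_one] using this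
  · have h3 : (fun t => (ε 0 t)⁻¹) =O[atTop] fun t => ε 0 t ^ (-1 : ℝ) := by
      refine Filter.EventuallyEq.isBigO ?_
      filter_upwards [h.eventually_pos] with t ht
      rw [Real.rpow_neg_one]
    have h4 := (h2.mul h3).trans (h.rpow_mul_rpow _ _).isBigO
    refine h4.trans_tendsto (h.tendsto_rpow ?_)
    have := h.pos 0
    rw [add_div, div_self this.ne']
    simp only [Nat.cast_one]
    have : 0 < 1 / ϱ 0 := by positivity
    linarith

/-- The dichotomy of the scalar equations `z' = p_jj z`. -/
lemma IsSmallParam.exists_dichotomy_pEntry (h : IsSmallParam t₀ ε ϱ k) {κ : ℝ}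
    (hsign : ∀ (c : ℝ) (g : (Fin m → ℕ) → ℝ),
      (∀ᶠ t in atTop, 0 ≤ c * (derivWithin (ε 0) (Ici t₀) t / ε 0 t) +
        ∑ P ∈ nonIntegrableIdx t₀ w ε, g P * mu ε P t) ∨
      (∀ᶠ t in atTop, c * (derivWithin (ε 0) (Ici t₀) t / ε 0 t) +
        ∑ P ∈ nonIntegrableIdx t₀ w ε, g P * mu ε P t ≤ 0)) {T₀ : ℝ} (hT₀ : t₀ ≤ T₀)
    {γ : Fin n → (Fin m → ℕ) → ℂ} {ς : Fin n → ℝ → ℂ} (hς : ∀ j, ContinuousOn (ς j) (Ici T₀))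
    (hςi : ∀ j, ∃ z : ℂ, Tendsto (fun t => ∫ τ in T₀..t, ς j τ) atTop (𝓝 z)) (i : Fin n) :
    ContinuousOn (pEntry t₀ w κ lam ε (nonIntegrableIdx t₀ w ε) γ ς i) (Ici T₀) ∧
    ∃ M, ∀ T ∈ Ici T₀, HasDichotomy (pEntry t₀ w κ lam ε (nonIntegrableIdx t₀ w ε) γ ς i)
      (i ∈ freeIdx T₀ (pEntry t₀ w κ lam ε (nonIntegrableIdx t₀ w ε) γ ς)) T M := by
  have hsub : Ici T₀ ⊆ Ici t₀ := Ici_subset_Ici.2 hT₀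
  obtain ⟨-, hdc, hd0⟩ := h.derivWithin_eps_zero
  set u : ℝ → ℝ := fun t => derivWithin (ε 0) (Ici t₀) t / ε 0 t with hu
  have huc : ContinuousOn u (Ici T₀) :=
    (hdc.div (h.continuousOn_eps 0) fun t ht => (h.eps_pos t ht).ne').mono hsub
  -- This is p_jj without Re ς_j, which has a convergent integral and does not affect the dichotomy.
  set σ : ℝ → ℝ := fun t => (lam i).re + ((w - κ) * u t +
    ∑ P ∈ nonIntegrableIdx t₀ w ε, (γ i P).re * mu ε P t) with hσ
  have hσc : ContinuousOn σ (Ici T₀) := continuousOn_const.add ((continuousOn_const.mul huc).add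
    (continuousOn_finsetSum _ fun P _ => continuousOn_const.mul ((h.continuousOn_mu P).mono hsub)))
  have e : ∀ t, pEntry t₀ w κ lam ε (nonIntegrableIdx t₀ w ε) γ ς i t = σ t + (ς i t).re := by
    intro t
    simp only [pEntry, diagEntry, hσ, hu, Complex.add_re, Complex.re_sum, Complex.re_mul_ofReal]
    ring
  have hre : ContinuousOn (fun t => (ς i t).re) (Ici T₀) :=
    Complex.continuous_re.comp_continuousOn (hς i)
  have hpc : ContinuousOn (pEntry t₀ w κ lam ε (nonIntegrableIdx t₀ w ε) γ ς i) (Ici T₀) :=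
    (hσc.add hre).congr fun t _ => e t
  refine ⟨hpc, exists_dichotomy hpc hσc (h.eventually_sign (Or.inr hd0) hsign) ?_⟩
  obtain ⟨z, hz⟩ := hςi i
  refine ⟨z.re, ((Complex.continuous_re.tendsto z).comp hz).congr' ?_⟩
  filter_upwards [eventually_ge_atTop T₀] with t ht
  simp only [e, add_sub_cancel_left, Function.comp_apply]
  have := Complex.reCLM.intervalIntegral_comp_comm
    ((hς i).mono (by rw [uIcc_of_le ht]; exact Icc_subset_Ici_self) :
      ContinuousOn (ς i) (uIcc T₀ t)).intervalIntegrable (μ := volume)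
  exact this.symm

lemma exists_common_bound {T : ℝ} {Q : ℝ → Matrix (Fin n) (Fin n) ℝ}
    (hQ : ∀ i j, ContinuousOn (fun t => Q t i j) (Ici T))
    (hQO : ∀ i j, (fun t => Q t i j) =O[atTop] fun _ => (1 : ℝ)) :
    ∃ C, 0 ≤ C ∧ ∀ t ∈ Ici T, ∀ i j, |Q t i j| ≤ C := by
  choose C hC0 hC using fun i j => exists_abs_le_of_isBigO_one (hQ i j) (hQO i j)
  exact ⟨∑ i, ∑ j, C i j, Finset.sum_nonneg fun i _ => Finset.sum_nonneg fun j _ => hC0 i j,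
    fun t ht i j => (hC i j t ht).trans
      ((Finset.single_le_sum (f := fun j => C i j) (fun j _ => hC0 i j) (Finset.mem_univ j)).trans
        (Finset.single_le_sum (f := fun i => ∑ j, C i j)
          (fun i _ => Finset.sum_nonneg fun j _ => hC0 i j) (Finset.mem_univ i)))⟩

/-- Bounds for a Lyapunov matrix and its inverse. -/
lemma IsLyapunov.exists_inverse {T : ℝ} {Q : ℝ → Matrix (Fin n) (Fin n) ℝ} (hQ : IsLyapunov T Q)
    {d : ℝ} (hd : d ≠ 0) (hlim : Tendsto (fun t => (Q t).det) atTop (𝓝 d)) :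
    ∃ R : ℝ → Matrix (Fin n) (Fin n) ℝ, (∀ t ∈ Ici T, Q t * R t = 1) ∧
      (∀ i j, ContinuousOn (fun t => R t i j) (Ici T)) ∧ ∃ b, 0 ≤ b ∧
      (∀ t ∈ Ici T, ∀ i j, |Q t i j| ≤ b) ∧ ∀ t ∈ Ici T, ∀ i j, |R t i j| ≤ b := by
  have hQij : ∀ i j, ContinuousOn (fun t => Q t i j) (Ici T) := fun i j =>
    (hQ.contDiffOn i j).continuousOn
  have hQc : ContinuousOn Q (Ici T) := continuousOn_pi.2 fun i => continuousOn_pi.2 fun j => hQij i j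
  obtain ⟨C, hC⟩ := hQ.bounded
  obtain ⟨c, hc, hdet⟩ := hQ.det_bounded_below
  have hdet0 : ∀ t ∈ Ici T, (Q t).det ≠ 0 := fun t ht =>
    abs_pos.1 (hc.trans_le (hdet t ht))
  have hQO : ∀ i j, (fun t => Q t i j) =O[atTop] fun _ => (1 : ℝ) := fun i j =>
    isBigO_one_of_bound fun t ht => hC t ht i j
  have hadj : ∀ i j, Continuous fun M : Matrix (Fin n) (Fin n) ℝ => M.adjugate i j := fun i j =>
    (continuous_id.matrix_adjugate).matrix_elem i j
  set R : ℝ → Matrix (Fin n) (Fin n) ℝ := fun t => (Q t).det⁻¹ • (Q t).adjugate with hR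
  have hRij : ∀ i j, ContinuousOn (fun t => R t i j) (Ici T) := fun i j =>
    (((continuous_id.matrix_det).comp_continuousOn hQc).inv₀ hdet0).mul
      ((hadj i j).comp_continuousOn hQc)
  have hRO : ∀ i j, (fun t => R t i j) =O[atTop] fun _ => (1 : ℝ) := fun i j =>
    isBigO_one_mul ((hlim.inv₀ hd).isBigO_one ℝ) (isBigO_one_comp hQO (hadj i j))
  obtain ⟨b, hb0, hb⟩ := exists_common_bound hRij hRO
  refine ⟨R, fun t ht => ?_, hRij, max C b, hb0.trans (le_max_right _ _), fun t ht i j =>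
    (hC t ht i j).trans (le_max_left _ _), fun t ht i j => (hb t ht i j).trans (le_max_right _ _)⟩
  simp only [hR]
  rw [Matrix.mul_smul, Matrix.mul_adjugate, smul_smul, inv_mul_cancel₀ (hdet0 t ht), one_smul]

omit [NeZero m] in
lemma continuousOn_linPart (ha : 0 < a) (hF : ∀ l, IsC0N t₀ a φ₀ 2 (F l))
    (hε : ∀ l, ContinuousOn (ε l) (Ici t₀)) (hT : t₀ ≤ T) {s : ℝ → Fin n → ℝ}
    (hs : ContinuousOn s (Ici T)) (hsa : ∀ t ∈ Ici T, s t ∈ Metric.closedBall (φ₀ t) a)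
    (i j : Fin n) : ContinuousOn (fun t => linPart a A ε F φ₀ s t i j) (Ici T) := by
  simp only [linPart, Matrix.of_apply]
  refine continuousOn_const.add (continuousOn_finsetSum _ fun l _ =>
    ((hε l).mono (Ici_subset_Ici.2 hT)).mul ?_)
  exact (continuous_apply i).comp_continuousOn (continuousOn_comp_tube
    (G := fun t => pd (Metric.closedBall (φ₀ t) a) j (F l t))
    ((hF l).continuousOn_pd ha one_le_two j) hT hs hsa)

omit [NeZero m] in
/-- Continuity of the remainder of the right-hand side after the linear part along `s` and a given
function have been subtracted. -/
lemma continuousOn_remainder (hf : ContinuousOn f (Ici t₀))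
    (hε : ∀ l, ContinuousOn (ε l) (Ici t₀)) (hF : ∀ l, IsC0N t₀ a φ₀ 2 (F l)) (hT : t₀ ≤ T)
    {s s' : ℝ → Fin n → ℝ} (hs : ContinuousOn s (Ici T)) (hs' : ContinuousOn s' (Ici T))
    {E : ℝ → Matrix (Fin n) (Fin n) ℝ} (hE : ∀ i j, ContinuousOn (fun t => E t i j) (Ici T))
    {β : ℝ → ℝ} (hmem : ∀ t ∈ Ici T, ∀ r : Fin n → ℝ, ‖r‖ ≤ β t →
      s t + r ∈ Metric.closedBall (φ₀ t) a) :
    ContinuousOn (fun x : ℝ × (Fin n → ℝ) =>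
      rightSide A f ε F x.1 (s x.1 + x.2) - s' x.1 - (E x.1).mulVec x.2)
      {x | T ≤ x.1 ∧ ‖x.2‖ ≤ β x.1} := by
  have hfst : MapsTo (Prod.fst : ℝ × (Fin n → ℝ) → ℝ) {x | T ≤ x.1 ∧ ‖x.2‖ ≤ β x.1} (Ici T) :=
    fun x hx => hx.1
  have h1 : ContinuousOn (fun x : ℝ × (Fin n → ℝ) => (x.1, s x.1 + x.2))
      {x | T ≤ x.1 ∧ ‖x.2‖ ≤ β x.1} :=
    continuousOn_fst.prodMk ((hs.comp continuousOn_fst hfst).add continuousOn_snd)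
  have h2 : MapsTo (fun x : ℝ × (Fin n → ℝ) => (x.1, s x.1 + x.2))
      {x | T ≤ x.1 ∧ ‖x.2‖ ≤ β x.1} (tube t₀ a φ₀) :=
    fun x hx => ⟨hT.trans hx.1, hmem x.1 hx.1 x.2 hx.2⟩
  have h3 := (continuousOn_rightSide (A := A) hf hε hF).comp h1 h2
  refine ContinuousOn.sub (ContinuousOn.sub h3 (hs'.comp continuousOn_fst hfst)) ?_
  refine continuousOn_pi.2 fun i => ?_
  simp only [Matrix.mulVec, dotProduct]
  exact continuousOn_finsetSum _ fun j _ => ((hE i j).comp continuousOn_fst hfst).mul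
    ((continuous_apply j).comp continuous_snd).continuousOn

/-- For y = s + r the equation reads r' = Â r + Ψ(t, r), where Ψ(t, 0) is minus the residual and Ψ
otherwise contains only the deviation of the right-hand side from its linearisation at s. The weight
α = ε₁^(κ-w) balances the two requirements: the residual divided by α must be integrable, and the
solution must be small. -/
theorem IsSmallParam.exists_solution_family (h : IsSmallParam t₀ ε ϱ k) (ha : 0 < a) (hw : 0 < w)
    (hεw : IntegrableOn (fun t => (ε 0 t) ^ w) (Ici t₀)) {Ω : Set ℂ} (hK : IsClassK1 Ω K)
    (hφ : IsFormalCoeff a K ϱ A F φ₀ k φ) (hf : ContinuousOn f (Ici t₀))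
    {s' : ℝ → Fin n → ℝ} (hs'c : ContinuousOn s' (Ici t₀))
    (hs' : ∀ t ∈ Ici t₀, HasDerivWithinAt (truncSum t₀ ε ϱ φ₀ k φ) (s' t) (Ici t₀) t)
    (hres : (fun t => s' t - rightSide A f ε F t (truncSum t₀ ε ϱ φ₀ k φ t)) =O[atTop]
        fun t => ε 0 t ^ (rho ϱ (k + 1) / ϱ 0))
    (hF : ∀ l, IsC0N t₀ a φ₀ 2 (F l))
    (hFbdd : ∀ l, ∀ P : Fin n → ℕ, ∑ j, P j ≤ 2 → BddPartial t₀ a φ₀ P (F l))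
    (hsign : ∀ (c : ℝ) (g : (Fin m → ℕ) → ℝ),
      (∀ᶠ t in atTop, 0 ≤ c * (derivWithin (ε 0) (Ici t₀) t / ε 0 t) +
        ∑ P ∈ nonIntegrableIdx t₀ w ε, g P * mu ε P t) ∨
      (∀ᶠ t in atTop, c * (derivWithin (ε 0) (Ici t₀) t / ε 0 t) +
        ∑ P ∈ nonIntegrableIdx t₀ w ε, g P * mu ε P t ≤ 0))
    (hk1 : ϱ 0 * w < rho ϱ (k + 1)) (hk2 : ϱ 0 * (2 * w - 1) ≤ rho ϱ (k + 1))
    {T₀ : ℝ} (hT₀ : T₀ ∈ Ici t₀) {Q : ℝ → Matrix (Fin n) (Fin n) ℝ}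
    {γ : Fin n → (Fin m → ℕ) → ℂ} {ς : Fin n → ℝ → ℂ}
    (hQ : IsDiagReduction T₀ (linPart a A ε F φ₀ (truncSum t₀ ε ϱ φ₀ k φ)) lam ε
          (nonIntegrableIdx t₀ w ε) Q γ ς) :
    ∃ T₁ ∈ Ici T₀, ∀ T ∈ Ici T₁, ∃ δ > 0, ∃ C : ℝ,
      ∃ r : (Fin (freeIdx T₀ (pEntry t₀ w (rho ϱ (k + 1) / ϱ 0) lam ε
          (nonIntegrableIdx t₀ w ε) γ ς)).ncard → ℝ) → ℝ → Fin n → ℝ,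
        (∀ c ∈ Metric.ball 0 δ,
          IsSolution a T A f ε F φ₀ (fun t => truncSum t₀ ε ϱ φ₀ k φ t + r c t) ∧
          ∀ t ∈ Ici T, ‖r c t‖ ≤ C * (ε 0 t) ^ (rho ϱ (k + 1) / ϱ 0 - w)) ∧
        InjOn (fun c => r c T) (Metric.ball 0 δ) ∧
        ∀ t ∈ Ici T, ContinuousOn (fun c => r c t) (Metric.ball 0 δ) := by
  set s := truncSum t₀ ε ϱ φ₀ k φ with hs
  set κ := rho ϱ (k + 1) / ϱ 0 with hκ
  have hκw : w < κ := by
    rw [hκ, lt_div_iff₀ (h.pos 0)]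
    linarith
  have hκ2 : 2 * w - 1 ≤ κ := by
    rw [hκ, le_div_iff₀ (h.pos 0)]
    linarith
  have hsub0 : Ici T₀ ⊆ Ici t₀ := Ici_subset_Ici.2 hT₀
  obtain ⟨hd, -, -⟩ := h.derivWithin_eps_zero
  obtain ⟨R, hQR, hRc, b, hb0, hQb, hRb⟩ :=
    hQ.lyapunov.exists_inverse hQ.det_limit.choose_spec.1 hQ.det_limit.choose_spec.2
  set α : ℝ → ℝ := fun t => ε 0 t ^ (κ - w) with hα
  have hα0 : ∀ t ∈ Ici t₀, 0 < α t := fun t ht => Real.rpow_pos_of_pos (h.eps_pos t ht) _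
  have hαc : ContinuousOn α (Ici t₀) := (h.continuousOn_eps 0).rpow_const fun t ht =>
    Or.inl (h.eps_pos t ht).ne'
  have hsc : ContinuousOn s (Ici t₀) := fun t ht => (hs' t ht).continuousWithinAt
  obtain ⟨Ta, hTa, hδ⟩ := h.exists_tube hK ha hφ
  -- Since κ > w, the weight α tends to 0, and from some time on r fits into the half of the tube
  -- left free by the truncated sum.
  obtain ⟨Tb, hTb⟩ := eventually_atTop.1 (((h.tendsto_rpow (sub_pos.2 hκw)).const_mul
    (n * b)).eventually (ge_mem_nhds (by rw [mul_zero]; exact half_pos ha : n * b * 0 < a / 2)))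
  set Tc := max (max T₀ Ta) Tb with hTc
  have hT0c : T₀ ≤ Tc := (le_max_left T₀ Ta).trans (le_max_left _ _)
  have htc : t₀ ≤ Tc := le_trans hT₀ hT0c
  have hsubc : Ici Tc ⊆ Ici t₀ := Ici_subset_Ici.2 htc
  have hδc : ∀ t ∈ Ici Tc, ‖h.delta φ t‖ ≤ a / 2 := fun t ht =>
    hδ t (((le_max_right T₀ Ta).trans (le_max_left _ _)).trans ht)
  have hαa : ∀ t ∈ Ici Tc, n * b * α t ≤ a / 2 := fun t ht => hTb t ((le_max_right _ Tb).trans ht)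
  have hmem : ∀ t ∈ Ici Tc, ∀ r : Fin n → ℝ, ‖r‖ ≤ n * b * α t →
      s t + r ∈ Metric.closedBall (φ₀ t) a := by
    intro t ht r hr
    rw [hs, h.truncSum_eq, mem_closedBall_iff_norm, add_assoc, add_sub_cancel_left]
    exact (norm_add_le _ _).trans (by linarith [hδc t ht, hαa t ht])
  have hsmem : ∀ t ∈ Ici Tc, s t ∈ Metric.closedBall (φ₀ t) a := fun t ht =>
    h.delta_mem ((hδc t ht).trans (by linarith))
  obtain ⟨C, hC0, hC⟩ := exists_second_bound ha hF hFbdd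
  obtain ⟨E, hE⟩ : ∃ E, E = linPart a A ε F φ₀ s := ⟨_, rfl⟩
  have hEc : ∀ i j, ContinuousOn (fun t => E t i j) (Ici Tc) := fun i j =>
    hE ▸ continuousOn_linPart ha hF h.continuousOn_eps htc (hsc.mono hsubc) hsmem i j
  obtain ⟨Ψ, hΨd⟩ : ∃ Ψ : ℝ → (Fin n → ℝ) → Fin n → ℝ, ∀ t r,
      Ψ t r = rightSide A f ε F t (s t + r) - s' t - (E t).mulVec r := ⟨_, fun _ _ => rfl⟩
  have hΨc : ContinuousOn (fun x : ℝ × (Fin n → ℝ) => Ψ x.1 x.2)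
      {x | Tc ≤ x.1 ∧ ‖x.2‖ ≤ n * b * α x.1} := by
    simp only [hΨd]
    exact continuousOn_remainder hf h.continuousOn_eps hF htc (hsc.mono hsubc) (hs'c.mono hsubc) hEc hmem
  have hΨ0 : ∀ t, Ψ t 0 = -(s' t - rightSide A f ε F t (s t)) := fun t => by
    simp only [hΨd, add_zero, Matrix.mulVec_zero, sub_zero, neg_sub]
  set q : ℝ → ℝ := fun t => (∑ l, |ε l t|) * (n * (n * C * (n * b * α t))) with hq
  have hΨL : ∀ t ∈ Ici Tc, ∀ r r', ‖r‖ ≤ n * b * α t → ‖r'‖ ≤ n * b * α t →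
      ‖Ψ t r - Ψ t r'‖ ≤ q t * ‖r - r'‖ := by
    intro t ht r r' hr hr'
    have := norm_rightSide_sub_le (A := A) (f := f) (ε := ε) ha hF hC0 hC (hsubc ht) (hsmem t ht)
      (hmem t ht r hr) (hmem t ht r' hr') hr hr'
    refine le_trans (le_of_eq ?_) this
    congr 1
    rw [hΨd, hΨd, hE]
    abel
  set g : ℝ → ℝ := fun t => n * b * (n * b) * q t + n * b * ((α t)⁻¹ * ‖Ψ t 0‖) with hg
  have hnb : 0 ≤ n * b := mul_nonneg (Nat.cast_nonneg n) hb0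
  have hq0 : ∀ t ∈ Ici Tc, 0 ≤ q t := fun t ht => mul_nonneg
    (Finset.sum_nonneg fun _ _ => abs_nonneg _) (mul_nonneg (Nat.cast_nonneg n)
      (mul_nonneg (mul_nonneg (Nat.cast_nonneg n) hC0) (mul_nonneg hnb (hα0 t (hsubc ht)).le)))
  have hgn : IsNegl Tc g := by
    refine h.isNegl_of_isBigO hw hεw ?_ ?_
    · have h0 : MapsTo (fun t => (t, (0 : Fin n → ℝ))) (Ici Tc)
          {x | Tc ≤ x.1 ∧ ‖x.2‖ ≤ n * b * α x.1} := fun t ht => ⟨ht, by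
        rw [norm_zero]
        exact mul_nonneg hnb (hα0 t (hsubc ht)).le⟩
      have h1 : ContinuousOn (fun t => Ψ t 0) (Ici Tc) := hΨc.comp
        (continuous_id.prodMk continuous_const).continuousOn h0
      have hαc' := hαc.mono hsubc
      refine (continuousOn_const.mul (ContinuousOn.mul (continuousOn_finsetSum _ fun l _ =>
        ((h.continuousOn_eps l).mono hsubc).abs) ?_)).add
        (continuousOn_const.mul ((hαc'.inv₀ fun t ht => (hα0 t (hsubc ht)).ne').mul h1.norm))
      exact continuousOn_const.mul (continuousOn_const.mul (continuousOn_const.mul hαc'))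
    · refine Asymptotics.IsBigO.add (Asymptotics.IsBigO.const_mul_left ?_ _)
        (Asymptotics.IsBigO.const_mul_left ?_ _)
      · have h1 : (fun t => ∑ l, |ε l t|) =O[atTop] fun t => ε 0 t ^ (1 : ℝ) := by
          simp only [Real.rpow_one]
          exact Asymptotics.IsBigO.fun_sum fun l _ => (h.eps_isBigO_eps l).abs_left
        have h2 : (fun t => n * (n * C * (n * b * α t))) =O[atTop] α :=
          (((Asymptotics.isBigO_refl α atTop).const_mul_left _).const_mul_left _).const_mul_left _
        -- On the ball of radius n b α the deviation has a Lipschitz constant of order ε₁ α, that is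
        -- ε₁^(1 + κ - w); the exponent is at least w because κ ≥ 2w - 1.
        exact (h1.mul h2).trans ((h.rpow_mul_rpow _ _).isBigO.trans (h.isBigO_rpow (by linarith)))
      · have h1 : (fun t => (α t)⁻¹) =O[atTop] fun t => ε 0 t ^ (w - κ) := by
          refine Filter.EventuallyEq.isBigO ?_
          filter_upwards [h.eventually_pos] with t ht
          rw [hα, ← Real.rpow_neg ht.le, neg_sub]
        have h2 : (fun t => ‖Ψ t 0‖) =O[atTop] fun t => ε 0 t ^ κ := by
          simp only [hΨ0, norm_neg]
          exact hres.norm_left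
        refine (h1.mul h2).trans ((h.rpow_mul_rpow _ _).isBigO.trans (h.isBigO_rpow ?_))
        linarith
  choose hpc M hM using fun i => h.exists_dichotomy_pEntry (lam := lam) (κ := κ) hsign hT₀
    hQ.rem_continuous hQ.rem_integral i
  set M' := ∑ i, |M i| with hM'
  have hMM : ∀ i, M i ≤ M' := fun i => (le_abs_self _).trans
    (Finset.single_le_sum (f := fun i => |M i|) (fun _ _ => abs_nonneg _) (Finset.mem_univ i))
  -- The dichotomy constants do not depend on the initial point, so T₂ may be chosen after them to
  -- make the tail integral of g small.
  obtain ⟨T₂, hT₂⟩ := eventually_atTop.1 (((tendsto_setIntegral_Ioi_zero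
    (hgn.integrableOn.mono_set Ioi_subset_Ici_self)).const_mul (Real.exp M')).eventually
      (ge_mem_nhds (by norm_num : Real.exp M' * 0 < 1 / 4)))
  refine ⟨max Tc T₂, hT0c.trans (le_max_left Tc T₂), fun T hT => ?_⟩
  have hTTc : Tc ≤ T := le_trans (le_max_left Tc T₂) hT
  have hsT : Ici T ⊆ Ici Tc := Ici_subset_Ici.2 hTTc
  have hsT0 : Ici T ⊆ Ici T₀ := Ici_subset_Ici.2 (hT0c.trans hTTc)
  have hsTt : Ici T ⊆ Ici t₀ := hsT.trans hsubc
  -- Since α'/α = (κ - w) ε₁'/ε₁, the coefficient Re d_j - α'/α is exactly p_jj. This is the origin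
  -- of the term with ε₁'/ε₁ in `pEntry`.
  obtain ⟨δ, hδ0, r, hr, hrinj, hrc⟩ := exists_small_solution_family (T := T) (M := M') (b := b) (α := α)
    (α' := fun t => derivWithin (ε 0) (Ici t₀) t * (κ - w) * ε 0 t ^ (κ - w - 1)) (q := q) (g := g)
    (E := E) (Q := Q) (R := R)
    (d := fun t j => (diagEntry lam ε (nonIntegrableIdx t₀ w ε) γ ς j t).re)
    (p := pEntry t₀ w κ lam ε (nonIntegrableIdx t₀ w ε) γ ς)
    (J := freeIdx T₀ (pEntry t₀ w κ lam ε (nonIntegrableIdx t₀ w ε) γ ς)) (Ψ := Ψ)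
    (fun t ht => hα0 t (hsTt ht))
    (fun t ht => ((hd t (hsTt ht)).rpow_const (Or.inl (h.eps_pos t (hsTt ht)).ne')).mono hsTt)
    (fun t ht i j => hE ▸ (hQ.reduces t (hsT0 ht) i j).mono hsT0)
    (fun i j => (hRc i j).mono hsT0) (fun t ht => hQR t (hsT0 ht)) hb0 (fun t ht => hQb t (hsT0 ht))
    (fun t ht => hRb t (hsT0 ht)) (fun i => (hpc i).mono hsT0) (fun t ht i => by
      have hpos := h.eps_pos t (hsTt ht)
      have h1 : ε 0 t ^ (κ - w - 1) = ε 0 t ^ (κ - w) / ε 0 t := Real.rpow_sub_one hpos.ne' _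
      have h2 := (hα0 t (hsTt ht)).ne'
      simp only [pEntry, hα, h1] at h2 ⊢
      field_simp
      ring)
    (fun i => (hM i T (hT0c.trans hTTc)).mono (hMM i))
    (hΨc.mono fun x hx => ⟨hTTc.trans hx.1, hx.2⟩) (fun t ht => hΨL t (hsT ht))
    (fun t ht => hq0 t (hsT ht)) (hgn.integrableOn.mono_set (Ioi_subset_Ici_self.trans hsT))
    (fun t ht => le_add_of_nonneg_right (mul_nonneg hnb (mul_nonneg
      (inv_nonneg.2 (hα0 t (hsTt ht)).le) (norm_nonneg _))))
    (fun t ht => le_add_of_nonneg_left (mul_nonneg (mul_nonneg hnb hnb) (hq0 t (hsT ht))))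
    (hT₂ T (le_trans (le_max_right Tc T₂) hT))
  refine ⟨δ, hδ0, n * b, r, fun c hc => ⟨fun t ht => ⟨hmem t (hsT ht) _ (hr c hc t ht).1, ?_⟩,
    fun t ht => (hr c hc t ht).1⟩, hrinj, hrc⟩
  refine (((hs' t (hsTt ht)).mono hsTt).add (hr c hc t ht).2).congr_deriv ?_
  simp only [hΨd, rightSide]
  abel

end FamilyOfSolutions


theorem mainTheorem3 {n m : ℕ} [NeZero m] (hn : 2 ≤ n)
    -- the truncated equation and the class
    (t₀ : ℝ) (A : Matrix (Fin n) (Fin n) ℝ) (lam : Fin n → ℂ)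
    (hlam : (A.map (fun x : ℝ => (x : ℂ))).charpoly =
      ∏ j, (Polynomial.X - Polynomial.C (lam j)))
    (K : Set (Ici t₀ → ℝ)) (hK : IsClassK3 lam K)
    (f : ℝ → Fin n → ℝ) (hf : ∀ i, InClass K (fun t => f t i))
    (φ₀ : ℝ → Fin n → ℝ) (hφ₀K : ∀ i, InClass K (fun t => φ₀ t i))
    (hφ₀C : ContDiffOn ℝ 1 φ₀ (Ici t₀))
    (hφ₀ : ∀ t ∈ Ici t₀, HasDerivWithinAt φ₀ (A.mulVec (φ₀ t) + f t) (Ici t₀) t)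
    (a : ℝ) (ha : 0 < a)
    -- the small parameters, their ranks, the order of truncation
    (ε : Fin m → ℝ → ℝ) (ϱ : Fin m → ℝ) (hϱpos : ∀ l, 0 < ϱ l) (hϱmono : Monotone ϱ)
    (k : ℕ) (hk : 1 ≤ k)
    (hεC : ∀ l, ContDiffOn ℝ ((⌊rho ϱ k - ϱ l⌋ + 1).toNat) (ε l) (Ici t₀))
    (hεO : ∀ l, ∀ r : ℕ, r ≤ (⌊rho ϱ k - ϱ l⌋ + 1).toNat →
      (fun t => iteratedDerivWithin r (ε l) (Ici t₀) t) =O[atTop]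
        fun t => (ε 0 t) ^ ((ϱ l + r) / ϱ 0))
    (hεpos : ∀ t ∈ Ici t₀, 0 < ε 0 t)
    (hε0 : Tendsto (ε 0) atTop (𝓝 0))
    -- the nonlinearities
    (F : Fin m → ℝ → (Fin n → ℝ) → (Fin n → ℝ))
    (hF : ∀ l, IsC0N t₀ a φ₀ (max 2 (⌊(rho ϱ k - ϱ l) / ϱ 0⌋₊ + 1)) (F l))
    (hFbdd : ∀ l, ∀ P : Fin n → ℕ, ∑ j, P j ≤ max 2 (⌊(rho ϱ k - ϱ l) / ϱ 0⌋₊ + 1) →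
      BddPartial t₀ a φ₀ P (F l))
    (hFK : ∀ l, ϱ l ≤ rho ϱ k →
      ∀ P : Fin n → ℕ, ∑ j, P j ≤ ⌊(rho ϱ k - ϱ l) / ϱ 0⌋₊ →
      ∀ i, InClass K (fun t => mpd (Metric.closedBall (φ₀ t) a) P (F l t) (φ₀ t) i))
    -- integrability of the small parameters and the additional smoothness it requires
    (w : ℝ) (hw : 0 < w) (hεw : IntegrableOn (fun t => (ε 0 t) ^ w) (Ici t₀))
    (hεder : ∀ l, ∀ r : ℕ, 1 ≤ r → (r : ℤ) ≤ ⌊rho ϱ k - ϱ l⌋ →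
      IntegrableOn (fun t => iteratedDerivWithin r (ε l) (Ici t₀) t) (Ici t₀))
    (hF' : ∀ l, ϱ l ≤ w * ϱ 0 → IsC0N t₀ a φ₀ (⌊w - ϱ l / ϱ 0⌋₊ + 2) (F l))
    (hFbdd' : ∀ l, ϱ l ≤ w * ϱ 0 →
      ∀ P : Fin n → ℕ, 3 ≤ ∑ j, P j → ∑ j, P j ≤ ⌊w - ϱ l / ϱ 0⌋₊ + 2 →
      BddPartial t₀ a φ₀ P (F l))
    (hFK' : ∀ l, ϱ l ≤ w * ϱ 0 →
      ∀ P : Fin n → ℕ, 1 ≤ ∑ j, P j → ∑ j, P j ≤ ⌊w - ϱ l / ϱ 0⌋₊ + 1 →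
      ∀ i, InClass K (fun t => mpd (Metric.closedBall (φ₀ t) a) P (F l t) (φ₀ t) i))
    -- simple eigenvalues, monotonicity, preservation of sign, size of `k`
    (hsimple : (0 : ℂ) ∉ eigenDiff lam)
    (hmono : ∀ l, ¬ IntegrableOn (ε l) (Ici t₀) →
      (MonotoneOn (ε l) (Ici t₀) ∨ AntitoneOn (ε l) (Ici t₀)) ∧ Tendsto (ε l) atTop (𝓝 0) ∧
      ContDiffOn ℝ 1 (ε l) (Ici t₀) ∧ IntegrableOn (derivWithin (ε l) (Ici t₀)) (Ici t₀))
    (hsign : ∀ (c : ℝ) (g : (Fin m → ℕ) → ℝ),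
      (∀ᶠ t in atTop, 0 ≤ c * (derivWithin (ε 0) (Ici t₀) t / ε 0 t) +
        ∑ P ∈ nonIntegrableIdx t₀ w ε, g P * mu ε P t) ∨
      (∀ᶠ t in atTop, c * (derivWithin (ε 0) (Ici t₀) t / ε 0 t) +
        ∑ P ∈ nonIntegrableIdx t₀ w ε, g P * mu ε P t ≤ 0))
    (hk1 : ϱ 0 * w < rho ϱ (k + 1)) (hk2 : ϱ 0 * (2 * w - 1) ≤ rho ϱ (k + 1)) :
    -- the coefficients of the formal solution exist
    (∃ φ : Mon m → ℝ → Fin n → ℝ, IsFormalCoeff a K ϱ A F φ₀ k φ) ∧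
    -- a solution is determined by its `n` initial values: at most `n` independent parameters
    (∀ T ∈ Ici t₀, ∀ y₁ y₂ : ℝ → Fin n → ℝ, IsSolution a T A f ε F φ₀ y₁ →
      IsSolution a T A f ε F φ₀ y₂ → y₁ T = y₂ T → EqOn y₁ y₂ (Ici T)) ∧
    -- for every choice of the coefficients:
    ∀ φ : Mon m → ℝ → Fin n → ℝ, IsFormalCoeff a K ϱ A F φ₀ k φ →
      -- the functions `d_j` exist, for all large initial points,
      (∃ T₁ ∈ Ici t₀, ∀ T ∈ Ici T₁, ∃ Q γ ς,
        IsDiagReduction T (linPart a A ε F φ₀ (truncSum t₀ ε ϱ φ₀ k φ)) lam ε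
          (nonIntegrableIdx t₀ w ε) Q γ ς) ∧
      -- and whichever are taken, there is a family of solutions `s + r` on each `[T, ∞)`, `T` large,
      -- with as many small parameters as there are `j` with `∫ p_jj ≠ +∞`
      ∀ T₀ ∈ Ici t₀, ∀ Q γ ς,
        IsDiagReduction T₀ (linPart a A ε F φ₀ (truncSum t₀ ε ϱ φ₀ k φ)) lam ε
          (nonIntegrableIdx t₀ w ε) Q γ ς →
        ∃ T₁ ∈ Ici T₀, ∀ T ∈ Ici T₁, ∃ δ > 0, ∃ C : ℝ,
          ∃ r : (Fin (freeIdx T₀ (pEntry t₀ w (rho ϱ (k + 1) / ϱ 0) lam ε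
              (nonIntegrableIdx t₀ w ε) γ ς)).ncard → ℝ) → ℝ → Fin n → ℝ,
            (∀ c ∈ Metric.ball 0 δ,
              IsSolution a T A f ε F φ₀ (fun t => truncSum t₀ ε ϱ φ₀ k φ t + r c t) ∧
              ∀ t ∈ Ici T, ‖r c t‖ ≤ C * (ε 0 t) ^ (rho ϱ (k + 1) / ϱ 0 - w)) ∧
            InjOn (fun c => r c T) (Metric.ball 0 δ) ∧
            ∀ t ∈ Ici T, ContinuousOn (fun c => r c t) (Metric.ball 0 δ) := by
  have h : IsSmallParam t₀ ε ϱ k := ⟨hϱpos, hϱmono, hk, hεC, hεO, hεpos, hε0⟩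
  have hF2 : ∀ l, IsC0N t₀ a φ₀ 2 (F l) := fun l =>
    ⟨fun t ht => ((hF l).1 t ht).of_le (by exact_mod_cast le_max_left _ _),
      fun P hP => (hF l).2 P (hP.trans (le_max_left _ _))⟩
  have hFbdd2 : ∀ l, ∀ P : Fin n → ℕ, ∑ j, P j ≤ 2 → BddPartial t₀ a φ₀ P (F l) :=
    fun l P hP => hFbdd l P (hP.trans (le_max_left _ _))
  have hfc : ContinuousOn f (Ici t₀) := continuousOn_pi.2 fun i => hK.1.continuousOn (hf i)
  obtain ⟨V, V', σ, hV⟩ := exists_isEigenFrame hlam hsimple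
  refine ⟨exists_isFormalCoeff hV hK.1 hϱpos hϱmono hFK, fun T hT y₁ y₂ h₁ h₂ h₁₂ =>
    h₁.eqOn ha hT h.continuousOn_eps hF2 hFbdd2 h₂ h₁₂, fun φ hφ => ⟨?_, fun T₀ hT₀ Q γ ς hQ => ?_⟩⟩
  · obtain ⟨T, hT, hδ⟩ := h.exists_tube hK.1 ha hφ
    have hA : ∀ i j, IsAdm K w ε T fun t =>
        linPart a A ε F φ₀ (truncSum t₀ ε ϱ φ₀ k φ) t i j - A i j := fun i j =>
      (IsAdm.sum hK.1 Finset.univ fun l _ => h.isAdm_eps_mul_pd ha hw hεw hεder hK.1 hT hφ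
        hφ₀C.continuousOn (fun t ht => (hδ t ht).trans (half_le_self ha.le)) (hF2 l) (hFbdd2 l)
        (hF' l) (hFbdd' l) (hFK' l) i j).congr fun t _ => by
          rw [linPart, Matrix.of_apply, add_sub_cancel_left]
    obtain ⟨T₁, hT₁, H⟩ := h.exists_isDiagReduction hw hεw hk1 (fun l hl => (hmono l hl).2.2.2)
      (u := fun t => derivWithin (ε 0) (Ici t₀) t / ε 0 t) hsign hV hK.2 hT hA
    exact ⟨T₁, Ici_subset_Ici.2 hT hT₁, H⟩
  · obtain ⟨s', hs'c, hs', hres⟩ := h.exists_residual ha hK.1 hφ hf hφ₀K hφ₀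
      (fun l t ht => ((hF l).1 t ht).of_le (by exact_mod_cast le_max_right _ _))
      (fun l P hP => hFbdd l P (hP.trans (le_max_right _ _))) hFK
    exact h.exists_solution_family ha hw hεw hK.1 hφ hfc hs'c hs' hres hF2 hFbdd2 hsign hk1 hk2 hT₀ hQ
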